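/- **Setting.** An offspring law is a probability law $q$ on $\{0,1,2,\dots\}$ with $q(0)>0$ and $q(1)=0$; an immigration law is a probability law $\eta$ on $\{1,2,\dots\}$. Write $\varphi_q(s)=\sum_{i\ge0}q(i)s^i$ and $\varphi_\eta(s)=\sum_{i\ge1}\eta(i)s^i$. A $\mathrm{GW}(q,\kappa)$-tree is a Galton–Watson plane tree with offspring law $q$ whose individuals carry independent lifetimes of law $\kappa$ on $(0,\infty)$. A $\mathrm{GWI}(q,\kappa,\eta,\chi)$-forest consists of the times $0<S_1<S_2<\cdots$ of a renewal process with inter-renewal law $\chi$ on $(0,\infty)$ and, independently at each time $S_i$, a bush (finite sequence) of an $\eta$-distributed number of independent $\mathrm{GW}(q,\kappa)$-trees; for $\chi=\mathrm{Exp}(0)$ it is the empty forest. For $p\in(0,1)$ the $p$-reduction $F^{p\text{-rdc}}$ of a forest $F$ is obtained as follows: colour each leaf independently red with probability $p$ and black with probability $1-p$; in each tree keep the individuals that have a black leaf in the subtree above them; merge every maximal line of individuals with exactly one kept child into one individual, adding the lifetimes; discard trees without black leaves and immigration times at which no tree is left. For $p=1$ the same is done with the individuals that have infinitely many descendants in place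 of those with a black leaf above them. The pair $(q',\eta')$ is the $p$-reduced pair associated with $(q,\eta)$ if for all $\kappa,\chi$ the $p$-reduction of a $\mathrm{GWI}(q,\kappa,\eta,\chi)$-forest, unless it is almost surely empty (which can happen only for $p=1$), is a $\mathrm{GWI}(q',\kappa',\eta',\chi')$-forest for some $\kappa',\chi'$. **Theorem.** For an offspring law $q$ and an immigration law $\eta$ the following are equivalent. (i) There are laws $(q_\lambda,\eta_\lambda)_{\lambda\ge0}$, offspring and immigration laws for $\lambda>0$, with $q_1=q$, $\eta_1=\eta$, such that $(q_\mu,\eta_\mu)$ is the $(1-\mu/\lambda)$-reduced pair associated with $(q_\lambda,\eta_\lambda)$ for all $0\le\mu<\lambda<\infty$. (ii) For $0\le s\le1$, $\varphi_q(s)=s+\widetilde\psi(1-s)$ and $\varphi_\eta(s)=1-\widetilde\phi(1-s)$, where for $r\ge0$ $$\widetilde\psi(r)=\widetilde b r+\widetilde a r^2+\int_{(0,\infty)}\bigl(e^{-rx}-1+rx\mathbf 1_{\{x<1\}}\bigr)\widetilde\Pi(dx),\qquad \widetilde\phi(r)=\widetilde d r+\int_{(0,\infty)}(1-e^{-rx})\widetilde\Lambda(dx)$$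 for some $\widetilde b\in\mathbb R$, $\widetilde a\ge0$, $\widetilde d\ge0$ and measures $\widetilde\Pi,\widetilde\Lambda$ on $(0,\infty)$ with $\int(1\wedge x^2)\widetilde\Pi(dx)<\infty$ and $\int(1\wedge x)\widetilde\Lambda(dx)<\infty$. Moreover, for every family $(q_\lambda,\eta_\lambda)_{\lambda\ge0}$ as in (i) and all $c,h\in(0,\infty)$ there are $(c_\lambda,h_\lambda)_{\lambda\ge0}$ with $c_1=c$, $h_1=h$ and, on some probability space, $\mathrm{GWI}(q_\lambda,\mathrm{Exp}(c_\lambda),\eta_\lambda,\mathrm{Exp}(h_\lambda))$-forests $F_\lambda$, $\lambda\ge0$, with $c_\lambda,h_\lambda>0$ for $\lambda>0$, such that $(F_\mu,F_\lambda)\overset{d}{=}(F_\lambda^{(1-\mu/\lambda)\text{-rdc}},F_\lambda)$ for all $0\le\mu<\lambda<\infty$. Call $(q_\lambda,c_\lambda,\eta_\lambda,h_\lambda)_{\lambda\ge0}$ consistent if such forests exist. In a consistent family, for every $\lambda$ with $h_\lambda>0$ (that is, for every $\lambda>0$, and for $\lambda=0$ unless $F_0$ is empty), $q_\lambda$ is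 determined by $q_1$ alone, $c_\lambda$ by $(q_1,c_1)$, and $\eta_\lambda$ by $(q_1,\eta_1)$; for every $\lambda\ge0$, $h_\lambda$ is determined by $(q_1,\eta_1,h_1)$. If $q_1=q$ and $\eta_1=\eta$ are as in (ii) and $R_\lambda$ denotes the largest $r\ge0$ with $\widetilde\psi(r)=\lambda\widetilde\psi(1)$, then for all $\lambda\ge 0$ $$h_\lambda=h_1\,\widetilde\phi(R_\lambda),\qquad\text{and, if }h_\lambda>0,\qquad \varphi_{\eta_\lambda}(s)=1-\frac{\widetilde\phi\bigl(R_\lambda(1-s)\bigr)}{\widetilde\phi(R_\lambda)},\quad 0\le s\le1.$$ -/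

import Mathlib

open MeasureTheory ProbabilityTheory Set
open scoped ENNReal NNReal

noncomputable section

namespace GWGrowth

/-! ### Plane trees with lifetimes

Individuals are finite words of natural numbers; `u ++ [j]` is the `j`-th child of `u`
(children are numbered from `0`). -/

/-- A plane tree in which every individual has finitely many children and carries a lifetime
in `(0, ∞)`. Outside the tree `life` is `0`, so that a tree is determined by its nodes and the
lifetimes of these nodes. -/
@[ext]
structure MTree where
  nodes : Set (List ℕ)
  life : List ℕ → ℝ
  root_mem : [] ∈ nodes
  parent_mem : ∀ (u : List ℕ) (j : ℕ), u ++ [j] ∈ nodes → u ∈ nodes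
  exists_children : ∀ u ∈ nodes, ∃ n : ℕ, ∀ j : ℕ, u ++ [j] ∈ nodes ↔ j < n
  life_pos : ∀ u ∈ nodes, 0 < life u
  life_eq_zero : ∀ u ∉ nodes, life u = 0

/-- The sigma-algebra on trees generated by the events `{u ∈ t, ζ_u ∈ H}`. -/
instance MTree.instMeasurableSpace : MeasurableSpace MTree :=
  MeasurableSpace.generateFrom
    {s | ∃ (u : List ℕ) (H : Set ℝ), MeasurableSet H ∧ s = {t | u ∈ t.nodes ∧ t.life u ∈ H}}

/-- The number of children of `u` inside a set `S` of words. -/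
def numChildren (S : Set (List ℕ)) (u : List ℕ) : ℕ := Set.ncard {k : ℕ | u ++ [k] ∈ S}

/-- The `j`-th child (in increasing order, from `0`) of `u` inside a set `S` of words. -/
def nthChild (S : Set (List ℕ)) (u : List ℕ) (j : ℕ) : List ℕ :=
  u ++ [Nat.nth (fun k => u ++ [k] ∈ S) j]

theorem nthChild_mem {S : Set (List ℕ)} {u : List ℕ} {j : ℕ} (h : j < numChildren S u) :
    nthChild S u j ∈ S := by
  have hfin : {k : ℕ | u ++ [k] ∈ S}.Finite := Set.finite_of_ncard_pos (by
    unfold numChildren at h; omega)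
  refine Nat.nth_mem (p := fun k => u ++ [k] ∈ S) j (fun hf => ?_)
  have : Set.ncard {k : ℕ | u ++ [k] ∈ S} = hf.toFinset.card := Set.ncard_eq_toFinset_card _ hf
  unfold numChildren at h
  omega

/-- The subtree above an individual. -/
def MTree.subtree (t : MTree) (u : List ℕ) (hu : u ∈ t.nodes) : MTree where
  nodes := {v | u ++ v ∈ t.nodes}
  life v := t.life (u ++ v)
  root_mem := by simpa using hu
  parent_mem v j h := t.parent_mem (u ++ v) j (by simpa using h)
  exists_children v hv := by simpa using t.exists_children (u ++ v) hv
  life_pos v hv := t.life_pos _ hv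
  life_eq_zero v hv := t.life_eq_zero _ hv

/-- `P` is the law of a Galton-Watson tree with offspring law `q` and independent lifetimes of
law `κ`: the root has `j` children and a lifetime in `H` with probability `q j * κ H`, and given
this the `j` subtrees of its children are independent with law `P`. -/
structure IsGWTreeLaw (q : PMF ℕ) (κ : Measure ℝ) (P : Measure MTree) : Prop where
  isProb : IsProbabilityMeasure P
  isProb_life : IsProbabilityMeasure κ
  life_pos : κ (Iic 0) = 0
  branching : ∀ (j : ℕ) (H : Set ℝ) (A : Fin j → Set MTree), MeasurableSet H →
    (∀ i, MeasurableSet (A i)) →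
    P {t | numChildren t.nodes [] = j ∧ t.life [] ∈ H ∧
        ∀ i : Fin j, ∃ h : [(i : ℕ)] ∈ t.nodes, t.subtree [(i : ℕ)] h ∈ A i}
      = q j * κ H * ∏ i, P (A i)

/-! ### Leaf colouring and reduction of a tree -/

/-- The black individuals of `t`, when leaves are coloured by `col` (`true` is black, `false` is
red) and the colouring has red-probability `p`. For `p < 1` these are the individuals with a black
leaf in the subtree above them. For `p = 1` they are the individuals with an infinite line
of descent, which is what remains black along a coupled colouring as `p` increases to `1`. -/
def blackNodes (p : ℝ) (t : MTree) (col : List ℕ → Bool) : Set (List ℕ) :=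
  {u | u ∈ t.nodes ∧
    ((p < 1 ∧ ∃ v, u ++ v ∈ t.nodes ∧ numChildren t.nodes (u ++ v) = 0 ∧ col (u ++ v) = true) ∨
     (p = 1 ∧ {v | u ++ v ∈ t.nodes}.Infinite))}

/-- The line of descent that starts from `v` and always passes to the first child inside `S`. -/
def spine (S : Set (List ℕ)) (v : List ℕ) : ℕ → List ℕ
  | 0 => v
  | i + 1 => nthChild S (spine S v i) 0

/-- The number of consecutive individuals, from `v` on, that have exactly one child inside `S`. -/
def spineLength (S : Set (List ℕ)) (v : List ℕ) : ℕ :=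
  sInf {i | numChildren S (spine S v i) ≠ 1}

/-- The first individual on the line of single children above `v` whose number of children
inside `S` is not one. -/
def spineEnd (S : Set (List ℕ)) (v : List ℕ) : List ℕ := spine S v (spineLength S v)

theorem spine_mem {S : Set (List ℕ)} {v : List ℕ} (hv : v ∈ S) :
    ∀ i, i ≤ spineLength S v → spine S v i ∈ S := by
  intro i
  induction i with
  | zero => intro _; exact hv
  | succ i _ =>
    intro hi
    have h1 : numChildren S (spine S v i) = 1 := by
      by_contra h
      have : spineLength S v ≤ i := Nat.sInf_le h
      omega
    exact nthChild_mem (by omega)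

open Classical in
/-- One step of the exploration of the reduced tree. An individual of the reduced tree is
represented by the first individual `v` of the line of single children that it stands for; its
`j`-th child is represented by the `j`-th child inside `S` of the last individual of this line. -/
def reduceStep (S : Set (List ℕ)) (v : List ℕ) (j : ℕ) : Option (List ℕ) :=
  if j < numChildren S (spineEnd S v) then some (nthChild S (spineEnd S v) j) else none

/-- The individual of `S` that represents the individual `w` of the reduced tree,
`none` if there is no such individual. -/
def locate (S : Set (List ℕ)) (w : List ℕ) : Option (List ℕ) := w.foldlM (reduceStep S) []

/-- The sum of the lifetimes along the line of single children above `v`. -/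
def mergedLife (t : MTree) (S : Set (List ℕ)) (v : List ℕ) : ℝ :=
  ∑ i ∈ Finset.range (spineLength S v + 1), t.life (spine S v i)

theorem locate_snoc (S : Set (List ℕ)) (w : List ℕ) (j : ℕ) :
    locate S (w ++ [j]) = (locate S w).bind (fun v => reduceStep S v j) := by
  simp only [locate, List.foldlM_append]
  cases h : List.foldlM (reduceStep S) [] w <;> simp

theorem locate_mem {S : Set (List ℕ)} (hS : [] ∈ S) (w : List ℕ) :
    ∀ v, locate S w = some v → v ∈ S := by
  induction w using List.reverseRecOn with
  | nil => intro v h; simp [locate] at h; rwa [h]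
  | append_singleton w j ih =>
    intro v h
    rw [locate_snoc] at h
    obtain ⟨u, hu, h⟩ := Option.bind_eq_some_iff.1 h
    unfold reduceStep at h
    split_ifs at h with hj
    have := Option.some.inj h
    rw [← this]
    exact nthChild_mem hj

/-- The reduced tree spanned by a set `S` of individuals of `t`: the tree of all individuals in
`S`, in which every maximal line of individuals with a single child is merged into one individual,
whose lifetime is the sum of the lifetimes on the line, and the individuals are renamed in
an order-preserving way. -/
def MTree.reduce (t : MTree) (S : Set (List ℕ)) (hS : [] ∈ S) (hSt : S ⊆ t.nodes) : MTree where
  nodes := {w | (locate S w).isSome}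
  life w := ((locate S w).map (mergedLife t S)).getD 0
  root_mem := by simp [locate]
  parent_mem w j h := by
    rw [mem_ofPred_eq, locate_snoc] at h
    cases h' : locate S w with
    | none => simp [h'] at h
    | some v => simp [h']
  exists_children w hw := by
    obtain ⟨v, hv⟩ := Option.isSome_iff_exists.1 hw
    refine ⟨numChildren S (spineEnd S v), fun j => ?_⟩
    rw [mem_ofPred_eq, locate_snoc, hv, Option.bind_some, reduceStep]
    split_ifs with h <;> simp [h]
  life_pos w hw := by
    obtain ⟨v, hv⟩ := Option.isSome_iff_exists.1 hw
    rw [hv]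
    refine Finset.sum_pos (fun i hi => t.life_pos _ (hSt (spine_mem (locate_mem hS w v hv) i ?_)))
      ⟨0, Finset.mem_range.2 (Nat.succ_pos _)⟩
    exact Nat.lt_succ_iff.1 (Finset.mem_range.1 hi)
  life_eq_zero w hw := by
    have : locate S w = none := Option.not_isSome_iff_eq_none.1 hw
    rw [this]
    rfl

/-! ### Bushes and forests -/

/-- A bush: a finite sequence of trees. -/
abbrev Bush : Type := Σ n : ℕ, (Fin n → MTree)

/-- The law of a bush of independent trees of law `P`, whose number has law `η`. -/
def bushLaw (η : PMF ℕ) (P : Measure MTree) : Measure Bush :=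
  Measure.sum fun n => η n • (Measure.pi fun _ : Fin n => P).map (Sigma.mk n)

/-- A forest: the sequence `(S_i, B_i)`, in the order of time, of immigration times and of bushes
that immigrate at these times. If there are only finitely many immigrations, the
sequence is continued with `noEntry`, which has time `0` and the empty bush. -/
abbrev Forest : Type := ℕ → ℝ × Bush

/-- The entry that stands for the absence of a further immigration. -/
def noEntry : ℝ × Bush := (0, ⟨0, Fin.elim0⟩)

/-- The forest without any immigration. -/
def emptyForest : Forest := fun _ => noEntry

/-- The inter-immigration times (the first one counted from time `0`). -/
def gap (f : Forest) : ℕ → ℝ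
  | 0 => (f 0).1
  | i + 1 => (f (i + 1)).1 - (f i).1

/-- `L` is the law of a Galton-Watson forest with immigration `GWI(q, κ, η, χ)`: immigration
happens at the times of a renewal process with inter-renewal law `χ` on `(0, ∞)`, and, independently
of everything else, the bush that immigrates at any such time consists of an `η`-distributed
number in `{1, 2, …}` of independent `GW(q, κ)`-trees. -/
structure IsGWILaw (q : PMF ℕ) (κ : Measure ℝ) (η : PMF ℕ) (χ : Measure ℝ) (L : Measure Forest) :
    Prop where
  isProb : IsProbabilityMeasure L
  isProb_gap : IsProbabilityMeasure χ
  gap_pos : χ (Iic 0) = 0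
  immigration_pos : η 0 = 0
  indep : iIndepFun (fun (i : ℕ) (f : Forest) => (gap f i, (f i).2)) L
  law : ∃ P : Measure MTree, IsGWTreeLaw q κ P ∧
    ∀ i : ℕ, L.map (fun f : Forest => (gap f i, (f i).2)) = χ.prod (bushLaw η P)

/-- `L` is the law of a `GWI(q, Exp(c), η, Exp(h))`-forest, where `h = 0` means that there is
no immigration at all. -/
def IsExpGWILaw (q : PMF ℕ) (c : ℝ) (η : PMF ℕ) (h : ℝ) (L : Measure Forest) : Prop :=
  (0 < c ∧ 0 < h ∧ IsGWILaw q (expMeasure c) η (expMeasure h) L) ∨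
    (h = 0 ∧ L = Measure.dirac emptyForest)

/-- Colours for all individuals of a forest; `(i, j, u)` is the word `u` in the `j`-th tree of the
`i`-th bush. -/
abbrev Colouring : Type := ℕ × ℕ × List ℕ → Bool

/-- Independent colours, red (`false`) with probability `p` and black (`true`) with
probability `1 - p`. -/
def colourLaw (p : ℝ) : Measure Colouring :=
  Measure.infinitePi fun _ =>
    ENNReal.ofReal p • Measure.dirac false + ENNReal.ofReal (1 - p) • Measure.dirac true

open Classical in
/-- The reduced bush: the trees whose root is black, each of them reduced. -/
def reduceBush (p : ℝ) (b : Bush) (col : ℕ → List ℕ → Bool) : Bush :=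
  let I : Finset (Fin b.1) := Finset.univ.filter fun i => [] ∈ blackNodes p (b.2 i) (col i)
  ⟨I.card, fun m =>
    (b.2 (I.orderEmbOfFin rfl m)).reduce
      (blackNodes p (b.2 (I.orderEmbOfFin rfl m)) (col (I.orderEmbOfFin rfl m)))
      (Finset.mem_filter.1 (I.orderEmbOfFin_mem rfl m)).2 (fun _ hu => hu.1)⟩

open Classical in
/-- The reduced forest: every bush is reduced, and the immigrations whose reduced bush is
empty are removed. -/
def reduceForest (p : ℝ) (f : Forest) (col : Colouring) : Forest :=
  let B : ℕ → Bush := fun i => reduceBush p (f i).2 (fun j u => col (i, j, u))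
  let kept : ℕ → Prop := fun i => (B i).1 ≠ 0
  fun m =>
    if ∃ i, kept i ∧ Nat.count kept i = m then
      ((f (Nat.nth kept m)).1, B (Nat.nth kept m))
    else noEntry

/-- The law of the pair `(F^{p-rdc}, F)` when `F` has law `L` and the colours are independent
of `F`. -/
def reducedPairLaw (p : ℝ) (L : Measure Forest) : Measure (Forest × Forest) :=
  (L.prod (colourLaw p)).map fun x => (reduceForest p x.1 x.2, x.1)

/-- The law of the `p`-reduced forest `F^{p-rdc}` when `F` has law `L`. -/
def reducedLaw (p : ℝ) (L : Measure Forest) : Measure Forest :=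
  (L.prod (colourLaw p)).map fun x => reduceForest p x.1 x.2

/-! ### Consistent families -/

/-- Offspring laws whose trees have leaves and no individuals with a single child. -/
def IsOffspringLaw (q : PMF ℕ) : Prop := 0 < q 0 ∧ q 1 = 0

/-- `(q', η')` is the `p`-reduced pair associated with `(q, η)`: the `p`-reduced forest of any
`GWI(q, κ, η, χ)`-forest, unless it is almost surely empty, is a `GWI(q', κ', η', χ')`-forest for
some `κ'` and `χ'`. -/
def IsReducedPair (p : ℝ) (q η q' η' : PMF ℕ) : Prop :=
  ∀ (κ χ : Measure ℝ) (L : Measure Forest), IsGWILaw q κ η χ L →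
    reducedLaw p L ≠ Measure.dirac emptyForest →
    ∃ κ' χ' : Measure ℝ, IsGWILaw q' κ' η' χ' (reducedLaw p L)

/-- `(Q l, E l)`, `l ≥ 0`, is a family of offspring and immigration laws that is consistent under
reduction by leaf colouring. -/
structure IsConsistentPairFamily (Q E : ℝ≥0 → PMF ℕ) : Prop where
  offspring : ∀ l, 0 < l → IsOffspringLaw (Q l)
  immigration : ∀ l, 0 < l → E l 0 = 0
  reduced : ∀ m l : ℝ≥0, m < l → IsReducedPair (1 - (m : ℝ) / l) (Q l) (E l) (Q m) (E m)

/-- On some probability space there is a consistent family `(F l)`, `l ≥ 0`, of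
`GWI(Q l, Exp(C l), E l, Exp(H l))`-forests: for `m < l` the pair `(F m, F l)` has the same law
as the pair of the `(1 - m / l)`-reduced forest of `F l` and `F l` itself. -/
def HasConsistentForests (Q : ℝ≥0 → PMF ℕ) (C : ℝ≥0 → ℝ) (E : ℝ≥0 → PMF ℕ) (H : ℝ≥0 → ℝ) :
    Prop :=
  (∀ l, 0 < l → IsOffspringLaw (Q l) ∧ E l 0 = 0 ∧ 0 < C l ∧ 0 < H l) ∧
  ∃ (Ω : Type) (_ : MeasurableSpace Ω) (P : Measure Ω) (F : ℝ≥0 → Ω → Forest),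
    IsProbabilityMeasure P ∧ (∀ l, Measurable (F l)) ∧
    (∀ l, IsExpGWILaw (Q l) (C l) (E l) (H l) (P.map (F l))) ∧
    ∀ m l : ℝ≥0, m < l →
      P.map (fun ω => (F m ω, F l ω)) = reducedPairLaw (1 - (m : ℝ) / l) (P.map (F l))

/-! ### Generating functions, branching and immigration mechanisms -/

/-- The probability generating function. -/
def pgf (q : PMF ℕ) (s : ℝ) : ℝ := ∑' i : ℕ, (q i).toReal * s ^ i

/-- Functions on `[0, ∞)` of the form
`b r + a r² + ∫_{(0,∞)} (e^{-r x} - 1 + r x 1_{x < 1}) Π(dx)` with `a ≥ 0` and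
`∫ (1 ∧ x²) Π(dx) < ∞`. -/
def IsBranchingMechanism (ψ : ℝ → ℝ) : Prop :=
  ∃ (b a : ℝ) (ν : Measure ℝ), 0 ≤ a ∧
    ∫⁻ x in Ioi (0 : ℝ), ENNReal.ofReal (min 1 (x ^ 2)) ∂ν < ∞ ∧
    ∀ r, 0 ≤ r → ψ r = b * r + a * r ^ 2 +
      ∫ x in Ioi (0 : ℝ), (Real.exp (-(r * x)) - 1 + r * x * (Iio (1 : ℝ)).indicator 1 x) ∂ν

/-- Functions on `[0, ∞)` of the form `d r + ∫_{(0,∞)} (1 - e^{-r x}) Λ(dx)` with `d ≥ 0` and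
`∫ (1 ∧ x) Λ(dx) < ∞`, the Laplace exponents of subordinators. -/
def IsImmigrationMechanism (φ : ℝ → ℝ) : Prop :=
  ∃ (d : ℝ) (ν : Measure ℝ), 0 ≤ d ∧
    ∫⁻ x in Ioi (0 : ℝ), ENNReal.ofReal (min 1 x) ∂ν < ∞ ∧
    ∀ r, 0 ≤ r → φ r = d * r + ∫ x in Ioi (0 : ℝ), (1 - Real.exp (-(r * x))) ∂ν

/-- `q` has generating function `s + ψ(1 - s)` on `[0, 1]`. -/
def OffspringRep (q : PMF ℕ) (ψ : ℝ → ℝ) : Prop :=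
  IsBranchingMechanism ψ ∧ ∀ s ∈ Icc (0 : ℝ) 1, pgf q s = s + ψ (1 - s)

/-- `η` has generating function `1 - φ(1 - s)` on `[0, 1]`. -/
def ImmigrationRep (η : PMF ℕ) (φ : ℝ → ℝ) : Prop :=
  IsImmigrationMechanism φ ∧ ∀ s ∈ Icc (0 : ℝ) 1, pgf η s = 1 - φ (1 - s)

/-- The right inverse of an eventually increasing convex function on `[0, ∞)`: the largest
`r ≥ 0` with `ψ r = y`. -/
def rightInv (ψ : ℝ → ℝ) (y : ℝ) : ℝ := sSup {r | 0 ≤ r ∧ ψ r = y}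

end GWGrowth

end

open MeasureTheory ProbabilityTheory Set
open scoped ENNReal NNReal

noncomputable section

namespace GWGrowth

open ENNReal (ofReal toReal_ofReal mul_ne_top toReal_nonneg ofReal_ne_top ofReal_one one_ne_top
  ofReal_mul tsum_le_tsum ofReal_toReal ofReal_add toReal_one toReal_mul tsum_add toReal_add
  ofReal_sub toReal_eq_zero_iff)
open MeasureTheory.Measure (infinitePi map_map map_apply prod_prod isProbabilityMeasure_map map_id
  map_prod_map fst_prod pi_pi snd_prod infinitePi_map_pi infinitePi_map_curry dirac smul_finite
  infinitePi_pi)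
open Real (exp norm_eq_abs exp_add exp_pos toNNReal)
open Nat (count nth)
open Finset (orderEmbOfFin_mem sum_range_succ sum_range_zero mul_sum card_map card_univ prod_const
  card_range)

variable {p p' r r' s θ θ' c y : ℝ} {q q' q₁ q₂ η η' : PMF ℕ} {κ κ' χ χ' : Measure ℝ}
  {P : Measure MTree} {L : Measure Forest} {S : Set (List ℕ)} {i j k n : ℕ} {u v w : List ℕ}
  {x : ColTree} {H : Set ℝ} {Q E : ℝ≥0 → PMF ℕ} {l m : ℝ≥0} {z : ℕ → ℝ × Bush} {f : Forest}
  {ψ φ : ℝ → ℝ} {W : ℝ≥0∞} {D : Set (ℕ → ℝ × Bush)} {B : Set Bush} {col : Colouring}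

/-! ### The measurable space of trees -/

/-! One computation carries everything: the law of a reduced forest. Let `psi q x` be the generating
function of `q` at `1 - x` minus `1 - x`, and let `phi η x` be one minus the generating function of
`η` at `1 - x`. The probability `r` of a black root solves `psi q r = (1 - p) * q 0`. It is the
largest solution in the unit interval, by convexity for `p < 1` and because extinction is the least
fixed point for `p = 1` (`IsGWTreeLaw.isRootProb`). A black root with exactly one black child hands
its subtree event on to that child and only adds its own lifetime. So the lifetime of the merged
root, restricted to an event for the branching above it, solves a renewal equation into which the
event enters only through the constant source. Uniqueness for this equation (`eq_of_renewal`) gives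
both the geometric sum and the independence (`IsGWTreeLaw.reduce`). The same argument treats gaps
between surviving immigrations (`map_thinSeq`). The reduction thus replaces `psi q` by `psi q (r *
x) / (r * θ)` and `phi η` by `phi η (r * x) / phi η r`, where `1 - θ` is the derivative of the
generating function of `q` at `1 - r`. Exponential rates are multiplied by `θ` and by `phi η r`
(`IsGWILaw.reduce_exp`).

For (ii) ⇒ (i), the mechanisms are expanded around `R_λ`. The coefficients that are not normalised
away are integrals of Poisson weights against the Lévy measures, hence nonnegative, so `ψ (R_λ * x)`
and `φ (R_λ * x)` are, up to factors, `psi` and `phi` of probability laws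
(`exists_consistentPairFamily`). The reduction from level `λ` to `μ` is the scaling by `R_μ / R_λ`,
which makes the family consistent.

For (i) ⇒ (ii), `q` is a reduction of `Q λ` with root probability `r`, and `r` becomes arbitrarily
small as `λ` varies. This follows from analytic continuation of generating functions beyond the
probabilistic range (`IsReducedOffspring.root_le`). Being a binomial thinning with small `r` means
that the weights of `q` are the factorial moments of a measure on a lattice of mesh `r / (1 - r)`. A
limit of these measures has them as ordinary moments (`exists_measure_moments`), and changing its
density gives the Lévy measure, the atom at zero giving the Gaussian or drift coefficient.

The coupled forests come from uniform marks on the leaves: at level `t` the leaves with a mark below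
`t` are black. After a reduction at level `s` the surviving marks, divided by `s`, are again
independent and uniform (`map_markStep`), and reductions compose (`reduceForest_reduceForest`). A
Markov chain of marked forests along the integer levels then yields all levels at once
(`exists_forests`).

Uniqueness below level `1` is immediate, since reduction determines the parameters. Above level `1`
the identity between `psi` functions, known on a short interval, extends analytically past `x = 1`;
the normalisations `q 1 = 0` and `η 0 = 0` then fix the remaining factors. The explicit formulas
follow by comparison with the family constructed from the mechanisms. -/

theorem MTree.mem_nodes_iff (t : MTree) (u : List ℕ) : u ∈ t.nodes ↔ 0 < t.life u := by
  refine ⟨t.life_pos u, fun h => ?_⟩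
  by_contra hu
  rw [t.life_eq_zero u hu] at h
  exact lt_irrefl _ h

theorem MTree.life_nonneg (t : MTree) (u : List ℕ) : 0 ≤ t.life u := by
  by_cases h : u ∈ t.nodes
  · exact (t.life_pos u h).le
  · exact (t.life_eq_zero u h).ge

/-- The nodes are the words of positive lifetime, so a tree is coded by its lifetimes alone. Trees
are compared in this way throughout. -/
theorem MTree.ext_life {s t : MTree} (h : ∀ u, s.life u = t.life u) : s = t := by
  refine MTree.ext ?_ (funext h)
  ext u
  rw [s.mem_nodes_iff, t.mem_nodes_iff, h]

theorem MTree.measurable_life (u : List ℕ) : Measurable fun t : MTree => t.life u := by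
  intro H hH
  have h1 : MeasurableSet {t : MTree | u ∈ t.nodes ∧ t.life u ∈ H} :=
    MeasurableSpace.measurableSet_generateFrom ⟨u, H, hH, rfl⟩
  have h2 : MeasurableSet {t : MTree | u ∈ t.nodes} := by
    have : MeasurableSet {t : MTree | u ∈ t.nodes ∧ t.life u ∈ (univ : Set ℝ)} :=
      MeasurableSpace.measurableSet_generateFrom ⟨u, univ, MeasurableSet.univ, rfl⟩
    simpa using this
  by_cases h0 : (0 : ℝ) ∈ H
  · convert h1.union h2.compl using 1
    ext t
    by_cases hu : u ∈ t.nodes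
    · simp [hu]
    · simp [hu, t.life_eq_zero u hu, h0]
  · convert h1 using 1
    ext t
    by_cases hu : u ∈ t.nodes
    · simp [hu]
    · simp [hu, t.life_eq_zero u hu, h0]

/-- The generating events are preimages under one lifetime each: membership in the tree is
positivity of the lifetime. -/
theorem measurable_mtree_iff {α : Type*} [MeasurableSpace α] {f : α → MTree} :
    Measurable f ↔ ∀ u, Measurable fun x => (f x).life u := by
  refine ⟨fun h u => (MTree.measurable_life u).comp h, fun h => ?_⟩
  refine measurable_generateFrom ?_
  rintro s ⟨u, H, hH, rfl⟩
  have : f ⁻¹' {t | u ∈ t.nodes ∧ t.life u ∈ H} = (fun x => (f x).life u) ⁻¹' (Ioi 0 ∩ H) := by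
    ext x
    simp [MTree.mem_nodes_iff]
  rw [this]
  exact h u (measurableSet_Ioi.inter hH)

theorem MTree.measurable_mem_nodes (u : List ℕ) : Measurable fun t : MTree => u ∈ t.nodes := by
  simp_rw [MTree.mem_nodes_iff]
  exact measurable_const.lt (MTree.measurable_life u)

theorem MTree.measurable_nodes : Measurable fun t : MTree => t.nodes :=
  measurable_set_iff.2 MTree.measurable_mem_nodes

theorem MTree.measurable_life_fun : Measurable fun t : MTree => t.life :=
  measurable_pi_lambda _ MTree.measurable_life

/-- The tree with a single individual, of lifetime `1`. -/
def singleTree : MTree where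
  nodes := {[]}
  life u := if u = [] then 1 else 0
  root_mem := rfl
  parent_mem u j h := by simp at h
  exists_children u hu := ⟨0, fun j => by simp⟩
  life_pos u hu := by simp_all
  life_eq_zero u hu := by simp_all

instance : Inhabited MTree := ⟨singleTree⟩

/-- The functions on words that are lifetimes of trees. -/
def IsLife (L : List ℕ → ℝ) : Prop :=
  0 < L [] ∧ (∀ u, 0 ≤ L u) ∧ (∀ u j, 0 < L (u ++ [j]) → 0 < L u) ∧
    ∀ u, 0 < L u → ∃ n : ℕ, ∀ j : ℕ, 0 < L (u ++ [j]) ↔ j < n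

/-- The tree with given lifetimes. -/
def MTree.ofLife (L : List ℕ → ℝ) (h : IsLife L) : MTree where
  nodes := {u | 0 < L u}
  life := L
  root_mem := h.1
  parent_mem := h.2.2.1
  exists_children := h.2.2.2
  life_pos _ hu := hu
  life_eq_zero u hu := le_antisymm (not_lt.1 hu) (h.2.1 u)

theorem MTree.isLife (t : MTree) : IsLife t.life := by
  refine ⟨(t.mem_nodes_iff _).1 t.root_mem, t.life_nonneg, fun u j h => ?_, fun u h => ?_⟩
  · exact (t.mem_nodes_iff _).1 (t.parent_mem u j ((t.mem_nodes_iff _).2 h))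
  · simpa only [t.mem_nodes_iff] using t.exists_children u ((t.mem_nodes_iff _).2 h)

theorem measurableSet_isLife : MeasurableSet {L : List ℕ → ℝ | IsLife L} := by
  refine measurableSet_setOfPred.2 ?_
  unfold IsLife
  have h : ∀ u, Measurable fun L : List ℕ → ℝ => 0 < L u := fun u =>
    measurable_const.lt (measurable_pi_apply u)
  have h' : ∀ u, Measurable fun L : List ℕ → ℝ => 0 ≤ L u := fun u =>
    measurableSet_setOfPred.1 (measurableSet_le measurable_const (measurable_pi_apply u))
  refine (h []).and ((Measurable.forall fun u => h' u).and ((Measurable.forall fun u =>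
    Measurable.forall fun j => (h _).imp (h _)).and (Measurable.forall fun u => (h u).imp
      (Measurable.exists fun n => Measurable.forall fun j => (h _).iff measurable_const))))

theorem MTree.range_life : range MTree.life = {L | IsLife L} := by
  ext L
  exact ⟨fun ⟨t, ht⟩ => ht ▸ t.isLife, fun h => ⟨MTree.ofLife L h, rfl⟩⟩

open Classical in
-- The image is cut out by countably many measurable conditions. The embedding makes trees a
-- standard Borel space, as the disintegrations of the coupling require, and reduces uniqueness of
-- tree laws to finitely many lifetimes.
theorem MTree.measurableEmbedding_life : MeasurableEmbedding MTree.life := by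
  refine MeasurableEmbedding.of_measurable_inverse (g := fun L => if h : IsLife L then
    MTree.ofLife L h else default) MTree.measurable_life_fun ?_ ?_ ?_
  · rw [MTree.range_life]; exact measurableSet_isLife
  · refine measurable_mtree_iff.2 fun u => ?_
    have : (fun L : List ℕ → ℝ => (if h : IsLife L then MTree.ofLife L h else default).life u)
        = fun L => if IsLife L then L u else (default : MTree).life u := by
      funext L
      split_ifs <;> rfl
    rw [this]
    exact Measurable.ite measurableSet_isLife (measurable_pi_apply u) measurable_const
  · intro t
    simp only [t.isLife, dif_pos]
    exact MTree.ext_life fun u => rfl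

/-- The range is a measurable set in a standard Borel space, and its Polish topology is pulled back
along the bijection onto it. -/
theorem standardBorelSpace_of_measurableEmbedding {α β : Type*} [MeasurableSpace α]
    [MeasurableSpace β] [StandardBorelSpace β] {f : α → β} (hf : MeasurableEmbedding f) :
    StandardBorelSpace α := by
  have : StandardBorelSpace (range f) := hf.measurableSet_range.standardBorel
  obtain ⟨τ', hb', hp'⟩ := this.polish
  let e := hf.equivRange
  let τ : TopologicalSpace α := TopologicalSpace.induced e τ'
  have hp : PolishSpace α :=
    (e.toEquiv.toHomeomorphOfIsInducing ⟨rfl⟩).isClosedEmbedding.polishSpace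
  have hb : BorelSpace α := by
    refine ⟨?_⟩
    rw [← e.measurableEmbedding.comap_eq]
    exact (congrArg (MeasurableSpace.comap e) hb'.measurable_eq).trans borel_comap.symm
  exact standardBorel_of_polish

instance : StandardBorelSpace MTree :=
  standardBorelSpace_of_measurableEmbedding MTree.measurableEmbedding_life

/-- A bush as a number and a sequence of trees. -/
def bushCode (b : Bush) : ℕ × (ℕ → MTree) :=
  (b.1, fun i => if h : i < b.1 then b.2 ⟨i, h⟩ else default)

theorem measurable_sigma {ι α : Type*} {β : ι → Type*} [∀ i, MeasurableSpace (β i)]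
    [MeasurableSpace α] {f : (Σ i, β i) → α} (h : ∀ i, Measurable fun b : β i => f ⟨i, b⟩) :
    Measurable f := by
  intro s hs
  refine MeasurableSpace.measurableSet_iInf.2 fun i => ?_
  exact h i hs

theorem measurable_sigma_mk {ι : Type*} {β : ι → Type*} [∀ i, MeasurableSpace (β i)] (i : ι) :
    Measurable (Sigma.mk i : β i → Σ i, β i) := by
  intro s hs
  exact MeasurableSpace.measurableSet_iInf.1 hs i

theorem measurableEmbedding_bushCode : MeasurableEmbedding bushCode := by
  refine MeasurableEmbedding.of_measurable_inverse
    (g := fun x => ⟨x.1, fun i => x.2 i⟩) ?_ ?_ ?_ ?_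
  · refine measurable_sigma fun n => ?_
    unfold bushCode
    refine measurable_const.prodMk (measurable_pi_lambda _ fun i => ?_)
    by_cases h : i < n
    · simpa [h] using measurable_pi_apply (⟨i, h⟩ : Fin n)
    · simp [h]
  -- Padding with `default` makes the code injective and its range a countable intersection of
  -- measurable sets.
  · have : range bushCode = {x | ∀ i, x.1 ≤ i → x.2 i = default} := by
      ext x
      constructor
      · rintro ⟨b, rfl⟩ i hi
        exact dif_neg (not_lt.2 hi)
      · intro h
        refine ⟨⟨x.1, fun i => x.2 i⟩, ?_⟩
        refine Prod.ext rfl (funext fun i => ?_)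
        by_cases hi : i < x.1
        · simp [bushCode, hi]
        · simp [bushCode, hi, h i (not_lt.1 hi)]
    rw [this]
    refine measurableSet_setOfPred.2 (Measurable.forall fun i => Measurable.imp ?_ ?_)
    · exact measurableSet_setOfPred.1 (measurableSet_le measurable_fst measurable_const)
    · have : Measurable fun x : ℕ × (ℕ → MTree) => x.2 i :=
        (measurable_pi_apply i).comp measurable_snd
      exact this.eq_const default
  · refine measurable_from_prod_countable_right fun n => ?_
    exact (measurable_sigma_mk n).comp (measurable_pi_lambda _ fun i => measurable_pi_apply _)
  · intro b
    obtain ⟨n, b⟩ := b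
    simp [bushCode]

instance : StandardBorelSpace Bush :=
  standardBorelSpace_of_measurableEmbedding measurableEmbedding_bushCode

theorem measurable_bush_size : Measurable (fun b : Bush => b.1) :=
  measurable_sigma fun _ => measurable_const

/-! ### Children of the root -/

/-- The number of children of the root. -/
def kids (t : MTree) : ℕ := numChildren t.nodes []

theorem MTree.singleton_mem_nodes (t : MTree) (i : ℕ) : [i] ∈ t.nodes ↔ i < kids t := by
  obtain ⟨n, hn⟩ := t.exists_children [] t.root_mem
  have : kids t = n := by
    unfold kids numChildren
    have : {k : ℕ | [] ++ [k] ∈ t.nodes} = Finset.range n := by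
      ext k
      simpa using hn k
    rw [this, Set.ncard_coe_finset, card_range]
  rw [this]
  exact hn i

open Classical in
/-- The subtree above the `i`-th child of the root; the tree itself if there is no such child. -/
def child (t : MTree) (i : ℕ) : MTree := if h : [i] ∈ t.nodes then t.subtree [i] h else t

theorem child_life {t : MTree} (h : i < kids t) (u : List ℕ) :
    (child t i).life u = t.life (i :: u) := by
  rw [← t.singleton_mem_nodes] at h
  simp [child, h, MTree.subtree]

theorem mem_child_nodes {t : MTree} (h : i < kids t) (u : List ℕ) :
    u ∈ (child t i).nodes ↔ i :: u ∈ t.nodes := by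
  rw [MTree.mem_nodes_iff, MTree.mem_nodes_iff, child_life h]

theorem MTree.cons_mem_nodes {t : MTree} (h : i :: u ∈ t.nodes) :
    i < kids t := by
  rw [← t.singleton_mem_nodes]
  induction u using List.reverseRecOn with
  | nil => exact h
  | append_singleton u j ih => exact ih (t.parent_mem (i :: u) j h)

theorem measurable_kids : Measurable kids := by
  refine measurable_to_countable' fun n => ?_
  have : kids ⁻¹' {n} = {t : MTree | (∀ i, i < n → [i] ∈ t.nodes) ∧ [n] ∉ t.nodes} := by
    ext t
    simp only [mem_preimage, mem_singleton_iff, mem_ofPred_eq, MTree.singleton_mem_nodes]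
    constructor
    · rintro rfl
      simp
    · rintro ⟨h1, h2⟩
      refine le_antisymm (not_lt.1 h2) ?_
      by_contra h
      exact lt_irrefl _ (h1 _ (not_le.1 h))
  rw [this]
  refine measurableSet_setOfPred.2 (Measurable.and (Measurable.forall fun i => Measurable.imp
    measurable_const (MTree.measurable_mem_nodes _)) (MTree.measurable_mem_nodes _).not)

open Classical in
theorem measurable_child (i : ℕ) : Measurable fun t => child t i := by
  refine measurable_mtree_iff.2 fun u => ?_
  have : (fun t : MTree => (child t i).life u)
      = fun t : MTree => if [i] ∈ t.nodes then t.life (i :: u) else t.life u := by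
    funext t
    unfold child
    split_ifs <;> simp [MTree.subtree]
  rw [this]
  exact Measurable.ite (measurableSet_setOfPred.2 (MTree.measurable_mem_nodes _))
    (MTree.measurable_life _) (MTree.measurable_life _)

theorem exists_subtree_mem_iff {t : MTree} (A : Set MTree) :
    (∃ h : [i] ∈ t.nodes, t.subtree [i] h ∈ A) ↔ i < kids t ∧ child t i ∈ A := by
  by_cases h : [i] ∈ t.nodes
  · simp [child, h, (t.singleton_mem_nodes i).1 h]
  · have h' := h
    rw [t.singleton_mem_nodes] at h'
    simp [h, h']

/-! ### Measurability of the reduction -/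

instance : MeasurableSpace (List ℕ) := ⊤

instance : DiscreteMeasurableSpace (List ℕ) := ⟨fun _ => trivial⟩

instance : MeasurableSpace (Option (List ℕ)) := ⊤

instance : DiscreteMeasurableSpace (Option (List ℕ)) := ⟨fun _ => trivial⟩

/-- Measurability may be checked on the countably many level sets of `f`. All random words, lengths
and indices below are substituted in this way. -/
theorem measurable_countable_comp {α β γ : Type*} [MeasurableSpace α] [MeasurableSpace β]
    [MeasurableSpace γ] [Countable γ] [DiscreteMeasurableSpace γ] {f : α → γ} {g : γ → α → β}
    (hf : Measurable f) (hg : ∀ c, Measurable (g c)) : Measurable fun a => g (f a) a := by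
  have : Measurable fun x : γ × α => g x.1 x.2 := measurable_from_prod_countable_right hg
  exact this.comp (hf.prodMk measurable_id)

theorem measurable_ncard : Measurable fun X : Set ℕ => X.ncard := by
  have h : ∀ n, n ≠ 0 → MeasurableSet {X : Set ℕ | X.ncard = n} := fun n hn => by
    -- A nonzero `ncard` forces finiteness, and there are countably many finite sets. The value `0`,
    -- shared by the infinite sets, is left to the complement.
    refine Set.Countable.measurableSet (Countable.ofPred_finite.mono fun X hX => ?_)
    exact Set.finite_of_ncard_ne_zero (by rw [mem_ofPred_eq] at hX; omega)
  refine measurable_to_countable' fun n => ?_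
  by_cases hn : n = 0
  · have : (fun X : Set ℕ => X.ncard) ⁻¹' {n} = (⋃ m : ℕ, {X : Set ℕ | X.ncard = m + 1})ᶜ := by
      ext X
      simp only [mem_preimage, mem_singleton_iff, mem_compl_iff, mem_iUnion, mem_ofPred_eq,
        not_exists]
      refine ⟨fun h m => by omega, fun h => ?_⟩
      by_contra h'
      exact h (X.ncard - 1) (by omega)
    rw [this]
    exact (MeasurableSet.iUnion fun m => h _ (by omega)).compl
  · exact h n hn

open Classical in
theorem measurable_count (k : ℕ) : Measurable fun X : Set ℕ => count (· ∈ X) k := by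
  induction k with
  | zero => simp
  | succ k ih =>
    simp only [Nat.count_succ]
    exact ih.add (Measurable.ite (measurableSet_mem k) measurable_const measurable_const)

open Classical in
-- The default value of `Nat.nth` is `0`; the measurability of `Nat.nth` has to treat this case
-- separately.
theorem nth_eq_zero_of_forall_count_ne {p : ℕ → Prop}
    (h : ∀ k, p k → count p k ≠ j) : nth p j = 0 := by
  by_contra h0
  have hj : ∀ hf : (Set.ofPred p).Finite, j < hf.toFinset.card := by
    intro hf
    by_contra hlt
    exact h0 (Nat.nth_of_card_le hf (not_lt.1 hlt))
  exact h _ (Nat.nth_mem j hj) (Nat.count_nth hj)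

open Classical in
theorem measurable_nth (j : ℕ) : Measurable fun X : Set ℕ => nth (· ∈ X) j := by
  refine measurable_to_countable' fun k => ?_
  have hk : ∀ k, MeasurableSet {X : Set ℕ | k ∈ X ∧ count (· ∈ X) k = j} := fun k =>
    (measurableSet_mem k).inter (measurable_count k (measurableSet_singleton j))
  have hkk : ∀ k (X : Set ℕ), k ∈ X ∧ count (· ∈ X) k = j → nth (· ∈ X) j = k := by
    rintro k X ⟨h1, rfl⟩
    exact Nat.nth_count (p := (· ∈ X)) h1
  have : (fun X : Set ℕ => nth (· ∈ X) j) ⁻¹' {k}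
      = {X : Set ℕ | k ∈ X ∧ count (· ∈ X) k = j} ∪
        (if k = 0 then (⋃ k, {X : Set ℕ | k ∈ X ∧ count (· ∈ X) k = j})ᶜ else ∅) := by
    ext X
    simp only [mem_preimage, mem_singleton_iff, mem_union]
    constructor
    · intro h
      by_cases hX : X ∈ ⋃ k, {X : Set ℕ | k ∈ X ∧ count (· ∈ X) k = j}
      · obtain ⟨k', hk'⟩ := mem_iUnion.1 hX
        have := hkk k' X hk'
        rw [h] at this
        exact Or.inl (this ▸ hk')
      · have h0 : nth (· ∈ X) j = 0 := by
          refine nth_eq_zero_of_forall_count_ne fun i hi hc => hX (mem_iUnion.2 ⟨i, hi, hc⟩)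
        have : k = 0 := h.symm.trans h0
        rw [if_pos this]
        exact Or.inr hX
    · rintro (h | h)
      · exact hkk k X h
      · split_ifs at h with h0
        · rw [h0]
          exact nth_eq_zero_of_forall_count_ne fun i hi hc => h (mem_iUnion.2 ⟨i, hi, hc⟩)
        · exact absurd h (notMem_empty _)
  rw [this]
  refine (hk k).union ?_
  split_ifs
  · exact (MeasurableSet.iUnion hk).compl
  · exact MeasurableSet.empty

theorem measurable_sInf_nat : Measurable fun X : Set ℕ => sInf X := by
  refine measurable_to_countable' fun n => ?_
  -- The second alternative is the default value `sInf ∅ = 0`.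
  have : (fun X : Set ℕ => sInf X) ⁻¹' {n}
      = {X : Set ℕ | (n ∈ X ∧ ∀ m, m < n → m ∉ X) ∨ (n = 0 ∧ ∀ m, m ∉ X)} := by
    ext X
    simp only [mem_preimage, mem_singleton_iff, mem_ofPred_eq]
    constructor
    · rintro rfl
      rcases X.eq_empty_or_nonempty with rfl | h
      · simp
      · exact Or.inl ⟨Nat.sInf_mem h, fun m => Nat.notMem_of_lt_sInf⟩
    · rintro (⟨h1, h2⟩ | ⟨rfl, h⟩)
      · refine le_antisymm (Nat.sInf_le h1) ?_
        by_contra h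
        exact h2 _ (not_le.1 h) (Nat.sInf_mem ⟨n, h1⟩)
      · rw [Set.eq_empty_of_forall_notMem h, Nat.sInf_empty]
  rw [this]
  refine measurableSet_setOfPred.2 (Measurable.or (Measurable.and (measurable_set_mem n)
    (Measurable.forall fun m => measurable_const.imp (measurable_set_notMem m)))
    (measurable_const.and (Measurable.forall fun m => measurable_set_notMem m)))

theorem measurable_childSet (u : List ℕ) :
    Measurable fun S : Set (List ℕ) => {k : ℕ | u ++ [k] ∈ S} :=
  measurable_set_iff.2 fun _ => measurable_set_mem _

theorem measurable_numChildren (u : List ℕ) : Measurable fun S => numChildren S u :=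
  measurable_ncard.comp (measurable_childSet u)

theorem measurable_nthChild (u : List ℕ) (j : ℕ) : Measurable fun S => nthChild S u j :=
  (Measurable.of_discrete (f := fun k => u ++ [k])).comp
    ((measurable_nth j).comp (measurable_childSet u))

theorem measurable_spine (v : List ℕ) (i : ℕ) : Measurable fun S => spine S v i := by
  induction i with
  | zero => exact measurable_const
  | succ i ih => exact measurable_countable_comp ih fun u => measurable_nthChild u 0

theorem measurable_spineLength (v : List ℕ) : Measurable fun S => spineLength S v := by
  refine measurable_sInf_nat.comp (measurable_set_iff.2 fun i => ?_)
  have : Measurable fun S => numChildren S (spine S v i) :=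
    measurable_countable_comp (measurable_spine v i) fun u => measurable_numChildren u
  exact (this.eq_const 1).not

theorem measurable_spineEnd (v : List ℕ) : Measurable fun S => spineEnd S v :=
  measurable_countable_comp (measurable_spineLength v) fun i => measurable_spine v i

theorem measurable_reduceStep (v : List ℕ) (j : ℕ) : Measurable fun S => reduceStep S v j := by
  unfold reduceStep
  refine Measurable.ite (measurableSet_lt measurable_const ?_)
    ((Measurable.of_discrete (f := some)).comp ?_) measurable_const
  · exact measurable_countable_comp (measurable_spineEnd v) fun u => measurable_numChildren u
  · exact measurable_countable_comp (measurable_spineEnd v) fun u => measurable_nthChild u j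

theorem measurable_locate (w : List ℕ) : Measurable fun S => locate S w := by
  induction w using List.reverseRecOn with
  | nil => exact measurable_const
  | append_singleton w j ih =>
    simp_rw [locate_snoc]
    refine measurable_countable_comp (g := fun (o : Option (List ℕ)) S =>
      o.bind fun v => reduceStep S v j) ih fun o => ?_
    cases o with
    | none => exact measurable_const
    | some v => exact measurable_reduceStep v j

/-- The lifetimes of the reduced tree, as a function of the lifetimes of the tree. -/
def reduceLife (L : List ℕ → ℝ) (S : Set (List ℕ)) (w : List ℕ) : ℝ :=
  ((locate S w).map fun v =>
    ∑ i ∈ Finset.range (spineLength S v + 1), L (spine S v i)).getD 0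

theorem measurable_reduceLife (w : List ℕ) :
    Measurable fun x : (List ℕ → ℝ) × Set (List ℕ) => reduceLife x.1 x.2 w := by
  unfold reduceLife
  refine measurable_countable_comp (g := fun (o : Option (List ℕ))
    (x : (List ℕ → ℝ) × Set (List ℕ)) => (o.map fun v =>
      ∑ i ∈ Finset.range (spineLength x.2 v + 1), x.1 (spine x.2 v i)).getD 0)
    ((measurable_locate w).comp measurable_snd) fun o => ?_
  cases o with
  | none => exact measurable_const
  | some v =>
    refine measurable_countable_comp (g := fun (n : ℕ) (x : (List ℕ → ℝ) × Set (List ℕ)) =>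
      ∑ i ∈ Finset.range (n + 1), x.1 (spine x.2 v i))
      ((measurable_spineLength v).comp measurable_snd) fun n => ?_
    refine Finset.measurable_sum _ fun i _ => ?_
    exact measurable_countable_comp (g := fun (u : List ℕ) (x : (List ℕ → ℝ) × Set (List ℕ)) =>
      x.1 u) ((measurable_spine v i).comp measurable_snd) fun u =>
        (measurable_pi_apply u).comp measurable_fst

/-- A tree with colours for all words. -/
abbrev ColTree : Type := MTree × (List ℕ → Bool)

/-- The root is black. -/
def rootBlack (p : ℝ) (x : ColTree) : Prop := [] ∈ blackNodes p x.1 x.2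

theorem measurable_blackNodes (p : ℝ) : Measurable fun x : ColTree => blackNodes p x.1 x.2 := by
  refine measurable_set_iff.2 fun u => ?_
  have hn : ∀ u, Measurable fun x : ColTree => u ∈ x.1.nodes := fun u =>
    (MTree.measurable_mem_nodes u).comp measurable_fst
  unfold blackNodes
  refine (hn u).and (Measurable.or (measurable_const.and (Measurable.exists fun v =>
    (hn _).and (Measurable.and ?_ ?_))) (measurable_const.and ?_))
  · exact (((measurable_numChildren (u ++ v)).comp MTree.measurable_nodes).comp
      measurable_fst).eq_const 0
  · have : Measurable fun x : ColTree => x.2 (u ++ v) :=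
      (measurable_pi_apply (u ++ v)).comp measurable_snd
    exact this.eq_const true
  · have : Measurable fun x : ColTree => {v | u ++ v ∈ x.1.nodes} :=
      measurable_set_iff.2 fun v => hn _
    exact measurableSet_setOfPred.1 (this MeasurableSet.setOfPred_infinite)

theorem measurableSet_rootBlack (p : ℝ) : MeasurableSet {x : ColTree | rootBlack p x} :=
  (measurable_blackNodes p) (measurableSet_mem [])

open Classical in
/-- The reduced tree of a coloured tree with black root. -/
def redTree (p : ℝ) (x : ColTree) : MTree :=
  if h : rootBlack p x then x.1.reduce (blackNodes p x.1 x.2) h (fun _ hu => hu.1) else default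

theorem redTree_life (h : rootBlack p x) (w : List ℕ) :
    (redTree p x).life w = reduceLife x.1.life (blackNodes p x.1 x.2) w := by
  rw [redTree, dif_pos h]
  rfl

theorem measurable_life_blackNodes (p : ℝ) : Measurable fun x : ColTree =>
    ((x.1.life, blackNodes p x.1 x.2) : (List ℕ → ℝ) × Set (List ℕ)) :=
  (MTree.measurable_life_fun.comp measurable_fst).prodMk (measurable_blackNodes p)

theorem measurable_reduceLife_blackNodes (p : ℝ) (w : List ℕ) :
    Measurable fun x : ColTree => reduceLife x.1.life (blackNodes p x.1 x.2) w := by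
  have h := (measurable_reduceLife w).comp (measurable_life_blackNodes p)
  simp only [Function.comp_def] at h
  exact h

theorem measurable_redTree (p : ℝ) : Measurable (redTree p) := by
  classical
  refine measurable_mtree_iff.2 fun w => ?_
  have h : (fun x : ColTree => (redTree p x).life w) = {x | rootBlack p x}.piecewise
      (fun x => reduceLife x.1.life (blackNodes p x.1 x.2) w)
      (fun _ => (default : MTree).life w) := by
    funext x
    by_cases h : rootBlack p x
    · rw [redTree_life h w, piecewise, if_pos]
      exact h
    · rw [redTree, dif_neg h, piecewise, if_neg]
      exact h
  rw [h]
  exact (measurable_reduceLife_blackNodes p w).piecewise (measurableSet_rootBlack p)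
    measurable_const

/-! ### Recursion at the root -/

/-- The part of a set of words above the letter `i`. -/
def above (S : Set (List ℕ)) (i : ℕ) : Set (List ℕ) := {v | i :: v ∈ S}

theorem numChildren_cons (S : Set (List ℕ)) (i : ℕ) (u : List ℕ) :
    numChildren S (i :: u) = numChildren (above S i) u := rfl

theorem nthChild_cons (S : Set (List ℕ)) (i : ℕ) (u : List ℕ) (j : ℕ) :
    nthChild S (i :: u) j = i :: nthChild (above S i) u j := rfl

theorem spine_cons (S : Set (List ℕ)) (i : ℕ) (u : List ℕ) (n : ℕ) :
    spine S (i :: u) n = i :: spine (above S i) u n := by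
  induction n with
  | zero => rfl
  | succ n ih => rw [spine, ih, nthChild_cons, spine]

theorem spineLength_cons (S : Set (List ℕ)) (i : ℕ) (u : List ℕ) :
    spineLength S (i :: u) = spineLength (above S i) u := by
  unfold spineLength
  simp_rw [spine_cons, numChildren_cons]

theorem spineEnd_cons (S : Set (List ℕ)) (i : ℕ) (u : List ℕ) :
    spineEnd S (i :: u) = i :: spineEnd (above S i) u := by
  rw [spineEnd, spineLength_cons, spine_cons, spineEnd]

theorem reduceStep_cons (S : Set (List ℕ)) (i : ℕ) (u : List ℕ) (j : ℕ) :
    reduceStep S (i :: u) j = (reduceStep (above S i) u j).map (i :: ·) := by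
  unfold reduceStep
  rw [spineEnd_cons, numChildren_cons, nthChild_cons]
  split_ifs <;> rfl

/-- The exploration never goes below its starting point, so above the letter `i` it sees only `above
S i`. -/
theorem foldlM_reduceStep_cons (S : Set (List ℕ)) (i : ℕ) (u w : List ℕ) :
    w.foldlM (reduceStep S) (i :: u) = (w.foldlM (reduceStep (above S i)) u).map (i :: ·) := by
  induction w generalizing u with
  | nil => rfl
  | cons j w ih =>
    rw [List.foldlM_cons, List.foldlM_cons, reduceStep_cons]
    cases h : reduceStep (above S i) u j with
    | none => rfl
    | some v => exact ih v

/-- The `j`-th letter inside `S`. -/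
def nthKid (S : Set (List ℕ)) (j : ℕ) : ℕ := nth (fun k => [k] ∈ S) j

theorem nthKid_mem (h : j < numChildren S []) : [nthKid S j] ∈ S :=
  nthChild_mem (u := []) h

/-- The line of single children from the root is finite. -/
def FiniteSpine (S : Set (List ℕ)) : Prop := ∃ i, numChildren S (spine S [] i) ≠ 1

theorem spine_nil_succ (S : Set (List ℕ)) (n : ℕ) :
    spine S [] (n + 1) = nthKid S 0 :: spine (above S (nthKid S 0)) [] n := by
  induction n with
  | zero => rfl
  | succ n ih => rw [spine, ih, nthChild_cons, spine]

theorem spineLength_nil_of_ne (h : numChildren S [] ≠ 1) :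
    spineLength S [] = 0 :=
  Nat.sInf_eq_zero.2 (Or.inl h)

theorem spineEnd_nil_of_ne (h : numChildren S [] ≠ 1) :
    spineEnd S [] = [] := by
  rw [spineEnd, spineLength_nil_of_ne h, spine]

theorem finiteSpine_iff (h : numChildren S [] = 1) :
    FiniteSpine S ↔ FiniteSpine (above S (nthKid S 0)) := by
  constructor
  · rintro ⟨i, hi⟩
    cases i with
    | zero => exact absurd h hi
    | succ i => rw [spine_nil_succ, numChildren_cons] at hi; exact ⟨i, hi⟩
  · rintro ⟨i, hi⟩
    exact ⟨i + 1, by rwa [spine_nil_succ, numChildren_cons]⟩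

/-- Finiteness is essential: along an infinite line both lengths have the default value `sInf ∅ =
0`. -/
theorem spineLength_nil_of_eq (h : numChildren S [] = 1) (hf : FiniteSpine S) :
    spineLength S [] = spineLength (above S (nthKid S 0)) [] + 1 := by
  unfold spineLength
  have h0 : (0 : ℕ) ∉ {i | numChildren S (spine S [] i) ≠ 1} := fun h' => h' h
  have hpos : 0 < sInf {i | numChildren S (spine S [] i) ≠ 1} := by
    refine Nat.pos_of_ne_zero fun h' => ?_
    rcases Nat.sInf_eq_zero.1 h' with h' | h'
    · exact h0 h'
    · obtain ⟨i, hi⟩ := hf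
      exact (Set.eq_empty_iff_forall_notMem.1 h') i hi
  have := Nat.sInf_add (p := fun i => numChildren S (spine S [] i) ≠ 1) (n := 1) hpos
  rw [← this]
  simp_rw [spine_nil_succ, numChildren_cons]

theorem spineEnd_nil_of_eq (h : numChildren S [] = 1) (hf : FiniteSpine S) :
    spineEnd S [] = nthKid S 0 :: spineEnd (above S (nthKid S 0)) [] := by
  rw [spineEnd, spineLength_nil_of_eq h hf, spine_nil_succ, spineEnd]

theorem locate_cons_of_lt (h : numChildren S [] ≠ 1)
    (hj : j < numChildren S []) (w : List ℕ) :
    locate S (j :: w) = (locate (above S (nthKid S j)) w).map (nthKid S j :: ·) := by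
  rw [locate, List.foldlM_cons, reduceStep, spineEnd_nil_of_ne h, if_pos hj]
  exact foldlM_reduceStep_cons S (nthKid S j) [] w

theorem locate_cons_of_le (h : numChildren S [] ≠ 1)
    (hj : numChildren S [] ≤ j) (w : List ℕ) : locate S (j :: w) = none := by
  rw [locate, List.foldlM_cons, reduceStep, spineEnd_nil_of_ne h, if_neg (not_lt.2 hj)]
  rfl

/-- A root with a single child is merged with it, so the two reduced trees agree above their roots
and the same word `j :: w` occurs on both sides. -/
theorem locate_cons_of_eq (h : numChildren S [] = 1) (hf : FiniteSpine S)
    (j : ℕ) (w : List ℕ) :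
    locate S (j :: w) = (locate (above S (nthKid S 0)) (j :: w)).map (nthKid S 0 :: ·) := by
  rw [locate, locate, List.foldlM_cons, List.foldlM_cons]
  have : reduceStep S [] j = (reduceStep (above S (nthKid S 0)) [] j).map (nthKid S 0 :: ·) := by
    unfold reduceStep
    rw [spineEnd_nil_of_eq h hf, numChildren_cons, nthChild_cons]
    split_ifs <;> rfl
  rw [this]
  cases h' : reduceStep (above S (nthKid S 0)) [] j with
  | none => rfl
  | some v => exact foldlM_reduceStep_cons S (nthKid S 0) v w

theorem sum_spine_cons (L : List ℕ → ℝ) (S : Set (List ℕ)) (i : ℕ) (v : List ℕ) :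
    ∑ k ∈ Finset.range (spineLength S (i :: v) + 1), L (spine S (i :: v) k)
      = ∑ k ∈ Finset.range (spineLength (above S i) v + 1), L (i :: spine (above S i) v k) := by
  simp_rw [spineLength_cons, spine_cons]

theorem reduceLife_nil_of_ne (L : List ℕ → ℝ) (h : numChildren S [] ≠ 1) :
    reduceLife L S [] = L [] := by
  simp [reduceLife, locate, spineLength_nil_of_ne h, spine]

theorem reduceLife_cons_of_lt (L : List ℕ → ℝ) (h : numChildren S [] ≠ 1) (hj : j < numChildren S []) (w : List ℕ) :
    reduceLife L S (j :: w)
      = reduceLife (fun u => L (nthKid S j :: u)) (above S (nthKid S j)) w := by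
  rw [reduceLife, locate_cons_of_lt h hj, Option.map_map, reduceLife]
  simp only [Function.comp_def, sum_spine_cons]

theorem reduceLife_cons_of_le (L : List ℕ → ℝ) (h : numChildren S [] ≠ 1) (hj : numChildren S [] ≤ j) (w : List ℕ) : reduceLife L S (j :: w) = 0 := by
  rw [reduceLife, locate_cons_of_le h hj]
  rfl

theorem reduceLife_cons_of_eq (L : List ℕ → ℝ) (h : numChildren S [] = 1)
    (hf : FiniteSpine S) (j : ℕ) (w : List ℕ) :
    reduceLife L S (j :: w)
      = reduceLife (fun u => L (nthKid S 0 :: u)) (above S (nthKid S 0)) (j :: w) := by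
  rw [reduceLife, locate_cons_of_eq h hf, Option.map_map, reduceLife]
  simp only [Function.comp_def, sum_spine_cons]

theorem reduceLife_nil_of_eq (L : List ℕ → ℝ) (h : numChildren S [] = 1)
    (hf : FiniteSpine S) :
    reduceLife L S []
      = L [] + reduceLife (fun u => L (nthKid S 0 :: u)) (above S (nthKid S 0)) [] := by
  simp only [reduceLife, locate, List.foldlM_nil]
  change ∑ i ∈ _, _ = L [] + ∑ i ∈ _, _
  rw [spineLength_nil_of_eq h hf, Finset.sum_range_succ', add_comm]
  simp_rw [spine_nil_succ]
  rfl

/-! ### Product measures -/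

section Product

variable {ι ι' : Type*}

theorem map_option_elim_prod_infinitePi {X : Type*} [MeasurableSpace X] (μ : Option ι → Measure X)
    [∀ i, IsProbabilityMeasure (μ i)] :
    ((μ none).prod (infinitePi fun j => μ (some j))).map
      (fun x (i : Option ι) => i.elim x.1 x.2) = infinitePi μ := by
  classical
  have hm : Measurable fun (x : X × (ι → X)) (i : Option ι) => i.elim x.1 x.2 := by
    refine measurable_pi_lambda _ fun i => ?_
    cases i with
    | none => exact measurable_fst
    | some j => exact (measurable_pi_apply j).comp measurable_snd
  refine Measure.eq_infinitePi μ fun s t ht => ?_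
  rw [map_apply hm (MeasurableSet.pi s.countable_toSet fun i _ => ht i)]
  have : (fun (x : X × (ι → X)) (i : Option ι) => i.elim x.1 x.2) ⁻¹' (Set.pi s t)
      = (if none ∈ s then t none else univ) ×ˢ
        (Set.pi (Finset.eraseNone s : Finset ι) fun j => t (some j)) := by
    ext x
    simp only [mem_preimage, Set.mem_pi, mem_prod, Finset.mem_coe, Finset.mem_eraseNone]
    constructor
    · intro h
      refine ⟨?_, fun j hj => h (some j) hj⟩
      split_ifs with hs
      · exact h none hs
      · trivial
    · rintro ⟨h1, h2⟩ i hi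
      cases i with
      | none => rwa [if_pos hi] at h1
      | some j => exact h2 j hi
  rw [this, prod_prod, infinitePi_pi _ fun j _ => ht _]
  have hs : ∏ i ∈ s.erase none, μ i (t i) = ∏ j ∈ Finset.eraseNone s, μ (some j) (t (some j)) := by
    rw [← Finset.map_some_eraseNone, Finset.prod_map]
    rfl
  split_ifs with h0
  · rw [← hs, Finset.mul_prod_erase s (fun i => μ i (t i)) h0]
  · rw [← hs, Finset.erase_eq_of_notMem h0, measure_univ, one_mul]

/-- One coordinate is independent of a family of other coordinates. -/
theorem infinitePi_map_split {X : Type*} [MeasurableSpace X] (μ : ι → Measure X)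
    [∀ i, IsProbabilityMeasure (μ i)] (i₀ : ι) {f : ι' → ι} (hf : Function.Injective f)
    (h₀ : ∀ j, f j ≠ i₀) :
    (infinitePi μ).map (fun ω => (ω i₀, fun j => ω (f j)))
      = (μ i₀).prod (infinitePi fun j => μ (f j)) := by
  -- Adjoining `i₀` keeps the indexing injective, and restricting a product measure along an
  -- injection gives a product measure.
  let g : Option ι' → ι := fun o => o.elim i₀ f
  have hg : Function.Injective g := by
    intro a b h
    cases a <;> cases b
    · rfl
    · exact absurd h.symm (h₀ _)
    · exact absurd h (h₀ _)
    · exact congrArg some (hf h)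
  have h1 : (infinitePi μ).map (fun ω o => ω (g o)) = infinitePi fun o => μ (g o) :=
    Measure.map_infinitePi_infinitePi_of_inj hg
  have h2 := map_option_elim_prod_infinitePi fun o => μ (g o)
  rw [← h1] at h2
  have hm : Measurable fun y : Option ι' → X => (y none, fun j => y (some j)) := by fun_prop
  have h3 := congrArg (Measure.map fun y : Option ι' → X => (y none, fun j => y (some j))) h2
  rw [map_map hm (by
      refine measurable_pi_lambda _ fun i => ?_
      cases i with
      | none => exact measurable_fst
      | some j => exact (measurable_pi_apply j).comp measurable_snd),
    map_map hm (by fun_prop)] at h3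
  exact h3.symm.trans map_id

theorem pi_prod_pi_map_zip [Fintype ι] {X Y : Type*} [MeasurableSpace X] [MeasurableSpace Y]
    (μ : ι → Measure X) (ν : ι → Measure Y) [∀ i, IsProbabilityMeasure (μ i)]
    [∀ i, IsProbabilityMeasure (ν i)] :
    ((Measure.pi μ).prod (Measure.pi ν)).map (fun x i => (x.1 i, x.2 i))
      = Measure.pi fun i => (μ i).prod (ν i) :=
  ((measurePreserving_arrowProdEquivProdArrow X Y ι μ ν).symm _).map_eq

theorem infinitePi_prod_map_zip {X Y : Type*} [MeasurableSpace X] [MeasurableSpace Y]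
    (μ : ι → Measure X) (ν : ι → Measure Y) [∀ i, IsProbabilityMeasure (μ i)]
    [∀ i, IsProbabilityMeasure (ν i)] :
    ((infinitePi μ).prod (infinitePi ν)).map (fun x i => (x.1 i, x.2 i))
      = infinitePi fun i => (μ i).prod (ν i) := by
  refine IsProjectiveLimit.unique (P := fun I : Finset ι => Measure.pi fun i : I =>
    (μ i).prod (ν i)) (fun I => ?_) (Measure.isProjectiveLimit_infinitePi _)
  change _ = Measure.pi fun i : I => (μ i).prod (ν i)
  rw [← pi_prod_pi_map_zip, ← Measure.infinitePi_map_restrict (μ := μ),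
    ← Measure.infinitePi_map_restrict (μ := ν), map_prod_map _ _ (by fun_prop)
    (by fun_prop), map_map (by fun_prop) (by fun_prop),
    map_map (by fun_prop) (by fun_prop)]
  rfl

theorem pi_prod_infinitePi_map_zip {X Y : Type*} [MeasurableSpace X] [MeasurableSpace Y]
    (μ : Measure X) (ν : Measure Y) [IsProbabilityMeasure μ] [IsProbabilityMeasure ν] (n : ℕ) :
    ((Measure.pi fun _ : Fin n => μ).prod (infinitePi fun _ : ℕ => ν)).map
      (fun x (i : Fin n) => (x.1 i, x.2 i)) = Measure.pi fun _ => μ.prod ν := by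
  have h1 : (infinitePi fun _ : ℕ => ν).map (fun ω (i : Fin n) => ω i)
      = Measure.pi fun _ : Fin n => ν :=
    (Measure.map_infinitePi_infinitePi_of_inj Fin.val_injective).trans
      (Measure.infinitePi_eq_pi _)
  rw [← pi_prod_pi_map_zip, ← h1]
  conv_rhs => rw [← map_id (μ := Measure.pi fun _ : Fin n => μ)]
  rw [map_prod_map _ _ measurable_id (by fun_prop),
    map_map (by fun_prop) (by fun_prop)]
  rfl

/-- The root and the fields above the letters of a field on words are independent. -/
theorem infinitePi_map_root {X : Type*} [MeasurableSpace X] (ν : Measure X)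
    [IsProbabilityMeasure ν] :
    (infinitePi fun _ : List ℕ => ν).map (fun ω => (ω [], fun (i : ℕ) u => ω (i :: u)))
      = ν.prod (infinitePi fun _ : ℕ => infinitePi fun _ : List ℕ => ν) := by
  have h := infinitePi_map_split (fun _ : List ℕ => ν) [] (f := fun x : ℕ × List ℕ => x.1 :: x.2)
    (fun a b h => by simp at h; exact Prod.ext h.1 h.2) (fun j => by simp)
  have h2 := infinitePi_map_curry (fun (_ : ℕ) (_ : List ℕ) => ν)
  have h3 := map_prod_map ν (infinitePi fun _ : ℕ × List ℕ => ν) measurable_id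
    (MeasurableEquiv.curry ℕ (List ℕ) X).measurable
  rw [map_id, h2, ← h, map_map (by fun_prop) (by fun_prop)] at h3
  exact h3.symm

theorem eq_smul_pi_of_rectangles [Fintype ι] {X : Type*} [MeasurableSpace X] (μ : ι → Measure X)
    [∀ i, IsProbabilityMeasure (μ i)] {c : ℝ≥0∞} (hc : c ≠ ∞) {ρ : Measure (ι → X)}
    (h : ∀ A : ι → Set X, (∀ i, MeasurableSet (A i)) → ρ (Set.pi univ A) = c * ∏ i, μ i (A i)) :
    ρ = c • Measure.pi μ := by
  have hu : ρ univ = c := by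
    have := h (fun _ => univ) fun _ => MeasurableSet.univ
    simpa using this
  by_cases h0 : c = 0
  · rw [h0, zero_smul, ← Measure.measure_univ_eq_zero, hu, h0]
  · have : Measure.pi μ = c⁻¹ • ρ := by
      refine Measure.pi_eq fun A hA => ?_
      rw [Measure.smul_apply, h A hA, smul_eq_mul, ← mul_assoc, ENNReal.inv_mul_cancel h0 hc,
        one_mul]
    rw [this, smul_smul, ENNReal.mul_inv_cancel h0 hc, one_smul]

end Product

/-! ### The root decomposition of a Galton-Watson tree -/

/-- The branching property speaks only of rectangles. For a fixed set of root lifetimes the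
rectangles of subtrees determine a multiple of a product measure, and the sets of lifetimes are then
varied. -/
theorem IsGWTreeLaw.map_root
    (h : IsGWTreeLaw q κ P) (n : ℕ) :
    (P.restrict {t | kids t = n}).map (fun t => (t.life [], fun i : Fin n => child t i))
      = q n • κ.prod (Measure.pi fun _ => P) := by
  have := h.isProb
  have := h.isProb_life
  have hk : MeasurableSet {t | kids t = n} := measurable_kids (measurableSet_singleton n)
  have hm : Measurable fun t : MTree => fun i : Fin n => child t i :=
    measurable_pi_lambda _ fun i => measurable_child i
  have hl := MTree.measurable_life []
  have : IsFiniteMeasure (q n • κ.prod (Measure.pi fun _ : Fin n => P)) :=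
    smul_finite _ (q.apply_ne_top n)
  refine Measure.ext_prod fun {H B} hH hB => ?_
  have key : ((P.restrict {t | kids t = n}).restrict ((fun t => t.life []) ⁻¹' H)).map
      (fun t => fun i : Fin n => child t i) = (q n * κ H) • Measure.pi fun _ => P := by
    refine eq_smul_pi_of_rectangles _ (mul_ne_top (q.apply_ne_top n)
      (measure_ne_top _ _)) fun A hA => ?_
    rw [map_apply hm (MeasurableSet.univ_pi hA), Measure.restrict_apply
      (hm (MeasurableSet.univ_pi hA)), Measure.restrict_apply
      ((hm (MeasurableSet.univ_pi hA)).inter (hl hH)), ← h.branching n H A hH hA]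
    congr 1
    ext t
    simp only [mem_inter_iff, mem_preimage, Set.mem_pi, mem_univ, true_imp_iff, mem_ofPred_eq,
      exists_subtree_mem_iff]
    constructor
    · rintro ⟨⟨h1, h2⟩, h3⟩
      exact ⟨h3, h2, fun i => ⟨h3 ▸ i.2, h1 i⟩⟩
    · rintro ⟨h3, h2, h1⟩
      exact ⟨⟨fun i => (h1 i).2, h2⟩, h3⟩
  have h2 := congrArg (fun ρ => ρ B) key
  simp only [Measure.smul_apply, smul_eq_mul] at h2
  rw [map_apply (hl.prodMk hm) (hH.prod hB), Measure.smul_apply, prod_prod,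
    smul_eq_mul, ← mul_assoc, ← h2, map_apply hm hB, Measure.restrict_apply (hm hB)]
  congr 1
  ext t
  simp only [mem_inter_iff, mem_preimage, mem_prod]
  tauto

/-- The coloured subtree above the `i`-th child of the root. -/
def colChild (x : ColTree) (i : ℕ) : ColTree := (child x.1 i, fun u => x.2 (i :: u))

theorem measurable_colChild (i : ℕ) : Measurable fun x => colChild x i :=
  ((measurable_child i).comp measurable_fst).prodMk
    (measurable_pi_lambda _ fun _ => (measurable_pi_apply _).comp measurable_snd)

/-- The law of a coloured tree. -/
def colTreeLaw (P : Measure MTree) (ν : Measure Bool) : Measure ColTree :=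
  P.prod (infinitePi fun _ : List ℕ => ν)

instance (P : Measure MTree) (ν : Measure Bool) [IsProbabilityMeasure P]
    [IsProbabilityMeasure ν] : IsProbabilityMeasure (colTreeLaw P ν) := by
  unfold colTreeLaw; infer_instance

/-- The lifetime and the colour of the root, and the coloured subtrees of its children. -/
def rootData (n : ℕ) (x : ColTree) : ℝ × Bool × (Fin n → ColTree) :=
  (x.1.life [], x.2 [], fun i => colChild x i)

theorem measurable_rootData (n : ℕ) : Measurable (rootData n) :=
  ((MTree.measurable_life []).comp measurable_fst).prodMk
    (((measurable_pi_apply []).comp measurable_snd).prodMk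
      (measurable_pi_lambda _ fun i => measurable_colChild i))

theorem IsGWTreeLaw.map_rootData
    (h : IsGWTreeLaw q κ P) (ν : Measure Bool) [IsProbabilityMeasure ν] (n : ℕ) :
    ((colTreeLaw P ν).restrict {x | kids x.1 = n}).map (rootData n)
      = q n • κ.prod (ν.prod (Measure.pi fun _ => colTreeLaw P ν)) := by
  have := h.isProb
  have := h.isProb_life
  have hk : MeasurableSet {t | kids t = n} := measurable_kids (measurableSet_singleton n)
  have hm : Measurable fun t : MTree => (t.life [], fun i : Fin n => child t i) :=
    (MTree.measurable_life []).prodMk (measurable_pi_lambda _ fun i => measurable_child i)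
  let N : Measure (List ℕ → Bool) := infinitePi fun _ : List ℕ => ν
  have h1 : (colTreeLaw P ν).restrict {x | kids x.1 = n} = (P.restrict {t | kids t = n}).prod N := by
    have : {x : ColTree | kids x.1 = n} = {t | kids t = n} ×ˢ univ := by
      ext x; simp
    rw [this, colTreeLaw, ← Measure.prod_restrict, Measure.restrict_univ]
  -- `D` splits the tree and the colour field at the root separately; `Z` regroups the pieces so
  -- that every subtree receives its own colours.
  let Z : (ℝ × (Fin n → MTree)) × (Bool × (ℕ → List ℕ → Bool)) → ℝ × Bool × (Fin n → ColTree) :=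
    fun y => (y.1.1, y.2.1, fun i => (y.1.2 i, y.2.2 i))
  have hZ : Measurable Z := by fun_prop
  let D : ColTree → (ℝ × (Fin n → MTree)) × (Bool × (ℕ → List ℕ → Bool)) :=
    Prod.map (fun t => (t.life [], fun i : Fin n => child t i))
      (fun ω => (ω [], fun (i : ℕ) u => ω (i :: u)))
  have hm2 : Measurable fun ω : List ℕ → Bool => (ω [], fun (i : ℕ) u => ω (i :: u)) := by fun_prop
  have hD : Measurable D := hm.prodMap hm2
  have h2 : rootData n = Z ∘ D := rfl
  rw [h1, h2, ← map_map hZ hD, ← map_prod_map _ _ hm hm2, h.map_root,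
    infinitePi_map_root, Measure.prod_smul_left, Measure.map_smul]
  congr 1
  have h3 := pi_prod_infinitePi_map_zip P N n
  have : IsProbabilityMeasure (Measure.map Z ((κ.prod (Measure.pi fun _ : Fin n => P)).prod
      (ν.prod (infinitePi fun _ : ℕ => N)))) :=
    isProbabilityMeasure_map hZ.aemeasurable
  refine Measure.ext_prod₃ fun {H C B} hH hC hB => ?_
  have hz : Measurable fun x : (Fin n → MTree) × (ℕ → List ℕ → Bool) =>
    fun i : Fin n => (x.1 i, x.2 i) := by fun_prop
  have h4 := congrArg (fun ρ => ρ B) h3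
  simp only [map_apply hz hB] at h4
  rw [prod_prod, prod_prod, colTreeLaw, ← h4, map_apply hZ
    (hH.prod (hC.prod hB))]
  have hB' := hz hB
  generalize hE : (fun x : (Fin n → MTree) × (ℕ → List ℕ → Bool) =>
    fun i : Fin n => ((x.1 i, x.2 i) : ColTree)) ⁻¹' B = E at *
  have : Z ⁻¹' (H ×ˢ C ×ˢ B) = {y | y.1.1 ∈ H ∧ y.2.1 ∈ C ∧ (y.1.2, y.2.2) ∈ E} := by
    rw [← hE]; rfl
  rw [this]
  have hms : MeasurableSet {y : (ℝ × (Fin n → MTree)) × (Bool × (ℕ → List ℕ → Bool)) |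
      y.1.1 ∈ H ∧ y.2.1 ∈ C ∧ (y.1.2, y.2.2) ∈ E} := by
    rw [← this]; exact hZ (hH.prod (hC.prod hB))
  have e1 : ∀ (a : ℝ × (Fin n → MTree)), (ν.prod (infinitePi fun _ : ℕ => N))
      (Prod.mk a ⁻¹' {y : (ℝ × (Fin n → MTree)) × (Bool × (ℕ → List ℕ → Bool)) |
      y.1.1 ∈ H ∧ y.2.1 ∈ C ∧ (y.1.2, y.2.2) ∈ E}) = H.indicator 1 a.1 *
        (ν C * (infinitePi fun _ : ℕ => N) (Prod.mk a.2 ⁻¹' E)) := by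
    intro a
    by_cases ha : a.1 ∈ H
    · rw [← prod_prod, indicator_of_mem ha, Pi.one_apply, one_mul]
      congr 1
      ext y
      simp [ha]
    · simp [ha]
  rw [Measure.prod_apply hms, lintegral_congr e1]
  have hmE : Measurable fun b : Fin n → MTree =>
      ν C * (infinitePi fun _ : ℕ => N) (Prod.mk b ⁻¹' E) :=
    (measurable_measure_prodMk_left hB').const_mul _
  rw [lintegral_prod_mul (measurable_one.indicator hH).aemeasurable hmE.aemeasurable,
    lintegral_indicator_one hH, lintegral_const_mul _ (measurable_measure_prodMk_left hB'),
    ← Measure.prod_apply hB']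

theorem IsGWTreeLaw.measure_rootData
    (h : IsGWTreeLaw q κ P) (ν : Measure Bool) [IsProbabilityMeasure ν] (n : ℕ)
    {D : Set (ℝ × Bool × (Fin n → ColTree))} (hD : MeasurableSet D) :
    colTreeLaw P ν {x | kids x.1 = n ∧ rootData n x ∈ D}
      = q n * (κ.prod (ν.prod (Measure.pi fun _ => colTreeLaw P ν))) D := by
  have := congrArg (fun ρ => ρ D) (h.map_rootData ν n)
  simp only [Measure.smul_apply, smul_eq_mul] at this
  rw [← this, map_apply (measurable_rootData n) hD, Measure.restrict_apply
    (measurable_rootData n hD), inter_comm]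
  rfl

/-! ### Filtering independent sequences -/

section Filter

variable {X : Type*}

open Classical in
/-- The indices of the entries that lie in `K`. -/
def keptIdx {n : ℕ} (K : Set X) (x : Fin n → X) : Finset (Fin n) :=
  Finset.univ.filter fun i => x i ∈ K

theorem mem_keptIdx {K : Set X} {x : Fin n → X} {i : Fin n} :
    i ∈ keptIdx K x ↔ x i ∈ K := by
  simp [keptIdx]

/-- The event that exactly `j` entries lie in `K` and that these lie in given sets. -/
def filterEvent (n j : ℕ) (K : Set X) (A : Fin j → Set X) : Set (Fin n → X) :=
  {x | ∃ h : (keptIdx K x).card = j, ∀ m : Fin j, x ((keptIdx K x).orderEmbOfFin h m) ∈ A m}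

open Classical in
-- For a fixed set `I` of kept indices the event is a rectangle. The rectangles of different `I` are
-- disjoint and have equal probability under a power of one law, which is where the binomial
-- coefficient of `pi_filterEvent` comes from.
theorem filterEvent_eq (n j : ℕ) (K : Set X) (A : Fin j → Set X) :
    filterEvent n j K A = ⋃ I : {I : Finset (Fin n) // I.card = j}, Set.pi univ fun i =>
      if hi : i ∈ I.1 then K ∩ A ((I.1.orderIsoOfFin I.2).symm ⟨i, hi⟩) else Kᶜ := by
  ext x
  simp only [filterEvent, mem_ofPred_eq, mem_iUnion, Set.mem_pi, mem_univ, true_imp_iff]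
  constructor
  · rintro ⟨h, hx⟩
    refine ⟨⟨keptIdx K x, h⟩, fun i => ?_⟩
    by_cases hi : i ∈ keptIdx K x
    · rw [dif_pos hi]
      refine ⟨mem_keptIdx.1 hi, ?_⟩
      have := hx (((keptIdx K x).orderIsoOfFin h).symm ⟨i, hi⟩)
      rwa [← Finset.coe_orderIsoOfFin_apply, OrderIso.apply_symm_apply] at this
    · rw [dif_neg hi]
      exact fun h' => hi (mem_keptIdx.2 h')
  · rintro ⟨⟨I, hI⟩, hx⟩
    have hk : keptIdx K x = I := by
      ext i
      rw [mem_keptIdx]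
      have := hx i
      by_cases hi : i ∈ I
      · rw [dif_pos hi] at this
        exact iff_of_true this.1 hi
      · rw [dif_neg hi] at this
        exact iff_of_false this hi
    subst hk
    refine ⟨hI, fun m => ?_⟩
    have := hx ((keptIdx K x).orderEmbOfFin hI m)
    rw [dif_pos (orderEmbOfFin_mem _ _ _)] at this
    convert! this.2
    symm
    rw [OrderIso.symm_apply_eq]
    rfl

variable [MeasurableSpace X]

theorem measurableSet_filterEvent (n j : ℕ) {K : Set X} {A : Fin j → Set X} (hK : MeasurableSet K)
    (hA : ∀ m, MeasurableSet (A m)) : MeasurableSet (filterEvent n j K A) := by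
  classical
  rw [filterEvent_eq]
  refine MeasurableSet.iUnion fun I => MeasurableSet.univ_pi fun i => ?_
  split_ifs
  · exact hK.inter (hA _)
  · exact hK.compl

theorem pi_filterEvent (n j : ℕ) {K : Set X} {A : Fin j → Set X} (hK : MeasurableSet K)
    (hA : ∀ m, MeasurableSet (A m)) (μ : Measure X) [IsProbabilityMeasure μ] :
    (Measure.pi fun _ : Fin n => μ) (filterEvent n j K A)
      = n.choose j * μ Kᶜ ^ (n - j) * ∏ m, μ (K ∩ A m) := by
  classical
  rw [filterEvent_eq, measure_iUnion]
  · have : ∀ I : {I : Finset (Fin n) // I.card = j}, (Measure.pi fun _ : Fin n => μ)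
        (Set.pi univ fun i => if hi : i ∈ I.1 then
          K ∩ A ((I.1.orderIsoOfFin I.2).symm ⟨i, hi⟩) else Kᶜ)
        = μ Kᶜ ^ (n - j) * ∏ m, μ (K ∩ A m) := by
      rintro ⟨I, hI⟩
      rw [pi_pi, ← Finset.prod_compl_mul_prod I]
      congr 1
      · rw [Finset.prod_congr rfl (g := fun _ => μ Kᶜ), prod_const, Finset.card_compl,
          Fintype.card_fin, hI]
        intro i hi
        rw [dif_neg (Finset.mem_compl.1 hi)]
      · rw [← Finset.prod_coe_sort I]
        refine (Fintype.prod_equiv (I.orderIsoOfFin hI).toEquiv _ _ fun m => ?_).symm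
        have hm : (I.orderEmbOfFin hI) m ∈ I := orderEmbOfFin_mem _ _ _
        have h2 : (I.orderIsoOfFin hI).symm ⟨(I.orderEmbOfFin hI) m, hm⟩ = m := by
          rw [OrderIso.symm_apply_eq]
          rfl
        change _ = μ (if hi : (I.orderEmbOfFin hI) m ∈ I then
          K ∩ A ((I.orderIsoOfFin hI).symm ⟨(I.orderEmbOfFin hI) m, hi⟩) else Kᶜ)
        rw [dif_pos hm, h2]
    rw [tsum_congr this, tsum_fintype, Finset.sum_const, nsmul_eq_mul, mul_assoc]
    congr 2
    rw [card_univ, Fintype.card_finset_len, Fintype.card_fin]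
  · rintro ⟨I, hI⟩ ⟨J, hJ⟩ hIJ
    refine disjoint_left.2 fun x hx hx' => hIJ (Subtype.ext ?_)
    ext i
    have h1 := hx i trivial
    have h2 := hx' i trivial
    dsimp only at h1 h2
    by_cases hi : i ∈ I <;> by_cases hj : i ∈ J
    · exact iff_of_true hi hj
    · rw [dif_pos hi] at h1
      rw [dif_neg hj] at h2
      exact absurd h1.1 h2
    · rw [dif_neg hi] at h1
      rw [dif_pos hj] at h2
      exact absurd h2.1 h1
    · exact iff_of_false hi hj
  · intro I
    refine MeasurableSet.univ_pi fun i => ?_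
    split_ifs
    · exact hK.inter (hA _)
    · exact hK.compl

end Filter

/-! ### Reduced bushes -/

/-- The indices of the trees with black root. -/
abbrev blackIdx (p : ℝ) {n : ℕ} (x : Fin n → ColTree) : Finset (Fin n) :=
  keptIdx {y | rootBlack p y} x

/-- The reduced bush of a sequence of coloured trees. -/
def redBush (p : ℝ) {n : ℕ} (x : Fin n → ColTree) : Bush :=
  ⟨(blackIdx p x).card, fun m => redTree p (x ((blackIdx p x).orderEmbOfFin rfl m))⟩

theorem redTree_eq_reduce (h : rootBlack p x) :
    redTree p x = x.1.reduce (blackNodes p x.1 x.2) h (fun _ hu => hu.1) := dif_pos h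

theorem reduceBush_eq (p : ℝ) (b : Bush) (col : ℕ → List ℕ → Bool) :
    reduceBush p b col = redBush p fun i => (b.2 i, col i) := by
  classical
  unfold reduceBush redBush
  refine Sigma.ext rfl (heq_of_eq (funext fun m => ?_))
  exact (redTree_eq_reduce (Finset.mem_filter.1 (orderEmbOfFin_mem
    (blackIdx p fun i : Fin b.1 => (b.2 i, col i)) rfl m)).2).symm

theorem measurable_redBush (p : ℝ) (n : ℕ) :
    Measurable fun x : Fin n → ColTree => redBush p x := by
  let : MeasurableSpace (Finset (Fin n)) := ⊤
  have : DiscreteMeasurableSpace (Finset (Fin n)) := ⟨fun _ => trivial⟩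
  have hk : Measurable fun x : Fin n → ColTree => blackIdx p x := by
    refine measurable_to_countable' fun I => ?_
    have : (fun x : Fin n → ColTree => blackIdx p x) ⁻¹' {I}
        = {x | ∀ i, rootBlack p (x i) ↔ i ∈ I} := by
      ext x
      simp only [mem_preimage, mem_singleton_iff, mem_ofPred_eq, Finset.ext_iff, mem_keptIdx]
    rw [this]
    refine measurableSet_setOfPred.2 (Measurable.forall fun i => Measurable.iff ?_
      measurable_const)
    have hi : Measurable fun x : Fin n → ColTree => x i := measurable_pi_apply i
    exact measurableSet_setOfPred.1 (hi (measurableSet_rootBlack p))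
  refine measurable_countable_comp (g := fun (I : Finset (Fin n)) (x : Fin n → ColTree) =>
    (⟨I.card, fun m => redTree p (x (I.orderEmbOfFin rfl m))⟩ : Bush)) hk fun I => ?_
  exact (measurable_sigma_mk I.card).comp (measurable_pi_lambda _ fun m =>
    (measurable_redTree p).comp (measurable_pi_apply _))

/-- The bushes of `j` trees that lie in given sets. -/
def bushRect (j : ℕ) (A : Fin j → Set MTree) : Set Bush :=
  {b | ∃ h : b.1 = j, ∀ m : Fin j, b.2 (Fin.cast h.symm m) ∈ A m}

theorem redBush_mem_bushRect (p : ℝ) (x : Fin n → ColTree) (A : Fin j → Set MTree) :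
    redBush p x ∈ bushRect j A ↔
      x ∈ filterEvent n j {y | rootBlack p y} (fun m => redTree p ⁻¹' A m) := by
  constructor
  · rintro ⟨h, hx⟩
    subst h
    exact ⟨rfl, hx⟩
  · rintro ⟨h, hx⟩
    subst h
    exact ⟨rfl, hx⟩

/-! ### Black individuals and the root -/

theorem kids_eq_iff_life {s t : MTree} (h : ∀ i, s.life [i] = t.life [i]) : kids s = kids t := by
  have : ∀ i, i < kids s ↔ i < kids t := fun i => by
    rw [← s.singleton_mem_nodes, ← t.singleton_mem_nodes, s.mem_nodes_iff, t.mem_nodes_iff, h]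
  refine le_antisymm ?_ ?_ <;> by_contra h'
  · exact lt_irrefl _ ((this _).1 (not_le.1 h'))
  · exact lt_irrefl _ ((this _).2 (not_le.1 h'))

/-- Being black depends only on the part of the tree above the individual. -/
theorem above_blackNodes (hi : i < kids x.1) :
    above (blackNodes p x.1 x.2) i = blackNodes p (colChild x i).1 (colChild x i).2 := by
  ext u
  simp only [above, blackNodes, colChild, mem_ofPred_eq, mem_child_nodes hi]
  have : ∀ v, numChildren (child x.1 i).nodes v = numChildren x.1.nodes (i :: v) := fun v => by
    unfold numChildren
    congr 1
    ext k
    simp [mem_child_nodes hi]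
  simp only [this, List.cons_append]

theorem singleton_mem_blackNodes :
    [i] ∈ blackNodes p x.1 x.2 ↔ i < kids x.1 ∧ rootBlack p (colChild x i) := by
  constructor
  · intro h
    have hi := (x.1.singleton_mem_nodes i).1 h.1
    refine ⟨hi, ?_⟩
    rw [rootBlack, ← above_blackNodes hi]
    exact h
  · rintro ⟨hi, h⟩
    rw [rootBlack, ← above_blackNodes hi] at h
    exact h

/-- This recursion becomes the equation for the probability of a black root. For `p = 1` it
expresses that a tree whose root has finitely many children is infinite only if one of the subtrees
is. -/
theorem rootBlack_iff :
    rootBlack p x ↔ (kids x.1 = 0 ∧ p < 1 ∧ x.2 [] = true) ∨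
      ∃ i < kids x.1, rootBlack p (colChild x i) := by
  have hc : ∀ i, (i < kids x.1 ∧ rootBlack p (colChild x i)) ↔ [i] ∈ blackNodes p x.1 x.2 :=
    fun i => singleton_mem_blackNodes.symm
  simp only [hc]
  constructor
  · rintro ⟨-, h | h⟩
    · obtain ⟨hp, v, hv, h0, hb⟩ := h
      cases v with
      | nil => exact Or.inl ⟨h0, hp, hb⟩
      | cons i v =>
        have hi := MTree.cons_mem_nodes hv
        refine Or.inr ⟨i, (x.1.singleton_mem_nodes i).2 hi, Or.inl ⟨hp, v, hv, h0, hb⟩⟩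
    · obtain ⟨hp, hinf⟩ := h
      right
      by_contra! hcon
      refine hinf ?_
      -- The tree is the root together with finitely many subtrees, so if these are all finite it is
      -- finite.
      have hsub : {v | [] ++ v ∈ x.1.nodes} ⊆ {[]} ∪
          ⋃ i ∈ Finset.range (kids x.1), (fun v => i :: v) '' {v | [i] ++ v ∈ x.1.nodes} := by
        intro v hv
        cases v with
        | nil => exact Or.inl rfl
        | cons i v =>
          have hi := MTree.cons_mem_nodes hv
          exact Or.inr (mem_iUnion₂.2 ⟨i, Finset.mem_range.2 hi, v, hv, rfl⟩)
      refine Set.Finite.subset ((finite_singleton _).union (Set.Finite.biUnion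
        (Finset.finite_toSet _) fun i hi => Set.Finite.image _ ?_)) hsub
      by_contra hfin
      exact hcon i ⟨(x.1.singleton_mem_nodes i).2
        (Finset.mem_range.1 hi), Or.inr ⟨hp, hfin⟩⟩
  · rintro (⟨h0, hp, hb⟩ | ⟨i, h, h'⟩)
    · exact ⟨x.1.root_mem, Or.inl ⟨hp, [], x.1.root_mem, h0, hb⟩⟩
    · refine ⟨x.1.root_mem, ?_⟩
      rcases h' with ⟨hp, v, hv⟩ | ⟨hp, hinf⟩
      · exact Or.inl ⟨hp, [i] ++ v, hv⟩
      · refine Or.inr ⟨hp, Set.Infinite.mono ?_ (Set.Infinite.image (f := fun v => [i] ++ v)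
          (fun a _ b _ h => by simpa using h) hinf)⟩
        rintro _ ⟨v, hv, rfl⟩
        exact hv

/-- The children of the root, with their colours. -/
def colChildren (x : ColTree) : Fin (kids x.1) → ColTree := fun i => colChild x i

theorem ofPred_singleton_mem_blackNodes (p : ℝ) (x : ColTree) :
    {k | [k] ∈ blackNodes p x.1 x.2}
      = ((blackIdx p (colChildren x)).map Fin.valEmbedding : Finset ℕ) := by
  ext k
  simp only [mem_ofPred_eq, singleton_mem_blackNodes, Finset.coe_map, mem_image, Finset.mem_coe,
    mem_keptIdx, Fin.valEmbedding_apply]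
  constructor
  · rintro ⟨h1, h2⟩
    exact ⟨⟨k, h1⟩, h2, rfl⟩
  · rintro ⟨i, hi, rfl⟩
    exact ⟨i.2, hi⟩

theorem numChildren_blackNodes_nil (p : ℝ) (x : ColTree) :
    numChildren (blackNodes p x.1 x.2) [] = (redBush p (colChildren x)).1 := by
  unfold numChildren
  simp only [List.nil_append]
  rw [ofPred_singleton_mem_blackNodes, Set.ncard_coe_finset, card_map]
  rfl

/-- The black children are numbered in two ways, by `Nat.nth` in the reduction of a tree and by
`Finset.orderEmbOfFin` in the reduction of a bush. Both enumerate the same finite set increasingly.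
-/
theorem nthKid_blackNodes (p : ℝ) (x : ColTree) (m : Fin (redBush p (colChildren x)).1) :
    nthKid (blackNodes p x.1 x.2) m
      = ((blackIdx p (colChildren x)).orderEmbOfFin rfl m : Fin (kids x.1)) := by
  have hs := ofPred_singleton_mem_blackNodes p x
  have hf : (Set.ofPred fun k => [k] ∈ blackNodes p x.1 x.2).Finite := by
    rw [hs]; exact Finset.finite_toSet _
  have hfs : hf.toFinset = (blackIdx p (colChildren x)).map Fin.valEmbedding := by
    apply Finset.coe_injective
    rw [Set.Finite.coe_toFinset]
    exact hs
  have hc : hf.toFinset.card = (blackIdx p (colChildren x)).card := by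
    rw [hfs, card_map]
  rw [nthKid, Nat.nth_eq_orderEmbOfFin hf (by rw [hc]; exact m.2)]
  have := Finset.orderEmbOfFin_unique (s := hf.toFinset) hc
    (f := fun m => ((blackIdx p (colChildren x)).orderEmbOfFin rfl m : ℕ)) (fun m => by
      rw [hfs]
      exact Finset.mem_map_of_mem _ (orderEmbOfFin_mem _ rfl m))
    (fun a b hab => by simpa using hab)
  have h2 := congrFun this m
  rw [h2]
  exact (Finset.orderEmbOfFin_eq_orderEmbOfFin_iff (s := hf.toFinset)).2 rfl

theorem colChild_nthKid (p : ℝ) (x : ColTree) (m : Fin (redBush p (colChildren x)).1) :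
    nthKid (blackNodes p x.1 x.2) m < kids x.1 ∧
      rootBlack p (colChild x (nthKid (blackNodes p x.1 x.2) m)) ∧
      redTree p (colChild x (nthKid (blackNodes p x.1 x.2) m))
        = (redBush p (colChildren x)).2 m := by
  have h := nthKid_blackNodes p x m
  have h1 := singleton_mem_blackNodes.1 (nthKid_mem (S := blackNodes p x.1 x.2) (j := m)
    (by rw [numChildren_blackNodes_nil]; exact m.2))
  refine ⟨h1.1, h1.2, ?_⟩
  rw [h]
  rfl

theorem redTree_life_nil_of_ne (hx : rootBlack p x)
    (h : (redBush p (colChildren x)).1 ≠ 1) : (redTree p x).life [] = x.1.life [] := by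
  rw [redTree_life hx, reduceLife_nil_of_ne]
  rwa [numChildren_blackNodes_nil]

theorem life_colChild (hi : i < kids x.1) :
    (fun u => x.1.life (i :: u)) = (colChild x i).1.life :=
  funext fun u => (child_life hi u).symm

theorem redTree_life_cons_of_lt (hx : rootBlack p x)
    (h : (redBush p (colChildren x)).1 ≠ 1) (m : Fin (redBush p (colChildren x)).1)
    (w : List ℕ) :
    (redTree p x).life ((m : ℕ) :: w) = ((redBush p (colChildren x)).2 m).life w := by
  obtain ⟨h1, h2, h3⟩ := colChild_nthKid p x m
  rw [← numChildren_blackNodes_nil] at h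
  rw [redTree_life hx, reduceLife_cons_of_lt _ h (by rw [numChildren_blackNodes_nil]; exact m.2),
    ← h3, redTree_life h2, above_blackNodes h1, life_colChild h1]

theorem redTree_life_cons_of_le (hx : rootBlack p x)
    (h : (redBush p (colChildren x)).1 ≠ 1) (hi : (redBush p (colChildren x)).1 ≤ i)
    (w : List ℕ) : (redTree p x).life (i :: w) = 0 := by
  rw [← numChildren_blackNodes_nil] at h hi
  rw [redTree_life hx, reduceLife_cons_of_le _ h hi]

theorem kids_redTree_of_ne (hx : rootBlack p x)
    (h : (redBush p (colChildren x)).1 ≠ 1) :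
    kids (redTree p x) = (redBush p (colChildren x)).1 := by
  have : ∀ i, i < kids (redTree p x) ↔ i < (redBush p (colChildren x)).1 := by
    intro i
    rw [← MTree.singleton_mem_nodes, MTree.mem_nodes_iff]
    by_cases hi : i < (redBush p (colChildren x)).1
    · rw [redTree_life_cons_of_lt hx h ⟨i, hi⟩]
      exact iff_of_true ((MTree.mem_nodes_iff _ _).1 (MTree.root_mem _)) hi
    · rw [redTree_life_cons_of_le hx h (not_lt.1 hi)]
      exact iff_of_false (lt_irrefl _) hi
  refine le_antisymm ?_ ?_ <;> by_contra h'
  · exact lt_irrefl _ ((this _).1 (not_le.1 h'))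
  · exact lt_irrefl _ ((this _).2 (not_le.1 h'))

theorem child_redTree_of_ne (hx : rootBlack p x)
    (h : (redBush p (colChildren x)).1 ≠ 1) (m : Fin (redBush p (colChildren x)).1) :
    child (redTree p x) m = (redBush p (colChildren x)).2 m := by
  refine MTree.ext_life fun u => ?_
  rw [child_life (by rw [kids_redTree_of_ne hx h]; exact m.2), redTree_life_cons_of_lt hx h]

/-- The line of single black children from the root is finite. -/
def finSpine (p : ℝ) (x : ColTree) : Prop := FiniteSpine (blackNodes p x.1 x.2)

theorem finSpine_of_ne (h : (redBush p (colChildren x)).1 ≠ 1) :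
    finSpine p x :=
  ⟨0, by rw [spine, numChildren_blackNodes_nil]; exact h⟩

/-- The only black child, if there is one; in general the first one. -/
def onlyKid (p : ℝ) (x : ColTree) : ColTree := colChild x (nthKid (blackNodes p x.1 x.2) 0)

theorem finSpine_iff_of_eq (h : (redBush p (colChildren x)).1 = 1) :
    finSpine p x ↔ finSpine p (onlyKid p x) := by
  have h1 := (colChild_nthKid p x ⟨0, by omega⟩).1
  rw [← numChildren_blackNodes_nil] at h
  rw [finSpine, finiteSpine_iff h, above_blackNodes h1]
  rfl

theorem redTree_life_nil_of_eq (hx : rootBlack p x)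
    (h : (redBush p (colChildren x)).1 = 1) (hf : finSpine p x) :
    (redTree p x).life [] = x.1.life [] + (redTree p (onlyKid p x)).life [] := by
  obtain ⟨h1, h2⟩ : nthKid (blackNodes p x.1 x.2) 0 < kids x.1 ∧ rootBlack p (onlyKid p x) :=
    (colChild_nthKid p x ⟨0, by omega⟩).imp id And.left
  rw [← numChildren_blackNodes_nil] at h
  rw [redTree_life hx, reduceLife_nil_of_eq _ h hf, redTree_life h2, above_blackNodes h1,
    life_colChild h1]
  rfl

theorem redTree_life_cons_of_eq (hx : rootBlack p x)
    (h : (redBush p (colChildren x)).1 = 1) (hf : finSpine p x) (i : ℕ) (w : List ℕ) :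
    (redTree p x).life (i :: w) = (redTree p (onlyKid p x)).life (i :: w) := by
  obtain ⟨h1, h2⟩ : nthKid (blackNodes p x.1 x.2) 0 < kids x.1 ∧ rootBlack p (onlyKid p x) :=
    (colChild_nthKid p x ⟨0, by omega⟩).imp id And.left
  rw [← numChildren_blackNodes_nil] at h
  rw [redTree_life hx, reduceLife_cons_of_eq _ h hf, redTree_life h2, above_blackNodes h1,
    life_colChild h1]
  rfl

theorem kids_redTree_of_eq (hx : rootBlack p x)
    (h : (redBush p (colChildren x)).1 = 1) (hf : finSpine p x) :
    kids (redTree p x) = kids (redTree p (onlyKid p x)) :=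
  kids_eq_iff_life fun i => redTree_life_cons_of_eq hx h hf i []

theorem child_redTree_of_eq (hx : rootBlack p x)
    (h : (redBush p (colChildren x)).1 = 1) (hf : finSpine p x)
    (hi : i < kids (redTree p x)) :
    child (redTree p x) i = child (redTree p (onlyKid p x)) i := by
  refine MTree.ext_life fun u => ?_
  rw [child_life hi, child_life (by rwa [← kids_redTree_of_eq hx h hf]),
    redTree_life_cons_of_eq hx h hf]

/-! ### Renewal equations -/

/-- Iterating `n` times leaves an error of at most `W ^ n * M₁ univ`, which tends to zero. -/
theorem le_of_renewal_le {M₁ M₂ : Measure ℝ} [IsProbabilityMeasure κ] [IsFiniteMeasure M₁]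
    {a : ℝ≥0∞} (hW : W < 1)
    (h₁ : ∀ H, MeasurableSet H → M₁ H ≤ a * κ H + W * ∫⁻ x, M₁ {y | x + y ∈ H} ∂κ)
    (h₂ : ∀ H, MeasurableSet H → a * κ H + W * ∫⁻ x, M₂ {y | x + y ∈ H} ∂κ ≤ M₂ H) :
    M₁ ≤ M₂ := by
  have key : ∀ (n : ℕ) (H : Set ℝ), MeasurableSet H → M₁ H ≤ M₂ H + W ^ n * M₁ univ := by
    intro n
    induction n with
    | zero =>
      intro H _
      rw [pow_zero, one_mul]
      exact (measure_mono (subset_univ H)).trans le_add_self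
    | succ n ih =>
      intro H hH
      have hs : ∀ x : ℝ, MeasurableSet {y | x + y ∈ H} := fun x => (measurable_const_add x) hH
      calc M₁ H ≤ a * κ H + W * ∫⁻ x, M₁ {y | x + y ∈ H} ∂κ := h₁ H hH
        _ ≤ a * κ H + W * ∫⁻ x, (M₂ {y | x + y ∈ H} + W ^ n * M₁ univ) ∂κ := by
          gcongr with x
          exact ih _ (hs x)
        _ = (a * κ H + W * ∫⁻ x, M₂ {y | x + y ∈ H} ∂κ) + W ^ (n + 1) * M₁ univ := by
          rw [lintegral_add_right _ measurable_const, lintegral_const, measure_univ (μ := κ),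
            mul_one, mul_add, pow_succ, add_assoc]
          ring
        _ ≤ M₂ H + W ^ (n + 1) * M₁ univ := by
          gcongr
          exact h₂ H hH
  refine Measure.le_iff.2 fun H hH => ?_
  refine ge_of_tendsto' (x := Filter.atTop) (f := fun n : ℕ => M₂ H + W ^ n * M₁ univ) ?_
    fun n => key n H hH
  have h3 : Filter.Tendsto (fun n : ℕ => W ^ n * M₁ univ) Filter.atTop (nhds (0 * M₁ univ)) :=
    ENNReal.Tendsto.mul_const (ENNReal.tendsto_pow_atTop_nhds_zero_of_lt_one hW)
      (Or.inr (measure_ne_top _ _))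
  simpa using tendsto_const_nhds.add h3

theorem eq_of_renewal {M₁ M₂ : Measure ℝ} [IsProbabilityMeasure κ] [IsFiniteMeasure M₁]
    [IsFiniteMeasure M₂] {a : ℝ≥0∞} (hW : W < 1)
    (h₁ : ∀ H, MeasurableSet H → M₁ H = a * κ H + W * ∫⁻ x, M₁ {y | x + y ∈ H} ∂κ)
    (h₂ : ∀ H, MeasurableSet H → M₂ H = a * κ H + W * ∫⁻ x, M₂ {y | x + y ∈ H} ∂κ) :
    M₁ = M₂ :=
  le_antisymm (le_of_renewal_le hW (fun H hH => (h₁ H hH).le) fun H hH => (h₂ H hH).ge)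
    (le_of_renewal_le hW (fun H hH => (h₂ H hH).le) fun H hH => (h₁ H hH).ge)

/-- `κ'` is the law of a geometric sum of independent random variables of law `κ`, with failure
probability `W`. -/
def IsGeomSum (W : ℝ≥0∞) (κ κ' : Measure ℝ) : Prop :=
  IsProbabilityMeasure κ' ∧
    ∀ H, MeasurableSet H → κ' H = (1 - W) * κ H + W * ∫⁻ x, κ' {y | x + y ∈ H} ∂κ

theorem IsGeomSum.unique (hW : W < 1) {κ₁ κ₂ : Measure ℝ} [IsProbabilityMeasure κ]
    (h₁ : IsGeomSum W κ κ₁) (h₂ : IsGeomSum W κ κ₂) : κ₁ = κ₂ := by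
  have := h₁.1
  have := h₂.1
  exact eq_of_renewal hW h₁.2 h₂.2

/-- The first summand is almost surely positive, so the mass of the nonpositive half-line is at most
`W` times itself. -/
theorem IsGeomSum.measure_Iic_zero (hW : W < 1)
    [IsProbabilityMeasure κ] (hκ : κ (Iic 0) = 0) (h : IsGeomSum W κ κ') : κ' (Iic 0) = 0 := by
  have := h.1
  have h1 := h.2 (Iic 0) measurableSet_Iic
  rw [hκ, mul_zero, zero_add] at h1
  have h2 : ∫⁻ x, κ' {y | x + y ∈ Iic 0} ∂κ ≤ κ' (Iic 0) := by
    have : ∀ᵐ x ∂κ, κ' {y | x + y ∈ Iic 0} ≤ κ' (Iic 0) := by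
      have h0 : ∀ᵐ x ∂κ, x ∉ Iic (0 : ℝ) := measure_eq_zero_iff_ae_notMem.1 hκ
      filter_upwards [h0] with x hx
      refine measure_mono fun y hy => ?_
      simp only [mem_ofPred_eq, mem_Iic, not_le] at hx hy ⊢
      linarith
    refine (lintegral_mono_ae this).trans ?_
    rw [lintegral_const, measure_univ, mul_one]
  by_contra h0
  have h3 : κ' (Iic 0) ≤ W * κ' (Iic 0) := by
    conv_lhs => rw [h1]
    gcongr
  have h4 : W * κ' (Iic 0) < 1 * κ' (Iic 0) :=
    (ENNReal.mul_lt_mul_iff_left h0 (measure_ne_top _ _)).2 hW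
  rw [one_mul] at h4
  exact absurd h3 (not_le.2 h4)

/-! ### The law of the reduced tree -/

theorem measure_eq_tsum_fiber {α : Type*} [MeasurableSpace α] (μ : Measure α) {f : α → ℕ}
    (hf : Measurable f) {E : Set α} (hE : MeasurableSet E) :
    μ E = ∑' n, μ {x | f x = n ∧ x ∈ E} := by
  have : E = ⋃ n, {x | f x = n ∧ x ∈ E} := by
    ext x; simp
  conv_lhs => rw [this]
  refine measure_iUnion ?_ fun n => (hf (measurableSet_singleton n)).inter hE
  intro m n hmn
  exact disjoint_left.2 fun x hx hx' => hmn (hx.1.symm.trans hx'.1)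

/-- The weights of the binomial thinning of `q`, where individuals are removed with
probability `g`, up to the powers of `1 - g`. -/
def thin (q : PMF ℕ) (g : ℝ≥0∞) (j : ℕ) : ℝ≥0∞ := ∑' n, q n * (n.choose j * g ^ (n - j))

/-- The trees with `j` children of the root, root lifetime in `H` and subtrees of the children of
the root in given sets. -/
def treeEvent (j : ℕ) (H : Set ℝ) (A : Fin j → Set MTree) : Set MTree :=
  {t | kids t = j ∧ t.life [] ∈ H ∧ ∀ i : Fin j, child t i ∈ A i}

theorem measurableSet_treeEvent (j : ℕ) {A : Fin j → Set MTree} (hH : MeasurableSet H)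
    (hA : ∀ i, MeasurableSet (A i)) : MeasurableSet (treeEvent j H A) := by
  have : treeEvent j H A = (kids ⁻¹' {j} ∩ ((fun t => t.life []) ⁻¹' H ∩
      ⋂ i : Fin j, (fun t => child t i) ⁻¹' (A i))) := by
    ext t; simp [treeEvent]
  rw [this]
  exact (measurable_kids (measurableSet_singleton j)).inter
    ((MTree.measurable_life [] hH).inter (MeasurableSet.iInter fun i => measurable_child i (hA i)))

theorem branching_set_eq (j : ℕ) (H : Set ℝ) (A : Fin j → Set MTree) :
    {t : MTree | numChildren t.nodes [] = j ∧ t.life [] ∈ H ∧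
        ∀ i : Fin j, ∃ h : [(i : ℕ)] ∈ t.nodes, t.subtree [(i : ℕ)] h ∈ A i}
      = treeEvent j H A := by
  ext t
  simp only [exists_subtree_mem_iff, mem_ofPred_eq, treeEvent]
  constructor
  · rintro ⟨h1, h2, h3⟩
    exact ⟨h1, h2, fun i => (h3 i).2⟩
  · rintro ⟨h1, h2, h3⟩
    exact ⟨h1, h2, fun i => ⟨by rw [h1]; exact i.2, h3 i⟩⟩

/-- The coloured trees with black root and finite root line whose reduced tree lies in a
given event. -/
def spineEvent (p : ℝ) (j : ℕ) (H : Set ℝ) (A : Fin j → Set MTree) : Set ColTree :=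
  {x | rootBlack p x ∧ finSpine p x ∧ redTree p x ∈ treeEvent j H A}

theorem measurableSet_finSpine (p : ℝ) : MeasurableSet {x : ColTree | finSpine p x} := by
  have : Measurable fun S : Set (List ℕ) => FiniteSpine S := by
    refine Measurable.exists fun i => ?_
    have : Measurable fun S => numChildren S (spine S [] i) :=
      measurable_countable_comp (measurable_spine [] i) fun u => measurable_numChildren u
    exact (this.eq_const 1).not
  exact measurableSet_setOfPred.2 (this.comp (measurable_blackNodes p))

theorem measurableSet_spineEvent (p : ℝ) (j : ℕ) {A : Fin j → Set MTree}
    (hH : MeasurableSet H) (hA : ∀ i, MeasurableSet (A i)) :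
    MeasurableSet (spineEvent p j H A) :=
  (measurableSet_rootBlack p).inter ((measurableSet_finSpine p).inter
    (measurable_redTree p (measurableSet_treeEvent j hH hA)))

theorem mem_filterEvent_one {X : Type*} {K A : Set X} {x : Fin n → X} :
    x ∈ filterEvent n 1 K (fun _ => A) ↔
      ∃ i, x i ∈ K ∧ x i ∈ A ∧ ∀ k, x k ∈ K → k = i := by
  constructor
  · rintro ⟨h, hx⟩
    obtain ⟨i, hi⟩ := Finset.card_eq_one.1 h
    have h0 : (keptIdx K x).orderEmbOfFin h 0 = i := by
      have := orderEmbOfFin_mem (keptIdx K x) h 0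
      exact Finset.mem_singleton.1 (hi.subset this)
    refine ⟨i, ?_, ?_, fun k hk => ?_⟩
    · exact mem_keptIdx.1 (hi ▸ Finset.mem_singleton_self i)
    · exact h0 ▸ hx 0
    · rw [← mem_keptIdx, hi] at hk
      simpa using hk
  · rintro ⟨i, h1, h2, h3⟩
    have hi : keptIdx K x = {i} := by
      ext k
      rw [mem_keptIdx, Finset.mem_singleton]
      exact ⟨h3 k, fun h => h ▸ h1⟩
    refine ⟨by rw [hi, Finset.card_singleton], fun m => ?_⟩
    have := orderEmbOfFin_mem (keptIdx K x) (by rw [hi, Finset.card_singleton]) m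
    rwa [Finset.mem_singleton.1 (hi.subset this)]

theorem colChildren_mem_filterEvent_one {A : Set ColTree} :
    colChildren x ∈ filterEvent (kids x.1) 1 {y | rootBlack p y} (fun _ => A) ↔
      (redBush p (colChildren x)).1 = 1 ∧ onlyKid p x ∈ A := by
  have h0 : ∀ h : (redBush p (colChildren x)).1 = 1, onlyKid p x
      = colChildren x ((blackIdx p (colChildren x)).orderEmbOfFin h 0) := by
    intro h
    have h1 : nthKid (blackNodes p x.1 x.2) 0
        = ((blackIdx p (colChildren x)).orderEmbOfFin h 0 : Fin (kids x.1)) :=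
      (nthKid_blackNodes p x ⟨0, by omega⟩).trans (congrArg Fin.val
        ((Finset.orderEmbOfFin_eq_orderEmbOfFin_iff (s := blackIdx p (colChildren x))).2 rfl))
    rw [onlyKid, colChildren, ← h1]
  constructor
  · rintro ⟨h, hx⟩
    refine ⟨h, ?_⟩
    rw [h0 h]
    exact hx 0
  · rintro ⟨h, hx⟩
    refine ⟨h, fun m => ?_⟩
    rw [h0 h] at hx
    rwa [Subsingleton.elim m 0]

theorem rootBlack_iff_redBush :
    rootBlack p x ↔ (kids x.1 = 0 ∧ p < 1 ∧ x.2 [] = true) ∨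
      (redBush p (colChildren x)).1 ≠ 0 := by
  rw [rootBlack_iff]
  refine or_congr Iff.rfl ?_
  change _ ↔ (blackIdx p (colChildren x)).card ≠ 0
  rw [Finset.card_ne_zero]
  constructor
  · rintro ⟨i, hi, h⟩
    exact ⟨⟨i, hi⟩, mem_keptIdx.2 h⟩
  · rintro ⟨i, hi⟩
    exact ⟨i, i.2, mem_keptIdx.1 hi⟩

/-- The dichotomy behind the renewal equation. With exactly one black child the event is inherited
by that child, the set of lifetimes being shifted by the lifetime of the root. Otherwise the merged
line is the root alone; for `j = 0` a black root without black children must be a black leaf. -/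
theorem mem_spineEvent_iff {A : Fin j → Set MTree} :
    x ∈ spineEvent p j H A ↔
      colChildren x ∈ filterEvent (kids x.1) 1 {y | rootBlack p y}
          (fun _ => spineEvent p j {y | x.1.life [] + y ∈ H} A) ∨
      (j ≠ 1 ∧ x.1.life [] ∈ H ∧ (j = 0 → kids x.1 = 0 ∧ p < 1 ∧ x.2 [] = true) ∧
        colChildren x ∈ filterEvent (kids x.1) j {y | rootBlack p y}
          (fun m => redTree p ⁻¹' A m)) := by
  rw [colChildren_mem_filterEvent_one, ← redBush_mem_bushRect]
  by_cases hJ : (redBush p (colChildren x)).1 = 1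
  · have hx : rootBlack p x := rootBlack_iff_redBush.2 (Or.inr (by omega))
    have hk : rootBlack p (onlyKid p x) := (colChild_nthKid p x ⟨0, by omega⟩).2.1
    have hno : ¬ (j ≠ 1 ∧ x.1.life [] ∈ H ∧ (j = 0 → kids x.1 = 0 ∧ p < 1 ∧ x.2 [] = true) ∧
        redBush p (colChildren x) ∈ bushRect j A) := by
      rintro ⟨h1, -, -, h, -⟩
      omega
    rw [or_iff_left hno]
    constructor
    · rintro ⟨-, hf, h1, h2, h3⟩
      refine ⟨hJ, hk, (finSpine_iff_of_eq hJ).1 hf, ?_, ?_, fun i => ?_⟩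
      · rw [← kids_redTree_of_eq hx hJ hf, h1]
      · rwa [mem_ofPred_eq, ← redTree_life_nil_of_eq hx hJ hf]
      · rw [← child_redTree_of_eq hx hJ hf (by rw [h1]; exact i.2)]
        exact h3 i
    · rintro ⟨-, -, hf, h1, h2, h3⟩
      have hf' := (finSpine_iff_of_eq hJ).2 hf
      have h1' : kids (redTree p x) = j := by rw [kids_redTree_of_eq hx hJ hf', h1]
      refine ⟨hx, hf', h1', ?_, fun i => ?_⟩
      · rwa [redTree_life_nil_of_eq hx hJ hf']
      · rw [child_redTree_of_eq hx hJ hf' (by rw [h1']; exact i.2)]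
        exact h3 i
  · rw [or_iff_right (fun h => hJ h.1)]
    constructor
    · rintro ⟨hx, -, h1, h2, h3⟩
      have h1' := h1
      rw [kids_redTree_of_ne hx hJ] at h1'
      refine ⟨by omega, ?_, fun h0 => ?_, h1', fun m => ?_⟩
      · rwa [← redTree_life_nil_of_ne hx hJ]
      · rcases rootBlack_iff_redBush.1 hx with h | h
        · exact h
        · omega
      · have := h3 m
        rwa [← child_redTree_of_ne hx hJ]
    · rintro ⟨-, h2, h0, h1, h3⟩
      have hx : rootBlack p x := by
        rw [rootBlack_iff_redBush]
        by_cases hj : j = 0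
        · exact Or.inl (h0 hj)
        · exact Or.inr (by omega)
      have h1' : kids (redTree p x) = j := by rw [kids_redTree_of_ne hx hJ, h1]
      refine ⟨hx, finSpine_of_ne hJ, h1', ?_, fun i => ?_⟩
      · rwa [redTree_life_nil_of_ne hx hJ]
      · have := h3 i
        rwa [← child_redTree_of_ne hx hJ] at this

/-- The weights of the numbers different from `1` of black children, up to the powers of the
probability of a black root. -/
def blackWeight (p : ℝ) (q : PMF ℕ) (ν : Measure Bool) (g : ℝ≥0∞) (j : ℕ) : ℝ≥0∞ :=
  if j = 0 then (if p < 1 then q 0 * ν {true} else 0) else if j = 1 then 0 else thin q g j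

section TreeReduction

variable (p : ℝ) (ν : Measure Bool)

theorem measurableSet_filterEvent_one_section {K : Set ColTree} (hK : MeasurableSet K)
    {F : Set (ℝ × ColTree)} (hF : MeasurableSet F) :
    MeasurableSet {y : ℝ × Bool × (Fin n → ColTree) |
      y.2.2 ∈ filterEvent n 1 K (fun _ => {z | (y.1, z) ∈ F})} := by
  simp_rw [mem_filterEvent_one]
  have hm : ∀ i : Fin n, Measurable fun y : ℝ × Bool × (Fin n → ColTree) => y.2.2 i := fun i =>
    (measurable_pi_apply i).comp (measurable_snd.comp measurable_snd)
  have hK' : ∀ i : Fin n, Measurable fun y : ℝ × Bool × (Fin n → ColTree) => y.2.2 i ∈ K :=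
    fun i => measurableSet_setOfPred.1 (hm i hK)
  refine measurableSet_setOfPred.2 (Measurable.exists fun i => (hK' i).and (Measurable.and ?_
    (Measurable.forall fun k => (hK' k).imp measurable_const)))
  exact measurableSet_setOfPred.1 ((measurable_fst.prodMk (hm i)) hF)

variable [IsProbabilityMeasure ν]

theorem IsGWTreeLaw.measure_filterEvent_one_section (h : IsGWTreeLaw q κ P) (n : ℕ)
    {K : Set ColTree} (hK : MeasurableSet K) {F : Set (ℝ × ColTree)} (hF : MeasurableSet F)
    (hFK : ∀ l z, (l, z) ∈ F → z ∈ K) :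
    (κ.prod (ν.prod (Measure.pi fun _ => colTreeLaw P ν))) {y : ℝ × Bool × (Fin n → ColTree) |
      y.2.2 ∈ filterEvent n 1 K (fun _ => {z | (y.1, z) ∈ F})}
      = n.choose 1 * colTreeLaw P ν Kᶜ ^ (n - 1) * ∫⁻ l, colTreeLaw P ν {z | (l, z) ∈ F} ∂κ := by
  have := h.isProb
  have := h.isProb_life
  have hs : ∀ l, MeasurableSet {z | (l, z) ∈ F} := fun l => measurable_prodMk_left hF
  have hm : Measurable fun l => colTreeLaw P ν {z | (l, z) ∈ F} :=
    measurable_measure_prodMk_left hF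
  rw [Measure.prod_apply (measurableSet_filterEvent_one_section hK hF),
    ← lintegral_const_mul _ hm]
  refine lintegral_congr fun l => ?_
  have : Prod.mk l ⁻¹' {y : ℝ × Bool × (Fin n → ColTree) |
      y.2.2 ∈ filterEvent n 1 K (fun _ => {z | (y.1, z) ∈ F})}
      = univ ×ˢ filterEvent n 1 K (fun _ => {z | (l, z) ∈ F}) := by
    ext y; simp
  rw [this, prod_prod, measure_univ, one_mul, pi_filterEvent n 1 hK fun _ => hs l]
  simp only [Finset.univ_unique, Fin.default_eq_zero, Finset.prod_singleton]
  congr 2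
  exact inter_eq_right.2 fun z hz => hFK l z hz

/-- The dichotomy `mem_spineEvent_iff` is evaluated for each number of children. As a function of
`H` this is a renewal equation, and the sets `A` occur only in the factor of `κ H`. -/
theorem IsGWTreeLaw.measure_spineEvent (h : IsGWTreeLaw q κ P) (j : ℕ)
    {A : Fin j → Set MTree} (hH : MeasurableSet H) (hA : ∀ i, MeasurableSet (A i)) :
    colTreeLaw P ν (spineEvent p j H A)
      = thin q (colTreeLaw P ν {x | rootBlack p x}ᶜ) 1
          * ∫⁻ l, colTreeLaw P ν (spineEvent p j {y | l + y ∈ H} A) ∂κ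
        + blackWeight p q ν (colTreeLaw P ν {x | rootBlack p x}ᶜ) j * κ H
          * ∏ m, colTreeLaw P ν ({x | rootBlack p x} ∩ redTree p ⁻¹' A m) := by
  have := h.isProb
  have := h.isProb_life
  set K : Set ColTree := {x | rootBlack p x} with hKdef
  have hK : MeasurableSet K := measurableSet_rootBlack p
  set g := colTreeLaw P ν Kᶜ
  set F : Set (ℝ × ColTree) := {y | y.2 ∈ spineEvent p j {z | y.1 + z ∈ H} A} with hFdef
  have hF : MeasurableSet F := by
    have h1 : MeasurableSet {y : ℝ × ColTree | y.2 ∈ spineEvent p j univ A} :=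
      measurable_snd (measurableSet_spineEvent p j MeasurableSet.univ hA)
    have h2 : Measurable fun y : ℝ × ColTree => y.1 + (redTree p y.2).life [] :=
      measurable_fst.add ((MTree.measurable_life []).comp
        ((measurable_redTree p).comp measurable_snd))
    convert h1.inter (h2 hH) using 1
    ext y
    simp only [hFdef, spineEvent, treeEvent, mem_ofPred_eq, mem_inter_iff, mem_preimage, mem_univ,
      true_and]
    tauto
  set R := ∏ m, colTreeLaw P ν (K ∩ redTree p ⁻¹' A m)
  set I := ∫⁻ l, colTreeLaw P ν (spineEvent p j {y | l + y ∈ H} A) ∂κ with hI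
  have hm : Measurable fun x : ColTree => kids x.1 := measurable_kids.comp measurable_fst
  rw [measure_eq_tsum_fiber (f := fun x : ColTree => kids x.1) _ hm
    (measurableSet_spineEvent p j hH hA)]
  have key : ∀ n, colTreeLaw P ν {x | kids x.1 = n ∧ x ∈ spineEvent p j H A}
      = q n * (n.choose 1 * g ^ (n - 1)) * I +
        (if j = 0 then (if p < 1 ∧ n = 0 then q 0 * ν {true} else 0) else
          if j = 1 then 0 else q n * (n.choose j * g ^ (n - j))) * (κ H * R) := by
    intro n
    -- `D1` is the case of one black child, to which the event is passed on; in `D2` the line ends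
    -- at the root.
    set D1 : Set (ℝ × Bool × (Fin n → ColTree)) :=
      {y | y.2.2 ∈ filterEvent n 1 K (fun _ => {z | (y.1, z) ∈ F})}
    have hD1 : MeasurableSet D1 := measurableSet_filterEvent_one_section hK hF
    -- The colour of the root is restricted only for `j = 0`, and `j = 1` is impossible at the end
    -- of a line.
    set C : Set Bool := {c | j ≠ 1 ∧ (j = 0 → n = 0 ∧ p < 1 ∧ c = true)} with hC
    have hfe := measurableSet_filterEvent n j hK (fun m => measurable_redTree p (hA m))
    set D2 : Set (ℝ × Bool × (Fin n → ColTree)) :=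
      H ×ˢ C ×ˢ filterEvent n j K (fun m => redTree p ⁻¹' A m)
    have hCm : MeasurableSet C := MeasurableSet.of_discrete
    have hD2 : MeasurableSet D2 := hH.prod (hCm.prod hfe)
    have hE : {x : ColTree | kids x.1 = n ∧ x ∈ spineEvent p j H A}
        = {x | kids x.1 = n ∧ rootData n x ∈ D1 ∪ D2} := by
      ext x
      refine and_congr_right fun hn => ?_
      subst hn
      rw [mem_spineEvent_iff]
      refine or_congr Iff.rfl ?_
      change _ ↔ x.1.life [] ∈ H ∧ (j ≠ 1 ∧ (j = 0 → kids x.1 = 0 ∧ p < 1 ∧ x.2 [] = true)) ∧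
        colChildren x ∈ filterEvent (kids x.1) j K (fun m => redTree p ⁻¹' A m)
      tauto
    rw [hE, h.measure_rootData ν n (hD1.union hD2)]
    have hdisj : Disjoint D1 D2 := by
      refine disjoint_left.2 ?_
      rintro y ⟨h1, -⟩ ⟨-, ⟨h2, -⟩, h3, -⟩
      exact h2 (h3.symm.trans h1)
    rw [measure_union hdisj hD2, mul_add, h.measure_filterEvent_one_section ν n hK hF
      (fun l z hz => hz.1), prod_prod, prod_prod, pi_filterEvent n j hK
      (fun m => measurable_redTree p (hA m)), ← mul_assoc]
    congr 1
    by_cases h0 : j = 0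
    · subst h0
      by_cases hn : p < 1 ∧ n = 0
      · have : C = {true} := by
          ext c; simp [hC, hn.1, hn.2]
        rw [this, if_pos rfl, if_pos hn, hn.2]
        simp only [Nat.choose_self, Nat.cast_one, Nat.sub_self, pow_zero, one_mul]
        change q 0 * (κ H * (ν {true} * R)) = _
        ring
      · have : C = ∅ := by
          ext c; simp [hC]; tauto
        rw [this, if_pos rfl, if_neg hn]
        simp
    · rw [if_neg h0]
      by_cases h1 : j = 1
      · have : C = ∅ := by
          ext c; simp [hC, h1]
        rw [this, if_pos h1]
        simp
      · have : C = univ := by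
          ext c; simp [hC, h0, h1]
        rw [this, if_neg h1, measure_univ, one_mul]
        change q n * (κ H * (↑(n.choose j) * g ^ (n - j) * R)) = _
        ring
  rw [tsum_congr key, tsum_add, ENNReal.tsum_mul_right, ENNReal.tsum_mul_right]
  congr 1
  rw [mul_assoc]
  congr 1
  unfold blackWeight
  split_ifs with h0 hp h1
  · rw [tsum_eq_single 0]
    · simp [hp]
    · intro n hn
      simp [hn]
  · simp [hp]
  · simp
  · rfl

/-- An infinite line passes through a single black child with the same property, so the probability
equals itself times a factor below one. -/
theorem IsGWTreeLaw.measure_not_finSpine (h : IsGWTreeLaw q κ P)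
    (hW : thin q (colTreeLaw P ν {x | rootBlack p x}ᶜ) 1 < 1) :
    colTreeLaw P ν {x | rootBlack p x ∧ ¬ finSpine p x} = 0 := by
  have := h.isProb
  have := h.isProb_life
  set K : Set ColTree := {x | rootBlack p x} with hKdef
  have hK : MeasurableSet K := measurableSet_rootBlack p
  set g := colTreeLaw P ν Kᶜ
  set N : Set ColTree := {x | rootBlack p x ∧ ¬ finSpine p x} with hN
  have hNm : MeasurableSet N := hK.inter (measurableSet_finSpine p).compl
  have hm : Measurable fun x : ColTree => kids x.1 := measurable_kids.comp measurable_fst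
  have key : ∀ n, colTreeLaw P ν {x | kids x.1 = n ∧ x ∈ N}
      = q n * (n.choose 1 * g ^ (n - 1)) * colTreeLaw P ν N := by
    intro n
    have hE : {x : ColTree | kids x.1 = n ∧ x ∈ N} = {x | kids x.1 = n ∧ rootData n x ∈
        {y : ℝ × Bool × (Fin n → ColTree) |
          y.2.2 ∈ filterEvent n 1 K (fun _ => {z | (y.1, z) ∈ (univ : Set ℝ) ×ˢ N})}} := by
      ext x
      refine and_congr_right fun hn => ?_
      subst hn
      change _ ↔ colChildren x ∈ filterEvent (kids x.1) 1 K (fun _ => {z | (x.1.life [], z) ∈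
        (univ : Set ℝ) ×ˢ N})
      rw [colChildren_mem_filterEvent_one]
      simp only [mem_prod, mem_univ, true_and, mem_ofPred_eq, hN]
      by_cases hJ : (redBush p (colChildren x)).1 = 1
      · have hx : rootBlack p x := rootBlack_iff_redBush.2 (Or.inr (by omega))
        have hk : rootBlack p (onlyKid p x) := (colChild_nthKid p x ⟨0, by omega⟩).2.1
        simp [hJ, hx, hk, finSpine_iff_of_eq hJ]
      · simp [hJ, finSpine_of_ne hJ]
    rw [hE, h.measure_rootData ν n (measurableSet_filterEvent_one_section hK
      (MeasurableSet.univ.prod hNm)), h.measure_filterEvent_one_section ν n hK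
      (MeasurableSet.univ.prod hNm) (fun l z hz => hz.2.1)]
    simp only [mem_prod, mem_univ, true_and, ofPred_mem_eq, lintegral_const, measure_univ, mul_one]
    ring
  have hsum := measure_eq_tsum_fiber (f := fun x : ColTree => kids x.1) (colTreeLaw P ν) hm hNm
  rw [tsum_congr key, ENNReal.tsum_mul_right] at hsum
  by_contra h0
  have h4 : thin q g 1 * colTreeLaw P ν N < 1 * colTreeLaw P ν N :=
    (ENNReal.mul_lt_mul_iff_left h0 (measure_ne_top _ _)).2 hW
  rw [one_mul] at h4
  exact absurd hsum h4.ne'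

end TreeReduction

/-! ### The law of the reduced tree given a black root -/

section TreeReduction

variable (p : ℝ) (ν : Measure Bool)

/-- The restriction of the law of the reduced tree to the event that the root is black. -/
def redMeasure (p : ℝ) (P : Measure MTree) (ν : Measure Bool) : Measure MTree :=
  ((colTreeLaw P ν).restrict {x | rootBlack p x}).map (redTree p)

theorem redMeasure_apply {A : Set MTree} (hA : MeasurableSet A) :
    redMeasure p P ν A = colTreeLaw P ν ({x | rootBlack p x} ∩ redTree p ⁻¹' A) := by
  rw [redMeasure, map_apply (measurable_redTree p) hA, Measure.restrict_apply
    (measurable_redTree p hA), inter_comm]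

theorem redMeasure_univ :
    redMeasure p P ν univ = colTreeLaw P ν {x | rootBlack p x} := by
  rw [redMeasure_apply p ν MeasurableSet.univ, preimage_univ, inter_univ]

/-- The law of the reduced tree given that the root is black. -/
def redTreeLaw (p : ℝ) (P : Measure MTree) (ν : Measure Bool) : Measure MTree :=
  (redMeasure p P ν univ)⁻¹ • redMeasure p P ν

/-- The law of the lifetime of the root of the reduced tree, on an event. -/
def rootLifeMeasure (p : ℝ) (P : Measure MTree) (ν : Measure Bool) (E : Set ColTree) : Measure ℝ :=
  ((colTreeLaw P ν).restrict E).map fun x => (redTree p x).life []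

theorem measurable_redTree_life : Measurable fun x : ColTree => (redTree p x).life [] :=
  (MTree.measurable_life []).comp (measurable_redTree p)

theorem rootLifeMeasure_spineEvent (j : ℕ) (A : Fin j → Set MTree)
    (hH : MeasurableSet H) :
    rootLifeMeasure p P ν (spineEvent p j univ A) H = colTreeLaw P ν (spineEvent p j H A) := by
  rw [rootLifeMeasure, map_apply (measurable_redTree_life p) hH, Measure.restrict_apply
    (measurable_redTree_life p hH)]
  congr 1
  ext x
  simp only [spineEvent, treeEvent, mem_inter_iff, mem_preimage, mem_ofPred_eq, mem_univ, true_and]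
  tauto

theorem rootLifeMeasure_eq_tsum (hH : MeasurableSet H) :
    rootLifeMeasure p P ν {x | rootBlack p x ∧ finSpine p x} H
      = ∑' j, colTreeLaw P ν (spineEvent p j H fun _ => univ) := by
  have hm : Measurable fun x : ColTree => kids (redTree p x) :=
    measurable_kids.comp (measurable_redTree p)
  have hs : MeasurableSet {x : ColTree | rootBlack p x ∧ finSpine p x} :=
    (measurableSet_rootBlack p).inter (measurableSet_finSpine p)
  rw [rootLifeMeasure, map_apply (measurable_redTree_life p) hH, Measure.restrict_apply
    (measurable_redTree_life p hH), measure_eq_tsum_fiber _ hm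
      ((measurable_redTree_life p hH).inter hs)]
  refine tsum_congr fun j => ?_
  congr 1
  ext x
  simp only [spineEvent, treeEvent, mem_inter_iff, mem_preimage, mem_ofPred_eq, mem_univ,
    implies_true, and_true]
  tauto

variable [IsProbabilityMeasure ν]

theorem isProbabilityMeasure_redTreeLaw [IsProbabilityMeasure P]
    (hr : redMeasure p P ν univ ≠ 0) : IsProbabilityMeasure (redTreeLaw p P ν) := by
  refine ⟨?_⟩
  rw [redTreeLaw, Measure.smul_apply, smul_eq_mul, ENNReal.inv_mul_cancel hr]
  rw [redMeasure_univ]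
  exact measure_ne_top _ _

theorem mul_prod_redTreeLaw [IsProbabilityMeasure P] (hr : redMeasure p P ν univ ≠ 0)
    (A : Fin j → Set MTree) :
    redMeasure p P ν univ ^ j * ∏ m, redTreeLaw p P ν (A m) = ∏ m, redMeasure p P ν (A m) := by
  have hr' : redMeasure p P ν univ ≠ ∞ := by
    rw [redMeasure_univ]
    exact measure_ne_top _ _
  have : ∀ m, redMeasure p P ν (A m) = redMeasure p P ν univ * redTreeLaw p P ν (A m) := by
    intro m
    rw [redTreeLaw, Measure.smul_apply, smul_eq_mul, ← mul_assoc, ENNReal.mul_inv_cancel hr hr',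
      one_mul]
  simp_rw [this, Finset.prod_mul_distrib, prod_const, card_univ, Fintype.card_fin]

/-- Summing `measure_spineEvent` over the number `j` of children removes the condition on the
branching. -/
theorem IsGWTreeLaw.rootLifeMeasure_renewal (h : IsGWTreeLaw q κ P)
    (hH : MeasurableSet H) :
    rootLifeMeasure p P ν {x | rootBlack p x ∧ finSpine p x} H
      = (∑' j, blackWeight p q ν (colTreeLaw P ν {x | rootBlack p x}ᶜ) j
          * redMeasure p P ν univ ^ j) * κ H
        + thin q (colTreeLaw P ν {x | rootBlack p x}ᶜ) 1 *
          ∫⁻ l, rootLifeMeasure p P ν {x | rootBlack p x ∧ finSpine p x} {y | l + y ∈ H} ∂κ := by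
  have := h.isProb
  have := h.isProb_life
  have hs : ∀ x : ℝ, MeasurableSet {y | x + y ∈ H} := fun x => (measurable_const_add x) hH
  have hm : ∀ j, Measurable fun l => colTreeLaw P ν (spineEvent p j {y | l + y ∈ H} fun _ => univ) := by
    intro j
    have hA : ∀ l : ℝ, colTreeLaw P ν (spineEvent p j {y | l + y ∈ H} fun _ => univ)
        = rootLifeMeasure p P ν (spineEvent p j univ fun _ => univ) (Prod.mk l ⁻¹'
            {z : ℝ × ℝ | z.1 + z.2 ∈ H}) := fun l =>
      (rootLifeMeasure_spineEvent p ν j (fun _ => univ) (hs l)).symm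
    have : IsFiniteMeasure (rootLifeMeasure p P ν (spineEvent p j univ fun _ => univ)) := by
      unfold rootLifeMeasure; infer_instance
    simp_rw [hA]
    exact measurable_measure_prodMk_left (measurable_add hH)
  rw [rootLifeMeasure_eq_tsum p ν hH]
  simp_rw [rootLifeMeasure_eq_tsum p ν (hs _)]
  rw [lintegral_tsum fun j => (hm j).aemeasurable, ← ENNReal.tsum_mul_left,
    ← ENNReal.tsum_mul_right, ← tsum_add]
  refine tsum_congr fun j => ?_
  rw [h.measure_spineEvent p ν j hH fun _ => MeasurableSet.univ, add_comm]
  congr 1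
  simp only [preimage_univ, inter_univ, prod_const, card_univ, Fintype.card_fin,
    redMeasure_univ]
  ring

/-- The reduced tree of a Galton-Watson tree, given that its root is black, is a Galton-Watson
tree. -/
theorem IsGWTreeLaw.reduce (h : IsGWTreeLaw q κ P) {c : ℝ≥0∞}
    (hc : ∑' j, blackWeight p q ν (colTreeLaw P ν {x | rootBlack p x}ᶜ) j
      * redMeasure p P ν univ ^ j = c) (hc0 : c ≠ 0)
    (hq' : ∀ j, q' j * c = blackWeight p q ν (colTreeLaw P ν {x | rootBlack p x}ᶜ) j
      * redMeasure p P ν univ ^ j) :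
    thin q (colTreeLaw P ν {x | rootBlack p x}ᶜ) 1 < 1 ∧
      c = (1 - thin q (colTreeLaw P ν {x | rootBlack p x}ᶜ) 1) * redMeasure p P ν univ ∧
      ∃ κ', IsGeomSum (thin q (colTreeLaw P ν {x | rootBlack p x}ᶜ) 1) κ κ' ∧
        IsGWTreeLaw q' κ' (redTreeLaw p P ν) := by
  have := h.isProb
  have := h.isProb_life
  set W := thin q (colTreeLaw P ν {x | rootBlack p x}ᶜ) 1 with hWdef
  set r := redMeasure p P ν univ with hr
  set N := rootLifeMeasure p P ν {x | rootBlack p x ∧ finSpine p x} with hN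
  have hNfin : IsFiniteMeasure N := by
    rw [hN]; unfold rootLifeMeasure; infer_instance
  have hren : ∀ H, MeasurableSet H → N H = c * κ H + W * ∫⁻ l, N {y | l + y ∈ H} ∂κ :=
    fun H hH => by
      rw [← hc]; exact h.rootLifeMeasure_renewal p ν hH
  have hNu := hren univ MeasurableSet.univ
  simp only [mem_univ, ofPred_true, lintegral_const, measure_univ (μ := κ), mul_one] at hNu
  have hN0 : N univ ≠ 0 := by
    rw [hNu]
    exact fun h0 => hc0 (add_eq_zero.1 h0).1
  have hNt : N univ ≠ ∞ := measure_ne_top _ _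
  -- The finite total mass satisfies `N univ = c + W * N univ` with `c > 0`, which excludes `W ≥ 1`.
  have hW : W < 1 := by
    by_contra hcon
    have h1 : 1 * N univ ≤ W * N univ := by
      gcongr
      exact not_lt.1 hcon
    have h2 : W * N univ < N univ := by
      conv_rhs => rw [hNu]
      rw [add_comm]
      refine ENNReal.lt_add_right ?_ hc0
      exact ne_top_of_le_ne_top hNt (by conv_rhs => rw [hNu]
                                        exact le_add_self)
    rw [one_mul] at h1
    exact absurd h1 (not_le.2 h2)
  have hnull := h.measure_not_finSpine p ν hW
  have hNr : N univ = r := by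
    rw [hN, rootLifeMeasure, map_apply (measurable_redTree_life p) MeasurableSet.univ,
      preimage_univ, Measure.restrict_apply_univ, hr, redMeasure_univ]
    have : {x : ColTree | rootBlack p x} = {x | rootBlack p x ∧ finSpine p x} ∪
        {x | rootBlack p x ∧ ¬ finSpine p x} := by
      ext x
      simp only [mem_ofPred_eq, mem_union]
      tauto
    rw [this]
    refine le_antisymm (measure_mono subset_union_left) ((measure_union_le _ _).trans ?_)
    rw [hnull, add_zero]
  rw [hNr] at hN0 hNt hNu
  have hWt : W * r ≠ ∞ := mul_ne_top hW.ne_top hNt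
  have hcr : c = (1 - W) * r := by
    rw [ENNReal.sub_mul (fun _ _ => hNt), one_mul]
    exact ENNReal.eq_sub_of_add_eq hWt hNu.symm
  have hct : c ≠ ∞ := ne_top_of_le_ne_top hNt (by rw [hNu]; exact le_self_add)
  refine ⟨hW, hcr, r⁻¹ • N, ?_, ?_⟩
  · refine ⟨⟨by rw [Measure.smul_apply, smul_eq_mul, hNr, ENNReal.inv_mul_cancel hN0 hNt]⟩,
      fun H hH => ?_⟩
    simp only [Measure.smul_apply, smul_eq_mul]
    rw [lintegral_const_mul' _ _ (ENNReal.inv_ne_top.2 hN0), hren H hH, mul_add, ← mul_assoc, hcr,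
      mul_comm (1 - W), ← mul_assoc, ENNReal.inv_mul_cancel hN0 hNt, one_mul]
    congr 1
    ring
  · have hκ' : IsGeomSum W κ (r⁻¹ • N) := by
      refine ⟨⟨by rw [Measure.smul_apply, smul_eq_mul, hNr, ENNReal.inv_mul_cancel hN0 hNt]⟩,
        fun H hH => ?_⟩
      simp only [Measure.smul_apply, smul_eq_mul]
      rw [lintegral_const_mul' _ _ (ENNReal.inv_ne_top.2 hN0), hren H hH, mul_add, ← mul_assoc, hcr,
        mul_comm (1 - W), ← mul_assoc, ENNReal.inv_mul_cancel hN0 hNt, one_mul]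
      congr 1
      ring
    refine ⟨isProbabilityMeasure_redTreeLaw p ν hN0, hκ'.1,
      hκ'.measure_Iic_zero hW h.life_pos, fun j H A hH hA => ?_⟩
    rw [branching_set_eq]
    set a := blackWeight p q ν (colTreeLaw P ν {x | rootBlack p x}ᶜ) j *
      ∏ m, redMeasure p P ν (A m) with ha
    have haq : a = q' j * c * ∏ m, redTreeLaw p P ν (A m) := by
      rw [hq', ha, ← mul_prod_redTreeLaw p ν hN0, mul_assoc]
    have hMfin : IsFiniteMeasure (rootLifeMeasure p P ν (spineEvent p j univ A)) := by
      unfold rootLifeMeasure; infer_instance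
    have hprob := isProbabilityMeasure_redTreeLaw p ν hN0
    have hat : a * c⁻¹ ≠ ∞ := by
      rw [haq]
      refine mul_ne_top (mul_ne_top (mul_ne_top (q'.apply_ne_top j) hct)
        (ENNReal.prod_ne_top fun m _ => measure_ne_top _ _)) (ENNReal.inv_ne_top.2 hc0)
    have hM2fin : IsFiniteMeasure ((a * c⁻¹) • N) := smul_finite _ hat
    -- Both measures solve the renewal equation with source `a * κ`. Proportionality to `N`,
    -- whatever the event, is the independence of the lifetime of the root from the branching above
    -- it.
    have hMN : rootLifeMeasure p P ν (spineEvent p j univ A) = (a * c⁻¹) • N := by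
      refine eq_of_renewal (κ := κ) (a := a) hW (fun H hH => ?_) fun H hH => ?_
      · have hs : ∀ x : ℝ, MeasurableSet {y | x + y ∈ H} := fun x => (measurable_const_add x) hH
        simp_rw [rootLifeMeasure_spineEvent p ν j A (hs _)]
        rw [rootLifeMeasure_spineEvent p ν j A hH, h.measure_spineEvent p ν j hH hA, add_comm]
        congr 1
        simp_rw [← redMeasure_apply p ν (hA _)]
        rw [ha]
        ring
      · simp only [Measure.smul_apply, smul_eq_mul]
        rw [lintegral_const_mul' _ _ hat, hren H hH, mul_add, ← mul_assoc, mul_assoc a,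
          ENNReal.inv_mul_cancel hc0 hct, mul_one]
        congr 1
        ring
    have hE : redMeasure p P ν (treeEvent j H A) = colTreeLaw P ν (spineEvent p j H A) := by
      rw [redMeasure_apply p ν (measurableSet_treeEvent j hH hA)]
      refine measure_congr ?_
      have hn : ∀ᵐ x ∂(colTreeLaw P ν), ¬ (rootBlack p x ∧ ¬ finSpine p x) := by
        rw [ae_iff]
        simpa using hnull
      filter_upwards [hn] with x hx
      refine propext ⟨fun hx' => ⟨hx'.1, ?_, hx'.2⟩, fun hx' => ⟨hx'.1, hx'.2.2⟩⟩
      by_contra hf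
      exact hx ⟨hx'.1, hf⟩
    have hM : colTreeLaw P ν (spineEvent p j H A) = a * c⁻¹ * N H := by
      rw [← rootLifeMeasure_spineEvent p ν j A hH, hMN, Measure.smul_apply, smul_eq_mul]
    rw [redTreeLaw, Measure.smul_apply, smul_eq_mul, hE, hM, haq, Measure.smul_apply, smul_eq_mul,
      mul_right_comm (q' j), mul_assoc _ c, ENNReal.mul_inv_cancel hc0 hct, mul_one]
    simp only [redTreeLaw]
    ring

end TreeReduction

/-! ### The law of the reduced bush -/

theorem measurableEmbedding_sigma_mk {ι : Type*} {β : ι → Type*} [∀ i, MeasurableSpace (β i)]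
    (i : ι) : MeasurableEmbedding (Sigma.mk i : β i → Σ i, β i) where
  injective := sigma_mk_injective
  measurable := measurable_sigma_mk i
  measurableSet_image' := by
    intro s hs
    refine MeasurableSpace.measurableSet_iInf.2 fun k => ?_
    change MeasurableSet (Sigma.mk k ⁻¹' (Sigma.mk i '' s))
    by_cases h : i = k
    · subst h
      rwa [preimage_image_eq _ sigma_mk_injective]
    · have : Sigma.mk k ⁻¹' (Sigma.mk i '' s) = (∅ : Set (β k)) := by
        ext x
        simp only [mem_preimage, mem_image, mem_empty_iff_false, iff_false, not_exists, not_and]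
        intro y _ hy
        exact h (congrArg Sigma.fst hy)
      rw [this]
      exact MeasurableSet.empty

/-- The measure on bushes with weight `a j` for bushes of `j` trees, which are independent
of law `ρ`. -/
def bushMeasure (a : ℕ → ℝ≥0∞) (ρ : Measure MTree) : Measure Bush :=
  Measure.sum fun n => a n • (Measure.pi fun _ : Fin n => ρ).map (Sigma.mk n)

theorem bushLaw_eq (η : PMF ℕ) (P : Measure MTree) : bushLaw η P = bushMeasure η P := rfl

theorem bushRect_eq_image (j : ℕ) (A : Fin j → Set MTree) :
    bushRect j A = Sigma.mk j '' Set.pi univ A := by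
  ext b
  constructor
  · rintro ⟨h, hb⟩
    obtain ⟨n, b⟩ := b
    cases h
    exact ⟨b, fun m _ => hb m, rfl⟩
  · rintro ⟨b, hb, rfl⟩
    exact ⟨rfl, fun m => hb m trivial⟩

theorem measurableSet_bushRect (j : ℕ) {A : Fin j → Set MTree} (hA : ∀ m, MeasurableSet (A m)) :
    MeasurableSet (bushRect j A) := by
  rw [bushRect_eq_image]
  exact (measurableEmbedding_sigma_mk j).measurableSet_image.2 (MeasurableSet.univ_pi hA)

theorem map_sigma_mk_apply_image {ρ : Measure MTree} (B : Set (Fin j → MTree)) :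
    (Measure.pi fun _ : Fin n => ρ).map (Sigma.mk n) (Sigma.mk j '' B : Set Bush)
      = if n = j then (Measure.pi fun _ : Fin j => ρ) B else 0 := by
  rw [(measurableEmbedding_sigma_mk n).map_apply]
  split_ifs with h
  · subst h
    rw [preimage_image_eq _ sigma_mk_injective]
  · have : Sigma.mk n ⁻¹' (Sigma.mk j '' B : Set Bush) = ∅ := by
      ext x
      simp only [mem_preimage, mem_image, mem_empty_iff_false, iff_false, not_exists, not_and]
      intro y _ hy
      exact h (congrArg Sigma.fst hy).symm
    rw [this, measure_empty]

theorem bushMeasure_image (a : ℕ → ℝ≥0∞) (ρ : Measure MTree) {B : Set (Fin j → MTree)}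
    (hB : MeasurableSet B) :
    bushMeasure a ρ (Sigma.mk j '' B) = a j * (Measure.pi fun _ : Fin j => ρ) B := by
  rw [bushMeasure, Measure.sum_apply _ ((measurableEmbedding_sigma_mk j).measurableSet_image.2 hB),
    tsum_eq_single j]
  · rw [Measure.smul_apply, map_sigma_mk_apply_image, if_pos rfl, smul_eq_mul]
  · intro n hn
    rw [Measure.smul_apply, map_sigma_mk_apply_image, if_neg hn, smul_zero]

/-- The bushes of each size form a separate component, and on this component the rectangles
determine a multiple of a product measure. -/
theorem eq_bushMeasure {ρ : Measure MTree} [IsProbabilityMeasure ρ] {a : ℕ → ℝ≥0∞}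
    (ha : ∀ j, a j ≠ ∞) {μ : Measure Bush}
    (h : ∀ (j : ℕ) (A : Fin j → Set MTree), (∀ m, MeasurableSet (A m)) →
      μ (bushRect j A) = a j * ∏ m, ρ (A m)) : μ = bushMeasure a ρ := by
  ext s hs
  have hdec : ∀ μ' : Measure Bush, μ' s
      = ∑' j, μ' (Sigma.mk j '' (Sigma.mk (β := fun n => Fin n → MTree) j ⁻¹' s)) := by
    intro μ'
    rw [measure_eq_tsum_fiber μ' measurable_bush_size hs]
    refine tsum_congr fun j => ?_
    congr 1
    ext b
    constructor
    · rintro ⟨h1, h2⟩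
      obtain ⟨n, b⟩ := b
      cases h1
      exact ⟨b, h2, rfl⟩
    · rintro ⟨b, hb, rfl⟩
      exact ⟨rfl, hb⟩
  rw [hdec μ, hdec (bushMeasure a ρ)]
  refine tsum_congr fun j => ?_
  rw [bushMeasure_image a ρ (measurable_sigma_mk j hs)]
  have h1 : μ.comap (Sigma.mk j) = a j • Measure.pi fun _ : Fin j => ρ := by
    refine eq_smul_pi_of_rectangles _ (ha j) fun A hA => ?_
    rw [(measurableEmbedding_sigma_mk j).comap_apply, ← bushRect_eq_image, h j A hA]
  have h2 := congrArg (fun m => m (Sigma.mk (β := fun n => Fin n → MTree) j ⁻¹' s)) h1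
  simpa only [(measurableEmbedding_sigma_mk j).comap_apply, Measure.smul_apply, smul_eq_mul]
    using h2

/-- The law of the reduced bush. -/
def redBushLaw (p : ℝ) (η : PMF ℕ) (P : Measure MTree) (ν : Measure Bool) : Measure Bush :=
  ((bushLaw η P).prod (infinitePi fun _ : ℕ => infinitePi fun _ : List ℕ => ν)).map
    fun x => reduceBush p x.1 x.2

theorem measurable_reduceBush (p : ℝ) :
    Measurable fun x : Bush × (ℕ → List ℕ → Bool) => reduceBush p x.1 x.2 := by
  simp_rw [reduceBush_eq]
  intro s hs
  have : (fun x : Bush × (ℕ → List ℕ → Bool) => redBush p fun i => (x.1.2 i, x.2 i)) ⁻¹' s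
      = ⋃ n, (Prod.map (Sigma.mk n) id) '' ((fun y : (Fin n → MTree) × (ℕ → List ℕ → Bool) =>
          redBush p fun i => (y.1 i, y.2 i)) ⁻¹' s) := by
    ext ⟨⟨n, b⟩, c⟩
    simp only [mem_preimage, mem_iUnion, mem_image, Prod.exists]
    constructor
    · intro h
      exact ⟨n, b, c, h, rfl⟩
    · rintro ⟨n', b', c', h, h'⟩
      obtain ⟨h1, rfl⟩ := Prod.mk.inj h'
      obtain ⟨rfl, h2⟩ := Sigma.mk.inj h1
      cases h2
      exact h
  rw [this]
  refine MeasurableSet.iUnion fun n => ?_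
  refine ((measurableEmbedding_sigma_mk n).prodMap MeasurableEmbedding.id).measurableSet_image.2 ?_
  have hz : Measurable fun x : (Fin n → MTree) × (ℕ → List ℕ → Bool) =>
    fun i : Fin n => ((x.1 i, x.2 i) : ColTree) := by fun_prop
  exact ((measurable_redBush p n).comp hz) hs

/-- A bush of `n` independent coloured trees keeps `j` of them with binomial weights; summing over
`n` produces `thin`. -/
theorem redBushLaw_bushRect (p : ℝ) (η : PMF ℕ) (P : Measure MTree) [IsProbabilityMeasure P]
    (ν : Measure Bool) [IsProbabilityMeasure ν] (j : ℕ) {A : Fin j → Set MTree}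
    (hA : ∀ m, MeasurableSet (A m)) :
    redBushLaw p η P ν (bushRect j A)
      = thin η (colTreeLaw P ν {x | rootBlack p x}ᶜ) j * ∏ m, redMeasure p P ν (A m) := by
  have hR := measurableSet_bushRect j hA
  set N : Measure (ℕ → List ℕ → Bool) :=
    infinitePi fun _ : ℕ => infinitePi fun _ : List ℕ => ν
  rw [redBushLaw, map_apply (measurable_reduceBush p) hR, bushLaw, Measure.prod_sum_left,
    Measure.sum_apply _ (measurable_reduceBush p hR), thin, ← ENNReal.tsum_mul_right]
  refine tsum_congr fun n => ?_
  rw [Measure.prod_smul_left, Measure.smul_apply, smul_eq_mul, mul_assoc]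
  congr 1
  have h1 : ((Measure.pi fun _ : Fin n => P).map (Sigma.mk n : _ → Bush)).prod N
      = ((Measure.pi fun _ : Fin n => P).prod N).map (Prod.map (Sigma.mk n) id) := by
    conv_lhs => rw [← map_id (μ := N)]
    exact map_prod_map _ _ (measurable_sigma_mk n) measurable_id
  rw [h1, map_apply ((measurable_sigma_mk n).prodMap measurable_id)
    (measurable_reduceBush p hR)]
  simp_rw [redMeasure_apply p ν (hA _)]
  have hfe := measurableSet_filterEvent n j (measurableSet_rootBlack p)
    (fun m => measurable_redTree p (hA m))
  rw [← pi_filterEvent n j (measurableSet_rootBlack p) (fun m => measurable_redTree p (hA m)),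
    colTreeLaw, ← pi_prod_infinitePi_map_zip, map_apply (by fun_prop) hfe]
  congr 1
  ext y
  rw [mem_preimage, mem_preimage, mem_preimage, reduceBush_eq]
  exact redBush_mem_bushRect p _ A

theorem tsum_thin_mul_pow (η : PMF ℕ) {g r : ℝ≥0∞} (hgr : g + r = 1) :
    ∑' j, thin η g j * r ^ j = 1 := by
  unfold thin
  simp_rw [← ENNReal.tsum_mul_right]
  rw [ENNReal.tsum_comm]
  rw [← η.tsum_coe]
  refine tsum_congr fun n => ?_
  have h1 : ∑' j, η n * (↑(n.choose j) * g ^ (n - j)) * r ^ j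
      = η n * ∑' j, r ^ j * g ^ (n - j) * (n.choose j) := by
    rw [← ENNReal.tsum_mul_left]
    refine tsum_congr fun j => ?_
    ring
  rw [h1, tsum_eq_sum (s := Finset.range (n + 1)), ← add_pow, add_comm, hgr, one_pow, mul_one]
  intro j hj
  rw [Nat.choose_eq_zero_of_lt (by simpa using hj)]
  simp

theorem compl_add_redMeasure (p : ℝ) (P : Measure MTree) [IsProbabilityMeasure P]
    (ν : Measure Bool) [IsProbabilityMeasure ν] :
    colTreeLaw P ν {x | rootBlack p x}ᶜ + redMeasure p P ν univ = 1 := by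
  rw [redMeasure_univ, add_comm, prob_add_prob_compl (measurableSet_rootBlack p)]

theorem redBushLaw_eq (p : ℝ) (η : PMF ℕ) (P : Measure MTree) [IsProbabilityMeasure P]
    (ν : Measure Bool) [IsProbabilityMeasure ν] (hr : redMeasure p P ν univ ≠ 0) :
    redBushLaw p η P ν
      = bushMeasure (fun j => thin η (colTreeLaw P ν {x | rootBlack p x}ᶜ) j
          * redMeasure p P ν univ ^ j) (redTreeLaw p P ν) := by
  have := isProbabilityMeasure_redTreeLaw p ν hr
  refine eq_bushMeasure (fun j => ?_) fun j A hA => ?_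
  · refine ne_top_of_le_ne_top one_ne_top ?_
    rw [← tsum_thin_mul_pow η (compl_add_redMeasure p P ν)]
    exact ENNReal.le_tsum j
  · rw [redBushLaw_bushRect p η P ν j hA, ← mul_prod_redTreeLaw p ν hr, mul_assoc]

/-! ### Forests as sequences of gaps and bushes -/

/-- The inter-immigration times and the bushes of a forest. -/
def gapBush (f : Forest) : ℕ → ℝ × Bush := fun i => (gap f i, (f i).2)

/-- The forest with given inter-immigration times and bushes. -/
def sumForest (z : ℕ → ℝ × Bush) : Forest := fun i => (∑ k ∈ Finset.range (i + 1), (z k).1, (z i).2)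

theorem gapBush_sumForest (z : ℕ → ℝ × Bush) : gapBush (sumForest z) = z := by
  funext i
  cases i with
  | zero => simp [gapBush, gap, sumForest]
  | succ i =>
    refine Prod.ext ?_ rfl
    simp only [gapBush, gap, sumForest]
    rw [sum_range_succ _ (i + 1)]
    ring

theorem sum_gap (f : Forest) (i : ℕ) : ∑ k ∈ Finset.range (i + 1), gap f k = (f i).1 := by
  induction i with
  | zero => simp [gap]
  | succ i ih => rw [sum_range_succ, ih, gap]; ring

theorem sumForest_gapBush (f : Forest) : sumForest (gapBush f) = f :=
  funext fun i => Prod.ext (sum_gap f i) rfl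

theorem measurable_gap (i : ℕ) : Measurable fun f : Forest => gap f i := by
  cases i with
  | zero => exact measurable_fst.comp (measurable_pi_apply 0)
  | succ i =>
    exact (measurable_fst.comp (measurable_pi_apply (i + 1))).sub
      (measurable_fst.comp (measurable_pi_apply i))

theorem measurable_gapBush : Measurable gapBush :=
  measurable_pi_lambda _ fun i => (measurable_gap i).prodMk
    (measurable_snd.comp (measurable_pi_apply i))

theorem measurable_sumForest : Measurable sumForest :=
  measurable_pi_lambda _ fun i => (Finset.measurable_sum _ fun k _ =>
    measurable_fst.comp (measurable_pi_apply k)).prodMk (measurable_snd.comp (measurable_pi_apply i))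

theorem bushLaw_univ (η : PMF ℕ) (P : Measure MTree) [IsProbabilityMeasure P] :
    IsProbabilityMeasure (bushLaw η P) := by
  refine ⟨?_⟩
  rw [bushLaw, Measure.sum_apply _ MeasurableSet.univ]
  have : ∀ n, (η n • (Measure.pi fun _ : Fin n => P).map (Sigma.mk n)) (univ : Set Bush) = η n := by
    intro n
    rw [Measure.smul_apply, map_apply (measurable_sigma_mk n) MeasurableSet.univ,
      preimage_univ, measure_univ, smul_eq_mul, mul_one]
  rw [tsum_congr this, η.tsum_coe]

/-- In the coordinates of gaps and bushes a forest with immigration is an independent identically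
distributed sequence; `isGWILaw_of_map_gapBush` is the converse. -/
theorem IsGWILaw.map_gapBush (h : IsGWILaw q κ η χ L) : ∃ P, IsGWTreeLaw q κ P ∧
      L.map gapBush = infinitePi fun _ => χ.prod (bushLaw η P) := by
  have := h.isProb
  have := h.isProb_gap
  obtain ⟨P, hP, hlaw⟩ := h.law
  have := hP.isProb
  have := bushLaw_univ η P
  refine ⟨P, hP, ?_⟩
  have h1 := h.indep.map_fun_eq_infinitePi_map
    (fun i => (measurable_gap i).prodMk (measurable_snd.comp (measurable_pi_apply i)))
  refine h1.trans ?_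
  congr 1
  funext i
  exact hlaw i

theorem isGWILaw_of_map_gapBush [IsProbabilityMeasure L] (hP : IsGWTreeLaw q κ P)
    [IsProbabilityMeasure χ] (hχ : χ (Iic 0) = 0) (hη : η 0 = 0)
    (hL : L.map gapBush = infinitePi fun _ => χ.prod (bushLaw η P)) :
    IsGWILaw q κ η χ L := by
  have := hP.isProb
  have := bushLaw_univ η P
  have hm : ∀ i, Measurable fun f : Forest => (gap f i, (f i).2) := fun i =>
    (measurable_gap i).prodMk (measurable_snd.comp (measurable_pi_apply i))
  have hlaw : ∀ i : ℕ, L.map (fun f : Forest => (gap f i, (f i).2)) = χ.prod (bushLaw η P) := by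
    intro i
    have h1 := congrArg (Measure.map fun z : ℕ → ℝ × Bush => z i) hL
    rw [map_map (measurable_pi_apply i) measurable_gapBush,
      Measure.infinitePi_map_eval] at h1
    exact h1
  refine ⟨inferInstance, inferInstance, hχ, hη, ?_, P, hP, hlaw⟩
  rw [iIndepFun_iff_map_fun_eq_infinitePi_map hm]
  simp_rw [hlaw]
  exact hL

/-! ### Thinning of sequences -/

/-- The bush is not empty. -/
def nonemptyAt (z : ℕ → ℝ × Bush) (i : ℕ) : Prop := (z i).2.1 ≠ 0

open Classical in
/-- The forest with given inter-immigration times and bushes, where the empty bushes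
are removed. -/
def thinForest (z : ℕ → ℝ × Bush) : Forest := fun m =>
  if ∃ i, nonemptyAt z i ∧ count (nonemptyAt z) i = m then
    sumForest z (nth (nonemptyAt z) m) else noEntry

/-- The gaps and the reduced bushes of a coloured forest. -/
def redSeq (p : ℝ) (x : Forest × Colouring) : ℕ → ℝ × Bush := fun i =>
  (gap x.1 i, reduceBush p (x.1 i).2 fun j u => x.2 (i, j, u))

theorem ite_count_congr {α : Sort*} {k k' : ℕ → Prop} {dk : DecidablePred k}
    {dk' : DecidablePred k'} (h : ∀ i, k i ↔ k' i) {m : ℕ}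
    {d : Decidable (∃ i, k i ∧ count k i = m)} {d' : Decidable (∃ i, k' i ∧ count k' i = m)}
    {a a' b : α} (ha : a = a') :
    (if ∃ i, k i ∧ count k i = m then a else b)
      = if ∃ i, k' i ∧ count k' i = m then a' else b := by
  obtain rfl : k = k' := funext fun i => propext (h i)
  subst ha
  congr!

theorem reduceForest_eq (p : ℝ) (f : Forest) (col : Colouring) :
    reduceForest p f col = thinForest (redSeq p (f, col)) := by
  funext m
  exact ite_count_congr (fun i => Iff.rfl) (Prod.ext (sum_gap f _).symm rfl)

theorem measurable_nonemptyAt : Measurable fun z : ℕ → ℝ × Bush => {i | nonemptyAt z i} := by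
  refine measurable_set_iff.2 fun i => ?_
  have : Measurable fun z : ℕ → ℝ × Bush => (z i).2.1 :=
    measurable_bush_size.comp (measurable_snd.comp (measurable_pi_apply i))
  exact (this.eq_const 0).not

theorem measurable_thinForest : Measurable thinForest := by
  classical
  refine measurable_pi_lambda _ fun m => ?_
  unfold thinForest
  have h1 : MeasurableSet {z : ℕ → ℝ × Bush | ∃ i, nonemptyAt z i ∧
      count (nonemptyAt z) i = m} := by
    refine measurableSet_setOfPred.2 (Measurable.exists fun i => Measurable.and ?_ ?_)
    · exact (measurable_set_iff.1 measurable_nonemptyAt) i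
    · exact ((measurable_count i).comp measurable_nonemptyAt).eq_const m
  have h2 : Measurable fun z : ℕ → ℝ × Bush => sumForest z (nth (nonemptyAt z) m) :=
    measurable_countable_comp (g := fun (n : ℕ) z => sumForest z n)
      ((measurable_nth m).comp measurable_nonemptyAt)
      fun n => (measurable_pi_apply n).comp measurable_sumForest
  exact Measurable.ite h1 h2 measurable_const

theorem measurable_redSeq (p : ℝ) : Measurable (redSeq p) := by
  refine measurable_pi_lambda _ fun i => ((measurable_gap i).comp measurable_fst).prodMk ?_
  have : Measurable fun x : Forest × Colouring =>
      (((x.1 i).2, fun j u => x.2 (i, j, u)) : Bush × (ℕ → List ℕ → Bool)) := by fun_prop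
  exact (measurable_reduceBush p).comp this

theorem measurable_reduceForest (p : ℝ) :
    Measurable fun x : Forest × Colouring => reduceForest p x.1 x.2 := by
  simp_rw [reduceForest_eq]
  exact measurable_thinForest.comp (measurable_redSeq p)

/-- The law of one colour. -/
def colourMeasure (p : ℝ) : Measure Bool :=
  ofReal p • dirac false + ofReal (1 - p) • dirac true

theorem isProbabilityMeasure_colourMeasure (h0 : 0 ≤ p) (h1 : p ≤ 1) :
    IsProbabilityMeasure (colourMeasure p) := by
  refine ⟨?_⟩
  simp only [colourMeasure, Measure.add_apply, Measure.smul_apply, measure_univ, smul_eq_mul,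
    mul_one]
  rw [← ofReal_add h0 (by linarith)]
  simp

theorem colourMeasure_true (p : ℝ) : colourMeasure p {true} = ofReal (1 - p) := by
  simp [colourMeasure]

theorem colourLaw_map_curry (p : ℝ) [IsProbabilityMeasure (colourMeasure p)] :
    (colourLaw p).map (fun c i j u => c (i, j, u))
      = infinitePi fun _ : ℕ => infinitePi fun _ : ℕ =>
          infinitePi fun _ : List ℕ => colourMeasure p := by
  have h1 := infinitePi_map_curry (fun (_ : ℕ) (_ : ℕ × List ℕ) => colourMeasure p)
  have h2 := infinitePi_map_curry (fun (_ : ℕ) (_ : List ℕ) => colourMeasure p)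
  rw [← h2, ← infinitePi_map_pi (μ := fun _ : ℕ =>
    infinitePi fun _ : ℕ × List ℕ => colourMeasure p) (f := fun _ =>
      MeasurableEquiv.curry ℕ (List ℕ) Bool) (fun _ => (MeasurableEquiv.curry ℕ (List ℕ) Bool).measurable),
    ← h1, map_map (by fun_prop) (by fun_prop)]
  rfl

theorem map_redSeq (p : ℝ) [IsProbabilityMeasure (colourMeasure p)]
    [IsProbabilityMeasure χ] [IsProbabilityMeasure P]
    [IsProbabilityMeasure L]
    (hL : L.map gapBush = infinitePi fun _ => χ.prod (bushLaw η P)) :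
    (L.prod (colourLaw p)).map (redSeq p)
      = infinitePi fun _ => χ.prod (redBushLaw p η P (colourMeasure p)) := by
  have := bushLaw_univ η P
  have : IsProbabilityMeasure (colourLaw p) := by
    change IsProbabilityMeasure (infinitePi fun _ => colourMeasure p); infer_instance
  set N : Measure (ℕ → List ℕ → Bool) := infinitePi fun _ : ℕ =>
    infinitePi fun _ : List ℕ => colourMeasure p
  have h1 := map_prod_map L (colourLaw p) measurable_gapBush
    (g := fun (c : Colouring) i j u => c (i, j, u)) (by fun_prop)
  rw [hL, colourLaw_map_curry] at h1
  have h2 := infinitePi_prod_map_zip (fun _ : ℕ => χ.prod (bushLaw η P)) (fun _ : ℕ => N)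
  rw [h1, map_map (by fun_prop) (measurable_gapBush.prodMap (by fun_prop))] at h2
  have hr : Measurable fun y : (ℝ × Bush) × (ℕ → List ℕ → Bool) =>
      (y.1.1, reduceBush p y.1.2 y.2) := by
    refine (measurable_fst.comp measurable_fst).prodMk ?_
    have : Measurable fun y : (ℝ × Bush) × (ℕ → List ℕ → Bool) => (y.1.2, y.2) := by fun_prop
    exact (measurable_reduceBush p).comp this
  have h3 := infinitePi_map_pi (μ := fun _ : ℕ => (χ.prod (bushLaw η P)).prod N)
    (fun _ => hr)
  have hr' : Measurable fun (x : ℕ → (ℝ × Bush) × (ℕ → List ℕ → Bool)) i =>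
      ((x i).1.1, reduceBush p (x i).1.2 (x i).2) :=
    measurable_pi_lambda _ fun i => hr.comp (measurable_pi_apply i)
  rw [← h2, map_map hr'
    ((by fun_prop : Measurable fun x : (ℕ → ℝ × Bush) × (ℕ → ℕ → List ℕ → Bool) =>
      fun i => (x.1 i, x.2 i)).comp (measurable_gapBush.prodMap (by fun_prop)))] at h3
  have h4 : ((χ.prod (bushLaw η P)).prod N).map (fun y => (y.1.1, reduceBush p y.1.2 y.2))
      = χ.prod (redBushLaw p η P (colourMeasure p)) := by
    have ha : ((χ.prod (bushLaw η P)).prod N) = (χ.prod ((bushLaw η P).prod N)).map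
        MeasurableEquiv.prodAssoc.symm :=
      ((measurePreserving_prodAssoc χ (bushLaw η P) N).symm _).map_eq.symm
    rw [ha, map_map hr (by fun_prop), redBushLaw]
    conv_rhs => rw [← map_id (μ := χ)]
    rw [map_prod_map _ _ measurable_id (measurable_reduceBush p)]
    rfl
  rw [h4] at h3
  exact h3

/-! ### Thinned sequences of independent entries -/

/-- If the head is independent of the tail and the tail has the law of the whole sequence, the
coordinates can be split off one at a time. -/
theorem eq_infinitePi_of_map_split {X : Type*} [MeasurableSpace X] {ρ : Measure X}
    [IsProbabilityMeasure ρ] {Λ : Measure (ℕ → X)} [IsProbabilityMeasure Λ]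
    (h : Λ.map (fun z => (z 0, fun i => z (i + 1))) = ρ.prod Λ) :
    Λ = infinitePi fun _ => ρ := by
  have hm : Measurable fun z : ℕ → X => (z 0, fun i : ℕ => z (i + 1)) := by fun_prop
  have key : ∀ (n : ℕ) (C : ℕ → Set X), (∀ i, MeasurableSet (C i)) →
      Λ (Set.pi (Finset.range n) C) = ∏ i ∈ Finset.range n, ρ (C i) := by
    intro n
    induction n with
    | zero => intro C _; simp
    | succ n ih =>
      intro C hC
      have hs : MeasurableSet (Set.pi (Finset.range n : Set ℕ) fun i => C (i + 1)) :=
        MeasurableSet.pi (Finset.countable_toSet _) fun i _ => hC _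
      have h1 := congrArg (fun μ => μ (C 0 ×ˢ Set.pi (Finset.range n) fun i => C (i + 1))) h
      simp only [map_apply hm ((hC 0).prod hs), prod_prod, ih _ fun i => hC _] at h1
      rw [Finset.prod_range_succ', mul_comm, ← h1]
      congr 1
      ext z
      simp only [Finset.coe_range, Set.mem_pi, mem_Iio, mem_preimage, mem_prod]
      constructor
      · intro hz
        exact ⟨hz 0 (by omega), fun i hi => hz _ (by omega)⟩
      · rintro ⟨h1, h2⟩ i hi
        cases i with
        | zero => exact h1
        | succ i => exact h2 i (by omega)
  refine Measure.eq_infinitePi _ fun s t ht => ?_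
  classical
  obtain ⟨n, hn⟩ : ∃ n, s ⊆ Finset.range n := ⟨s.sup id + 1, fun i hi => by
    have := Finset.le_sup (f := id) hi
    simp only [id] at this
    exact Finset.mem_range.2 (by omega)⟩
  have h1 := key n (fun i => if i ∈ s then t i else univ) (fun i => by
    split_ifs
    · exact ht i
    · exact MeasurableSet.univ)
  have h2 : Set.pi (s : Set ℕ) t = Set.pi (Finset.range n) fun i => if i ∈ s then t i else univ := by
    ext z
    simp only [Set.mem_pi, Finset.mem_coe]
    constructor
    · intro hz i _
      split_ifs with hi
      · exact hz i hi
      · trivial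
    · intro hz i hi
      have := hz i (hn hi)
      rwa [if_pos hi] at this
  rw [h2, h1, ← Finset.prod_subset hn]
  · exact Finset.prod_congr rfl fun i hi => by rw [if_pos hi]
  · intro i _ hi
    rw [if_neg hi, measure_univ]

/-- The sequence without its first entry. -/
def shift {X : Type*} (z : ℕ → X) : ℕ → X := fun i => z (i + 1)

/-- The gaps and bushes of the thinned forest. -/
def thinSeq (z : ℕ → ℝ × Bush) : ℕ → ℝ × Bush := gapBush (thinForest z)

/-- There are infinitely many nonempty bushes. -/
def infKept (z : ℕ → ℝ × Bush) : Prop := {i | nonemptyAt z i}.Infinite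

theorem infKept_shift : infKept (shift z) ↔ infKept z := by
  unfold infKept
  have h1 : {i | nonemptyAt (shift z) i} = (fun i => i + 1) ⁻¹' {i | nonemptyAt z i} := rfl
  constructor
  · intro h
    rw [h1] at h
    exact Set.Infinite.mono (image_preimage_subset _ _) (h.image (by simp [InjOn]))
  · intro h hfin
    refine h (Set.Finite.subset ((hfin.image (fun i => i + 1)).union (finite_singleton 0)) ?_)
    intro i hi
    cases i with
    | zero => exact Or.inr rfl
    | succ i => exact Or.inl ⟨i, hi, rfl⟩

theorem thinForest_of_infKept (hz : infKept z) (m : ℕ) :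
    thinForest z m = sumForest z (nth (nonemptyAt z) m) := by
  classical
  refine if_pos ⟨nth (nonemptyAt z) m, Nat.nth_mem_of_infinite hz m, ?_⟩
  exact Nat.count_nth_of_infinite hz m

theorem nth_eq_of_count {p : ℕ → Prop} [DecidablePred p] {m : ℕ} (h : p i)
    (hm : count p i = m) : nth p m = i := by
  rw [← hm, Nat.nth_count h]

theorem nth_nonemptyAt_of_not (hz : infKept z) (h0 : ¬ nonemptyAt z 0) (m : ℕ) :
    nth (nonemptyAt z) m = nth (nonemptyAt (shift z)) m + 1 := by
  classical
  have hs := infKept_shift.2 hz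
  refine nth_eq_of_count (Nat.nth_mem_of_infinite hs m) ?_
  rw [Nat.count_succ', if_neg h0, add_zero]
  exact Nat.count_nth_of_infinite hs m

theorem nth_nonemptyAt_succ (hz : infKept z) (h0 : nonemptyAt z 0) (m : ℕ) :
    nth (nonemptyAt z) (m + 1) = nth (nonemptyAt (shift z)) m + 1 := by
  classical
  have hs := infKept_shift.2 hz
  refine nth_eq_of_count (Nat.nth_mem_of_infinite hs m) ?_
  rw [Nat.count_succ', if_pos h0, add_left_inj]
  exact Nat.count_nth_of_infinite hs m

theorem sumForest_succ (z : ℕ → ℝ × Bush) (i : ℕ) :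
    sumForest z (i + 1) = ((z 0).1 + (sumForest (shift z) i).1, (sumForest (shift z) i).2) := by
  refine Prod.ext ?_ rfl
  simp only [sumForest, shift]
  rw [Finset.sum_range_succ', add_comm]

/-- The regeneration of the thinned sequence: a nonempty first bush is its first entry. In
`thinSeq_of_empty` an empty one contributes only its gap, which is added to the first gap of the
rest. -/
theorem thinSeq_of_nonempty (hz : infKept z) (h0 : nonemptyAt z 0) :
    thinSeq z 0 = z 0 ∧ shift (thinSeq z) = thinSeq (shift z) := by
  classical
  have hs := infKept_shift.2 hz
  have hn0 : nth (nonemptyAt z) 0 = 0 := nth_eq_of_count h0 (Nat.count_zero _)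
  have e0 : thinForest z 0 = z 0 := by
    rw [thinForest_of_infKept hz, hn0]
    exact Prod.ext (by simp [sumForest]) rfl
  have e1 : ∀ m, thinForest z (m + 1)
      = ((z 0).1 + (thinForest (shift z) m).1, (thinForest (shift z) m).2) := by
    intro m
    rw [thinForest_of_infKept hz, nth_nonemptyAt_succ hz h0, sumForest_succ,
      thinForest_of_infKept hs]
  refine ⟨?_, funext fun m => ?_⟩
  · rw [thinSeq, gapBush, gap, e0]
  · simp only [shift, thinSeq, gapBush, gap]
    rw [e1]
    refine Prod.ext ?_ rfl
    cases m with
    | zero =>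
      rw [e0]
      simp only
      ring_nf
    | succ m =>
      rw [e1]
      simp only
      ring_nf

theorem thinSeq_of_empty (hz : infKept z) (h0 : ¬ nonemptyAt z 0) :
    thinSeq z 0 = ((z 0).1 + (thinSeq (shift z) 0).1, (thinSeq (shift z) 0).2) ∧
      shift (thinSeq z) = shift (thinSeq (shift z)) := by
  have hs := infKept_shift.2 hz
  have e1 : ∀ m, thinForest z m
      = ((z 0).1 + (thinForest (shift z) m).1, (thinForest (shift z) m).2) := by
    intro m
    rw [thinForest_of_infKept hz, nth_nonemptyAt_of_not hz h0, sumForest_succ,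
      thinForest_of_infKept hs]
  refine ⟨?_, funext fun m => ?_⟩
  · rw [thinSeq, gapBush, gap, e1]
    rfl
  · simp only [shift, thinSeq, gapBush, gap]
    rw [e1, e1]
    refine Prod.ext ?_ rfl
    ring_nf

/-! ### The law of the thinned sequence -/

theorem infinitePi_map_shift {X : Type*} [MeasurableSpace X] (ρ : Measure X)
    [IsProbabilityMeasure ρ] :
    (infinitePi fun _ : ℕ => ρ).map (fun z => (z 0, shift z))
      = ρ.prod (infinitePi fun _ : ℕ => ρ) :=
  infinitePi_map_split (fun _ : ℕ => ρ) 0 (f := Nat.succ) Nat.succ_injective fun j => Nat.succ_ne_zero j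

theorem measurable_shift {X : Type*} [MeasurableSpace X] :
    Measurable (shift : (ℕ → X) → ℕ → X) :=
  measurable_pi_lambda _ fun i => measurable_pi_apply (i + 1)

theorem measurable_thinSeq : Measurable thinSeq := measurable_gapBush.comp measurable_thinForest

theorem measurableSet_nonemptyBush : MeasurableSet {b : Bush | b.1 ≠ 0} :=
  (measurable_bush_size (measurableSet_singleton 0)).compl

/-- The law of the first gap of the thinned sequence on an event. -/
def thinGapMeasure (χ : Measure ℝ) (β : Measure Bush) (B : Set Bush) (D : Set (ℕ → ℝ × Bush)) :
    Measure ℝ :=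
  ((infinitePi fun _ : ℕ => χ.prod β).restrict
    {z | (thinSeq z 0).2 ∈ B ∧ shift (thinSeq z) ∈ D}).map fun z => (thinSeq z 0).1

theorem thinGapMeasure_apply {β : Measure Bush}
    (hH : MeasurableSet H) :
    thinGapMeasure χ β B D H = infinitePi (fun _ : ℕ => χ.prod β)
      {z | (thinSeq z 0).1 ∈ H ∧ (thinSeq z 0).2 ∈ B ∧ shift (thinSeq z) ∈ D} := by
  have hm : Measurable fun z => (thinSeq z 0).1 :=
    measurable_fst.comp ((measurable_pi_apply 0).comp measurable_thinSeq)
  rw [thinGapMeasure, map_apply hm hH, Measure.restrict_apply (hm hH)]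
  rfl

section

variable [IsProbabilityMeasure χ] {β : Measure Bush} [IsProbabilityMeasure β]

/-- This is the second Borel–Cantelli lemma for independent events of one positive probability. -/
theorem ae_infKept (hf : β {b | b.1 ≠ 0} ≠ 0) :
    ∀ᵐ z ∂infinitePi (fun _ : ℕ => χ.prod β), infKept z := by
  set Z := infinitePi fun _ : ℕ => χ.prod β
  have hT : MeasurableSet {x : ℝ × Bush | x.2.1 ≠ 0} := measurable_snd measurableSet_nonemptyBush
  have hs : ∀ n : ℕ, MeasurableSet {z : ℕ → ℝ × Bush | nonemptyAt z n} := fun n =>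
    (measurable_pi_apply (X := fun _ : ℕ => ℝ × Bush) n) hT
  have hpi : ∀ S : Finset ℕ, Z (⋂ i ∈ S, {z | nonemptyAt z i})
      = ∏ i ∈ S, β {b | b.1 ≠ 0} := by
    intro S
    have h1 : (⋂ i ∈ S, {z : ℕ → ℝ × Bush | nonemptyAt z i})
        = Set.pi (S : Set ℕ) fun _ => {x : ℝ × Bush | x.2.1 ≠ 0} := by
      ext z
      simp [nonemptyAt, Set.mem_pi]
    have h2 : {x : ℝ × Bush | x.2.1 ≠ 0} = univ ×ˢ {b : Bush | b.1 ≠ 0} := by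
      ext x; simp
    rw [h1, infinitePi_pi _ (fun _ _ => hT)]
    refine Finset.prod_congr rfl fun i _ => ?_
    rw [h2, prod_prod, measure_univ, one_mul]
  have hone : ∀ n, Z {z | nonemptyAt z n} = β {b | b.1 ≠ 0} := fun n => by
    simpa using hpi {n}
  have h1 : iIndepSet (fun n => {z : ℕ → ℝ × Bush | nonemptyAt z n}) Z := by
    rw [iIndepSet_iff_meas_biInter hs]
    intro S
    rw [hpi]
    exact Finset.prod_congr rfl fun i _ => (hone i).symm
  have h2 := measure_limsup_eq_one hs h1 (by
    rw [tsum_congr hone]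
    exact ENNReal.tsum_const_eq_top_of_ne_zero hf)
  have h3 := (prob_compl_eq_zero_iff (MeasurableSet.measurableSet_limsup hs)).2 h2
  filter_upwards [measure_eq_zero_iff_ae_notMem.1 h3] with z hz
  rw [notMem_compl_iff, Filter.mem_limsup_iff_frequently_mem, Nat.frequently_atTop_iff_infinite] at hz
  exact hz

/-- Conditioning on whether the first bush is empty gives a renewal equation of the same kind as for
the merged lifetimes. -/
theorem thinGapMeasure_renewal (hf : β {b | b.1 ≠ 0} ≠ 0)
    (hB : MeasurableSet B) (hD : MeasurableSet D) (hH : MeasurableSet H) :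
    thinGapMeasure χ β B D H
      = (β ({b | b.1 ≠ 0} ∩ B) *
          (infinitePi fun _ : ℕ => χ.prod β).map thinSeq D) * χ H
        + β {b | b.1 ≠ 0}ᶜ * ∫⁻ x, thinGapMeasure χ β B D {y | x + y ∈ H} ∂χ := by
  set Z := infinitePi fun _ : ℕ => χ.prod β with hZ
  have hsplit : Measurable fun z : ℕ → ℝ × Bush => (z 0, shift z) :=
    (measurable_pi_apply 0).prodMk measurable_shift
  have hT : MeasurableSet {x : ℝ × Bush | x.2.1 ≠ 0} := measurable_snd measurableSet_nonemptyBush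
  have hm1 : Measurable fun z => (thinSeq z 0).1 :=
    measurable_fst.comp ((measurable_pi_apply 0).comp measurable_thinSeq)
  have hm2 : Measurable fun z => (thinSeq z 0).2 :=
    measurable_snd.comp ((measurable_pi_apply 0).comp measurable_thinSeq)
  have hm3 : Measurable fun z => shift (thinSeq z) := measurable_shift.comp measurable_thinSeq
  have hN : MeasurableSet {z : ℕ → ℝ × Bush | nonemptyAt z 0} :=
    (measurable_pi_apply (X := fun _ : ℕ => ℝ × Bush) 0) hT
  rw [thinGapMeasure_apply hH, ← measure_inter_add_sdiff _ hN]
  congr 1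
  · have h1 : ({z | (thinSeq z 0).1 ∈ H ∧ (thinSeq z 0).2 ∈ B ∧ shift (thinSeq z) ∈ D} ∩
        {z | nonemptyAt z 0} : Set (ℕ → ℝ × Bush)) =ᵐ[Z] (fun z => (z 0, shift z)) ⁻¹'
          ((H ×ˢ ({b : Bush | b.1 ≠ 0} ∩ B)) ×ˢ (thinSeq ⁻¹' D)) := by
      filter_upwards [ae_infKept (χ := χ) hf] with z hz
      refine propext ?_
      change ((_ ∧ _ ∧ _) ∧ _) ↔ ((_ ∧ (_ ∧ _)) ∧ _)
      constructor
      · rintro ⟨⟨h1, h2, h3⟩, h0⟩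
        obtain ⟨e1, e2⟩ := thinSeq_of_nonempty hz h0
        rw [e1] at h1 h2
        rw [e2] at h3
        exact ⟨⟨h1, h0, h2⟩, h3⟩
      · rintro ⟨⟨h1, h0, h2⟩, h3⟩
        obtain ⟨e1, e2⟩ := thinSeq_of_nonempty hz h0
        rw [e1, e2]
        exact ⟨⟨h1, h2, h3⟩, h0⟩
    rw [measure_congr h1, ← map_apply hsplit
      ((hH.prod (measurableSet_nonemptyBush.inter hB)).prod (measurable_thinSeq hD)),
      hZ, infinitePi_map_shift, prod_prod, prod_prod,
      map_apply measurable_thinSeq hD]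
    ring
  · set G : Set ((ℝ × Bush) × (ℕ → ℝ × Bush)) := {y | ¬ y.1.2.1 ≠ 0 ∧
      y.1.1 + (thinSeq y.2 0).1 ∈ H ∧ (thinSeq y.2 0).2 ∈ B ∧ shift (thinSeq y.2) ∈ D} with hG
    have hGm : MeasurableSet G := by
      refine (measurable_fst hT.compl).inter ((?_ : MeasurableSet _).inter
        ((hm2.comp measurable_snd hB).inter (hm3.comp measurable_snd hD)))
      exact ((measurable_fst.comp measurable_fst).add (hm1.comp measurable_snd)) hH
    have h1 : ({z | (thinSeq z 0).1 ∈ H ∧ (thinSeq z 0).2 ∈ B ∧ shift (thinSeq z) ∈ D} \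
        {z | nonemptyAt z 0} : Set (ℕ → ℝ × Bush)) =ᵐ[Z] (fun z => (z 0, shift z)) ⁻¹' G := by
      filter_upwards [ae_infKept (χ := χ) hf] with z hz
      refine propext ?_
      change ((_ ∧ _ ∧ _) ∧ _) ↔ (_ ∧ (_ ∧ _))
      constructor
      · rintro ⟨⟨h1, h2, h3⟩, h0⟩
        obtain ⟨e1, e2⟩ := thinSeq_of_empty hz h0
        rw [e1] at h1 h2
        rw [e2] at h3
        exact ⟨h0, h1, h2, h3⟩
      · rintro ⟨h0, h1, h2, h3⟩
        obtain ⟨e1, e2⟩ := thinSeq_of_empty hz h0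
        rw [e1, e2]
        exact ⟨⟨h1, h2, h3⟩, h0⟩
    rw [measure_congr h1, ← map_apply hsplit hGm, hZ, infinitePi_map_shift,
      Measure.prod_apply hGm]
    have h2 : ∀ x : ℝ × Bush, Z (Prod.mk x ⁻¹' G)
        = thinGapMeasure χ β B D {y | x.1 + y ∈ H} * {b : Bush | b.1 ≠ 0}ᶜ.indicator 1 x.2 := by
      intro x
      rw [thinGapMeasure_apply (show MeasurableSet {y | x.1 + y ∈ H} from measurable_const_add x.1 hH)]
      by_cases hx : x.2.1 ≠ 0
      · have : Prod.mk x ⁻¹' G = ∅ := by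
          ext z
          simp only [hG, mem_preimage, mem_ofPred_eq, mem_empty_iff_false, iff_false]
          exact fun h => h.1 hx
        rw [this, measure_empty, indicator_of_notMem (notMem_compl_iff.2 hx), mul_zero]
      · rw [indicator_of_mem hx, Pi.one_apply, mul_one]
        congr 1
        ext z
        simp only [hG, mem_preimage, mem_ofPred_eq]
        tauto
    rw [lintegral_congr h2]
    have hmeas : Measurable fun x : ℝ => thinGapMeasure χ β B D {y | x + y ∈ H} := by
      have : IsFiniteMeasure (thinGapMeasure χ β B D) := by unfold thinGapMeasure; infer_instance
      exact measurable_measure_prodMk_left (measurable_add hH)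
    rw [lintegral_prod_mul hmeas.aemeasurable
      (g := {b : Bush | b.1 ≠ 0}ᶜ.indicator 1)
      ((measurable_one.indicator measurableSet_nonemptyBush.compl).aemeasurable),
      lintegral_indicator_one measurableSet_nonemptyBush.compl, mul_comm]

/-- The law of the gaps of the thinned sequence. -/
def thinGapLaw (χ : Measure ℝ) (β : Measure Bush) : Measure ℝ :=
  thinGapMeasure χ β univ univ

theorem isGeomSum_thinGapLaw (hf : β {b | b.1 ≠ 0} ≠ 0) :
    IsGeomSum (β {b | b.1 ≠ 0}ᶜ) χ (thinGapLaw χ β) := by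
  have hΛ : IsProbabilityMeasure ((infinitePi fun _ : ℕ => χ.prod β).map thinSeq) :=
    isProbabilityMeasure_map measurable_thinSeq.aemeasurable
  refine ⟨⟨?_⟩, fun H hH => ?_⟩
  · rw [thinGapLaw, thinGapMeasure_apply MeasurableSet.univ]
    simp
  · rw [thinGapLaw, thinGapMeasure_renewal hf MeasurableSet.univ MeasurableSet.univ hH, inter_univ,
      measure_univ, mul_one]
    congr 2
    have h1 := prob_add_prob_compl (μ := β) measurableSet_nonemptyBush
    rw [← h1, ENNReal.add_sub_cancel_right (measure_ne_top _ _)]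

/-- The sets `B` and `D` affect only the source of the renewal equation, so its solution is a
multiple of the unrestricted one. This makes the first gap independent of the first bush and of the
later entries. -/
theorem thinGapMeasure_eq (hf : β {b | b.1 ≠ 0} ≠ 0)
    (hB : MeasurableSet B) (hD : MeasurableSet D) :
    thinGapMeasure χ β B D = ((β {b | b.1 ≠ 0})⁻¹ * (β ({b | b.1 ≠ 0} ∩ B) *
          (infinitePi fun _ : ℕ => χ.prod β).map thinSeq D)) • thinGapLaw χ β := by
  set Λ := (infinitePi fun _ : ℕ => χ.prod β).map thinSeq
  have hΛ : IsProbabilityMeasure Λ :=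
    isProbabilityMeasure_map measurable_thinSeq.aemeasurable
  have hgs := isGeomSum_thinGapLaw (χ := χ) hf
  have := hgs.1
  have hfin : IsFiniteMeasure (thinGapMeasure χ β B D) := by unfold thinGapMeasure; infer_instance
  have hft : β {b | b.1 ≠ 0} ≠ ∞ := measure_ne_top _ _
  have h1 := prob_add_prob_compl (μ := β) measurableSet_nonemptyBush
  have he : 1 - β {b | b.1 ≠ 0}ᶜ = β {b | b.1 ≠ 0} := by
    rw [← h1, ENNReal.add_sub_cancel_right (measure_ne_top _ _)]
  set a := β ({b | b.1 ≠ 0} ∩ B) * Λ D with ha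
  have hat : a ≠ ∞ := mul_ne_top (measure_ne_top _ _) (measure_ne_top _ _)
  have hct : (β {b | b.1 ≠ 0})⁻¹ * a ≠ ∞ := mul_ne_top (ENNReal.inv_ne_top.2 hf) hat
  have : IsFiniteMeasure (((β {b | b.1 ≠ 0})⁻¹ * a) • thinGapLaw χ β) :=
    smul_finite _ hct
  refine eq_of_renewal (κ := χ) (a := a) (W := β {b | b.1 ≠ 0}ᶜ) ?_
    (fun H hH => thinGapMeasure_renewal hf hB hD hH) fun H hH => ?_
  · rw [← h1]
    rw [add_comm]
    exact ENNReal.lt_add_right (measure_ne_top _ _) hf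
  · simp only [Measure.smul_apply, smul_eq_mul]
    rw [lintegral_const_mul' _ _ hct]
    conv_lhs => rw [hgs.2 H hH, he]
    rw [mul_add]
    congr 1
    · rw [mul_comm _ a, mul_assoc, ← mul_assoc _ _ (χ H), ENNReal.inv_mul_cancel hf hft, one_mul]
    · ring

/-- The hypothesis `hβ'` says that `β'` is `β` conditioned on a nonempty bush. By
`thinGapMeasure_eq` the thinned sequence splits into independent head and tail, the tail having the
law of the whole. -/
theorem map_thinSeq (hf : β {b | b.1 ≠ 0} ≠ 0) {β' : Measure Bush} [IsProbabilityMeasure β']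
    (hβ' : ∀ B, MeasurableSet B → β {b | b.1 ≠ 0} * β' B = β ({b | b.1 ≠ 0} ∩ B)) :
    (infinitePi fun _ : ℕ => χ.prod β).map thinSeq
      = infinitePi fun _ : ℕ => (thinGapLaw χ β).prod β' := by
  set Λ := (infinitePi fun _ : ℕ => χ.prod β).map thinSeq with hΛd
  have hΛ : IsProbabilityMeasure Λ :=
    isProbabilityMeasure_map measurable_thinSeq.aemeasurable
  have := (isGeomSum_thinGapLaw (χ := χ) hf).1
  have hsplit : Measurable fun z : ℕ → ℝ × Bush => (z 0, fun i => z (i + 1)) :=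
    (measurable_pi_apply 0).prodMk measurable_shift
  refine eq_infinitePi_of_map_split ?_
  rw [hΛd, map_map hsplit measurable_thinSeq, ← hΛd]
  have : IsProbabilityMeasure ((infinitePi fun _ : ℕ => χ.prod β).map
      ((fun z : ℕ → ℝ × Bush => (z 0, fun i => z (i + 1))) ∘ thinSeq)) :=
    isProbabilityMeasure_map (hsplit.comp measurable_thinSeq).aemeasurable
  refine Measure.ext_prod₃_iff'.2 fun {H B D} hH hB hD => ?_
  rw [map_apply (hsplit.comp measurable_thinSeq) ((hH.prod hB).prod hD),
    prod_prod, prod_prod]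
  have h1 := congrArg (fun μ => μ H) (thinGapMeasure_eq (χ := χ) hf hB hD)
  simp only [thinGapMeasure_apply hH, Measure.smul_apply, smul_eq_mul] at h1
  rw [← hβ' B hB, ← hΛd] at h1
  rw [mul_assoc (β {b | b.1 ≠ 0}), ← mul_assoc _⁻¹,
    ENNReal.inv_mul_cancel hf (measure_ne_top _ _), one_mul] at h1
  rw [mul_assoc, mul_comm (thinGapLaw χ β H), ← h1]
  congr 1
  ext z
  exact ⟨fun h => ⟨h.1.1, h.1.2, h.2⟩, fun h => ⟨⟨h.1, h.2.1⟩, h.2.2⟩⟩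

end

/-! ### Generating functions -/

theorem summable_toReal (q : PMF ℕ) : Summable fun n => (q n).toReal :=
  ENNReal.summable_toReal q.tsum_coe_ne_top

theorem summable_pgf (q : PMF ℕ) (hs : |s| ≤ 1) :
    Summable fun n => (q n).toReal * s ^ n := by
  refine Summable.of_norm_bounded (summable_toReal q) fun n => ?_
  rw [norm_mul, norm_pow, norm_eq_abs, abs_of_nonneg toReal_nonneg, norm_eq_abs]
  exact mul_le_of_le_one_right toReal_nonneg (pow_le_one₀ (abs_nonneg s) hs)

theorem pgf_zero (q : PMF ℕ) : pgf q 0 = (q 0).toReal := by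
  rw [pgf, tsum_eq_single 0 (fun n hn => by simp [hn])]
  simp

theorem tsum_toReal (q : PMF ℕ) : ∑' n, (q n).toReal = 1 := by
  rw [← ENNReal.tsum_toReal_eq fun n => q.apply_ne_top n, q.tsum_coe, toReal_one]

theorem pgf_one (q : PMF ℕ) : pgf q 1 = 1 := by
  simp [pgf, tsum_toReal]

theorem abs_le_one_of_mem (hs : s ∈ Icc (0 : ℝ) 1) : |s| ≤ 1 := by
  rw [abs_of_nonneg hs.1]; exact hs.2

theorem pgf_toReal (q : PMF ℕ) {g : ℝ≥0∞} (hg : g ≤ 1) :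
    (∑' n, q n * g ^ n).toReal = pgf q g.toReal := by
  rw [ENNReal.tsum_toReal_eq fun n => mul_ne_top (q.apply_ne_top n)
    (ENNReal.pow_ne_top (ne_top_of_le_ne_top one_ne_top hg))]
  simp [pgf]

theorem convexOn_pgf (q : PMF ℕ) : ConvexOn ℝ (Icc 0 1) (pgf q) := by
  refine ⟨convex_Icc 0 1, fun x hx y hy a b ha hb hab => ?_⟩
  have hz := convex_Icc (0 : ℝ) 1 hx hy ha hb hab
  simp only [smul_eq_mul] at hz ⊢
  have h1 := summable_pgf q (abs_le_one_of_mem hx)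
  have h2 := summable_pgf q (abs_le_one_of_mem hy)
  unfold pgf
  rw [← tsum_mul_left, ← tsum_mul_left, ← (h1.mul_left a).tsum_add (h2.mul_left b)]
  refine (summable_pgf q (abs_le_one_of_mem hz)).tsum_le_tsum (fun n => ?_)
    ((h1.mul_left a).add (h2.mul_left b))
  have h3 := (convexOn_pow n).2 hx.1 hy.1 ha hb hab
  simp only [smul_eq_mul] at h3
  nlinarith [toReal_nonneg (a := q n)]

theorem hasFPowerSeriesOnBall_pgf (q : PMF ℕ) : HasFPowerSeriesOnBall (pgf q)
    (FormalMultilinearSeries.ofScalars ℝ fun n => (q n).toReal) 0 1 := by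
  set p := FormalMultilinearSeries.ofScalars ℝ fun n => (q n).toReal with hp
  have hr : (1 : ℝ≥0∞) ≤ p.radius := by
    refine p.le_radius_of_summable_norm (r := 1) ?_
    simp only [hp, FormalMultilinearSeries.ofScalars_norm, NNReal.coe_one, one_pow, mul_one]
    exact (summable_toReal q).norm
  have h1 := (p.hasFPowerSeriesOnBall (lt_of_lt_of_le zero_lt_one hr)).mono zero_lt_one hr
  have h2 : p.sum = pgf q := by
    funext x
    change FormalMultilinearSeries.ofScalarsSum (fun n => (q n).toReal) x = _
    rw [FormalMultilinearSeries.ofScalars_sum_eq]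
    simp [pgf]
  rwa [h2] at h1

theorem analyticOnNhd_pgf (q : PMF ℕ) : AnalyticOnNhd ℝ (pgf q) (Ioo (-1) 1) := by
  have h := (hasFPowerSeriesOnBall_pgf q).analyticOnNhd
  rwa [show Metric.eball (0 : ℝ) 1 = Ioo (-1) 1 by
    rw [← ofReal_one, Metric.eball_ofReal, Real.ball_eq_Ioo]; norm_num] at h

/-- The identity theorem carries the equality to a neighbourhood of `0`, where the power series
coefficients are read off. -/
theorem pgf_injOn (h : ∀ s ∈ Ioo (0 : ℝ) 1, pgf q s = pgf q' s) : q = q' := by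
  have h1 : EqOn (pgf q) (pgf q') (Ioo (-1) 1) := by
    refine (analyticOnNhd_pgf q).eqOn_of_preconnected_of_eventuallyEq (analyticOnNhd_pgf q')
      isPreconnected_Ioo (z₀ := 1 / 2) (by norm_num) ?_
    filter_upwards [Ioo_mem_nhds (show (0 : ℝ) < 1 / 2 by norm_num)
      (show (1 / 2 : ℝ) < 1 by norm_num)] with s hs using h s hs
  have h2 := (hasFPowerSeriesOnBall_pgf q).hasFPowerSeriesAt.eq_formalMultilinearSeries_of_eventually
    (hasFPowerSeriesOnBall_pgf q').hasFPowerSeriesAt (by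
      filter_upwards [Ioo_mem_nhds (show (-1 : ℝ) < 0 by norm_num)
        (show (0 : ℝ) < 1 by norm_num)] with s hs using h1 hs)
  have h3 := FormalMultilinearSeries.ofScalars_series_injective ℝ ℝ h2
  ext n
  exact (ENNReal.toReal_eq_toReal_iff' (q.apply_ne_top n) (q'.apply_ne_top n)).1 (congrFun h3 n)

/-- The branching mechanism `ψ` with `φ_q(s) = s + ψ(1 - s)`. -/
def psi (q : PMF ℕ) (x : ℝ) : ℝ := pgf q (1 - x) - (1 - x)

/-- The immigration mechanism `φ` with `φ_η(s) = 1 - φ(1 - s)`. -/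
def phi (η : PMF ℕ) (x : ℝ) : ℝ := 1 - pgf η (1 - x)

theorem psi_zero (q : PMF ℕ) : psi q 0 = 0 := by simp [psi, pgf_one]

theorem psi_one (q : PMF ℕ) : psi q 1 = (q 0).toReal := by simp [psi, pgf_zero]

theorem convexOn_psi (q : PMF ℕ) : ConvexOn ℝ (Icc 0 1) (psi q) := by
  refine ⟨convex_Icc 0 1, fun x hx y hy a b ha hb hab => ?_⟩
  have h := (convexOn_pgf q).2 (show 1 - x ∈ Icc 0 1 from ⟨by linarith [hx.2], by linarith [hx.1]⟩)
    (show 1 - y ∈ Icc 0 1 from ⟨by linarith [hy.2], by linarith [hy.1]⟩) ha hb hab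
  simp only [smul_eq_mul, psi] at h ⊢
  rw [show a * (1 - x) + b * (1 - y) = 1 - (a * x + b * y) by linear_combination hab] at h
  linear_combination h + hab

/-- By convexity the graph lies below the chord from the origin to `(y, c)`. -/
theorem psi_lt_of_lt (q : PMF ℕ) {x : ℝ} (hx : 0 ≤ x) (hxy : x < y) (hy : y ≤ 1) (hc : 0 < c)
    (hyc : psi q y = c) : psi q x < c := by
  have hy0 : 0 < y := lt_of_le_of_lt hx hxy
  have h := (convexOn_psi q).2 ⟨le_rfl, zero_le_one⟩ ⟨hy0.le, hy⟩
    (show 0 ≤ 1 - x / y by rw [sub_nonneg, div_le_one hy0]; exact hxy.le)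
    (show 0 ≤ x / y by positivity) (by ring)
  simp only [smul_eq_mul, psi_zero, mul_zero, zero_add, hyc] at h
  rw [div_mul_cancel₀ _ hy0.ne'] at h
  have : x / y * c < 1 * c := mul_lt_mul_of_pos_right ((div_lt_one hy0).2 hxy) hc
  linarith

/-- `r` is the largest root in `[0, 1]` of `ψ_q(r) = (1 - p) q(0)`. -/
structure IsRootProb (p : ℝ) (q : PMF ℕ) (r : ℝ) : Prop where
  mem : r ∈ Icc (0 : ℝ) 1
  eq : psi q r = (1 - p) * (q 0).toReal
  le : ∀ x ∈ Icc (0 : ℝ) 1, psi q x = (1 - p) * (q 0).toReal → x ≤ r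

theorem IsRootProb.unique (h : IsRootProb p q r)
    (h' : IsRootProb p q r') : r = r' :=
  le_antisymm (h'.le r h.mem h.eq) (h.le r' h'.mem h'.eq)

theorem IsOffspringLaw.toReal_pos (hq : IsOffspringLaw q) : 0 < (q 0).toReal :=
  ENNReal.toReal_pos hq.1.ne' (q.apply_ne_top 0)

/-- For `p < 1` the level is positive. A convex function that vanishes at `0` attains a positive
level at most once, so maximality is automatic. -/
theorem isRootProb_of_lt (hq : IsOffspringLaw q) (hp : p < 1)
    (hr : r ∈ Icc (0 : ℝ) 1) (h : psi q r = (1 - p) * (q 0).toReal) : IsRootProb p q r := by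
  have hc : 0 < (1 - p) * (q 0).toReal := mul_pos (by linarith) hq.toReal_pos
  refine ⟨hr, h, fun x hx hx' => ?_⟩
  by_contra hlt
  exact (psi_lt_of_lt q hr.1 (not_le.1 hlt) hx.2 hc hx').ne h

/-! ### The probability of a black root -/

theorem IsGWTreeLaw.measure_forall_colChild
    (h : IsGWTreeLaw q κ P) (ν : Measure Bool) [IsProbabilityMeasure ν] {B : Set ColTree}
    (hB : MeasurableSet B) :
    colTreeLaw P ν {x | ∀ i < kids x.1, colChild x i ∈ B} = ∑' n, q n * colTreeLaw P ν B ^ n := by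
  have := h.isProb
  have := h.isProb_life
  have hm : Measurable fun x : ColTree => kids x.1 := measurable_kids.comp measurable_fst
  have hE : MeasurableSet {x : ColTree | ∀ i < kids x.1, colChild x i ∈ B} := by
    refine measurableSet_setOfPred.2 (Measurable.forall fun i => Measurable.imp ?_ ?_)
    · exact measurableSet_setOfPred.1 (measurableSet_lt measurable_const hm)
    · exact measurableSet_setOfPred.1 (measurable_colChild i hB)
  rw [measure_eq_tsum_fiber (f := fun x : ColTree => kids x.1) _ hm hE]
  refine tsum_congr fun n => ?_
  have hD : MeasurableSet ((univ : Set ℝ) ×ˢ ((univ : Set Bool) ×ˢ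
      Set.pi (univ : Set (Fin n)) fun _ => B)) :=
    MeasurableSet.univ.prod (MeasurableSet.univ.prod (MeasurableSet.univ_pi fun _ => hB))
  have h1 := h.measure_rootData ν n hD
  rw [prod_prod, prod_prod, measure_univ, measure_univ, pi_pi, one_mul,
    one_mul, prod_const, card_univ, Fintype.card_fin] at h1
  rw [← h1]
  congr 1
  ext x
  refine and_congr_right fun hn => ?_
  change (∀ i < kids x.1, _) ↔ (True ∧ True ∧ ∀ i : Fin n, True → colChild x i ∈ B)
  rw [hn]
  exact ⟨fun h => ⟨trivial, trivial, fun i _ => h i i.2⟩, fun h i hi => h.2.2 ⟨i, hi⟩ trivial⟩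

/-- All children of the root fail to be black exactly if the root is not black or is itself a black
leaf, and these two cases are disjoint. -/
theorem IsGWTreeLaw.not_rootBlack_add
    (h : IsGWTreeLaw q κ P) (p : ℝ) (ν : Measure Bool) [IsProbabilityMeasure ν] :
    colTreeLaw P ν {x | rootBlack p x}ᶜ + (if p < 1 then q 0 * ν {true} else 0)
      = ∑' n, q n * colTreeLaw P ν {x | rootBlack p x}ᶜ ^ n := by
  have := h.isProb
  have := h.isProb_life
  have hK : MeasurableSet {x : ColTree | rootBlack p x} := measurableSet_rootBlack p
  have hm : Measurable fun x : ColTree => kids x.1 := measurable_kids.comp measurable_fst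
  have hc : Measurable fun x : ColTree => x.2 [] := (measurable_pi_apply []).comp measurable_snd
  set L : Set ColTree := {x | kids x.1 = 0 ∧ p < 1 ∧ x.2 [] = true} with hL
  have hLm : MeasurableSet L := by
    refine (hm (measurableSet_singleton 0)).inter ((MeasurableSet.const _).inter
      (hc (measurableSet_singleton true)))
  have hLP : colTreeLaw P ν L = if p < 1 then q 0 * ν {true} else 0 := by
    split_ifs with hp
    · have hD : MeasurableSet ((univ : Set ℝ) ×ˢ (({true} : Set Bool) ×ˢ
        (univ : Set (Fin 0 → ColTree)))) :=
        MeasurableSet.univ.prod ((measurableSet_singleton _).prod MeasurableSet.univ)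
      have h1 := h.measure_rootData ν 0 hD
      rw [prod_prod, prod_prod, measure_univ, measure_univ, one_mul, mul_one] at h1
      rw [← h1]
      congr 1
      ext x
      refine and_congr_right fun hn => ?_
      change (_ ∧ _) ↔ (True ∧ (_ ∈ ({true} : Set Bool)) ∧ True)
      simp [hp, rootData]
    · rw [show L = ∅ by ext x; simp [hL, hp], measure_empty]
  rw [← hLP, ← h.measure_forall_colChild ν hK.compl, ← measure_union _ hLm]
  · congr 1
    ext x
    simp only [hL, mem_union, mem_compl_iff, mem_ofPred_eq]
    rw [rootBlack_iff]
    constructor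
    · rintro (h1 | h1) i hi h2
      · exact h1 (Or.inr ⟨i, hi, h2⟩)
      · omega
    · intro h1
      by_cases h2 : kids x.1 = 0 ∧ p < 1 ∧ x.2 [] = true
      · exact Or.inr h2
      · left
        rintro (h3 | ⟨i, hi, h3⟩)
        · exact h2 h3
        · exact h1 i hi h3
  · refine disjoint_left.2 fun x hx hx' => hx (rootBlack_iff.2 (Or.inl hx'))

/-- The coloured trees that have no individual in generation `n`. -/
def extinctAt (n : ℕ) : Set ColTree := {x | ∀ u ∈ x.1.nodes, u.length ≠ n}

theorem measurableSet_extinctAt (n : ℕ) : MeasurableSet (extinctAt n) := by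
  refine measurableSet_setOfPred.2 (Measurable.forall fun u => Measurable.imp ?_ measurable_const)
  exact (MTree.measurable_mem_nodes u).comp measurable_fst

theorem mem_extinctAt_succ :
    x ∈ extinctAt (n + 1) ↔ ∀ i < kids x.1, colChild x i ∈ extinctAt n := by
  constructor
  · intro h i hi u hu hn
    exact h (i :: u) ((mem_child_nodes hi u).1 hu) (by simp [hn])
  · intro h u hu hn
    cases u with
    | nil => simp at hn
    | cons i u =>
      have hi := MTree.cons_mem_nodes hu
      exact h i hi u ((mem_child_nodes hi u).2 hu) (by simpa using hn)

theorem extinctAt_mono : Monotone extinctAt := by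
  refine monotone_nat_of_le_succ fun n => ?_
  intro x hx u hu hn
  obtain ⟨v, j, rfl⟩ : ∃ v j, u = v ++ [j] := by
    rcases List.eq_nil_or_concat u with h | ⟨v, j, h⟩
    · simp [h] at hn
    · exact ⟨v, j, by simpa using h⟩
  exact hx v (x.1.parent_mem v j hu) (by simpa using hn)

/-- The extinction probability is the least fixed point: by induction the probability of extinction
before generation `n` is at most `x`, and a finite tree has bounded height. -/
theorem IsGWTreeLaw.not_rootBlack_one_le
    (h : IsGWTreeLaw q κ P) (ν : Measure Bool) [IsProbabilityMeasure ν] {x : ℝ≥0∞}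
    (hx : ∑' n, q n * x ^ n ≤ x) : colTreeLaw P ν {x | rootBlack 1 x}ᶜ ≤ x := by
  have := h.isProb
  have h1 : ∀ n, colTreeLaw P ν (extinctAt n) ≤ x := by
    intro n
    induction n with
    | zero =>
      have : extinctAt 0 = ∅ := by
        ext x
        simp only [extinctAt, mem_ofPred_eq, mem_empty_iff_false, iff_false, not_forall]
        exact ⟨[], x.1.root_mem, by simp⟩
      rw [this, measure_empty]
      exact zero_le
    | succ n ih =>
      have : extinctAt (n + 1) = {x | ∀ i < kids x.1, colChild x i ∈ extinctAt n} :=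
        Set.ext fun x => mem_extinctAt_succ
      rw [this, h.measure_forall_colChild ν (measurableSet_extinctAt n)]
      refine le_trans (tsum_le_tsum fun k => ?_) hx
      gcongr
  have h2 : {x : ColTree | rootBlack 1 x}ᶜ ⊆ ⋃ n, extinctAt n := by
    intro x hx
    have hfin : x.1.nodes.Finite := by
      by_contra hinf
      exact hx ⟨x.1.root_mem, Or.inr ⟨rfl, by simpa using hinf⟩⟩
    obtain ⟨n, hn⟩ := (hfin.image List.length).bddAbove
    refine mem_iUnion.2 ⟨n + 1, fun u hu hl => ?_⟩
    have := hn ⟨u, hu, rfl⟩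
    omega
  refine (measure_mono h2).trans ?_
  rw [extinctAt_mono.measure_iUnion]
  exact iSup_le h1

theorem IsGWTreeLaw.isRootProb (hq : IsOffspringLaw q) (h : IsGWTreeLaw q κ P) (hp : p ∈ Icc (0 : ℝ) 1) :
    IsRootProb p q (redMeasure p P (colourMeasure p) univ).toReal := by
  have := h.isProb
  have := isProbabilityMeasure_colourMeasure hp.1 hp.2
  set ν := colourMeasure p
  set g := colTreeLaw P ν {x | rootBlack p x}ᶜ with hg
  set r := redMeasure p P ν univ with hr
  have hgr : g + r = 1 := compl_add_redMeasure p P ν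
  have hg1 : g ≤ 1 := hgr ▸ le_self_add
  have hr1 : r ≤ 1 := hgr ▸ le_add_self
  have hgt : g ≠ ∞ := ne_top_of_le_ne_top one_ne_top hg1
  have hrt : r ≠ ∞ := ne_top_of_le_ne_top one_ne_top hr1
  have hgr' : g.toReal = 1 - r.toReal := by
    rw [eq_sub_iff_add_eq, ← toReal_add hgt hrt, hgr, toReal_one]
  have hmem : r.toReal ∈ Icc (0 : ℝ) 1 := ⟨toReal_nonneg, by
    rw [← toReal_one]; exact ENNReal.toReal_mono one_ne_top hr1⟩
  have heq := congrArg ENNReal.toReal (h.not_rootBlack_add p ν)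
  rw [← hg, pgf_toReal q hg1, toReal_add hgt (by
    split_ifs
    · exact mul_ne_top (q.apply_ne_top 0) (measure_ne_top _ _)
    · exact ENNReal.zero_ne_top), hgr'] at heq
  have hε : (if p < 1 then q 0 * ν {true} else 0 : ℝ≥0∞).toReal = (1 - p) * (q 0).toReal := by
    split_ifs with h1
    · rw [colourMeasure_true, toReal_mul, toReal_ofReal (by linarith), mul_comm]
    · rw [show p = 1 from le_antisymm hp.2 (not_lt.1 h1)]
      simp
  rw [hε] at heq
  have heq' : psi q r.toReal = (1 - p) * (q 0).toReal := by
    rw [psi, ← heq]; ring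
  rcases hp.2.lt_or_eq with h1 | h1
  · exact isRootProb_of_lt hq h1 hmem heq'
  -- For `p = 1` the level is `0`, which is also attained at `0`, so convexity does not suffice. A
  -- larger root `x` would give a fixed point `1 - x` below the extinction probability.
  · refine ⟨hmem, heq', fun x hx hxe => ?_⟩
    have h2 : ∑' n, q n * ofReal (1 - x) ^ n ≤ ofReal (1 - x) := by
      have hx1 : ofReal (1 - x) ≤ 1 := ENNReal.ofReal_le_one.2 (by linarith [hx.1])
      have hle : ∑' n, q n * ofReal (1 - x) ^ n ≤ 1 := by
        rw [← q.tsum_coe]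
        exact tsum_le_tsum fun n => mul_le_of_le_one_right (zero_le)
          (pow_le_one₀ (zero_le) hx1)
      rw [← ofReal_toReal (ne_top_of_le_ne_top one_ne_top hle), pgf_toReal q hx1,
        toReal_ofReal (by linarith [hx.2])]
      refine ENNReal.ofReal_le_ofReal (le_of_eq ?_)
      rw [h1, psi] at hxe
      linarith
    have h3 : g ≤ ofReal (1 - x) := by
      have := h.not_rootBlack_one_le ν h2
      rw [hg, h1]
      exact this
    have h4 := ENNReal.toReal_mono ofReal_ne_top h3
    rw [toReal_ofReal (by linarith [hx.2]), hgr'] at h4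
    linarith

/-! ### The reduced laws -/

theorem tsum_thin_mul_pow' (η : PMF ℕ) (g x : ℝ≥0∞) :
    ∑' j, thin η g j * x ^ j = ∑' n, η n * (g + x) ^ n := by
  unfold thin
  simp_rw [← ENNReal.tsum_mul_right]
  rw [ENNReal.tsum_comm]
  refine tsum_congr fun n => ?_
  simp_rw [mul_assoc]
  rw [ENNReal.tsum_mul_left]
  congr 1
  rw [add_comm g x, add_pow, tsum_eq_sum (s := Finset.range (n + 1))]
  · exact Finset.sum_congr rfl fun j _ => by ring
  · intro j hj
    rw [Finset.mem_range, not_lt] at hj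
    rw [Nat.choose_eq_zero_of_lt (by omega)]
    simp

theorem thin_zero (η : PMF ℕ) (g : ℝ≥0∞) : thin η g 0 = ∑' n, η n * g ^ n := by
  simp [thin]

theorem tsum_mul_pow_le_one (q : PMF ℕ) {g : ℝ≥0∞} (hg : g ≤ 1) : ∑' n, q n * g ^ n ≤ 1 := by
  rw [← q.tsum_coe]
  exact tsum_le_tsum fun n => mul_le_of_le_one_right zero_le (pow_le_one₀ zero_le hg)

theorem ofReal_add_ofReal_mul (hr : r ∈ Icc (0 : ℝ) 1) (hs : s ∈ Icc (0 : ℝ) 1) :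
    ofReal (1 - r) + ofReal r * ofReal s
      = ofReal (1 - r * (1 - s)) := by
  rw [← ofReal_mul hr.1, ← ofReal_add (by linarith [hr.2])
    (mul_nonneg hr.1 hs.1)]
  congr 1
  ring

theorem tsum_thin_toReal (η : PMF ℕ) (hr : r ∈ Icc (0 : ℝ) 1) (hs : s ∈ Icc (0 : ℝ) 1) :
    ∑' j, thin η (ofReal (1 - r)) j * (ofReal r * ofReal s) ^ j
      = ofReal (pgf η (1 - r * (1 - s))) := by
  have h0 : 0 ≤ r * (1 - s) := mul_nonneg hr.1 (by linarith [hs.2])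
  have h1 : r * (1 - s) ≤ 1 := mul_le_one₀ hr.2 (by linarith [hs.2]) (by linarith [hs.1])
  have hle : ofReal (1 - r * (1 - s)) ≤ 1 := ENNReal.ofReal_le_one.2 (by linarith)
  rw [tsum_thin_mul_pow', ofReal_add_ofReal_mul hr hs,
    ← ofReal_toReal (ne_top_of_le_ne_top one_ne_top (tsum_mul_pow_le_one η hle)),
    pgf_toReal η hle, toReal_ofReal (by linarith)]

theorem pgf_nonneg (q : PMF ℕ) (hs : 0 ≤ s) : 0 ≤ pgf q s :=
  tsum_nonneg fun _ => mul_nonneg toReal_nonneg (pow_nonneg hs _)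

/-- `q'` is the offspring law of the reduced trees, where `r` is the probability of a black
root and `1 - θ` is the probability that a black individual has exactly one black child. -/
structure IsReducedOffspring (p : ℝ) (q : PMF ℕ) (r θ : ℝ) (q' : PMF ℕ) : Prop where
  root : IsRootProb p q r
  root_pos : 0 < r
  theta_pos : 0 < θ
  theta_le : θ ≤ 1
  thin_one : thin q (ofReal (1 - r)) 1 = ofReal (1 - θ)
  weight : ∀ j, q' j * ofReal (θ * r)
    = blackWeight p q (colourMeasure p) (ofReal (1 - r)) j * ofReal r ^ j
  pgf_eq : ∀ s ∈ Icc (0 : ℝ) 1, pgf q' s = s + psi q (r * (1 - s)) / (r * θ)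

theorem IsReducedOffspring.theta_unique
    (h₁ : IsReducedOffspring p q r θ q₁) (h₂ : IsReducedOffspring p' q r θ' q₂) : θ = θ' := by
  have h := h₁.thin_one.symm.trans h₂.thin_one
  rw [ENNReal.ofReal_eq_ofReal_iff (by linarith [h₁.theta_le]) (by linarith [h₂.theta_le])] at h
  linarith

theorem IsReducedOffspring.unique
    (h₁ : IsReducedOffspring p q r θ q₁) (h₂ : IsReducedOffspring p q r' θ' q₂) : q₁ = q₂ := by
  obtain rfl := h₁.root.unique h₂.root
  obtain rfl := h₁.theta_unique h₂
  refine pgf_injOn fun s hs => ?_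
  rw [h₁.pgf_eq s ⟨hs.1.le, hs.2.le⟩, h₂.pgf_eq s ⟨hs.1.le, hs.2.le⟩]

theorem blackWeight_zero (hp : p ∈ Icc (0 : ℝ) 1) (q : PMF ℕ) (g : ℝ≥0∞) :
    blackWeight p q (colourMeasure p) g 0 = ofReal ((1 - p) * (q 0).toReal) := by
  rw [blackWeight, if_pos rfl]
  split_ifs with h
  · rw [colourMeasure_true, ofReal_mul (by linarith), ofReal_toReal
      (q.apply_ne_top 0), mul_comm]
  · rw [show p = 1 from le_antisymm hp.2 (not_lt.1 h)]
    simp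

theorem thin_mul_pow_ne_top (η : PMF ℕ) (hr : r ∈ Icc (0 : ℝ) 1) (j : ℕ) :
    thin η (ofReal (1 - r)) j * ofReal r ^ j ≠ ∞ := by
  have h := tsum_thin_toReal η hr (s := 1) ⟨zero_le_one, le_rfl⟩
  rw [ofReal_one, mul_one] at h
  exact ENNReal.ne_top_of_tsum_ne_top (h ▸ ofReal_ne_top) j

/-- The generating function of a binomial thinning is the original one at `1 - r + r * s`. -/
theorem hasSum_thin (η : PMF ℕ) (hr : r ∈ Icc (0 : ℝ) 1) (hs : s ∈ Icc (0 : ℝ) 1) :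
    HasSum (fun j => (thin η (ofReal (1 - r)) j * ofReal r ^ j).toReal * s ^ j)
      (pgf η (1 - r * (1 - s))) := by
  have h := tsum_thin_toReal η hr hs
  have hb : 0 ≤ 1 - r * (1 - s) := by
    linarith [mul_le_one₀ hr.2 (by linarith [hs.2] : 0 ≤ 1 - s) (by linarith [hs.1])]
  have hne := h.trans_ne ofReal_ne_top
  have h1 := ENNReal.hasSum_toReal hne
  rw [← ENNReal.tsum_toReal_eq (ENNReal.ne_top_of_tsum_ne_top hne), h, toReal_ofReal (pgf_nonneg η hb)] at h1
  refine h1.congr_fun fun j => ?_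
  simp [mul_pow, mul_assoc, toReal_ofReal hs.1]

theorem exists_pmf {w : ℕ → ℝ} (hw : ∀ n, 0 ≤ w n) (h : HasSum w 1) :
    ∃ q : PMF ℕ, ∀ n, (q n).toReal = w n := by
  refine ⟨⟨fun n => ofReal (w n), ?_⟩, fun n => toReal_ofReal (hw n)⟩
  rw [ENNReal.summable.hasSum_iff, ← ENNReal.ofReal_tsum_of_nonneg hw h.summable, h.tsum_eq,
    ofReal_one]

/-- The weights of the numbers of black children other than one have generating function `psi q (r *
(1 - s)) + (1 - W) * r * s` and total mass `(1 - W) * r`. Normalising gives `q'` with `θ = 1 - W`;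
the point is that the mass is positive. -/
theorem exists_isReducedOffspring (hq : IsOffspringLaw q)
    (hp : p ∈ Icc (0 : ℝ) 1) (hr : IsRootProb p q r) (hr0 : 0 < r) :
    ∃ θ q', IsReducedOffspring p q r θ q' := by
  have htt := thin_mul_pow_ne_top q hr.mem
  have ht := fun s hs => hasSum_thin q hr.mem (s := s) hs
  set g := ofReal (1 - r) with hg
  set R := ofReal r with hR
  have hR0 : R ≠ 0 := by simpa [hR] using hr0
  have hWt : thin q g 1 ≠ ∞ := (ENNReal.lt_top_of_mul_ne_top_left (by simpa using htt 1) hR0).ne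
  set W := (thin q g 1).toReal with hW
  have ht0 : (thin q g 0).toReal = pgf q (1 - r) := by
    have h := (ht 0 ⟨le_rfl, zero_le_one⟩).unique (hasSum_single 0 fun n hn => by simp [hn])
    simpa using h.symm
  set f : ℕ → ℝ≥0∞ := fun j => blackWeight p q (colourMeasure p) g j * R ^ j with hf
  have hf2 : ∀ j, f (j + 2) = thin q g (j + 2) * R ^ (j + 2) := fun j => by simp [hf, blackWeight]
  have hf0 : f 0 = ofReal ((1 - p) * (q 0).toReal) := by simp [hf, blackWeight_zero hp]
  have hε : 0 ≤ (1 - p) * (q 0).toReal :=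
    mul_nonneg (by linarith [hp.2]) toReal_nonneg
  have hft : ∀ j, f j ≠ ∞
    | 0 => hf0 ▸ ofReal_ne_top
    | 1 => by simp [hf, blackWeight]
    | j + 2 => hf2 j ▸ htt _
  have hsum : ∀ s ∈ Icc (0 : ℝ) 1,
      HasSum (fun j => (f j).toReal * s ^ j) (psi q (r * (1 - s)) + (1 - W) * r * s) := by
    intro s hs
    -- Only the terms `j = 0` and `j = 1` differ from those of the thinning; the equation for `r`
    -- evaluates the difference at `j = 0`.
    have h := (hasSum_nat_add_iff' 2).2 (ht s hs)
    rw [← hasSum_nat_add_iff' 2]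
    simp_rw [hf2]
    convert h using 1
    have h1 : (f 1).toReal = 0 := by simp [hf, blackWeight]
    have h2 := hr.eq
    simp only [sum_range_succ, sum_range_zero, h1, hf0, toReal_ofReal hε,
      toReal_mul, pow_zero, pow_one, mul_one, ht0, hR, toReal_ofReal hr0.le, psi,
      toReal_one, ← hW, zero_add] at h2 ⊢
    linear_combination h2
  have hK : HasSum (fun j => (f j).toReal) ((1 - W) * r) := by
    simpa [psi_zero] using hsum 1 ⟨zero_le_one, le_rfl⟩
  -- If all weights vanished, `q` would be concentrated at `0`. Then `psi q r = r`, while the level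
  -- `(1 - p) * q 0` would be `0`, contradicting `r > 0`.
  have hKpos : 0 < (1 - W) * r := by
    refine (hK.nonneg fun _ => toReal_nonneg).lt_of_ne fun h0 => ?_
    rw [← h0, hasSum_zero_iff_of_nonneg fun _ => toReal_nonneg] at hK
    have hz : ∀ j, f j = 0 := fun j =>
      ((toReal_eq_zero_iff _).1 (congrFun hK j)).resolve_right (hft j)
    have hq2 : ∀ n, n ≠ 0 → q n = 0
      | 0 => fun h => absurd rfl h
      | 1 => fun _ => hq.2
      | n + 2 => fun _ => by
        have h2 := (mul_eq_zero.1 ((hf2 n).symm.trans (hz (n + 2)))).resolve_right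
          (pow_ne_zero _ hR0)
        simpa using ENNReal.tsum_eq_zero.1 h2 (n + 2)
    have h1 : ∀ s, pgf q s = (q 0).toReal := fun s => by
      rw [pgf, tsum_eq_single 0 fun n hn => by rw [hq2 n hn]; simp]
      simp
    have h2 := hr.eq
    rw [psi, h1, ← h1 1, pgf_one] at h2
    have h3 := ENNReal.ofReal_eq_zero.1 (hf0 ▸ hz 0)
    rw [← h1 1, pgf_one] at h3
    linarith
  have hθ : 0 < 1 - W := pos_of_mul_pos_left hKpos hr0.le
  obtain ⟨q', hq'⟩ := exists_pmf (w := fun j => (f j).toReal / ((1 - W) * r))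
    (fun j => div_nonneg toReal_nonneg hKpos.le) (by
      simpa [hKpos.ne'] using hK.div_const ((1 - W) * r))
  refine ⟨1 - W, q', hr, hr0, hθ, by linarith [toReal_nonneg (a := thin q g 1)], ?_,
    fun j => ?_, fun s hs => ?_⟩
  · rw [sub_sub_cancel, hW, ofReal_toReal hWt]
  · rw [← ENNReal.toReal_eq_toReal_iff' (mul_ne_top (q'.apply_ne_top j)
      ofReal_ne_top) (hft j), toReal_mul, hq', toReal_ofReal hKpos.le,
      div_mul_cancel₀ _ hKpos.ne']
  · have h := (hsum s hs).div_const ((1 - W) * r)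
    rw [pgf, ← (h.congr_fun fun j => by rw [hq']; ring).tsum_eq.symm]
    field_simp
    ring

/-- `η'` is the law of the number of trees in the nonempty reduced bushes, where `r` is the
probability of a black root. -/
structure IsReducedImmigration (η : PMF ℕ) (r : ℝ) (η' : PMF ℕ) : Prop where
  mem : r ∈ Icc (0 : ℝ) 1
  phi_pos : 0 < phi η r
  zero : η' 0 = 0
  weight : ∀ j, j ≠ 0 → η' j * ofReal (phi η r)
    = thin η (ofReal (1 - r)) j * ofReal r ^ j
  pgf_eq : ∀ s ∈ Icc (0 : ℝ) 1, pgf η' s = 1 - phi η (r * (1 - s)) / phi η r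

theorem IsReducedImmigration.unique {η₁ η₂ : PMF ℕ}
    (h₁ : IsReducedImmigration η r η₁) (h₂ : IsReducedImmigration η r η₂) : η₁ = η₂ := by
  refine pgf_injOn fun s hs => ?_
  rw [h₁.pgf_eq s ⟨hs.1.le, hs.2.le⟩, h₂.pgf_eq s ⟨hs.1.le, hs.2.le⟩]

/-- Without mass at `0` the generating function is at most the identity, hence `phi η r ≥ r`. -/
theorem phi_pos (hη : η 0 = 0) (hr : r ∈ Icc (0 : ℝ) 1) (hr0 : 0 < r) :
    0 < phi η r := by
  have hg : 1 - r ∈ Icc (0 : ℝ) 1 := ⟨by linarith [hr.2], by linarith⟩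
  have h1 : pgf η (1 - r) ≤ 1 - r := by
    have h2 : ∀ n, (η n).toReal * (1 - r) ^ n ≤ (η n).toReal * (1 - r) := by
      intro n
      cases n with
      | zero => simp [hη]
      | succ n =>
        refine mul_le_mul_of_nonneg_left ?_ toReal_nonneg
        rw [pow_succ]
        exact mul_le_of_le_one_left hg.1 (pow_le_one₀ hg.1 hg.2)
    calc pgf η (1 - r) ≤ ∑' n, (η n).toReal * (1 - r) :=
          (summable_pgf η (abs_le_one_of_mem hg)).tsum_le_tsum h2
            ((summable_toReal η).mul_right _)
      _ = 1 - r := by rw [tsum_mul_right, tsum_toReal, one_mul]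
  rw [phi]
  linarith

theorem exists_isReducedImmigration (hη : η 0 = 0) (hr : r ∈ Icc (0 : ℝ) 1)
    (hr0 : 0 < r) : ∃ η', IsReducedImmigration η r η' := by
  have hφ := phi_pos hη hr hr0
  have htt := thin_mul_pow_ne_top η hr
  set f : ℕ → ℝ≥0∞ := fun j => thin η (ofReal (1 - r)) j * ofReal r ^ j with hf
  have ht : ∀ s ∈ Icc (0 : ℝ) 1, HasSum (fun j => (f j).toReal * s ^ j) (pgf η (1 - r * (1 - s))) :=
    fun s hs => hasSum_thin η hr hs
  have ht0 : (f 0).toReal = pgf η (1 - r) := by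
    have h := (ht 0 ⟨le_rfl, zero_le_one⟩).unique (hasSum_single 0 fun n hn => by simp [hn])
    simpa [hf] using h.symm
  set w : ℕ → ℝ := fun j => if j = 0 then 0 else (f j).toReal / phi η r with hw
  have hsum : ∀ s ∈ Icc (0 : ℝ) 1,
      HasSum (fun j => w j * s ^ j) (1 - phi η (r * (1 - s)) / phi η r) := by
    intro s hs
    have h := ((hasSum_nat_add_iff' 1).2 (ht s hs)).div_const (phi η r)
    rw [← hasSum_nat_add_iff' 1]
    rw [show 1 - phi η (r * (1 - s)) / phi η r - ∑ i ∈ Finset.range 1, w i * s ^ i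
      = (pgf η (1 - r * (1 - s)) - ∑ i ∈ Finset.range 1, (f i).toReal * s ^ i) / phi η r by
        simp only [Finset.sum_range_one, ht0, hw, if_pos]
        field_simp
        simp only [phi]
        ring]
    exact h.congr_fun fun j => by simp [hw]; ring
  obtain ⟨η', hη'⟩ := exists_pmf (w := w) (fun j => by
      simp only [hw]
      split_ifs
      exacts [le_rfl, div_nonneg toReal_nonneg hφ.le]) (by
    simpa [phi, pgf_one] using hsum 1 ⟨zero_le_one, le_rfl⟩)
  refine ⟨η', hr, hφ, ?_, fun j hj => ?_, fun s hs => ?_⟩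
  · simpa [hw, toReal_eq_zero_iff, η'.apply_ne_top] using hη' 0
  · rw [← ENNReal.toReal_eq_toReal_iff' (mul_ne_top (η'.apply_ne_top j)
      ofReal_ne_top) (htt j), toReal_mul, hη', toReal_ofReal hφ.le]
    simp only [hw, if_neg hj]
    exact div_mul_cancel₀ _ hφ.ne'
  · simpa [pgf, hη'] using (hsum s hs).tsum_eq

/-! ### The law of the reduced forest -/

theorem bushMeasure_apply (a : ℕ → ℝ≥0∞) (ρ : Measure MTree) (hB : MeasurableSet B) :
    bushMeasure a ρ B = ∑' n, a n * (Measure.pi fun _ : Fin n => ρ)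
      (Sigma.mk (β := fun n => Fin n → MTree) n ⁻¹' B) := by
  rw [bushMeasure, Measure.sum_apply _ hB]
  refine tsum_congr fun n => ?_
  rw [Measure.smul_apply, map_apply (measurable_sigma_mk n) hB, smul_eq_mul]

theorem thin_zero_toReal (η : PMF ℕ) (hr : r ∈ Icc (0 : ℝ) 1) :
    thin η (ofReal (1 - r)) 0 = ofReal (1 - phi η r) := by
  have hg1 : ofReal (1 - r) ≤ 1 := ENNReal.ofReal_le_one.2 (by linarith [hr.1])
  rw [thin_zero, ← ofReal_toReal (ne_top_of_le_ne_top one_ne_top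
    (tsum_mul_pow_le_one η hg1)), pgf_toReal η hg1, toReal_ofReal (by linarith [hr.2]), phi]
  congr 1
  ring

theorem phi_le_one (η : PMF ℕ) (hr : r ≤ 1) : phi η r ≤ 1 := by
  have := pgf_nonneg η (s := 1 - r) (by linarith)
  rw [phi]
  linarith

theorem redMeasure_univ_eq (hq : IsOffspringLaw q) (hp : p ∈ Icc (0 : ℝ) 1)
    (hP : IsGWTreeLaw q κ P) (hr : IsRootProb p q r) :
    redMeasure p P (colourMeasure p) univ = ofReal r ∧
      colTreeLaw P (colourMeasure p) {x | rootBlack p x}ᶜ = ofReal (1 - r) := by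
  have := hP.isProb
  have := isProbabilityMeasure_colourMeasure hp.1 hp.2
  have h1 := (hP.isRootProb hq hp).unique hr
  have hgr := compl_add_redMeasure p P (colourMeasure p)
  have hrt : redMeasure p P (colourMeasure p) univ ≠ ∞ :=
    ne_top_of_le_ne_top one_ne_top (hgr ▸ le_add_self)
  have h2 : redMeasure p P (colourMeasure p) univ = ofReal r := by
    rw [← h1, ofReal_toReal hrt]
  refine ⟨h2, ?_⟩
  rw [h2] at hgr
  rw [ofReal_sub _ hr.mem.1, ofReal_one, ← hgr,
    ENNReal.add_sub_cancel_right ofReal_ne_top]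

theorem reducedLaw_eq_map_thinForest (hp : p ∈ Icc (0 : ℝ) 1) [IsProbabilityMeasure χ] [IsProbabilityMeasure P] [IsProbabilityMeasure L]
    (hL : L.map gapBush = infinitePi fun _ => χ.prod (bushLaw η P)) :
    reducedLaw p L = (infinitePi fun _ : ℕ =>
      χ.prod (redBushLaw p η P (colourMeasure p))).map thinForest := by
  have := isProbabilityMeasure_colourMeasure hp.1 hp.2
  rw [← map_redSeq p hL, map_map measurable_thinForest (measurable_redSeq p), reducedLaw]
  simp_rw [reduceForest_eq]
  rfl

theorem isProbabilityMeasure_redBushLaw (η : PMF ℕ) (P : Measure MTree) [IsProbabilityMeasure P]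
    (ν : Measure Bool) [IsProbabilityMeasure ν] : IsProbabilityMeasure (redBushLaw p η P ν) := by
  have := bushLaw_univ η P
  exact isProbabilityMeasure_map (measurable_reduceBush p).aemeasurable

theorem IsGWTreeLaw.reduce_of_isReducedOffspring (hq : IsOffspringLaw q) (hp : p ∈ Icc (0 : ℝ) 1) (hP : IsGWTreeLaw q κ P)
    (hq' : IsReducedOffspring p q r θ q') : ∃ κ', IsGeomSum (ofReal (1 - θ)) κ κ' ∧
      IsGWTreeLaw q' κ' (redTreeLaw p P (colourMeasure p)) := by
  have := hP.isProb
  have := isProbabilityMeasure_colourMeasure hp.1 hp.2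
  obtain ⟨hr, hg⟩ := redMeasure_univ_eq hq hp hP hq'.root
  have hc : ∑' j, blackWeight p q (colourMeasure p)
      (colTreeLaw P (colourMeasure p) {x | rootBlack p x}ᶜ) j *
        redMeasure p P (colourMeasure p) univ ^ j = ofReal (θ * r) := by
    rw [hr, hg, ← tsum_congr hq'.weight, ENNReal.tsum_mul_right, q'.tsum_coe, one_mul]
  obtain ⟨-, -, κ', hκ', hP'⟩ := hP.reduce p (colourMeasure p) hc
    (by simpa using mul_pos hq'.theta_pos hq'.root_pos)
    (q' := q') (fun j => by rw [hr, hg]; exact hq'.weight j)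
  rw [hg, hq'.thin_one] at hκ'
  exact ⟨κ', hκ', hP'⟩

/-- Reduction of a Galton-Watson forest with immigration. -/
theorem IsGWILaw.reduce (hq : IsOffspringLaw q) (hp : p ∈ Icc (0 : ℝ) 1)
    (hL : IsGWILaw q κ η χ L) (hq' : IsReducedOffspring p q r θ q')
    (hη' : IsReducedImmigration η r η') :
    ∃ κ' χ', IsGeomSum (ofReal (1 - θ)) κ κ' ∧
      IsGeomSum (ofReal (1 - phi η r)) χ χ' ∧ IsGWILaw q' κ' η' χ' (reducedLaw p L) := by
  have := hL.isProb
  have := hL.isProb_gap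
  obtain ⟨P, hP, hmap⟩ := hL.map_gapBush
  have := hP.isProb
  have := hP.isProb_life
  have := isProbabilityMeasure_colourMeasure hp.1 hp.2
  have := isProbabilityMeasure_redBushLaw (p := p) η P (colourMeasure p)
  obtain ⟨hr, hg⟩ := redMeasure_univ_eq hq hp hP hq'.root
  have hr0 : redMeasure p P (colourMeasure p) univ ≠ 0 := by
    rw [hr]; simpa using hq'.root_pos
  have hρ := isProbabilityMeasure_redTreeLaw p (colourMeasure p) hr0
  obtain ⟨κ', hκ', hP'⟩ := hP.reduce_of_isReducedOffspring hq hp hq'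
  set β := redBushLaw p η P (colourMeasure p) with hβ
  have hβeq := redBushLaw_eq p η P (colourMeasure p) hr0
  rw [← hβ, hr, hg] at hβeq
  set ρ := redTreeLaw p P (colourMeasure p)
  have hβ0 : β {b | b.1 ≠ 0}ᶜ = ofReal (1 - phi η r) := by
    rw [hβeq, bushMeasure_apply _ _ measurableSet_nonemptyBush.compl, tsum_eq_single 0]
    · rw [show Sigma.mk (β := fun n => Fin n → MTree) 0 ⁻¹' {b : Bush | b.1 ≠ 0}ᶜ = univ by ext b; simp, measure_univ, mul_one,
        pow_zero, mul_one, thin_zero_toReal η hη'.mem]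
    · intro n hn
      rw [show Sigma.mk (β := fun n => Fin n → MTree) n ⁻¹' {b : Bush | b.1 ≠ 0}ᶜ = ∅ by ext b; simp [hn], measure_empty, mul_zero]
  have hφ1 := phi_le_one η hη'.mem.2
  have hf : β {b | b.1 ≠ 0} = ofReal (phi η r) := by
    have h1 := prob_add_prob_compl (μ := β) measurableSet_nonemptyBush
    rw [hβ0] at h1
    have h2 : ofReal (phi η r) + ofReal (1 - phi η r) = 1 := by
      rw [← ofReal_add hη'.phi_pos.le (by linarith)]
      simp
    exact (ENNReal.add_left_inj ofReal_ne_top).1 (h1.trans h2.symm)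
  have hf0 : β {b | b.1 ≠ 0} ≠ 0 := by rw [hf]; simpa using hη'.phi_pos
  have hβ' : IsProbabilityMeasure (bushLaw η' ρ) := bushLaw_univ η' ρ
  -- Conditioned on being nonempty, the reduced bush has law `bushLaw η' ρ`.
  have hcond : ∀ B, MeasurableSet B →
      β {b | b.1 ≠ 0} * bushLaw η' ρ B = β ({b | b.1 ≠ 0} ∩ B) := by
    intro B hB
    rw [hf, bushLaw_eq, bushMeasure_apply _ _ hB, hβeq,
      bushMeasure_apply _ _ (measurableSet_nonemptyBush.inter hB), ← ENNReal.tsum_mul_left]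
    refine tsum_congr fun n => ?_
    by_cases hn : n = 0
    · subst hn
      rw [show Sigma.mk (β := fun n => Fin n → MTree) 0 ⁻¹' ({b : Bush | b.1 ≠ 0} ∩ B) = ∅ by ext b; simp, hη'.zero]
      simp
    · rw [show Sigma.mk (β := fun n => Fin n → MTree) n ⁻¹' ({b : Bush | b.1 ≠ 0} ∩ B) =
          Sigma.mk (β := fun n => Fin n → MTree) n ⁻¹' B by ext b; simp [hn],
        ← hη'.weight n hn]
      ring
  have hthin := map_thinSeq (χ := χ) hf0 hcond
  have hgs := isGeomSum_thinGapLaw (χ := χ) hf0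
  rw [hβ0] at hgs
  have hlt : ofReal (1 - phi η r) < 1 := by
    rw [← ofReal_one]
    exact (ENNReal.ofReal_lt_ofReal_iff one_pos).2 (by linarith [hη'.phi_pos])
  refine ⟨κ', thinGapLaw χ β, hκ', hgs, ?_⟩
  have := hgs.1
  have hred := reducedLaw_eq_map_thinForest hp hmap
  have : IsProbabilityMeasure (reducedLaw p L) := by
    rw [hred]
    exact isProbabilityMeasure_map measurable_thinForest.aemeasurable
  refine isGWILaw_of_map_gapBush hP' (hgs.measure_Iic_zero hlt hL.gap_pos) hη'.zero ?_
  rw [hred, map_map measurable_gapBush measurable_thinForest]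
  exact hthin

theorem thinForest_of_forall_empty (h : ∀ i, ¬ nonemptyAt z i) :
    thinForest z = emptyForest := by
  funext m
  exact if_neg fun ⟨i, hi, _⟩ => h i hi

/-- Reduction with almost surely red roots leads to the empty forest. -/
theorem IsGWILaw.reduce_zero (hq : IsOffspringLaw q) (hp : p ∈ Icc (0 : ℝ) 1)
    (hL : IsGWILaw q κ η χ L) (hr : IsRootProb p q 0) :
    reducedLaw p L = dirac emptyForest := by
  have := hL.isProb
  have := hL.isProb_gap
  obtain ⟨P, hP, hmap⟩ := hL.map_gapBush
  have := hP.isProb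
  have := isProbabilityMeasure_colourMeasure hp.1 hp.2
  have := isProbabilityMeasure_redBushLaw (p := p) η P (colourMeasure p)
  obtain ⟨-, hg⟩ := redMeasure_univ_eq hq hp hP hr
  set β := redBushLaw p η P (colourMeasure p) with hβ
  have hβ1 : β {b | b.1 ≠ 0}ᶜ = 1 := by
    have h1 := redBushLaw_bushRect p η P (colourMeasure p) 0 (A := fun _ => univ)
      fun _ => MeasurableSet.univ
    rw [hg, sub_zero, ofReal_one, thin_zero] at h1
    simp only [one_pow, mul_one, η.tsum_coe, Finset.univ_eq_empty, Finset.prod_empty] at h1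
    rw [← h1]
    congr 1
    ext b
    simp [bushRect]
  have hβ0 : β {b | b.1 ≠ 0} = 0 := by
    rw [← compl_compl {b : Bush | b.1 ≠ 0}]
    exact (prob_compl_eq_zero_iff measurableSet_nonemptyBush.compl).2 hβ1
  set Z := infinitePi fun _ : ℕ => χ.prod β with hZ
  have hae : ∀ᵐ z ∂Z, thinForest z = emptyForest := by
    have h1 : ∀ i : ℕ, ∀ᵐ z ∂Z, ¬ nonemptyAt z i := by
      intro i
      have hT : MeasurableSet {x : ℝ × Bush | x.2.1 ≠ 0} := measurable_snd measurableSet_nonemptyBush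
      have h2 : (Z.map fun z => z i) {x : ℝ × Bush | x.2.1 ≠ 0} = 0 := by
        rw [hZ, Measure.infinitePi_map_eval,
          show {x : ℝ × Bush | x.2.1 ≠ 0} = univ ×ˢ {b : Bush | b.1 ≠ 0} by ext x; simp,
          prod_prod, hβ0, mul_zero]
      rw [map_apply (measurable_pi_apply i) hT] at h2
      exact measure_eq_zero_iff_ae_notMem.1 h2
    filter_upwards [ae_all_iff.2 h1] with z hz using thinForest_of_forall_empty hz
  rw [reducedLaw_eq_map_thinForest hp hmap, ← hβ, ← hZ, Measure.map_congr hae, Measure.map_const,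
    measure_univ, one_smul]

/-! ### Exponential lifetimes -/

theorem expMeasure_Iic_zero (hc : 0 < c) : expMeasure c (Iic 0) = 0 := by
  have := isProbabilityMeasure_expMeasure hc
  have h := cdf_expMeasure_eq hc 0
  rw [cdf_eq_real] at h
  simp only [le_refl, if_true, mul_zero, neg_zero, Real.exp_zero, sub_self] at h
  exact (measureReal_eq_zero_iff (measure_ne_top _ _)).1 h

theorem charFun_expMeasure (hc : 0 < c) (t : ℝ) :
    charFun (expMeasure c) t = c / (c - t * Complex.I) := by
  have : expMeasure c = volume.withDensity fun x => ofReal (exponentialPDFReal c x) := rfl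
  have h : (t * Complex.I - c).re < 0 := by simpa
  rw [charFun_apply_real, this, integral_withDensity_eq_integral_toReal_smul
    (measurable_exponentialPDFReal c).ennreal_ofReal (by simp)]
  calc _ = ∫ x, (Ici (0 : ℝ)).indicator (fun x => c * Complex.exp ((t * Complex.I - c) * x)) x := by
        refine integral_congr_ae (.of_forall fun x => ?_)
        beta_reduce
        rw [toReal_ofReal (exponentialPDFReal_nonneg hc x), exponentialPDFReal,
          gammaPDFReal, indicator_apply]
        split_ifs with h1 h2 h2
        · simp only [Real.rpow_one, Real.Gamma_one, div_one, sub_self, Real.rpow_zero, mul_one,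
            Complex.real_smul, Complex.ofReal_mul, Complex.ofReal_exp, mul_assoc, ← Complex.exp_add]
          push_cast
          ring_nf
        · exact (h2 h1).elim
        · exact (h1 h2).elim
        · simp
    _ = _ := by
        rw [integral_indicator measurableSet_Ici, integral_Ici_eq_integral_Ioi,
          integral_const_mul, integral_exp_mul_complex_Ioi h, ← neg_sub (t * Complex.I), div_neg]
        simp [div_eq_mul_inv]

theorem sub_mul_I_ne_zero {a : ℝ} (t : ℝ) (ha : 0 < a) : (a - t * Complex.I : ℂ) ≠ 0 := fun h => by
  simpa [ha.ne'] using congr_arg Complex.re h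

theorem expMeasure_injective {c' : ℝ} (hc : 0 < c) (hc' : 0 < c')
    (h : expMeasure c = expMeasure c') : c = c' := by
  have h1 := charFun_expMeasure hc 1
  rw [h, charFun_expMeasure hc', div_eq_div_iff (sub_mul_I_ne_zero 1 hc') (sub_mul_I_ne_zero 1 hc)]
    at h1
  simpa using congr_arg Complex.im h1.symm

/-- A geometric sum of exponential variables is exponential. The recursion is an identity between
the characteristic functions `c / (c - i t)` and `c θ / (c θ - i t)`. -/
theorem isGeomSum_expMeasure (hc : 0 < c) (hθ : 0 < θ) (hθ1 : θ ≤ 1) :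
    IsGeomSum (ofReal (1 - θ)) (expMeasure c) (expMeasure (c * θ)) := by
  have hcθ := mul_pos hc hθ
  have := isProbabilityMeasure_expMeasure hc
  have := isProbabilityMeasure_expMeasure hcθ
  refine ⟨this, fun H hH => ?_⟩
  have h : expMeasure (c * θ) = ofReal θ • expMeasure c + ofReal (1 - θ) •
      ((expMeasure c).prod (expMeasure (c * θ))).map fun y => y.1 + y.2 := by
    have hf (s : ℝ) (μ : Measure ℝ) [IsFiniteMeasure μ] : IsFiniteMeasure (ofReal s • μ) :=
      μ.smul_finite ofReal_ne_top
    refine Measure.ext_of_charFun (funext fun t => ?_)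
    have h1 := sub_mul_I_ne_zero t hc
    have h2 := sub_mul_I_ne_zero t hcθ
    have hi (μ : Measure ℝ) [IsFiniteMeasure μ] :
        Integrable (fun x : ℝ => Complex.exp (t * x * Complex.I)) μ :=
      .of_bound (by fun_prop) 1 (.of_forall fun x => by
        rw [← Complex.ofReal_mul, Complex.norm_exp_ofReal_mul_I])
    rw [charFun_apply_real (μ := _ + _), integral_add_measure (hi _) (hi _), integral_smul_measure,
      integral_smul_measure, ← charFun_apply_real, ← charFun_apply_real,
      charFun_map_add_prod_eq_mul, Pi.mul_apply, charFun_expMeasure hc, charFun_expMeasure hcθ,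
      toReal_ofReal hθ.le, toReal_ofReal (by linarith)]
    simp only [Complex.real_smul]
    push_cast at h2 ⊢
    field_simp
    ring
  conv_lhs => rw [h]
  rw [Measure.add_apply, Measure.smul_apply, Measure.smul_apply, map_apply measurable_add hH,
    Measure.prod_apply (measurable_add hH), ← ofReal_one,
    ← ofReal_sub _ (by linarith), sub_sub_cancel]
  rfl
-- Geometric sums are unique, so those provided by the general reduction are the exponential laws of
-- `isGeomSum_expMeasure`.
theorem IsGWILaw.reduce_exp {h : ℝ}
    (hq : IsOffspringLaw q) (hp : p ∈ Icc (0 : ℝ) 1) (hc : 0 < c) (hh : 0 < h)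
    (hL : IsGWILaw q (expMeasure c) η (expMeasure h) L)
    (hq' : IsReducedOffspring p q r θ q') (hη' : IsReducedImmigration η r η') :
    IsGWILaw q' (expMeasure (c * θ)) η' (expMeasure (h * phi η r)) (reducedLaw p L) := by
  have := isProbabilityMeasure_expMeasure hc
  have := isProbabilityMeasure_expMeasure hh
  obtain ⟨κ', χ', h1, h2, h3⟩ := hL.reduce hq hp hq' hη'
  have hlt : ∀ {x : ℝ}, 0 < x → ofReal (1 - x) < 1 := fun hx => by
    rw [← ofReal_one]
    exact (ENNReal.ofReal_lt_ofReal_iff one_pos).2 (by linarith)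
  rw [IsGeomSum.unique (hlt hq'.theta_pos) h1
      (isGeomSum_expMeasure hc hq'.theta_pos hq'.theta_le),
    IsGeomSum.unique (hlt hη'.phi_pos) h2
      (isGeomSum_expMeasure hh hη'.phi_pos (phi_le_one η hη'.mem.2))] at h3
  exact h3

/-! ### Uniqueness of Galton-Watson laws -/

/-- The lifetimes of the individuals in the generations before `n`. -/
def truncLife (n : ℕ) (t : MTree) : List ℕ → ℝ := fun u => if u.length < n then t.life u else 0

theorem measurable_truncLife (n : ℕ) : Measurable (truncLife n) := by
  refine measurable_pi_lambda _ fun u => ?_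
  unfold truncLife
  split_ifs
  · exact MTree.measurable_life u
  · exact measurable_const

/-- The function on words with given value at the root and given values above the first
`j` letters. -/
def graft (j : ℕ) (y : ℝ × (Fin j → List ℕ → ℝ)) : List ℕ → ℝ
  | [] => y.1
  | i :: u => if h : i < j then y.2 ⟨i, h⟩ u else 0

theorem measurable_graft (j : ℕ) : Measurable (graft j) := by
  refine measurable_pi_lambda _ fun u => ?_
  cases u with
  | nil => exact measurable_fst
  | cons i u =>
    simp only [graft]
    split_ifs with h
    · exact (measurable_pi_apply u).comp ((measurable_pi_apply _).comp measurable_snd)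
    · exact measurable_const

theorem truncLife_succ (n : ℕ) (t : MTree) :
    truncLife (n + 1) t = graft (kids t) (t.life [], fun i => truncLife n (child t i)) := by
  funext u
  cases u with
  | nil => simp [truncLife, graft]
  | cons i u =>
    simp only [truncLife, graft, List.length_cons, add_lt_add_iff_right]
    by_cases h : i < kids t
    · rw [dif_pos h, child_life h]
    · rw [dif_neg h, t.life_eq_zero _ fun h' => h (MTree.cons_mem_nodes h')]
      simp

section

variable {P' : Measure MTree}

/-- The root decomposition expresses the law of the first `n + 1` generations through that of the
first `n`, which proves uniqueness by induction. -/
theorem IsGWTreeLaw.map_truncLife_succ (h : IsGWTreeLaw q κ P) (n : ℕ) {S : Set (List ℕ → ℝ)}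
    (hS : MeasurableSet S) :
    P.map (truncLife (n + 1)) S = ∑' j, q j *
      (κ.prod (Measure.pi fun _ : Fin j => P.map (truncLife n))).map (graft j) S := by
  have := h.isProb
  have := h.isProb_life
  have : IsProbabilityMeasure (P.map (truncLife n)) :=
    isProbabilityMeasure_map (measurable_truncLife n).aemeasurable
  rw [map_apply (measurable_truncLife _) hS,
    measure_eq_tsum_fiber P measurable_kids (measurable_truncLife _ hS)]
  refine tsum_congr fun j => ?_
  have hm : Measurable fun t : MTree => (t.life [], fun i : Fin j => child t i) :=
    (MTree.measurable_life []).prodMk (measurable_pi_lambda _ fun i => measurable_child i)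
  have hT : Measurable fun (x : Fin j → MTree) (i : Fin j) => truncLife n (x i) :=
    measurable_pi_lambda _ fun i => (measurable_truncLife n).comp (measurable_pi_apply i)
  have h2 := map_prod_map κ (Measure.pi fun _ : Fin j => P) measurable_id hT
  rw [map_id, Measure.pi_map_pi (fun _ => (measurable_truncLife n).aemeasurable)] at h2
  have h1 := congrArg (fun μ => μ ((graft j ∘ Prod.map id fun (x : Fin j → MTree) (i : Fin j) =>
    truncLife n (x i)) ⁻¹' S)) (h.map_root j)
  have hS' := ((measurable_graft j).comp (measurable_id.prodMap hT)) hS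
  simp only [Measure.smul_apply, smul_eq_mul] at h1
  rw [map_apply hm hS', Measure.restrict_apply (hm hS')] at h1
  rw [h2, map_map (measurable_graft j) (measurable_id.prodMap hT),
    map_apply ((measurable_graft j).comp (measurable_id.prodMap hT)) hS, ← h1]
  congr 1
  ext t
  simp only [mem_ofPred_eq, mem_preimage, mem_inter_iff, Function.comp_apply]
  rw [and_comm]
  refine and_congr_left fun hj => ?_
  subst hj
  rw [truncLife_succ]
  rfl

theorem IsGWTreeLaw.map_truncLife_eq (h : IsGWTreeLaw q κ P) (h' : IsGWTreeLaw q κ P') (n : ℕ) :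
    P.map (truncLife n) = P'.map (truncLife n) := by
  have := h.isProb
  have := h'.isProb
  induction n with
  | zero =>
    have : truncLife 0 = fun _ _ => 0 := by
      funext t u; simp [truncLife]
    rw [this, Measure.map_const, Measure.map_const, measure_univ, measure_univ]
  | succ n ih =>
    ext S hS
    rw [h.map_truncLife_succ n hS, h'.map_truncLife_succ n hS, ih]

theorem IsGWTreeLaw.unique (h : IsGWTreeLaw q κ P) (h' : IsGWTreeLaw q κ P') : P = P' := by
  have := h.isProb
  have := h'.isProb
  have hl : Measurable MTree.life := MTree.measurable_life_fun
  have hP : IsProbabilityMeasure (P.map MTree.life) :=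
    isProbabilityMeasure_map hl.aemeasurable
  have key : P.map MTree.life = P'.map MTree.life := by
    have : ∀ I : Finset (List ℕ), IsProbabilityMeasure ((P.map MTree.life).map I.restrict) :=
      fun I => isProbabilityMeasure_map (by fun_prop)
    refine IsProjectiveLimit.unique (P := fun I => (P.map MTree.life).map I.restrict)
      (fun I => rfl) fun I => ?_
    change (P'.map MTree.life).map I.restrict = (P.map MTree.life).map I.restrict
    -- Finitely many words lie in finitely many generations, whose joint law is already known to be
    -- unique.
    obtain ⟨n, hn⟩ : ∃ n, ∀ u ∈ I, u.length < n := ⟨I.sup List.length + 1, fun u hu =>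
      Nat.lt_succ_of_le (Finset.le_sup hu)⟩
    have hr : Measurable (I.restrict : (List ℕ → ℝ) → _) := by fun_prop
    have hI : I.restrict ∘ MTree.life = I.restrict ∘ truncLife n := by
      funext t
      funext u
      simp [truncLife, Finset.restrict, hn u u.2]
    rw [map_map hr hl, map_map hr hl, hI,
      ← map_map hr (measurable_truncLife n), ← map_map hr (measurable_truncLife n),
      h.map_truncLife_eq h' n]
  ext S hS
  have h1 := congrArg (fun μ => μ (MTree.life '' S)) key
  simp only [MTree.measurableEmbedding_life.map_apply,
    preimage_image_eq _ MTree.measurableEmbedding_life.injective] at h1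
  exact h1

theorem IsGWILaw.unique {L' : Measure Forest}
    (h : IsGWILaw q κ η χ L) (h' : IsGWILaw q κ η χ L') : L = L' := by
  obtain ⟨P, hP, hL⟩ := h.map_gapBush
  obtain ⟨P', hP', hL'⟩ := h'.map_gapBush
  have hid : sumForest ∘ gapBush = id := funext sumForest_gapBush
  have key : ∀ L : Measure Forest, (L.map gapBush).map sumForest = L := fun L => by
    rw [map_map measurable_sumForest measurable_gapBush, hid, map_id]
  rw [← key L, ← key L', hL, hL', hP.unique hP']

/-! ### Uniqueness of the parameters -/

theorem IsGWTreeLaw.measure_kids (h : IsGWTreeLaw q κ P) (j : ℕ)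
    (hH : MeasurableSet H) : P {t | kids t = j ∧ t.life [] ∈ H} = q j * κ H := by
  have := h.isProb
  have h1 := h.branching j H (fun _ => univ) hH fun _ => MeasurableSet.univ
  rw [branching_set_eq] at h1
  simpa [treeEvent] using h1

theorem exists_ne_zero (q : PMF ℕ) : ∃ n, q n ≠ 0 := by
  obtain ⟨n, hn⟩ := q.support_nonempty
  exact ⟨n, hn⟩

theorem IsGWTreeLaw.parameters_unique (h : IsGWTreeLaw q κ P) (h' : IsGWTreeLaw q' κ' P) :
    q = q' ∧ κ = κ' := by
  have := h.isProb_life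
  have := h'.isProb_life
  have hq : q = q' := by
    ext j
    have h1 := h.measure_kids j MeasurableSet.univ
    rw [h'.measure_kids j MeasurableSet.univ, measure_univ, measure_univ, mul_one, mul_one] at h1
    exact h1.symm
  refine ⟨hq, ?_⟩
  subst hq
  obtain ⟨n, hn⟩ := exists_ne_zero q
  ext H hH
  have h1 := h.measure_kids n hH
  rw [h'.measure_kids n hH, ENNReal.mul_right_inj hn (q.apply_ne_top n)] at h1
  exact h1.symm

/-- The size and the first tree suffice to recover `η` and `P` from the law of a bush. Empty bushes
satisfy the condition vacuously. -/
theorem bushLaw_size_and_first (η : PMF ℕ) (P : Measure MTree) [IsProbabilityMeasure P] (n : ℕ)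
    {A : Set MTree} (hA : MeasurableSet A) :
    bushLaw η P {b | b.1 = n ∧ ∀ h : 0 < b.1, b.2 ⟨0, h⟩ ∈ A}
      = η n * (if n = 0 then 1 else P A) := by
  have hE : ∀ n, MeasurableSet (Set.pi univ fun i : Fin n => if (i : ℕ) = 0 then A else univ) :=
    fun n => MeasurableSet.univ_pi fun i => by split_ifs; exacts [hA, MeasurableSet.univ]
  have : {b : Bush | b.1 = n ∧ ∀ h : 0 < b.1, b.2 ⟨0, h⟩ ∈ A}
      = Sigma.mk n '' Set.pi univ fun i : Fin n => if (i : ℕ) = 0 then A else univ := by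
    ext b
    constructor
    · rintro ⟨h, hb⟩
      obtain ⟨m, b⟩ := b
      cases h
      refine ⟨b, fun i _ => ?_, rfl⟩
      simp only
      split_ifs with hi
      · have := hb (by have := i.2; simp only at this ⊢; omega)
        convert this
      · trivial
    · rintro ⟨b, hb, rfl⟩
      exact ⟨rfl, fun h => by simpa using hb ⟨0, h⟩ trivial⟩
  rw [this, bushLaw_eq, bushMeasure_image _ _ (hE n), pi_pi]
  congr 1
  cases n with
  | zero => simp
  | succ n =>
    rw [Fin.prod_univ_succ]
    simp

theorem IsGWILaw.parameters_unique
    (h : IsGWILaw q κ η χ L) (h' : IsGWILaw q' κ' η' χ' L) :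
    q = q' ∧ κ = κ' ∧ η = η' ∧ χ = χ' := by
  have := h.isProb_gap
  have := h'.isProb_gap
  obtain ⟨P, hP, hL⟩ := h.law
  obtain ⟨P', hP', hL'⟩ := h'.law
  have := hP.isProb
  have := hP'.isProb
  have := bushLaw_univ η P
  have := bushLaw_univ η' P'
  have h0 := (hL 0).symm.trans (hL' 0)
  have hχ := congrArg Measure.fst h0
  rw [fst_prod, fst_prod] at hχ
  have hb := congrArg Measure.snd h0
  rw [snd_prod, snd_prod] at hb
  have hη : η = η' := by
    ext n
    have h1 := bushLaw_size_and_first η P n MeasurableSet.univ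
    rw [hb, bushLaw_size_and_first η' P' n MeasurableSet.univ] at h1
    simpa using h1.symm
  subst hη
  obtain ⟨n, hn⟩ := exists_ne_zero η
  have hn0 : n ≠ 0 := fun h1 => hn (h1 ▸ h.immigration_pos)
  have hPP : P = P' := by
    ext A hA
    have h1 := bushLaw_size_and_first η P n hA
    rw [hb, bushLaw_size_and_first η P' n hA, if_neg hn0, if_neg hn0,
      ENNReal.mul_right_inj hn (η.apply_ne_top n)] at h1
    exact h1.symm
  subst hPP
  obtain ⟨hq, hκ⟩ := hP.parameters_unique hP'
  exact ⟨hq, hκ, rfl, hχ⟩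

/-- The first bush is almost surely nonempty because `η 0 = 0`, whereas the empty forest has empty
bushes only. -/
theorem IsGWILaw.ne_dirac
    (h : IsGWILaw q κ η χ L) : L ≠ dirac emptyForest := by
  rintro rfl
  have := h.isProb_gap
  obtain ⟨P, hP, hL⟩ := h.law
  have := hP.isProb
  have := bushLaw_univ η P
  have h0 := congrArg Measure.snd (hL 0)
  have hm : Measurable fun f : Forest => (gap f 0, (f 0).2) :=
    (measurable_gap 0).prodMk (measurable_snd.comp (measurable_pi_apply 0))
  rw [snd_prod, Measure.map_dirac' hm, Measure.snd, Measure.map_dirac' measurable_snd] at h0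
  have h1 := bushLaw_size_and_first η P 0 MeasurableSet.univ
  rw [← h0, h.immigration_pos, zero_mul] at h1
  have h2 : MeasurableSet {b : Bush | b.1 = 0 ∧ ∀ h : 0 < b.1, b.2 ⟨0, h⟩ ∈ univ} := by
    have := measurable_bush_size (measurableSet_singleton 0)
    convert this using 1
    ext b
    simp
  rw [Measure.dirac_apply' _ h2, indicator_of_mem] at h1
  · simp at h1
  · exact ⟨rfl, fun _ => trivial⟩

end

/-! ### Existence of Galton-Watson laws -/

/-- The words that are individuals when `N u` is the number of children of `u`. -/
def inField (N : List ℕ → ℕ) : List ℕ → Prop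
  | [] => True
  | i :: u => i < N [] ∧ inField (fun v => N (i :: v)) u

theorem inField_snoc (N : List ℕ → ℕ) (u : List ℕ) (j : ℕ) :
    inField N (u ++ [j]) ↔ inField N u ∧ j < N u := by
  induction u generalizing N with
  | nil => simp [inField]
  | cons i u ih =>
    simp only [List.cons_append, inField, ih, and_assoc]

open Classical in
/-- The tree with given numbers of children and given lifetimes. -/
def fieldTree (ω : List ℕ → ℕ × ℝ) : MTree where
  nodes := {u | inField (fun v => (ω v).1) u}
  -- A nonpositive mark, which later has probability zero, is replaced by `1` to obtain a tree in
  -- every case.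
  life u := if inField (fun v => (ω v).1) u then (if 0 < (ω u).2 then (ω u).2 else 1) else 0
  root_mem := trivial
  parent_mem u j h := ((inField_snoc _ _ _).1 h).1
  exists_children u hu := ⟨(ω u).1, fun j => (inField_snoc _ _ _).trans (and_iff_right hu)⟩
  life_pos u hu := by
    rw [if_pos (show inField _ u from hu)]
    split_ifs with h
    · exact h
    · exact one_pos
  life_eq_zero u hu := if_neg hu

theorem measurable_inField (u : List ℕ) :
    Measurable fun ω : List ℕ → ℕ × ℝ => inField (fun v => (ω v).1) u := by
  induction u with
  | nil => exact measurable_const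
  | cons i u ih =>
    refine Measurable.and ?_ ?_
    · exact measurableSet_setOfPred.1 (measurableSet_lt measurable_const
        (measurable_fst.comp (measurable_pi_apply [])))
    · have hs : Measurable fun (ω : List ℕ → ℕ × ℝ) v => ω (i :: v) := by fun_prop
      exact ih.comp hs

theorem measurable_fieldTree : Measurable fieldTree := by
  classical
  refine measurable_mtree_iff.2 fun u => ?_
  have h1 : Measurable fun ω : List ℕ → ℕ × ℝ => (ω u).2 :=
    measurable_snd.comp (measurable_pi_apply u)
  exact Measurable.ite (measurableSet_setOfPred.2 (measurable_inField u))
    (Measurable.ite (measurableSet_lt measurable_const h1) h1 measurable_const) measurable_const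

theorem kids_fieldTree (ω : List ℕ → ℕ × ℝ) : kids (fieldTree ω) = (ω []).1 := by
  have h : ∀ i, i < kids (fieldTree ω) ↔ i < (ω []).1 := by
    intro i
    rw [← MTree.singleton_mem_nodes]
    exact and_iff_left trivial
  have h1 := h (kids (fieldTree ω))
  have h2 := h (ω []).1
  omega

theorem child_fieldTree {ω : List ℕ → ℕ × ℝ} (hi : i < (ω []).1) :
    child (fieldTree ω) i = fieldTree fun u => ω (i :: u) := by
  refine MTree.ext_life fun u => ?_
  rw [child_life (by rwa [kids_fieldTree])]
  have : inField (fun v => (ω v).1) (i :: u) ↔ inField (fun v => (ω (i :: v)).1) u :=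
    and_iff_right hi
  by_cases h : inField (fun v => (ω (i :: v)).1) u
  · exact (if_pos (this.2 h)).trans (if_pos h).symm
  · exact (if_neg (this.not.2 h)).trans (if_neg h).symm

/-- The tree is read off from independent pairs of a number of children and a lifetime, attached to
all words. The fields above different letters are independent copies of the whole field. -/
theorem exists_isGWTreeLaw (q : PMF ℕ) (κ : Measure ℝ) [IsProbabilityMeasure κ]
    (hκ : κ (Iic 0) = 0) : ∃ P, IsGWTreeLaw q κ P := by
  set μ : Measure (ℕ × ℝ) := q.toMeasure.prod κ
  set Z : Measure (List ℕ → ℕ × ℝ) := infinitePi fun _ => μ with hZ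
  have hP : IsProbabilityMeasure (Z.map fieldTree) :=
    isProbabilityMeasure_map measurable_fieldTree.aemeasurable
  refine ⟨Z.map fieldTree, hP, inferInstance, hκ, fun j H A hH hA => ?_⟩
  rw [branching_set_eq, map_apply measurable_fieldTree (measurableSet_treeEvent j hH hA)]
  set H' : Set ℝ := {x | (if 0 < x then x else 1) ∈ H} with hH'
  have hH'm : MeasurableSet H' :=
    (Measurable.ite measurableSet_Ioi measurable_id measurable_const : Measurable fun x : ℝ =>
      if 0 < x then x else 1) hH
  have hκH : κ H' = κ H := by
    refine measure_congr ?_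
    filter_upwards [measure_eq_zero_iff_ae_notMem.1 hκ] with x hx
    have hx0 : 0 < x := by simpa using hx
    refine propext ?_
    change (if 0 < x then x else 1) ∈ H ↔ x ∈ H
    rw [if_pos hx0]
  set C : ℕ → Set (List ℕ → ℕ × ℝ) := fun i => if h : i < j then fieldTree ⁻¹' A ⟨i, h⟩ else univ
  have hC : ∀ i, MeasurableSet (C i) := fun i => by
    simp only [C]
    split_ifs
    · exact measurable_fieldTree (hA _)
    · exact MeasurableSet.univ
  have hm : Measurable fun ω : List ℕ → ℕ × ℝ => (ω [], fun (i : ℕ) u => ω (i :: u)) := by fun_prop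
  have hCm : MeasurableSet (Set.pi (Finset.range j : Set ℕ) C) :=
    MeasurableSet.pi (Finset.countable_toSet _) fun i _ => hC i
  have hset : fieldTree ⁻¹' treeEvent j H A = (fun ω : List ℕ → ℕ × ℝ =>
      (ω [], fun (i : ℕ) u => ω (i :: u))) ⁻¹' (({j} ×ˢ H') ×ˢ Set.pi (Finset.range j : Set ℕ) C) := by
    ext ω
    have hl : (fieldTree ω).life [] = if 0 < (ω []).2 then (ω []).2 else 1 := by
      simp [fieldTree, inField]
    simp only [mem_preimage, treeEvent, mem_ofPred_eq, kids_fieldTree, hl, mem_prod,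
      mem_singleton_iff, Set.mem_pi, Finset.coe_range, mem_Iio, hH', and_assoc]
    refine and_congr_right fun hj => and_congr_right fun _ => ?_
    constructor
    · intro h i hi
      have := h ⟨i, hi⟩
      rw [child_fieldTree (by omega)] at this
      simp only [C, dif_pos hi]
      exact this
    · intro h i
      have := h i i.2
      simp only [C, dif_pos i.2] at this
      rw [child_fieldTree (by omega)]
      exact this
  rw [hset, ← map_apply hm (((measurableSet_singleton j).prod hH'm).prod hCm), hZ,
    infinitePi_map_root, prod_prod, prod_prod, hκH,
    PMF.toMeasure_apply_singleton _ _ (measurableSet_singleton j),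
    infinitePi_pi _ fun i _ => hC i, Finset.prod_range]
  congr 1
  refine Finset.prod_congr rfl fun i _ => ?_
  simp only [C, dif_pos i.2]
  rw [map_apply measurable_fieldTree (hA i)]

theorem exists_isGWILaw (q η : PMF ℕ) (hη : η 0 = 0) (κ χ : Measure ℝ) [IsProbabilityMeasure κ]
    [IsProbabilityMeasure χ] (hκ : κ (Iic 0) = 0) (hχ : χ (Iic 0) = 0) :
    ∃ L, IsGWILaw q κ η χ L := by
  obtain ⟨P, hP⟩ := exists_isGWTreeLaw q κ hκ
  have := hP.isProb
  have := bushLaw_univ η P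
  set Z := infinitePi fun _ : ℕ => χ.prod (bushLaw η P)
  have : IsProbabilityMeasure (Z.map sumForest) :=
    isProbabilityMeasure_map measurable_sumForest.aemeasurable
  refine ⟨Z.map sumForest, isGWILaw_of_map_gapBush hP hχ hη ?_⟩
  rw [map_map measurable_gapBush measurable_sumForest,
    show gapBush ∘ sumForest = id from funext gapBush_sumForest, map_id]

/-! ### Renaming of the individuals of a reduced tree -/

open Classical in
/-- The individual of the reduced tree spanned by `S` into which `u` is merged. -/
def rename (S : Set (List ℕ)) (u : List ℕ) : List ℕ :=
  -- The state consists of the prefix read so far and of its new name. A letter is dropped below a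
  -- single child and otherwise replaced by its rank among the siblings in `S`.
  (u.foldl (fun (a : List ℕ × List ℕ) k => (a.1 ++ [k], if numChildren S a.1 = 1 then a.2
    else a.2 ++ [count (fun j => a.1 ++ [j] ∈ S) k])) ([], [])).2

open Classical in
theorem rename_snoc (S : Set (List ℕ)) (u : List ℕ) (k : ℕ) :
    rename S (u ++ [k]) = if numChildren S u = 1 then rename S u
      else rename S u ++ [count (fun j => u ++ [j] ∈ S) k] := by
  have h : ∀ u : List ℕ, (u.foldl (fun (a : List ℕ × List ℕ) k => (a.1 ++ [k],
      if numChildren S a.1 = 1 then a.2 else a.2 ++ [count (fun j => a.1 ++ [j] ∈ S) k]))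
      ([], [])).1 = u := by
    intro u
    induction u using List.reverseRecOn with
    | nil => rfl
    | append_singleton u k ih => rw [List.foldl_append, List.foldl_cons, List.foldl_nil, ih]
  rw [rename, List.foldl_append, List.foldl_cons, List.foldl_nil, h]
  rfl

/-- The sets of individuals that span a reduced tree. -/
structure IsTreeSet (S : Set (List ℕ)) : Prop where
  root : [] ∈ S
  parent : ∀ u j, u ++ [j] ∈ S → u ∈ S
  finite : ∀ u, {k | u ++ [k] ∈ S}.Finite
  finiteSpine : ∀ v ∈ S, ∃ i, numChildren S (spine S v i) ≠ 1

theorem spine_prefix (S : Set (List ℕ)) (v : List ℕ) (h : i ≤ j) :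
    spine S v i <+: spine S v j := by
  induction j, h using Nat.le_induction with
  | base => exact List.prefix_rfl
  | succ j _ ih => exact ih.trans (List.prefix_append _ _)

theorem length_spine (S : Set (List ℕ)) (v : List ℕ) (i : ℕ) :
    (spine S v i).length = v.length + i := by
  induction i with
  | zero => rfl
  | succ i ih => rw [spine, nthChild, List.length_append, ih, List.length_singleton, add_assoc]

theorem spine_injective (S : Set (List ℕ)) (v : List ℕ) : Function.Injective (spine S v) :=
  fun i j h => by
    have := congrArg List.length h
    rw [length_spine, length_spine] at this
    omega

theorem numChildren_spine (h : i < spineLength S v) :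
    numChildren S (spine S v i) = 1 :=
  not_not.1 fun h' => Nat.notMem_of_lt_sInf h h'

open Classical in
theorem count_nthChild (h : j < numChildren S u) :
    count (fun k => u ++ [k] ∈ S) (nth (fun k => u ++ [k] ∈ S) j) = j := by
  refine Nat.count_nth fun hf => ?_
  rwa [numChildren, Set.ncard_eq_toFinset_card _ hf] at h

open Classical in
theorem nthChild_count (hf : {k | u ++ [k] ∈ S}.Finite)
    (hk : u ++ [k] ∈ S) : count (fun k => u ++ [k] ∈ S) k < numChildren S u ∧
      nthChild S u (count (fun k => u ++ [k] ∈ S) k) = u ++ [k] := by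
  refine ⟨?_, by rw [nthChild, Nat.nth_count (p := fun k => u ++ [k] ∈ S) hk]⟩
  rw [numChildren, Set.ncard_eq_toFinset_card _ hf]
  exact Nat.count_lt_card hf hk

theorem nthChild_zero_of_eq_one (h : numChildren S u = 1)
    (hk : u ++ [k] ∈ S) : nthChild S u 0 = u ++ [k] := by
  classical
  obtain ⟨h1, h2⟩ := nthChild_count (Set.finite_of_ncard_ne_zero (by
    unfold numChildren at h; omega)) hk
  rw [h] at h1
  rwa [Nat.lt_one_iff.1 h1] at h2

theorem rename_spine (hi : i ≤ spineLength S v) :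
    rename S (spine S v i) = rename S v := by
  induction i with
  | zero => rfl
  | succ i ih =>
    rw [spine, nthChild, rename_snoc, if_pos (numChildren_spine hi), ih (by omega)]

theorem rename_append (S : Set (List ℕ)) (u y : List ℕ) : rename S u <+: rename S (u ++ y) := by
  classical
  induction y using List.reverseRecOn with
  | nil => simp
  | append_singleton y k ih =>
    rw [← List.append_assoc, rename_snoc]
    split_ifs
    · exact ih
    · exact ih.trans (List.prefix_append _ _)

namespace IsTreeSet

theorem numChildren_spineEnd (hS : IsTreeSet S) (hv : v ∈ S) : numChildren S (spineEnd S v) ≠ 1 :=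
  Nat.sInf_mem (hS.finiteSpine v hv)

/-- `rename` is a left inverse of the exploration, so a reduced individual can be studied through
the individuals merged into it. -/
theorem rename_locate (hS : IsTreeSet S) (h : locate S w = some v) : rename S v = w := by
  classical
  induction w using List.reverseRecOn generalizing v with
  | nil =>
    cases h
    rfl
  | append_singleton w j ih =>
    rw [locate_snoc] at h
    obtain ⟨v₀, h₀, h⟩ := Option.bind_eq_some_iff.1 h
    unfold reduceStep at h
    split_ifs at h with hj
    cases h
    have hv₀ := locate_mem hS.root w v₀ h₀
    rw [nthChild, rename_snoc, if_neg (hS.numChildren_spineEnd hv₀), count_nthChild hj, spineEnd,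
      rename_spine le_rfl, ih h₀]

/-- Along the word, a child of an individual with a single child continues the current line, and any
other child starts a new line. -/
theorem exists_locate (hS : IsTreeSet S) (hu : u ∈ S) :
    ∃ v i, locate S (rename S u) = some v ∧ i ≤ spineLength S v ∧ spine S v i = u := by
  classical
  induction u using List.reverseRecOn with
  | nil => exact ⟨[], 0, rfl, Nat.zero_le _, rfl⟩
  | append_singleton u k ih =>
    obtain ⟨v, i, hv, hi, rfl⟩ := ih (hS.parent _ k hu)
    have hvS := locate_mem hS.root _ v hv
    obtain ⟨hcard, hnth⟩ := nthChild_count (hS.finite _) hu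
    rw [rename_snoc]
    split_ifs with h1
    · have hlt : i < spineLength S v := lt_of_le_of_ne hi fun h => by
        rw [h] at h1
        exact hS.numChildren_spineEnd hvS h1
      refine ⟨v, i + 1, hv, hlt, ?_⟩
      exact nthChild_zero_of_eq_one h1 hu
    · have hend : spineEnd S v = spine S v i := by
        rcases hi.lt_or_eq with h | h
        · exact absurd (numChildren_spine h) h1
        · rw [h, spineEnd]
      refine ⟨spine S v i ++ [k], 0, ?_, Nat.zero_le _, rfl⟩
      rw [locate_snoc, hv, Option.bind_some, reduceStep, hend, if_pos hcard, hnth]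

theorem locate_spineEnd (hS : IsTreeSet S) (hu : u ∈ S) (h1 : numChildren S u ≠ 1) :
    ∃ v, locate S (rename S u) = some v ∧ spineEnd S v = u := by
  obtain ⟨v, i, hv, hi, rfl⟩ := hS.exists_locate hu
  rcases hi.lt_or_eq with h | h
  · exact absurd (numChildren_spine h) h1
  · exact ⟨v, hv, by rw [h, spineEnd]⟩

theorem rename_spineEnd (hS : IsTreeSet S) (h : locate S w = some v) : rename S (spineEnd S v) = w := by
  rw [spineEnd, rename_spine le_rfl, hS.rename_locate h]

theorem fiber_eq (hS : IsTreeSet S) (h : locate S w = some v) :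
    {u | u ∈ S ∧ rename S u = w} = ((Finset.range (spineLength S v + 1)).image (spine S v) :
      Finset (List ℕ)) := by
  ext u
  simp only [mem_ofPred_eq, Finset.coe_image, Finset.coe_range, mem_image, mem_Iio]
  constructor
  · rintro ⟨hu, rfl⟩
    obtain ⟨v', i, hv', hi, rfl⟩ := hS.exists_locate hu
    rw [h] at hv'
    cases hv'
    exact ⟨i, by omega, rfl⟩
  · rintro ⟨i, hi, rfl⟩
    exact ⟨spine_mem (locate_mem hS.root w v h) i (by omega), by
      rw [rename_spine (by omega), hS.rename_locate h]⟩

theorem fiber_finite (hS : IsTreeSet S) (w : List ℕ) : {u | u ∈ S ∧ rename S u = w}.Finite := by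
  cases h : locate S w with
  | none =>
    refine (finite_empty).subset ?_
    rintro u ⟨hu, rfl⟩
    obtain ⟨v, i, hv, -⟩ := hS.exists_locate hu
    rw [h] at hv
    cases hv
  | some v =>
    rw [hS.fiber_eq h]
    exact Finset.finite_toSet _

/-- Lifetimes of the reduced tree are sums over the fibres of `rename`. Unlike the recursive
definition, this form is easily composed. -/
theorem reduceLife_eq (hS : IsTreeSet S) (L : List ℕ → ℝ) (w : List ℕ) :
    reduceLife L S w = ∑ᶠ u ∈ {u | u ∈ S ∧ rename S u = w}, L u := by
  cases h : locate S w with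
  | none =>
    have : {u | u ∈ S ∧ rename S u = w} = ∅ := by
      ext u
      simp only [mem_ofPred_eq, mem_empty_iff_false, iff_false]
      rintro ⟨hu, rfl⟩
      obtain ⟨v, i, hv, -⟩ := hS.exists_locate hu
      rw [h] at hv
      cases hv
    rw [this, finsum_mem_empty, reduceLife, h]
    rfl
  | some v =>
    rw [hS.fiber_eq h, finsum_mem_coe_finset, Finset.sum_image (spine_injective S v).injOn,
      reduceLife, h]
    rfl

theorem prefix_spineEnd (hS : IsTreeSet S) (h : locate S w = some v) (hu : u ∈ S)
    (huw : rename S u <+: w) : u <+: spineEnd S v := by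
  have hfib : ∀ {w v : List ℕ}, locate S w = some v → rename S u = w → u <+: spineEnd S v := by
    intro w v h huw
    obtain ⟨v', i, hv', hi, rfl⟩ := hS.exists_locate hu
    rw [huw, h] at hv'
    cases hv'
    exact spine_prefix S v hi
  induction w using List.reverseRecOn generalizing v with
  | nil => exact hfib h (List.prefix_nil.1 huw)
  | append_singleton w j ih =>
    rcases List.prefix_concat_iff.1 huw with h1 | h1
    · exact hfib h (by simpa using h1)
    · rw [locate_snoc] at h
      obtain ⟨v₀, h₀, h⟩ := Option.bind_eq_some_iff.1 h
      unfold reduceStep at h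
      split_ifs at h with hj
      cases h
      exact ((ih h₀ h1).trans (List.prefix_append _ _)).trans (spine_prefix S _ (Nat.zero_le _))

end IsTreeSet

open Classical in
-- Ranks compose: `B'` is the subset `B` of `A` seen through the numbering of `A`. This serves for
-- children, trees in a bush and bushes alike.
theorem count_count {A B B' : ℕ → Prop} (hBA : ∀ k, B k → A k)
    (h : ∀ k, A k → (B' (count A k) ↔ B k)) (k : ℕ) :
    count B' (count A k) = count B k := by
  induction k with
  | zero => simp
  | succ k ih =>
    rw [Nat.count_succ, Nat.count_succ (p := B)]
    by_cases hA : A k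
    · rw [if_pos hA, Nat.count_succ, ih]
      simp only [h k hA]
    · rw [if_neg hA, if_neg fun hB => hA (hBA k hB), add_zero, add_zero, ih]

/-! ### Reduction in two steps -/

/-- `S'` is the set of individuals, of the reduced tree spanned by `S₁`, that corresponds
to `S₂`. -/
structure IsRestriction (S₁ S₂ S' : Set (List ℕ)) : Prop where
  isTreeSet₁ : IsTreeSet S₁
  isTreeSet₂ : IsTreeSet S₂
  isTreeSet' : IsTreeSet S'
  subset : S₂ ⊆ S₁
  mem_iff : ∀ u ∈ S₁, rename S₁ u ∈ S' ↔ u ∈ S₂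
  located : ∀ w ∈ S', ∃ v, locate S₁ w = some v

/-- A parent with one child in `S₁` also has exactly one in `S₂`, as the next letter lies there, and
both renamings drop this letter. Otherwise the children in `S₂` correspond by their ranks in `S₁` to
those in `S'`, and the ranks compose. -/
theorem IsRestriction.rename_rename {S₁ S₂ S' : Set (List ℕ)} (h : IsRestriction S₁ S₂ S') (hu : u ∈ S₂) : rename S' (rename S₁ u) = rename S₂ u := by
  classical
  induction u using List.reverseRecOn with
  | nil => rfl
  | append_singleton u k ih =>
    have hu₀ := h.isTreeSet₂.parent _ _ hu
    have ih := ih hu₀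
    rw [rename_snoc, rename_snoc S₂]
    by_cases h1 : numChildren S₁ u = 1
    · have h2 : numChildren S₂ u = 1 := by
        refine le_antisymm ?_ ?_
        · rw [← h1]
          exact Set.ncard_le_ncard (fun k hk => h.subset hk) (h.isTreeSet₁.finite u)
        · exact (Set.ncard_pos (h.isTreeSet₂.finite u)).2 ⟨k, hu⟩
      rw [if_pos h1, if_pos h2, ih]
    · rw [if_neg h1, rename_snoc]
      have hmem : ∀ k, u ++ [k] ∈ S₁ → (rename S₁ u ++ [count (fun j => u ++ [j] ∈ S₁) k] ∈ S'
          ↔ u ++ [k] ∈ S₂) := by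
        intro k hk
        rw [← h.mem_iff _ hk, rename_snoc, if_neg h1]
      have hnum : numChildren S' (rename S₁ u) = numChildren S₂ u := by
        have himg : {c | rename S₁ u ++ [c] ∈ S'}
            = (fun k => count (fun j => u ++ [j] ∈ S₁) k) '' {k | u ++ [k] ∈ S₂} := by
          ext c
          constructor
          · intro hc
            obtain ⟨v, hv⟩ := h.located _ hc
            obtain ⟨v₀, hv₀, hend⟩ := h.isTreeSet₁.locate_spineEnd (h.subset hu₀) h1
            have hv' := hv
            rw [locate_snoc, hv₀, Option.bind_some, reduceStep, hend] at hv'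
            split_ifs at hv' with hc'
            cases hv'
            have hk := nthChild_mem hc'
            have hcount := count_nthChild hc'
            refine ⟨nth (fun k => u ++ [k] ∈ S₁) c, ?_, hcount⟩
            rw [mem_ofPred_eq, ← hmem _ hk, hcount]
            exact hc
          · rintro ⟨k, hk, rfl⟩
            exact (hmem k (h.subset hk)).2 hk
        rw [numChildren, numChildren, himg, Set.InjOn.ncard_image]
        intro a ha b hb hab
        exact Nat.count_injective (h.subset ha) (h.subset hb) hab
      rw [hnum, ih]
      split_ifs
      · rfl
      · congr 2
        exact count_count (fun k hk => h.subset hk) hmem k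

/-- The fibres of the composed renaming are disjoint unions of fibres of the first one, so the sums
of lifetimes agree. -/
theorem IsRestriction.reduceLife_reduceLife {S₁ S₂ S' : Set (List ℕ)} (h : IsRestriction S₁ S₂ S')
    (L : List ℕ → ℝ) (w : List ℕ) :
    reduceLife (reduceLife L S₁) S' w = reduceLife L S₂ w := by
  rw [h.isTreeSet'.reduceLife_eq, h.isTreeSet₂.reduceLife_eq]
  simp_rw [h.isTreeSet₁.reduceLife_eq]
  have hset : {u | u ∈ S₂ ∧ rename S₂ u = w}
      = ⋃ w' ∈ {w' | w' ∈ S' ∧ rename S' w' = w}, {u | u ∈ S₁ ∧ rename S₁ u = w'} := by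
    ext u
    simp only [mem_iUnion, mem_ofPred_eq, exists_prop]
    constructor
    · rintro ⟨hu, rfl⟩
      exact ⟨_, ⟨(h.mem_iff u (h.subset hu)).2 hu, h.rename_rename hu⟩, h.subset hu, rfl⟩
    · rintro ⟨w', ⟨hw', rfl⟩, hu, rfl⟩
      have hu₂ := (h.mem_iff u hu).1 hw'
      exact ⟨hu₂, (h.rename_rename hu₂).symm⟩
  rw [hset, finsum_mem_biUnion]
  · intro a _ b _ hab
    exact disjoint_left.2 fun u hu hu' => hab (hu.2.symm.trans hu'.2)
  · exact h.isTreeSet'.fiber_finite w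
  · exact fun w' _ => h.isTreeSet₁.fiber_finite w'

/-! ### Reduction of coloured trees in two steps -/

theorem MTree.mem_of_append (t : MTree) (h : u ++ v ∈ t.nodes) : u ∈ t.nodes := by
  induction v using List.reverseRecOn with
  | nil => simpa using h
  | append_singleton v k ih => exact ih (t.parent_mem _ k (by simpa using h))

theorem MTree.finite_children (t : MTree) (u : List ℕ) : {k | u ++ [k] ∈ t.nodes}.Finite := by
  by_cases hu : u ∈ t.nodes
  · obtain ⟨n, hn⟩ := t.exists_children u hu
    exact (finite_Iio n).subset fun k hk => (hn k).1 hk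
  · exact finite_empty.subset fun k hk => hu (t.parent_mem u k hk)

theorem numChildren_eq_zero_iff (hf : {k | u ++ [k] ∈ S}.Finite) :
    numChildren S u = 0 ↔ ∀ k, u ++ [k] ∉ S := by
  rw [numChildren, Set.ncard_eq_zero hf, Set.eq_empty_iff_forall_notMem]
  rfl

section

variable {t : MTree} {col : List ℕ → Bool}

theorem finite_children_blackNodes (u : List ℕ) : {k | u ++ [k] ∈ blackNodes p t col}.Finite :=
  (t.finite_children u).subset fun _ hk => hk.1

theorem mem_blackNodes_of_lt (hp : p < 1) : u ∈ blackNodes p t col ↔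
    ∃ v, u ++ v ∈ t.nodes ∧ numChildren t.nodes (u ++ v) = 0 ∧ col (u ++ v) = true := by
  constructor
  · rintro ⟨-, ⟨-, h⟩ | ⟨h, -⟩⟩
    · exact h
    · exact absurd h hp.ne
  · exact fun ⟨v, h⟩ => ⟨t.mem_of_append h.1, Or.inl ⟨hp, v, h⟩⟩

theorem mem_blackNodes_one :
    u ∈ blackNodes 1 t col ↔ {v | u ++ v ∈ t.nodes}.Infinite := by
  constructor
  · rintro ⟨-, ⟨h, -⟩ | ⟨-, h⟩⟩
    · exact absurd h (lt_irrefl 1)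
    · exact h
  · intro h
    obtain ⟨v, hv⟩ := h.nonempty
    exact ⟨t.mem_of_append hv, Or.inr ⟨rfl, h⟩⟩

theorem parent_mem_blackNodes (h : u ++ [j] ∈ blackNodes p t col) :
    u ∈ blackNodes p t col := by
  obtain ⟨h1, ⟨hp, v, hv⟩ | ⟨hp, hinf⟩⟩ := h
  · rw [List.append_assoc] at hv
    exact ⟨t.parent_mem u j h1, Or.inl ⟨hp, [j] ++ v, hv⟩⟩
  · refine ⟨t.parent_mem u j h1, Or.inr ⟨hp, ?_⟩⟩
    refine (hinf.image (f := fun v => [j] ++ v) fun a _ b _ h => by simpa using h).mono ?_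
    rintro - ⟨v, hv, rfl⟩
    simpa using hv

theorem isTreeSet_blackNodes (hb : [] ∈ blackNodes p t col)
    (hs : ∀ v ∈ blackNodes p t col, ∃ i,
      numChildren (blackNodes p t col) (spine (blackNodes p t col) v i) ≠ 1) :
    IsTreeSet (blackNodes p t col) :=
  ⟨hb, fun _ _ => parent_mem_blackNodes, finite_children_blackNodes, hs⟩

/-- A line of single black children has to follow the path to any black leaf above its start, so it
ends at that leaf at the latest. -/
theorem isTreeSet_blackNodes_of_lt (hp : p < 1) (hb : [] ∈ blackNodes p t col) :
    IsTreeSet (blackNodes p t col) := by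
  refine isTreeSet_blackNodes hb fun v hv => ?_
  obtain ⟨y, hy, hleaf, hcol⟩ := (mem_blackNodes_of_lt hp).1 hv
  by_contra! hone
  have key : ∀ i, ∃ y', spine (blackNodes p t col) v i ++ y' = v ++ y := by
    intro i
    induction i with
    | zero => exact ⟨y, rfl⟩
    | succ i ih =>
      obtain ⟨y', hy'⟩ := ih
      rw [← hy'] at hy hleaf hcol
      cases y' with
      | nil =>
        have h1 := hone i
        rw [List.append_nil] at hleaf
        rw [(numChildren_eq_zero_iff (finite_children_blackNodes _)).2 fun k hk =>
          (numChildren_eq_zero_iff (t.finite_children _)).1 hleaf k hk.1] at h1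
        cases h1
      | cons k y' =>
        rw [List.append_cons] at hy hleaf hcol
        have hk : spine (blackNodes p t col) v i ++ [k] ∈ blackNodes p t col :=
          (mem_blackNodes_of_lt hp).2 ⟨y', hy, hleaf, hcol⟩
        refine ⟨y', ?_⟩
        rw [spine, nthChild_zero_of_eq_one (hone i) hk, ← hy']
        simp
  obtain ⟨y', hy'⟩ := key (y.length + 1)
  have := congrArg List.length hy'
  rw [List.length_append, List.length_append, length_spine] at this
  omega

theorem numChildren_blackNodes_eq_zero (hp : p < 1) {e : List ℕ} (he : e ∈ blackNodes p t col) :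
    numChildren (blackNodes p t col) e = 0 ↔ numChildren t.nodes e = 0 ∧ col e = true := by
  rw [numChildren_eq_zero_iff (finite_children_blackNodes _)]
  constructor
  · intro h
    obtain ⟨v, hv⟩ := (mem_blackNodes_of_lt hp).1 he
    cases v with
    | nil => simpa using hv.2
    | cons k v =>
      refine absurd ((mem_blackNodes_of_lt hp).2 ⟨v, ?_⟩) (h k)
      simpa using hv
  · exact fun h k hk => (numChildren_eq_zero_iff (t.finite_children _)).1 h.1 k hk.1

theorem mem_redTree_nodes (hb : [] ∈ blackNodes p t col) :
    w ∈ (redTree p (t, col)).nodes ↔ ∃ v, locate (blackNodes p t col) w = some v := by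
  rw [redTree_eq_reduce (x := (t, col)) hb]
  exact Option.isSome_iff_exists

theorem numChildren_redTree (hb : [] ∈ blackNodes p t col)
    (hv : locate (blackNodes p t col) w = some v) : numChildren (redTree p (t, col)).nodes w
      = numChildren (blackNodes p t col) (spineEnd (blackNodes p t col) v) := by
  have : {k | w ++ [k] ∈ (redTree p (t, col)).nodes}
      = Iio (numChildren (blackNodes p t col) (spineEnd (blackNodes p t col) v)) := by
    ext k
    rw [mem_ofPred_eq, mem_redTree_nodes hb, locate_snoc, hv, Option.bind_some, reduceStep]
    split_ifs with h <;> simp [h]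
  rw [numChildren, this, ← Finset.coe_Iio, Set.ncard_coe_finset, Nat.card_Iio]

end

open Classical in
/-- The leaf, of the tree spanned by `S`, that ends the line merged into `w`. -/
def leafOf (S : Set (List ℕ)) (w : List ℕ) : Option (List ℕ) :=
  (locate S w).bind fun v => if numChildren S (spineEnd S v) = 0 then some (spineEnd S v) else none

theorem leafOf_eq_some {e : List ℕ} : leafOf S w = some e ↔
    ∃ v, locate S w = some v ∧ numChildren S (spineEnd S v) = 0 ∧ spineEnd S v = e := by
  rw [leafOf, Option.bind_eq_some_iff]
  refine exists_congr fun v => and_congr_right fun _ => ?_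
  split_ifs with h <;> simp [h]

/-! ### Correspondence of black individuals in two successive colourings -/

section

variable {p₁ p₂ : ℝ} {t : MTree} {col₁ col₂ col' : List ℕ → Bool}

/-- The individuals that are black in the second colouring are those whose merged individual is
black in the colouring of the reduced tree. -/
def Corresponds (p₁ p₂ p' : ℝ) (t : MTree) (col₁ col₂ col' : List ℕ → Bool) : Prop :=
  blackNodes p₂ t col₂ ⊆ blackNodes p₁ t col₁ ∧ ∀ u ∈ blackNodes p₁ t col₁,
    (rename (blackNodes p₁ t col₁) u ∈ blackNodes p' (redTree p₁ (t, col₁)) col' ↔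
      u ∈ blackNodes p₂ t col₂)

theorem mem_blackNodes_of_append (h : u ++ v ∈ blackNodes p₁ t col₁) :
    u ∈ blackNodes p₁ t col₁ := by
  induction v using List.reverseRecOn with
  | nil => simpa using h
  | append_singleton v k ih => exact ih (parent_mem_blackNodes (by simpa using h))

/-- The leaves of the reduced tree are the ends of lines at black leaves of `t`. By `hcol` each
carries the second colour of that leaf, so black leaves above an individual correspond in both
descriptions. -/
theorem corresponds_of_lt (h₁ : p₁ < 1) (h₂ : p₂ < 1) (h' : p' < 1)
    (hle : ∀ u, col₂ u = true → col₁ u = true)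
    (hcol : [] ∈ blackNodes p₁ t col₁ → ∀ w e, leafOf (blackNodes p₁ t col₁) w = some e →
      col' w = col₂ e) : Corresponds p₁ p₂ p' t col₁ col₂ col' := by
  have hsub : blackNodes p₂ t col₂ ⊆ blackNodes p₁ t col₁ := fun u hu => by
    obtain ⟨v, h1, h2, h3⟩ := (mem_blackNodes_of_lt h₂).1 hu
    exact (mem_blackNodes_of_lt h₁).2 ⟨v, h1, h2, hle _ h3⟩
  refine ⟨hsub, fun u hu => ?_⟩
  have hb : [] ∈ blackNodes p₁ t col₁ := mem_blackNodes_of_append (u := []) hu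
  have hS := isTreeSet_blackNodes_of_lt h₁ hb
  rw [mem_blackNodes_of_lt h', mem_blackNodes_of_lt h₂]
  constructor
  · rintro ⟨y, hy, hleaf, hc⟩
    obtain ⟨v, hv⟩ := (mem_redTree_nodes hb).1 hy
    rw [numChildren_redTree hb hv] at hleaf
    obtain ⟨y', hy'⟩ := hS.prefix_spineEnd hv hu (List.prefix_append _ _)
    have he := spine_mem (locate_mem hb _ v hv) _ le_rfl
    rw [hcol hb _ _ (leafOf_eq_some.2 ⟨v, hv, hleaf, rfl⟩)] at hc
    refine ⟨y', ?_⟩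
    rw [hy']
    exact ⟨he.1, ((numChildren_blackNodes_eq_zero h₁ he).1 hleaf).1, hc⟩
  · rintro ⟨y, hy, hleaf, hc⟩
    have he : u ++ y ∈ blackNodes p₁ t col₁ := (mem_blackNodes_of_lt h₁).2
      ⟨[], by simpa using ⟨hy, hleaf, hle _ hc⟩⟩
    have h0 := (numChildren_blackNodes_eq_zero h₁ he).2 ⟨hleaf, hle _ hc⟩
    obtain ⟨v, hv, hve⟩ := hS.locate_spineEnd he (by omega)
    obtain ⟨y', hy'⟩ := rename_append (blackNodes p₁ t col₁) u y
    refine ⟨y', ?_⟩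
    rw [hy', mem_redTree_nodes hb, numChildren_redTree hb hv, hve,
      hcol hb _ (u ++ y) (leafOf_eq_some.2 ⟨v, hv, by rw [hve, h0], hve⟩)]
    exact ⟨⟨v, hv⟩, h0, hc⟩

/-- Merging has finite fibres, hence it preserves infinity in both directions. -/
theorem infinite_redTree_iff (h₁ : p₁ < 1) (hu : u ∈ blackNodes p₁ t col₁) :
    {y | rename (blackNodes p₁ t col₁) u ++ y ∈ (redTree p₁ (t, col₁)).nodes}.Infinite ↔
      {v | u ++ v ∈ blackNodes p₁ t col₁}.Infinite := by
  have hb : [] ∈ blackNodes p₁ t col₁ := mem_blackNodes_of_append (u := []) hu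
  have hS := isTreeSet_blackNodes_of_lt h₁ hb
  constructor
  · intro h
    have hloc : ∀ y ∈ {v | rename (blackNodes p₁ t col₁) u ++ v ∈ (redTree p₁ (t, col₁)).nodes},
        ∃ v, u ++ v ∈ blackNodes p₁ t col₁ ∧
          rename (blackNodes p₁ t col₁) (u ++ v) = rename (blackNodes p₁ t col₁) u ++ y := by
      intro y hy
      obtain ⟨v, hv⟩ := (mem_redTree_nodes hb).1 hy
      obtain ⟨y', hy'⟩ := hS.prefix_spineEnd hv hu (List.prefix_append _ _)
      refine ⟨y', ?_⟩
      rw [hy', hS.rename_spineEnd hv]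
      exact ⟨spine_mem (locate_mem hb _ v hv) _ le_rfl, rfl⟩
    choose! g hg using hloc
    refine (h.image (f := g) fun a ha b hb hab => ?_).mono ?_
    · have h1 := (hg a ha).2
      rw [hab, (hg b hb).2] at h1
      exact (List.append_cancel_left h1).symm
    · rintro - ⟨y, hy, rfl⟩
      exact (hg y hy).1
  · intro h hfin
    refine h (Set.Finite.of_finite_fibers
      (fun v => rename (blackNodes p₁ t col₁) (u ++ v)) ((hfin.image
        fun y => rename (blackNodes p₁ t col₁) u ++ y).subset ?_) fun w _ => ?_)
    · rintro - ⟨v, hv, rfl⟩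
      obtain ⟨y, hy⟩ := rename_append (blackNodes p₁ t col₁) u v
      refine ⟨y, ?_, hy⟩
      obtain ⟨v', i, hv', -⟩ := hS.exists_locate hv
      rw [mem_ofPred_eq, hy]
      exact (mem_redTree_nodes hb).2 ⟨v', hv'⟩
    · refine ((hS.fiber_finite w).preimage (f := fun v => u ++ v)
        fun a _ b _ h => by simpa using h).subset ?_
      rintro v ⟨hv, hw⟩
      exact ⟨hv, hw⟩

theorem corresponds_one (h₁ : p₁ < 1)
    (hinf : ∀ u ∈ t.nodes, {v | u ++ v ∈ t.nodes}.Infinite →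
      {v | u ++ v ∈ blackNodes p₁ t col₁}.Infinite) :
    Corresponds p₁ 1 1 t col₁ col₂ col' := by
  refine ⟨fun u hu => ?_, fun u hu => ?_⟩
  · obtain ⟨v, hv⟩ := (hinf u hu.1 (mem_blackNodes_one.1 hu)).nonempty
    exact mem_blackNodes_of_append hv
  rw [mem_blackNodes_one, mem_blackNodes_one, infinite_redTree_iff h₁ hu]
  exact ⟨fun h => h.mono fun v hv => hv.1, hinf u hu.1⟩

theorem Corresponds.rootBlack_iff (h : Corresponds p₁ p₂ p' t col₁ col₂ col') :
    rootBlack p₂ (t, col₂) ↔ rootBlack p₁ (t, col₁) ∧ rootBlack p' (redTree p₁ (t, col₁), col') := by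
  constructor
  · intro h2
    exact ⟨h.1 h2, (h.2 [] (h.1 h2)).2 h2⟩
  · exact fun h2 => (h.2 [] h2.1).1 h2.2

theorem Corresponds.redTree_redTree (h : Corresponds p₁ p₂ p' t col₁ col₂ col') (h₁ : p₁ < 1)
    (hb : rootBlack p₂ (t, col₂))
    (hs₂ : ∀ v ∈ blackNodes p₂ t col₂, ∃ i,
      numChildren (blackNodes p₂ t col₂) (spine (blackNodes p₂ t col₂) v i) ≠ 1)
    (hs' : ∀ v ∈ blackNodes p' (redTree p₁ (t, col₁)) col', ∃ i,
      numChildren (blackNodes p' (redTree p₁ (t, col₁)) col')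
        (spine (blackNodes p' (redTree p₁ (t, col₁)) col') v i) ≠ 1) :
    redTree p' (redTree p₁ (t, col₁), col') = redTree p₂ (t, col₂) := by
  obtain ⟨hb₁, hb'⟩ := h.rootBlack_iff.1 hb
  have hr : IsRestriction (blackNodes p₁ t col₁) (blackNodes p₂ t col₂)
      (blackNodes p' (redTree p₁ (t, col₁)) col') :=
    ⟨isTreeSet_blackNodes_of_lt h₁ hb₁, isTreeSet_blackNodes hb hs₂, isTreeSet_blackNodes hb' hs',
      h.1, h.2, fun w hw => (mem_redTree_nodes hb₁).1 hw.1⟩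
  refine MTree.ext_life fun w => ?_
  rw [redTree_life hb', redTree_life hb, ← hr.reduceLife_reduceLife]
  congr 1
  exact funext (redTree_life hb₁)

end

/-! ### Almost sure properties of all subtrees -/

/-- The coloured trees whose subtrees above the individuals of generation `n` lie in `B`. -/
def holdsAt (B : Set ColTree) : ℕ → Set ColTree
  | 0 => B
  | n + 1 => {x | ∀ i < kids x.1, colChild x i ∈ holdsAt B n}

theorem measurableSet_holdsAt {B : Set ColTree} (hB : MeasurableSet B) (n : ℕ) :
    MeasurableSet (holdsAt B n) := by
  induction n with
  | zero => exact hB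
  | succ n ih =>
    refine measurableSet_setOfPred.2 (Measurable.forall fun i => Measurable.imp ?_ ?_)
    · exact measurableSet_setOfPred.1 (measurableSet_lt measurable_const
        (measurable_kids.comp measurable_fst))
    · exact measurableSet_setOfPred.1 (measurable_colChild i ih)

theorem of_mem_holdsAt {φ : ColTree → List ℕ → Prop}
    (hφ : ∀ x i u, i < kids x.1 → φ (colChild x i) u → φ x (i :: u))
    (hx : x ∈ holdsAt {x | φ x []} u.length) (hu : u ∈ x.1.nodes) : φ x u := by
  induction u generalizing x with
  | nil => exact hx
  | cons i u ih =>
    have hi := MTree.cons_mem_nodes hu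
    exact hφ x i u hi (ih (hx i hi) ((mem_child_nodes hi u).2 hu))

/-- The subtrees above one generation are copies of the tree, so a property that is almost sure at
the root holds in each of the countably many generations. -/
theorem IsGWTreeLaw.ae_forall_nodes (h : IsGWTreeLaw q κ P) (ν : Measure Bool)
    [IsProbabilityMeasure ν] {φ : ColTree → List ℕ → Prop}
    (hφ : ∀ x i u, i < kids x.1 → φ (colChild x i) u → φ x (i :: u))
    (hm : MeasurableSet {x | φ x []}) (h0 : ∀ᵐ x ∂colTreeLaw P ν, φ x []) :
    ∀ᵐ x ∂colTreeLaw P ν, ∀ u ∈ x.1.nodes, φ x u := by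
  have := h.isProb
  have key : ∀ n, ∀ᵐ x ∂colTreeLaw P ν, x ∈ holdsAt {x | φ x []} n := by
    intro n
    induction n with
    | zero => exact h0
    | succ n ih =>
      have hB := measurableSet_holdsAt hm n
      refine (prob_compl_eq_zero_iff (measurableSet_holdsAt hm (n + 1))).2 ?_
      refine (h.measure_forall_colChild ν hB).trans ?_
      rw [(prob_compl_eq_zero_iff hB).1 ih]
      simp [q.tsum_coe]
  filter_upwards [ae_all_iff.2 key] with x hx u hu
  exact of_mem_holdsAt hφ (hx u.length) hu

/-! ### Infinite trees and infinite lines of descent -/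

theorem blackNodes_one_congr (t : MTree) (col col' : List ℕ → Bool) :
    blackNodes 1 t col = blackNodes 1 t col' := by
  ext u
  rw [mem_blackNodes_one, mem_blackNodes_one]

/-- The lines of single children among the individuals with infinitely many descendants are
finite. -/
def FiniteInfiniteSpines (t : MTree) : Prop := ∀ col, ∀ v ∈ blackNodes 1 t col, ∃ i,
  numChildren (blackNodes 1 t col) (spine (blackNodes 1 t col) v i) ≠ 1

/-- If the survival probability is zero, there is nothing to show; otherwise `θ > 0` bounds the
probability of a single surviving child away from one. The colours play no role for `p = 1`, so one
colouring decides for all of them. -/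
theorem IsGWTreeLaw.ae_finiteInfiniteSpines (hq : IsOffspringLaw q) (h : IsGWTreeLaw q κ P) :
    ∀ᵐ t ∂P, FiniteInfiniteSpines t := by
  have := h.isProb
  have h01 : (1 : ℝ) ∈ Icc (0 : ℝ) 1 := ⟨zero_le_one, le_rfl⟩
  have := isProbabilityMeasure_colourMeasure h01.1 h01.2
  set ν := colourMeasure 1 with hν
  have hnull : colTreeLaw P ν {x | rootBlack 1 x ∧ ¬ finSpine 1 x} = 0 := by
    have hR := h.isRootProb hq h01
    obtain ⟨h1, h2⟩ := redMeasure_univ_eq hq h01 h hR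
    rcases hR.mem.1.eq_or_lt with h0 | h0
    · rw [← h0, ENNReal.ofReal_zero, redMeasure_apply 1 ν MeasurableSet.univ] at h1
      rw [preimage_univ, inter_univ] at h1
      exact measure_mono_null (fun x hx => hx.1) h1
    · obtain ⟨θ, q', hθ⟩ := exists_isReducedOffspring hq h01 hR h0
      refine h.measure_not_finSpine 1 ν ?_
      rw [h2, hθ.thin_one, ← ofReal_one]
      exact (ENNReal.ofReal_lt_ofReal_iff one_pos).2 (by linarith [hθ.theta_pos])
  have hae := h.ae_forall_nodes ν (φ := fun x u => u ∈ blackNodes 1 x.1 x.2 → ∃ i,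
    numChildren (blackNodes 1 x.1 x.2) (spine (blackNodes 1 x.1 x.2) u i) ≠ 1)
    (fun x i u hi hu => by
      intro hiu
      rw [← above_blackNodes hi] at hu
      obtain ⟨n, hn⟩ := hu hiu
      exact ⟨n, by rwa [spine_cons, numChildren_cons]⟩)
    (measurableSet_setOfPred.2 ((measurableSet_setOfPred.1 (measurableSet_rootBlack 1)).imp
      (measurableSet_setOfPred.1 (measurableSet_finSpine 1))))
    (by
      refine measure_mono_null (fun x hx => ?_) hnull
      exact Classical.not_imp.1 hx)
  filter_upwards [Measure.ae_ae_of_ae_prod hae] with t ht col v hv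
  obtain ⟨c, hc⟩ := ht.exists
  rw [blackNodes_one_congr t col c] at hv ⊢
  exact hc v hv.1 hv

theorem measurableSet_infinite : MeasurableSet {t : MTree | t.nodes.Infinite} :=
  MTree.measurable_nodes MeasurableSet.setOfPred_infinite

theorem IsGWTreeLaw.measure_infinite (hq : IsOffspringLaw q) (h : IsGWTreeLaw q κ P) {R : ℝ}
    (hR : IsRootProb 1 q R) : P {t | t.nodes.Infinite} = ofReal R := by
  have := h.isProb
  have h01 : (1 : ℝ) ∈ Icc (0 : ℝ) 1 := ⟨zero_le_one, le_rfl⟩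
  have := isProbabilityMeasure_colourMeasure h01.1 h01.2
  rw [← (redMeasure_univ_eq hq h01 h hR).1, redMeasure_apply 1 _ MeasurableSet.univ]
  have : {x : ColTree | rootBlack 1 x} ∩ redTree 1 ⁻¹' univ
      = Prod.fst ⁻¹' {t : MTree | t.nodes.Infinite} := by
    ext x
    simp only [preimage_univ, inter_univ, mem_ofPred_eq, rootBlack, mem_blackNodes_one,
      List.nil_append, mem_preimage]
    rfl
  rw [this, colTreeLaw, ← Measure.fst_apply measurableSet_infinite, fst_prod]

theorem IsReducedOffspring.psi_eq (h : IsReducedOffspring p q r θ q') (hy : y ∈ Icc (0 : ℝ) 1) : psi q' y = psi q (r * y) / (r * θ) := by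
  rw [psi, h.pgf_eq _ ⟨by linarith [hy.2], by linarith [hy.1]⟩]
  ring_nf

theorem IsReducedOffspring.isOffspringLaw (hq : IsOffspringLaw q)
    (hp : p < 1) (h : IsReducedOffspring p q r θ q') : IsOffspringLaw q' := by
  constructor
  · have h0 := h.psi_eq ⟨zero_le_one, le_rfl⟩
    rw [psi_one, mul_one, h.root.eq] at h0
    have : 0 < (q' 0).toReal := by
      rw [h0]
      exact div_pos (mul_pos (by linarith) hq.toReal_pos) (mul_pos h.root_pos h.theta_pos)
    exact (ENNReal.toReal_pos_iff.1 this).1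
  · have h1 := h.weight 1
    rw [blackWeight, if_neg one_ne_zero, if_pos rfl, zero_mul] at h1
    refine (mul_eq_zero.1 h1).resolve_right ?_
    simpa using mul_pos h.theta_pos h.root_pos

/-- The zeros of `psi q'` are those of `psi q` divided by `r`. None is lost: since `psi q r > 0`,
convexity excludes zeros of `psi q` beyond `r`. -/
theorem IsReducedOffspring.isRootProb_one (hq : IsOffspringLaw q)
    (hp : p < 1) (h : IsReducedOffspring p q r θ q') {R : ℝ} (hR : IsRootProb 1 q' R) :
    IsRootProb 1 q (r * R) := by
  have hr := h.root.mem
  have hrθ := mul_pos h.root_pos h.theta_pos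
  have h0 := hR.eq
  rw [sub_self, zero_mul, h.psi_eq hR.mem, div_eq_zero_iff, or_iff_left hrθ.ne'] at h0
  refine ⟨⟨mul_nonneg hr.1 hR.mem.1, mul_le_one₀ hr.2 hR.mem.1 hR.mem.2⟩, by simpa using h0,
    fun x hx hx0 => ?_⟩
  rw [sub_self, zero_mul] at hx0
  have hxr : x ≤ r := by
    by_contra hlt
    rw [not_le] at hlt
    have hc : 0 < psi q r := by
      rw [h.root.eq]
      exact mul_pos (by linarith) hq.toReal_pos
    have := (convexOn_psi q).2 ⟨le_rfl, zero_le_one⟩ hx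
      (show 0 ≤ 1 - r / x by rw [sub_nonneg, div_le_one (by linarith [hr.1])]; linarith)
      (show 0 ≤ r / x from div_nonneg hr.1 hx.1) (by ring)
    simp only [smul_eq_mul, psi_zero, mul_zero, zero_add, hx0] at this
    rw [div_mul_cancel₀ _ (by linarith [hr.1])] at this
    linarith
  have hm : x / r ∈ Icc (0 : ℝ) 1 := ⟨div_nonneg hx.1 hr.1, (div_le_one h.root_pos).2 hxr⟩
  have := hR.le (x / r) hm (by
    rw [h.psi_eq hm, mul_div_cancel₀ _ h.root_pos.ne', hx0]
    simp)
  rwa [div_le_iff₀ h.root_pos, mul_comm] at this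

/-- Infinite subtrees have infinitely many individuals with a black leaf above them. -/
def InfiniteBlack (p : ℝ) (t : MTree) (col : List ℕ → Bool) : Prop :=
  ∀ u ∈ t.nodes, {v | u ++ v ∈ t.nodes}.Infinite → {v | u ++ v ∈ blackNodes p t col}.Infinite

/-- Two probabilities are compared. The tree is infinite with probability `r * R`. The set of black
individuals is infinite if the root is black and the reduced tree survives, which has probability `r
* R` as well. The second event is contained in the first, so they agree up to a null set. -/
theorem IsGWTreeLaw.ae_infiniteBlack (hq : IsOffspringLaw q) (h : IsGWTreeLaw q κ P)
    (hp : p ∈ Ico (0 : ℝ) 1) :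
    ∀ᵐ t ∂P, ∀ᵐ c ∂infinitePi fun _ : List ℕ => colourMeasure p, InfiniteBlack p t c := by
  have := h.isProb
  have hp' : p ∈ Icc (0 : ℝ) 1 := ⟨hp.1, hp.2.le⟩
  have := isProbabilityMeasure_colourMeasure hp'.1 hp'.2
  set ν := colourMeasure p with hν
  obtain ⟨r, hr⟩ : ∃ r, IsRootProb p q r := ⟨_, h.isRootProb hq hp'⟩
  have hr0 : 0 < r := hr.mem.1.lt_of_ne fun h0 => by
    have h1 := hr.eq
    rw [← h0, psi_zero] at h1
    exact (mul_pos (by linarith [hp.2]) hq.toReal_pos).ne h1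
  obtain ⟨θ, q', hθ⟩ := exists_isReducedOffspring hq hp' hr hr0
  obtain ⟨κ', -, hP'⟩ := h.reduce_of_isReducedOffspring hq hp' hθ
  have hq' := hθ.isOffspringLaw hq hp.2
  have := hP'.isProb
  obtain ⟨R, hR⟩ : ∃ R, IsRootProb 1 q' R := ⟨_, hP'.isRootProb hq' ⟨zero_le_one, le_rfl⟩⟩
  set A : Set ColTree := Prod.fst ⁻¹' {t : MTree | t.nodes.Infinite} with hA
  set D : Set ColTree := {x | (blackNodes p x.1 x.2).Infinite} with hD
  have hDm : MeasurableSet D := measurable_blackNodes p MeasurableSet.setOfPred_infinite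
  have hDA : D ⊆ A := fun x hx => Set.Infinite.mono (fun u hu => hu.1) hx
  have hmA : colTreeLaw P ν A = ofReal (r * R) := by
    rw [hA, colTreeLaw, ← Measure.fst_apply measurableSet_infinite, fst_prod,
      h.measure_infinite hq (hθ.isRootProb_one hq hp.2 hR)]
  have hmD : colTreeLaw P ν D = ofReal (r * R) := by
    have h1 := hP'.measure_infinite hq' hR
    have hu := (redMeasure_univ_eq hq hp' h hr).1
    rw [redTreeLaw, Measure.smul_apply, smul_eq_mul, hu, redMeasure_apply p _ measurableSet_infinite]
      at h1
    have hset : {x : ColTree | rootBlack p x} ∩ redTree p ⁻¹' {t : MTree | t.nodes.Infinite} = D := by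
      ext ⟨t, col⟩
      constructor
      · rintro ⟨hb, hx⟩
        exact (infinite_redTree_iff (u := []) hp.2 hb).1 hx
      · intro hx
        obtain ⟨u, hu⟩ := Set.Infinite.nonempty hx
        have hb : [] ∈ blackNodes p t col := mem_blackNodes_of_append (u := []) hu
        exact ⟨hb, (infinite_redTree_iff (u := []) hp.2 hb).2 hx⟩
    rw [hset] at h1
    rw [ofReal_mul hr.mem.1, ← h1, ← mul_assoc, ENNReal.mul_inv_cancel (by simpa using hr0)
      ofReal_ne_top, one_mul]
  have hnull : colTreeLaw P ν (A \ D) = 0 := by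
    rw [measure_sdiff hDA hDm.nullMeasurableSet (measure_ne_top _ _), hmA, hmD, tsub_self]
  have hae := h.ae_forall_nodes ν (φ := fun x u => {v | u ++ v ∈ x.1.nodes}.Infinite →
      {v | u ++ v ∈ blackNodes p x.1 x.2}.Infinite)
    (fun x i u hi hu => by
      rw [← above_blackNodes hi] at hu
      simp only [colChild, mem_child_nodes hi] at hu
      exact hu)
    (measurableSet_setOfPred.2 ((measurableSet_setOfPred.1 (measurable_fst
      measurableSet_infinite)).imp (measurableSet_setOfPred.1 hDm)))
    (by
      refine measure_mono_null (fun x hx => ?_) hnull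
      exact Classical.not_imp.1 hx)
  exact Measure.ae_ae_of_ae_prod hae

/-! ### From almost all trees to almost all forests -/

theorem IsGWILaw.ae_forest
    (hL : IsGWILaw q κ η χ L) {φ : MTree → Prop}
    (hφ : ∀ P, IsGWTreeLaw q κ P → ∀ᵐ t ∂P, φ t) :
    ∀ᵐ f ∂L, ∀ i m, φ ((f i).2.2 m) := by
  have := hL.isProb_gap
  obtain ⟨P, hP, hmap⟩ := hL.law
  have := hP.isProb
  have := bushLaw_univ η P
  -- The property `φ` need not be measurable, so the exceptional set is enlarged to a measurable
  -- null set.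
  set N := toMeasurable P {t | ¬ φ t}
  have hN : P N = 0 := (measure_toMeasurable _).trans (hφ P hP)
  have hsub : ∀ t, t ∉ N → φ t := fun t ht => not_not.1 fun h => ht (subset_toMeasurable P _ h)
  have hNm : MeasurableSet {b : Bush | ∀ m, b.2 m ∉ N} := by
    refine MeasurableSpace.measurableSet_iInf.2 fun n => ?_
    have : MeasurableSet {b : Fin n → MTree | ∀ m, b m ∉ N} :=
      measurableSet_setOfPred.2 (Measurable.forall fun m => (measurableSet_setOfPred.1
        ((measurable_pi_apply m) (measurableSet_toMeasurable P _))).not)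
    exact this
  have hB : ∀ᵐ b ∂bushLaw η P, ∀ m, b.2 m ∉ N := by
    refine Measure.ae_sum_iff.2 fun n => ?_
    refine Measure.ae_smul_measure ?_ _
    rw [ae_map_iff (measurable_sigma_mk n).aemeasurable hNm]
    refine (ae_all_iff (ι := Fin n) (p := fun (b : Fin n → MTree) m => b m ∉ N)).2 fun m => ?_
    exact (Measure.quasiMeasurePreserving_eval (fun _ : Fin n => P) m).ae (p := fun t => t ∉ N) (measure_eq_zero_iff_ae_notMem.1 hN)
  refine ae_all_iff.2 fun i => ?_
  have h2 := (Measure.quasiMeasurePreserving_snd (μ := χ)).ae hB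
  rw [← hmap i] at h2
  have hm : Measurable fun f : Forest => (gap f i, (f i).2) :=
    (measurable_gap i).prodMk (measurable_snd.comp (measurable_pi_apply i))
  filter_upwards [ae_of_ae_map hm.aemeasurable h2] with f hf m
  exact hsub _ (hf m)

/-! ### Reduction of forests in two steps -/

open Classical in
theorem count_orderEmbOfFin {I : Finset (Fin n)} {K : ℕ → Prop}
    (hK : ∀ j, K j ↔ ∃ h : j < n, (⟨j, h⟩ : Fin n) ∈ I) (m : Fin I.card) :
    count K (I.orderEmbOfFin rfl m : Fin n) = m := by
  rw [Nat.count_eq_card_filter_range]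
  have : (Finset.range (I.orderEmbOfFin rfl m : Fin n)).filter K
      = (Finset.Iio m).map ((I.orderEmbOfFin rfl).toEmbedding.trans Fin.valEmbedding) := by
    ext j
    simp only [Finset.mem_filter, Finset.mem_range, Finset.mem_map, Finset.mem_Iio, hK]
    constructor
    · rintro ⟨hj, hn, hI⟩
      obtain ⟨a, ha⟩ : (⟨j, hn⟩ : Fin n) ∈ Set.range (I.orderEmbOfFin rfl) := by
        rw [Finset.range_orderEmbOfFin]
        exact hI
      refine ⟨a, (I.orderEmbOfFin rfl).lt_iff_lt.1 ?_, congrArg Fin.val ha⟩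
      rw [ha]
      exact hj
    · rintro ⟨a, ha, rfl⟩
      exact ⟨(I.orderEmbOfFin rfl).lt_iff_lt.2 ha, Fin.is_lt _, I.orderEmbOfFin_mem rfl a⟩
  rw [this, card_map, Fin.card_Iio]

theorem redBush_eq {x : Fin n → ColTree} (h : (blackIdx p x).card = k) :
    redBush p x = ⟨k, fun m => redTree p (x ((blackIdx p x).orderEmbOfFin h m))⟩ := by
  subst h
  rfl

/-- The index set of the second selection is the image of that within the first one, and the
increasing enumeration of a finite set is unique. -/
theorem redBush_redBush {p₁ p₂ : ℝ} {x₁ x₂ : Fin n → ColTree} {c' : ℕ → List ℕ → Bool}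
    (h1 : ∀ i, rootBlack p₂ (x₂ i) → rootBlack p₁ (x₁ i))
    (h2 : ∀ m : Fin (blackIdx p₁ x₁).card,
      rootBlack p' (redTree p₁ (x₁ ((blackIdx p₁ x₁).orderEmbOfFin rfl m)), c' m) ↔
        rootBlack p₂ (x₂ ((blackIdx p₁ x₁).orderEmbOfFin rfl m)))
    (h3 : ∀ m : Fin (blackIdx p₁ x₁).card,
      rootBlack p₂ (x₂ ((blackIdx p₁ x₁).orderEmbOfFin rfl m)) →
        redTree p' (redTree p₁ (x₁ ((blackIdx p₁ x₁).orderEmbOfFin rfl m)), c' m) =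
          redTree p₂ (x₂ ((blackIdx p₁ x₁).orderEmbOfFin rfl m))) :
    redBush p' (fun m : Fin (redBush p₁ x₁).1 => ((redBush p₁ x₁).2 m, c' m)) = redBush p₂ x₂ := by
  set e := (blackIdx p₁ x₁).orderEmbOfFin rfl with he
  set x' : Fin (blackIdx p₁ x₁).card → ColTree := fun m => (redTree p₁ (x₁ (e m)), c' m) with hx'
  change redBush p' x' = redBush p₂ x₂
  have hI : blackIdx p₂ x₂ = (blackIdx p' x').map e.toEmbedding := by
    ext i
    rw [mem_keptIdx, Finset.mem_map]
    constructor
    · intro hi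
      obtain ⟨a, ha⟩ : i ∈ Set.range e := by
        rw [he, Finset.range_orderEmbOfFin]
        exact mem_keptIdx.2 (h1 i hi)
      exact ⟨a, mem_keptIdx.2 ((h2 a).2 (by rw [ha]; exact hi)), ha⟩
    · rintro ⟨a, ha, rfl⟩
      exact (h2 a).1 (mem_keptIdx.1 ha)
  have hc : (blackIdx p₂ x₂).card = (blackIdx p' x').card := by rw [hI, card_map]
  rw [redBush_eq hc, redBush]
  congr 1
  funext m
  have hm := congrFun (Finset.orderEmbOfFin_unique hc
    (f := fun m => e ((blackIdx p' x').orderEmbOfFin rfl m)) (fun m => by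
      rw [hI]
      exact Finset.mem_map_of_mem _ (orderEmbOfFin_mem _ rfl m))
    (fun a b hab => by simpa using hab)) m
  rw [← hm]
  refine h3 _ ((h2 _).1 ?_)
  exact mem_keptIdx.1 (orderEmbOfFin_mem (blackIdx p' x') rfl m)

/-- The bush that immigrates at the `i`-th immigration does not disappear in the reduction. -/
def keptAt (p : ℝ) (f : Forest) (col : Colouring) (i : ℕ) : Prop :=
  (reduceBush p (f i).2 fun j u => col (i, j, u)).1 ≠ 0

/-- The `j`-th tree of the `i`-th bush. -/
def treeAt (f : Forest) (i j : ℕ) : MTree := (bushCode (f i).2).2 j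

theorem treeAt_fin (f : Forest) (i : ℕ) (j : Fin (f i).2.1) : treeAt f i j = (f i).2.2 j := by
  rw [treeAt, bushCode]
  exact dif_pos j.2

/-- The `j`-th tree of the `i`-th bush does not disappear in the reduction. -/
def blackAt (p : ℝ) (f : Forest) (col : Colouring) (i j : ℕ) : Prop :=
  j < (f i).2.1 ∧ rootBlack p (treeAt f i j, fun u => col (i, j, u))

theorem blackAt_iff :
    blackAt p f col i j ↔ ∃ h : j < (f i).2.1, (⟨j, h⟩ : Fin (f i).2.1) ∈
      blackIdx p fun j : Fin (f i).2.1 => ((f i).2.2 j, fun u => col (i, j, u)) := by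
  have h : ∀ h : j < (f i).2.1, treeAt f i j = (f i).2.2 ⟨j, h⟩ := fun h => treeAt_fin f i ⟨j, h⟩
  simp only [mem_keptIdx]
  exact ⟨fun ⟨h1, h2⟩ => ⟨h1, h h1 ▸ h2⟩, fun ⟨h1, h2⟩ => ⟨h1, (h h1).symm ▸ h2⟩⟩

theorem keptAt_iff : keptAt p f col i ↔
    ∃ j : Fin (f i).2.1, rootBlack p ((f i).2.2 j, fun u => col (i, j, u)) := by
  rw [keptAt, reduceBush_eq]
  change (blackIdx p _).card ≠ 0 ↔ _
  rw [Finset.card_ne_zero]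
  exact ⟨fun ⟨j, hj⟩ => ⟨j, mem_keptIdx.1 hj⟩, fun ⟨j, hj⟩ => ⟨j, mem_keptIdx.2 hj⟩⟩

open Classical in
theorem reduceForest_apply (p : ℝ) (f : Forest) (col : Colouring) (n : ℕ) : reduceForest p f col n =
    if ∃ i, keptAt p f col i ∧ count (keptAt p f col) i = n then
      ((f (nth (keptAt p f col) n)).1, reduceBush p (f (nth (keptAt p f col) n)).2
        fun j u => col (nth (keptAt p f col) n, j, u))
    else noEntry := ite_count_congr (fun _ => Iff.rfl) rfl

open Classical in
theorem reduceForest_count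
    (h : keptAt p f col i) : reduceForest p f col (count (keptAt p f col) i)
      = ((f i).1, reduceBush p (f i).2 fun j u => col (i, j, u)) := by
  rw [reduceForest_apply, if_pos ⟨i, h, rfl⟩, Nat.nth_count h]

open Classical in
theorem reduceForest_of_not
    (h : ¬ ∃ i, keptAt p f col i ∧ count (keptAt p f col) i = n) :
    reduceForest p f col n = noEntry := by
  rw [reduceForest_apply, if_neg h]

theorem spines_of_le {t : MTree} {col : List ℕ → Bool} (hp : p ≤ 1)
    (h : p = 1 → FiniteInfiniteSpines t) (hb : [] ∈ blackNodes p t col) :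
    ∀ v ∈ blackNodes p t col, ∃ i,
      numChildren (blackNodes p t col) (spine (blackNodes p t col) v i) ≠ 1 := by
  rcases hp.lt_or_eq with hp | rfl
  · exact (isTreeSet_blackNodes_of_lt hp hb).finiteSpine
  · exact h rfl col

open Classical in
-- Bushes and trees of the reduced forest are addressed in `col'` by their ranks among the surviving
-- ones; `count_count` composes the two numberings of the bushes. Finite lines are an extra
-- hypothesis only in the case of infinite descent.
theorem reduceForest_reduceForest {p₁ p₂ : ℝ} {col₁ col₂ col' : Colouring}
    (h₁ : p₁ < 1) (h₂ : p₂ ≤ 1) (h' : p' ≤ 1)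
    (hC : ∀ i (j : Fin (f i).2.1), Corresponds p₁ p₂ p' ((f i).2.2 j) (fun u => col₁ (i, j, u))
      (fun u => col₂ (i, j, u)) fun w => col' (count (keptAt p₁ f col₁) i,
        count (blackAt p₁ f col₁ i) j, w))
    (hs₂ : p₂ = 1 → ∀ i j, FiniteInfiniteSpines ((f i).2.2 j))
    (hs' : p' = 1 → ∀ n m, FiniteInfiniteSpines ((reduceForest p₁ f col₁ n).2.2 m)) :
    reduceForest p' (reduceForest p₁ f col₁) col' = reduceForest p₂ f col₂ := by
  set f₁ := reduceForest p₁ f col₁ with hf₁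
  have hsub : ∀ i, keptAt p₂ f col₂ i → keptAt p₁ f col₁ i := by
    intro i hi
    obtain ⟨j, hj⟩ := keptAt_iff.1 hi
    exact keptAt_iff.2 ⟨j, ((hC i j).rootBlack_iff.1 hj).1⟩
  have hbush : ∀ i, keptAt p₁ f col₁ i →
      reduceBush p' (f₁ (count (keptAt p₁ f col₁) i)).2
        (fun j u => col' (count (keptAt p₁ f col₁) i, j, u))
      = reduceBush p₂ (f i).2 fun j u => col₂ (i, j, u) := by
    intro i hi
    have hsp := fun hp m => hs' hp (count (keptAt p₁ f col₁) i) m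
    rw [hf₁, reduceForest_count hi] at hsp ⊢
    simp only at hsp ⊢
    rw [reduceBush_eq p₁] at hsp ⊢
    rw [reduceBush_eq p', reduceBush_eq p₂]
    set x₁ : Fin (f i).2.1 → ColTree := fun j => ((f i).2.2 j, fun u => col₁ (i, j, u)) with hx₁
    have hC' : ∀ m : Fin (blackIdx p₁ x₁).card, Corresponds p₁ p₂ p'
        ((f i).2.2 ((blackIdx p₁ x₁).orderEmbOfFin rfl m))
        (fun u => col₁ (i, ((blackIdx p₁ x₁).orderEmbOfFin rfl m : Fin (f i).2.1), u))
        (fun u => col₂ (i, ((blackIdx p₁ x₁).orderEmbOfFin rfl m : Fin (f i).2.1), u))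
        (fun w => col' (count (keptAt p₁ f col₁) i, m, w)) := by
      intro m
      have := hC i ((blackIdx p₁ x₁).orderEmbOfFin rfl m)
      rwa [count_orderEmbOfFin fun j => blackAt_iff] at this
    have hb₁ : ∀ m : Fin (blackIdx p₁ x₁).card,
        rootBlack p₁ (x₁ ((blackIdx p₁ x₁).orderEmbOfFin rfl m)) := fun m =>
      mem_keptIdx.1 (orderEmbOfFin_mem (blackIdx p₁ x₁) rfl m)
    refine redBush_redBush (x₁ := x₁)
      (c' := fun j u => col' (count (keptAt p₁ f col₁) i, j, u))
      (fun j hj => ((hC i j).rootBlack_iff.1 hj).1) (fun m => ?_)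
      fun m hm => ?_
    · exact ⟨fun h => (hC' m).rootBlack_iff.2 ⟨hb₁ m, h⟩,
        fun h => ((hC' m).rootBlack_iff.1 h).2⟩
    · exact (hC' m).redTree_redTree h₁ hm (spines_of_le h₂ (fun h => hs₂ h i _) hm)
        (spines_of_le h' (fun h => hsp h m) ((hC' m).rootBlack_iff.1 hm).2)
  have hiff : ∀ i, keptAt p₁ f col₁ i →
      (keptAt p' f₁ col' (count (keptAt p₁ f col₁) i) ↔ keptAt p₂ f col₂ i) := by
    intro i hi
    rw [keptAt, keptAt, hbush i hi]
  have hloc : ∀ n, keptAt p' f₁ col' n →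
      ∃ i, keptAt p₁ f col₁ i ∧ count (keptAt p₁ f col₁) i = n := by
    intro n hn
    by_contra h
    obtain ⟨j, -⟩ := keptAt_iff.1 hn
    rw [hf₁, reduceForest_of_not h] at j
    exact j.elim0
  funext m
  by_cases hm : ∃ i, keptAt p₂ f col₂ i ∧ count (keptAt p₂ f col₂) i = m
  · obtain ⟨i, hi, rfl⟩ := hm
    have hi₁ := hsub i hi
    rw [reduceForest_count hi, ← count_count hsub hiff i, reduceForest_count ((hiff i hi₁).2 hi),
      hbush i hi₁, hf₁, reduceForest_count hi₁]
  · rw [reduceForest_of_not hm, reduceForest_of_not]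
    rintro ⟨n, hn, rfl⟩
    obtain ⟨i, hi, rfl⟩ := hloc n hn
    exact hm ⟨i, (hiff i hi).1 hn, (count_count hsub hiff i).symm⟩

open Classical in
/-- The leaf of the forest that ends the line merged into the leaf `k` of the reduced forest. -/
def leafIndex (p : ℝ) (x : Forest × Colouring) (k : ℕ × ℕ × List ℕ) :
    Option (ℕ × ℕ × List ℕ) :=
  let i := nth (keptAt p x.1 x.2) k.1
  let j := nth (blackAt p x.1 x.2 i) k.2.1
  -- The conditions detect the default value `0` of `Nat.nth`, which occurs when there is no such
  -- bush or tree.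
  if keptAt p x.1 x.2 i ∧ count (keptAt p x.1 x.2) i = k.1 ∧ blackAt p x.1 x.2 i j ∧
      count (blackAt p x.1 x.2 i) j = k.2.1 then
    (leafOf (blackNodes p (treeAt x.1 i j) fun u => x.2 (i, j, u)) k.2.2).map fun e => (i, j, e)
  else none

open Classical in
theorem leafIndex_eq_some {x : Forest × Colouring} {k : ℕ × ℕ × List ℕ}
    {e : List ℕ} : leafIndex p x k = some (i, j, e) ↔ keptAt p x.1 x.2 i ∧
      count (keptAt p x.1 x.2) i = k.1 ∧ blackAt p x.1 x.2 i j ∧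
      count (blackAt p x.1 x.2 i) j = k.2.1 ∧
      leafOf (blackNodes p (treeAt x.1 i j) fun u => x.2 (i, j, u)) k.2.2 = some e := by
  simp only [leafIndex]
  constructor
  · intro h
    split_ifs at h with hc
    obtain ⟨e', he', h⟩ := Option.map_eq_some_iff.1 h
    simp only [Prod.mk.injEq] at h
    obtain ⟨rfl, rfl, rfl⟩ := h
    exact ⟨hc.1, hc.2.1, hc.2.2.1, hc.2.2.2, he'⟩
  · rintro ⟨h1, h2, h3, h4, h5⟩
    rw [nth_eq_of_count h1 h2, nth_eq_of_count h3 h4, if_pos ⟨h1, h2, h3, h4⟩, h5]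
    rfl

/-- Different leaves of the reduced forest inherit from different leaves, since the ranks and
`rename` recover the new address. Without this the inherited marks would not be independent. -/
theorem leafIndex_injective (hp : p < 1) {x : Forest × Colouring} {k k' : ℕ × ℕ × List ℕ}
    {y : ℕ × ℕ × List ℕ} (h : leafIndex p x k = some y) (h' : leafIndex p x k' = some y) :
    k = k' := by
  obtain ⟨i, j, e⟩ := y
  obtain ⟨-, h1, hb, h2, h3⟩ := leafIndex_eq_some.1 h
  obtain ⟨-, h1', -, h2', h3'⟩ := leafIndex_eq_some.1 h'
  obtain ⟨v, hv, -, rfl⟩ := leafOf_eq_some.1 h3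
  obtain ⟨v', hv', -, he⟩ := leafOf_eq_some.1 h3'
  have hS := isTreeSet_blackNodes_of_lt hp hb.2
  have h4 := hS.rename_spineEnd hv'
  rw [he, hS.rename_spineEnd hv] at h4
  exact Prod.ext (h1.symm.trans h1') (Prod.ext (h2.symm.trans h2') h4)

theorem reduceForest_reduceForest_of_lt {p₁ p₂ : ℝ} {col₁ col₂ col' : Colouring}
    (h₁ : p₁ < 1) (h₂ : p₂ < 1) (h' : p' < 1) (hle : ∀ y, col₂ y = true → col₁ y = true)
    (hcol : ∀ k y, leafIndex p₁ (f, col₁) k = some y → col' k = col₂ y) :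
    reduceForest p' (reduceForest p₁ f col₁) col' = reduceForest p₂ f col₂ := by
  classical
  refine reduceForest_reduceForest h₁ h₂.le h'.le (fun i j => ?_) (fun h => absurd h h₂.ne)
    fun h => absurd h h'.ne
  refine corresponds_of_lt h₁ h₂ h' (fun u => hle _) fun hb w e he => ?_
  have hbl : blackAt p₁ f col₁ i j := ⟨j.2, by rw [treeAt_fin]; exact hb⟩
  refine hcol _ (i, j, e) (leafIndex_eq_some.2 ⟨keptAt_iff.2 ⟨j, hb⟩, rfl, hbl,
    rfl, by rw [treeAt_fin]; exact he⟩)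

theorem reduceForest_reduceForest_one {p₁ : ℝ} {col₁ col₂ col' : Colouring}
    (h₁ : p₁ < 1)
    (hinf : ∀ i (j : Fin (f i).2.1), InfiniteBlack p₁ ((f i).2.2 j) fun u => col₁ (i, j, u))
    (hs₂ : ∀ i j, FiniteInfiniteSpines ((f i).2.2 j))
    (hs' : ∀ n m, FiniteInfiniteSpines ((reduceForest p₁ f col₁ n).2.2 m)) :
    reduceForest 1 (reduceForest p₁ f col₁) col' = reduceForest 1 f col₂ := by
  classical
  exact reduceForest_reduceForest h₁ le_rfl le_rfl (fun i j => corresponds_one h₁ (hinf i j))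
    (fun _ => hs₂) fun _ => hs'

/-! ### Leaves with uniform marks -/

theorem measurable_leafOf (w : List ℕ) : Measurable fun S : Set (List ℕ) => leafOf S w := by
  classical
  refine measurable_countable_comp (g := fun (o : Option (List ℕ)) S => o.bind fun v =>
    if numChildren S (spineEnd S v) = 0 then some (spineEnd S v) else none) (measurable_locate w)
    fun o => ?_
  cases o with
  | none => exact measurable_const
  | some v =>
    simp only [Option.bind_some]
    have h1 : Measurable fun S : Set (List ℕ) => numChildren S (spineEnd S v) :=
      measurable_countable_comp (g := fun u S => numChildren S u) (measurable_spineEnd v)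
        measurable_numChildren
    exact Measurable.ite (h1 (measurableSet_singleton 0))
      ((measurable_of_countable (some : List ℕ → Option (List ℕ))).comp (measurable_spineEnd v))
      measurable_const

/-- The leaves and other individuals of a forest. -/
abbrev Idx : Type := ℕ × ℕ × List ℕ

instance : MeasurableSpace (Option Idx) := ⊤

instance : DiscreteMeasurableSpace (Option Idx) := ⟨fun _ => trivial⟩

theorem measurable_treeAt (i j : ℕ) : Measurable fun f : Forest => treeAt f i j :=
  (measurable_pi_apply j).comp (measurable_snd.comp (measurableEmbedding_bushCode.measurable.comp
    (measurable_snd.comp (measurable_pi_apply i))))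

theorem measurable_colTreeAt (i j : ℕ) : Measurable fun x : Forest × Colouring =>
    ((treeAt x.1 i j, fun u => x.2 (i, j, u)) : ColTree) :=
  ((measurable_treeAt i j).comp measurable_fst).prodMk (by fun_prop)

theorem measurable_size (i : ℕ) : Measurable fun f : Forest => (f i).2.1 :=
  measurable_bush_size.comp (measurable_snd.comp (measurable_pi_apply i))

theorem measurable_keptAt (p : ℝ) :
    Measurable fun x : Forest × Colouring => {i | keptAt p x.1 x.2 i} :=
  measurable_nonemptyAt.comp (measurable_redSeq p)

theorem measurable_blackAt (p : ℝ) (i : ℕ) :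
    Measurable fun x : Forest × Colouring => {j | blackAt p x.1 x.2 i j} := by
  refine measurable_set_iff.2 fun j => Measurable.and ?_ ?_
  · exact measurableSet_setOfPred.1 (measurableSet_lt measurable_const
      ((measurable_size i).comp measurable_fst))
  · exact measurableSet_setOfPred.1 (measurable_colTreeAt i j (measurableSet_rootBlack p))

theorem measurable_leafIndex (p : ℝ) (k : Idx) :
    Measurable fun x : Forest × Colouring => leafIndex p x k := by
  classical
  let g : ℕ → ℕ → Forest × Colouring → Option Idx := fun i j x =>
    if keptAt p x.1 x.2 i ∧ count (keptAt p x.1 x.2) i = k.1 ∧ blackAt p x.1 x.2 i j ∧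
      count (blackAt p x.1 x.2 i) j = k.2.1 then
    (leafOf (blackNodes p (treeAt x.1 i j) fun u => x.2 (i, j, u)) k.2.2).map fun e => (i, j, e)
    else none
  have hg : ∀ i j, Measurable (g i j) := fun i j => by
    refine Measurable.ite (measurableSet_setOfPred.2 (Measurable.and ?_ (Measurable.and ?_
      (Measurable.and ?_ ?_)))) ?_ measurable_const
    · exact (measurable_set_iff.1 (measurable_keptAt p)) i
    · exact ((measurable_count i).comp (measurable_keptAt p)).eq_const k.1
    · exact (measurable_set_iff.1 (measurable_blackAt p i)) j
    · exact ((measurable_count j).comp (measurable_blackAt p i)).eq_const k.2.1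
    · exact (measurable_of_countable (Option.map fun e => ((i, j, e) : Idx))).comp
        ((measurable_leafOf k.2.2).comp ((measurable_blackNodes p).comp (measurable_colTreeAt i j)))
  have h1 : ∀ i, Measurable fun x : Forest × Colouring =>
      g i (nth (blackAt p x.1 x.2 i) k.2.1) x := fun i =>
    measurable_countable_comp (g := g i) ((measurable_nth k.2.1).comp (measurable_blackAt p i)) (hg i)
  exact measurable_countable_comp (g := fun i (x : Forest × Colouring) =>
    g i (nth (blackAt p x.1 x.2 i) k.2.1) x) ((measurable_nth k.1).comp (measurable_keptAt p)) h1

theorem leafIndex_colour (hp : p < 1) {x : Forest × Colouring} {k y : Idx}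
    (h : leafIndex p x k = some y) : x.2 y = true := by
  obtain ⟨i, j, e⟩ := y
  obtain ⟨-, -, hb, -, h3⟩ := leafIndex_eq_some.1 h
  obtain ⟨v, hv, h0, rfl⟩ := leafOf_eq_some.1 h3
  exact ((numChildren_blackNodes_eq_zero hp (spine_mem (locate_mem hb.2 _ v hv) _ le_rfl)).1 h0).2

/-- The uniform law on `[0, 1)`. -/
def unif : Measure ℝ := volume.restrict (Ico 0 1)

instance : IsProbabilityMeasure unif := ⟨by simp [unif]⟩

/-- Independent uniform marks. -/
def markLaw : Measure (Idx → ℝ) := infinitePi fun _ => unif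

instance : IsProbabilityMeasure markLaw := by unfold markLaw; infer_instance

/-- The colouring in which the leaves with a mark below `t` are black. -/
def markColour (t : ℝ) (U : Idx → ℝ) : Colouring := fun y => decide (U y < t)

theorem measurable_decide_lt (t : ℝ) : Measurable fun u : ℝ => decide (u < t) := by
  refine measurable_to_bool ?_
  convert measurableSet_Iio (a := t) using 1
  ext u
  simp

theorem measurable_markColour (t : ℝ) : Measurable (markColour t) :=
  measurable_pi_lambda _ fun y => (measurable_decide_lt t).comp (measurable_pi_apply y)

/-- A uniform mark conditioned to lie below `s` becomes uniform after division by `s`. -/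
theorem unif_Iio_inter (h0 : 0 < s) (h1 : s ≤ 1) {B : Set ℝ} (hB : MeasurableSet B) :
    unif {u | u < s ∧ u / s ∈ B} = ofReal s * unif B := by
  have hm : MeasurableSet {u : ℝ | u < s ∧ u / s ∈ B} :=
    measurableSet_Iio.inter ((measurable_id.div_const s) hB)
  rw [unif, Measure.restrict_apply hm, Measure.restrict_apply hB]
  have : {u | u < s ∧ u / s ∈ B} ∩ Ico 0 1 = (fun u => u * s⁻¹) ⁻¹' (B ∩ Ico 0 1) := by
    ext u
    simp only [mem_inter_iff, mem_ofPred_eq, mem_Ico, mem_preimage, ← div_eq_mul_inv,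
      div_lt_one h0, div_nonneg_iff]
    constructor
    · rintro ⟨⟨h2, h3⟩, h4, -⟩
      exact ⟨h3, Or.inl ⟨h4, h0.le⟩, h2⟩
    · rintro ⟨h3, h4, h2⟩
      exact ⟨⟨h2, h3⟩, h4.elim (fun h => h.1) fun h => absurd h.2 (not_le.2 h0), by linarith⟩
  rw [this, Real.volume_preimage_mul_right (inv_ne_zero h0.ne'), inv_inv, abs_of_pos h0]

theorem unif_Iio {t : ℝ} (h1 : t ≤ 1) : unif (Iio t) = ofReal t := by
  rw [unif, Measure.restrict_apply measurableSet_Iio, inter_comm, Ico_inter_Iio, min_eq_right h1,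
    Real.volume_Ico, sub_zero]

theorem unif_Ici {t : ℝ} (h0 : 0 ≤ t) (h1 : t ≤ 1) : unif (Ici t) = ofReal (1 - t) := by
  rw [← compl_Iio, prob_compl_eq_one_sub measurableSet_Iio, unif_Iio h1,
    ofReal_sub _ h0, ofReal_one]

theorem colourMeasure_apply (p : ℝ) (A : Set Bool) : colourMeasure p A =
    ofReal p * A.indicator 1 false + ofReal (1 - p) * A.indicator 1 true := by
  simp [colourMeasure]

theorem map_decide_unif {t : ℝ} (h0 : 0 ≤ t) (h1 : t ≤ 1) :
    unif.map (fun u => decide (u < t)) = colourMeasure (1 - t) := by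
  refine Measure.ext_of_singleton fun b => ?_
  rw [map_apply (measurable_decide_lt t) (measurableSet_singleton b), colourMeasure_apply]
  cases b
  · have : (fun u => decide (u < t)) ⁻¹' {false} = Ici t := by ext u; simp
    rw [this, unif_Ici h0 h1]
    simp
  · have : (fun u => decide (u < t)) ⁻¹' {true} = Iio t := by ext u; simp
    rw [this, unif_Iio h1]
    simp

theorem map_markColour {t : ℝ} (h0 : 0 ≤ t) (h1 : t ≤ 1) :
    markLaw.map (markColour t) = colourLaw (1 - t) := by
  have := infinitePi_map_pi (μ := fun _ : Idx => unif)
    (f := fun _ u => decide (u < t)) fun _ => measurable_decide_lt t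
  simp only [map_decide_unif h0 h1] at this
  exact this

/-- The colour of a mark, and a new mark: a mark below `s` is rescaled. -/
def splitMark (s : ℝ) (z : ℝ × ℝ) : Bool × ℝ := (decide (z.1 < s), if z.1 < s then z.1 / s else z.2)

theorem measurable_splitMark (s : ℝ) : Measurable (splitMark s) :=
  ((measurable_decide_lt s).comp measurable_fst).prodMk (Measurable.ite
    (measurable_fst measurableSet_Iio) (measurable_fst.div_const s) measurable_snd)

/-- The new mark is uniform given either colour: rescaled below `s`, fresh above. Hence it is
independent of the colour. -/
theorem map_splitMark (h0 : 0 < s) (h1 : s ≤ 1) :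
    (unif.prod unif).map (splitMark s) = (colourMeasure (1 - s)).prod unif := by
  classical
  have := isProbabilityMeasure_colourMeasure (p := 1 - s) (by linarith) (by linarith)
  refine (Measure.prod_eq fun A B hA hB => ?_).symm
  rw [map_apply (measurable_splitMark s) (hA.prod hB), ← measure_inter_add_sdiff _
    (measurable_fst (measurableSet_Iio (a := s)))]
  have e1 : splitMark s ⁻¹' A ×ˢ B ∩ Prod.fst ⁻¹' Iio s
      = {u | u < s ∧ u / s ∈ B} ×ˢ {_v : ℝ | true ∈ A} := by
    ext ⟨u, v⟩
    by_cases hu : u < s <;> simp [splitMark, hu, and_comm]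
  have e2 : (splitMark s ⁻¹' A ×ˢ B) \ Prod.fst ⁻¹' Iio s = {u | s ≤ u ∧ false ∈ A} ×ˢ B := by
    ext ⟨u, v⟩
    by_cases hu : u < s
    · simp [splitMark, hu]
    · simp [splitMark, hu, not_lt.1 hu]
  rw [e1, e2, prod_prod, prod_prod, unif_Iio_inter h0 h1 hB, colourMeasure_apply,
    sub_sub_cancel]
  have h2 := unif_Ici h0.le h1
  rw [show Ici s = {u | s ≤ u} from rfl] at h2
  by_cases ht : true ∈ A <;> by_cases hf : false ∈ A <;> (simp [ht, hf, h2]; try ring)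

theorem map_splitMarks (h0 : 0 < s) (h1 : s ≤ 1) :
    (markLaw.prod markLaw).map (fun z => (markColour s z.1, fun y => (splitMark s (z.1 y, z.2 y)).2))
      = (colourLaw (1 - s)).prod markLaw := by
  have := isProbabilityMeasure_colourMeasure (p := 1 - s) (by linarith) (by linarith)
  have hs := measurable_splitMark s
  have e1 := infinitePi_prod_map_zip (fun _ : Idx => colourMeasure (1 - s)) fun _ => unif
  have e2 := infinitePi_map_pi (μ := fun _ : Idx => unif.prod unif)
    (f := fun _ => splitMark s) fun _ => hs
  have e3 := infinitePi_prod_map_zip (fun _ : Idx => unif) fun _ => unif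
  simp only [map_splitMark h0 h1] at e2
  have hz : ∀ ρ : Measure ((Idx → Bool) × (Idx → ℝ)),
      (ρ.map fun x i => (x.1 i, x.2 i)).map (fun w => (fun i => (w i).1, fun i => (w i).2)) = ρ := by
    intro ρ
    rw [map_map (by fun_prop) (by fun_prop)]
    exact map_id
  rw [← hz ((colourLaw (1 - s)).prod markLaw)]
  have e4 : ((colourLaw (1 - s)).prod markLaw).map (fun x i => (x.1 i, x.2 i)) = _ := e1
  have hpi : Measurable fun (x : Idx → ℝ × ℝ) i => splitMark s (x i) :=
    measurable_pi_lambda _ fun i => hs.comp (measurable_pi_apply i)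
  have hun : Measurable fun w : Idx → Bool × ℝ => (fun i => (w i).1, fun i => (w i).2) := by
    fun_prop
  rw [e4, ← e2, ← e3, map_map hun hpi, map_map (hun.comp hpi) (by fun_prop)]
  rfl

/-- Choosing coordinates of an independent uniform field without repetition gives such a field
again. -/
theorem map_relabel {τ : Idx → Option Idx} (hτ : ∀ k k' y, τ k = some y → τ k' = some y → k = k') :
    (markLaw.prod markLaw).map (fun z k => (τ k).elim (z.2 k) z.1) = markLaw := by
  have e1 := infinitePi_map_curry (fun (_ : Bool) (_ : Idx) => unif)
  have e2 := Measure.infinitePi_map_eval_prod (P := fun _ : Bool => markLaw) (i := true)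
    (j := false) (by decide)
  -- Both mark fields are viewed as one field over `Bool × Idx`; inherited marks use the copy
  -- `true`, fresh ones the copy `false`.
  let g : Idx → Bool × Idx := fun k => (τ k).elim (false, k) fun y => (true, y)
  have hg : Function.Injective g := by
    intro k k' h
    simp only [g] at h
    cases hk : τ k <;> cases hk' : τ k' <;> simp only [hk, hk', Option.elim, Prod.mk.injEq] at h
    · exact h.2
    · exact absurd h.1 (by decide)
    · exact absurd h.1 (by decide)
    · exact hτ k k' _ hk (hk'.trans (congrArg some h.2.symm))
  have hm : Measurable fun (z : (Idx → ℝ) × (Idx → ℝ)) k => (τ k).elim (z.2 k) z.1 := by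
    refine measurable_pi_lambda _ fun k => ?_
    cases τ k <;> simp only [Option.elim] <;> fun_prop
  have e3 : (infinitePi fun _ : Bool => markLaw)
    = (infinitePi fun _ : Bool × Idx => unif).map (MeasurableEquiv.curry Bool Idx ℝ) := e1.symm
  rw [← e2, e3, map_map hm (by fun_prop), map_map (hm.comp (by fun_prop))
    (by fun_prop), markLaw, ← Measure.map_infinitePi_infinitePi_of_inj (P := fun _ => unif) hg]
  congr 1
  funext W k
  simp only [Function.comp_apply, g]
  cases τ k <;> rfl

/-- Independent variables of which the second is only transformed by a measure preserving map that
depends on the first. -/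
theorem map_prod_of_forall {X W Y Z : Type*} [MeasurableSpace X] [MeasurableSpace W]
    [MeasurableSpace Y] [MeasurableSpace Z] {ρ : Measure X} [IsProbabilityMeasure ρ] {N : Measure W}
    [IsProbabilityMeasure N] {N' : Measure Z} [IsProbabilityMeasure N'] {g : X → Y}
    {r : X × W → Z} (hg : Measurable g) (hr : Measurable r)
    (h : ∀ x, N.map (fun w => r (x, w)) = N') :
    (ρ.prod N).map (fun z => (g z.1, r z)) = (ρ.map g).prod N' := by
  have := isProbabilityMeasure_map (μ := ρ) hg.aemeasurable
  refine (Measure.prod_eq fun A B hA hB => ?_).symm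
  have hm : Measurable fun z : X × W => (g z.1, r z) := (hg.comp measurable_fst).prodMk hr
  rw [map_apply hm (hA.prod hB), Measure.prod_apply (hm (hA.prod hB)),
    map_apply hg hA]
  have : ∀ x, N (Prod.mk x ⁻¹' ((fun z : X × W => (g z.1, r z)) ⁻¹' A ×ˢ B))
      = (g ⁻¹' A).indicator (fun _ => N' B) x := by
    intro x
    by_cases hx : g x ∈ A
    · rw [indicator_of_mem (mem_preimage.2 hx), ← h x, map_apply (by fun_prop) hB]
      congr 1
      ext w
      simp [hx]
    · rw [indicator_of_notMem (s := g ⁻¹' A) hx]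
      convert measure_empty (μ := N)
      ext w
      simp [hx]
  simp_rw [this]
  rw [lintegral_indicator_const (hg hA), mul_comm]

/-! ### Forests with marks -/

/-- The reduction of a marked forest in which the leaves with a mark below `t` are black. -/
def redMark (t : ℝ) (g : Forest × (Idx → ℝ)) : Forest := reduceForest (1 - t) g.1 (markColour t g.2)

theorem measurable_redMark (t : ℝ) : Measurable (redMark t) :=
  (measurable_reduceForest (1 - t)).comp
    (measurable_fst.prodMk ((measurable_markColour t).comp measurable_snd))

/-- The marks of the reduced forest: those of the leaves are inherited, the others are new. -/
def relabel (p : ℝ) (z : (Forest × Colouring) × (Idx → ℝ) × (Idx → ℝ)) : Idx → ℝ :=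
  fun k => (leafIndex p z.1 k).elim (z.2.2 k) z.2.1

theorem measurable_relabel (p : ℝ) : Measurable (relabel p) := by
  refine measurable_pi_lambda _ fun k => ?_
  refine measurable_countable_comp (g := fun (o : Option Idx)
    (z : (Forest × Colouring) × (Idx → ℝ) × (Idx → ℝ)) => o.elim (z.2.2 k) z.2.1)
    ((measurable_leafIndex p k).comp measurable_fst) fun o => ?_
  cases o <;> simp only [Option.elim] <;> fun_prop

/-- The forest, its marks and two further sequences of marks, in the form in which `relabel`
uses them. -/
def splitData (s : ℝ) (z : Forest × ((Idx → ℝ) × (Idx → ℝ)) × (Idx → ℝ)) :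
    (Forest × Colouring) × (Idx → ℝ) × (Idx → ℝ) :=
  ((z.1, markColour s z.2.1.1), (fun y => (splitMark s (z.2.1.1 y, z.2.1.2 y)).2, z.2.2))

/-- The reduced forest with its marks. -/
def markStep (s : ℝ) (z : Forest × ((Idx → ℝ) × (Idx → ℝ)) × (Idx → ℝ)) : Forest × (Idx → ℝ) :=
  (reduceForest (1 - s) (splitData s z).1.1 (splitData s z).1.2, relabel (1 - s) (splitData s z))

/-- The law of a forest, its marks and two further sequences of marks. -/
def seedLaw (L : Measure Forest) : Measure (Forest × ((Idx → ℝ) × (Idx → ℝ)) × (Idx → ℝ)) :=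
  L.prod ((markLaw.prod markLaw).prod markLaw)

instance (L : Measure Forest) [IsProbabilityMeasure L] : IsProbabilityMeasure (seedLaw L) := by
  unfold seedLaw; infer_instance

theorem measurable_splitMarks (s : ℝ) : Measurable fun z : (Idx → ℝ) × (Idx → ℝ) =>
    ((markColour s z.1, fun y => (splitMark s (z.1 y, z.2 y)).2) : Colouring × (Idx → ℝ)) :=
  ((measurable_markColour s).comp measurable_fst).prodMk (measurable_pi_lambda _ fun y =>
    measurable_snd.comp ((measurable_splitMark s).comp (by fun_prop)))

theorem measurable_splitData (s : ℝ) : Measurable (splitData s) := by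
  have h0 : Measurable fun z : Forest × ((Idx → ℝ) × (Idx → ℝ)) × (Idx → ℝ) => z.2.1 := by fun_prop
  have h := (measurable_splitMarks s).comp h0
  exact (measurable_fst.prodMk (measurable_fst.comp h)).prodMk
    ((measurable_snd.comp h).prodMk (measurable_snd.comp measurable_snd))

theorem measurable_markStep (s : ℝ) : Measurable (markStep s) :=
  ((measurable_reduceForest (1 - s)).comp (measurable_fst.comp (measurable_splitData s))).prodMk
    ((measurable_relabel (1 - s)).comp (measurable_splitData s))

theorem map_splitData (h0 : 0 < s) (h1 : s ≤ 1) (L : Measure Forest)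
    [IsProbabilityMeasure L] : (seedLaw L).map (splitData s)
      = (L.prod (colourLaw (1 - s))).prod (markLaw.prod markLaw) := by
  have hC : IsProbabilityMeasure (colourLaw (1 - s)) := by
    rw [← map_markColour h0.le h1]
    exact isProbabilityMeasure_map (measurable_markColour s).aemeasurable
  have hsm : MeasurePreserving (fun z : (Idx → ℝ) × (Idx → ℝ) =>
      ((markColour s z.1, fun y => (splitMark s (z.1 y, z.2 y)).2) : Colouring × (Idx → ℝ)))
      (markLaw.prod markLaw) ((colourLaw (1 - s)).prod markLaw) :=
    ⟨measurable_splitMarks s, map_splitMarks h0 h1⟩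
  have e1 := (MeasurePreserving.id L).prod (hsm.prod (MeasurePreserving.id markLaw))
  have e2 := (MeasurePreserving.id L).prod
    (measurePreserving_prodAssoc (colourLaw (1 - s)) markLaw markLaw)
  have e3 := (measurePreserving_prodAssoc L (colourLaw (1 - s)) (markLaw.prod markLaw)).symm
  exact (e3.comp (e2.comp e1)).map_eq

/-- The address `leafIndex` depends only on the forest and its colours, of which the rescaled marks
are independent. So for every fixed forest and colouring the relabelled marks are independent and
uniform. -/
theorem map_markStep (h0 : 0 < s) (h1 : s ≤ 1) (L : Measure Forest)
    [IsProbabilityMeasure L] :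
    (seedLaw L).map (markStep s) = (reducedLaw (1 - s) L).prod markLaw := by
  have hC : IsProbabilityMeasure (colourLaw (1 - s)) := by
    rw [← map_markColour h0.le h1]
    exact isProbabilityMeasure_map (measurable_markColour s).aemeasurable
  have hm : Measurable fun z : (Forest × Colouring) × (Idx → ℝ) × (Idx → ℝ) =>
      (reduceForest (1 - s) z.1.1 z.1.2, relabel (1 - s) z) :=
    ((measurable_reduceForest (1 - s)).comp measurable_fst).prodMk (measurable_relabel _)
  have := map_prod_of_forall (ρ := L.prod (colourLaw (1 - s))) (N := markLaw.prod markLaw)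
    (N' := markLaw) (measurable_reduceForest (1 - s)) (measurable_relabel (1 - s))
    fun x => map_relabel fun k k' y h h' => leafIndex_injective (by linarith) h h'
  rw [reducedLaw, ← this, ← map_splitData h0 h1, map_map hm (measurable_splitData s)]
  rfl

/-- A surviving leaf with old mark `U` has the new mark `U / s`, and `U / s < t / s` means `U < t`.
The identity holds for every realisation. -/
theorem redMark_markStep_of_pos {t : ℝ} (ht : 0 < t) (hts : t < s)
    (z : Forest × ((Idx → ℝ) × (Idx → ℝ)) × (Idx → ℝ)) :
    redMark (t / s) (markStep s z) = redMark t (z.1, z.2.1.1) := by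
  have hs : 0 < s := ht.trans hts
  have h' : 1 - t / s < 1 := by linarith [div_pos ht hs]
  refine reduceForest_reduceForest_of_lt (f := z.1) (col₁ := markColour s z.2.1.1) (by linarith) (by linarith) h' (fun y hy => ?_)
    fun k y hk => ?_
  · simp only [markColour, decide_eq_true_eq] at hy ⊢
    linarith
  · have hc := leafIndex_colour (by linarith) hk
    simp only [markColour, decide_eq_true_eq] at hc
    have : (markStep s z).2 k = z.2.1.1 y / s := by
      simp only [markStep, relabel, splitData, hk]
      simp [splitMark, hc]
    simp only [markColour, this]
    congr 1
    rw [div_lt_div_iff_of_pos_right hs]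

theorem measurableSet_infiniteBlack (p : ℝ) :
    MeasurableSet {x : ColTree | InfiniteBlack p x.1 x.2} := by
  have hn : ∀ u, Measurable fun x : ColTree => u ∈ x.1.nodes := fun u =>
    (MTree.measurable_mem_nodes u).comp measurable_fst
  refine measurableSet_setOfPred.2 (Measurable.forall fun u => (hn u).imp (Measurable.imp ?_ ?_))
  · have : Measurable fun x : ColTree => {v | u ++ v ∈ x.1.nodes} :=
      measurable_set_iff.2 fun v => hn _
    exact measurableSet_setOfPred.1 (this MeasurableSet.setOfPred_infinite)
  · have : Measurable fun x : ColTree => {v | u ++ v ∈ blackNodes p x.1 x.2} :=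
      measurable_set_iff.2 fun v => (measurable_set_iff.1 (measurable_blackNodes p)) _
    exact measurableSet_setOfPred.1 (this MeasurableSet.setOfPred_infinite)

theorem IsGWILaw.ae_infiniteBlack (hq : IsOffspringLaw q) (hL : IsGWILaw q κ η χ L)
    (hp : p ∈ Ico (0 : ℝ) 1) : ∀ᵐ x ∂L.prod (colourLaw p),
      ∀ i (j : Fin (x.1 i).2.1), InfiniteBlack p ((x.1 i).2.2 j) fun u => x.2 (i, j, u) := by
  have := hL.isProb
  have := isProbabilityMeasure_colourMeasure hp.1 hp.2.le
  have hC : IsProbabilityMeasure (colourLaw p) := by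
    change IsProbabilityMeasure (infinitePi fun _ : Idx => colourMeasure p)
    infer_instance
  have hf := hL.ae_forest fun P hP => hP.ae_infiniteBlack hq hp
  have key : ∀ i j : ℕ, ∀ᵐ x ∂L.prod (colourLaw p), j < (x.1 i).2.1 →
      InfiniteBlack p (treeAt x.1 i j) fun u => x.2 (i, j, u) := by
    intro i j
    have hm : MeasurableSet {x : Forest × Colouring | j < (x.1 i).2.1 →
        InfiniteBlack p (treeAt x.1 i j) fun u => x.2 (i, j, u)} :=
      measurableSet_setOfPred.2 (Measurable.imp (measurableSet_setOfPred.1 (measurableSet_lt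
        measurable_const ((measurable_size i).comp measurable_fst))) (measurableSet_setOfPred.1
          (measurable_colTreeAt i j (measurableSet_infiniteBlack p))))
    refine (Measure.ae_prod_mem_iff_ae_ae_mem hm).2 ?_
    filter_upwards [hf] with f hf
    by_cases hj : j < (f i).2.1
    · have h1 := hf i ⟨j, hj⟩
      rw [← treeAt_fin] at h1
      have hinj : Function.Injective fun u : List ℕ => ((i, j, u) : Idx) := fun u v h => by
        simpa using h
      have h2 : (colourLaw p).map (fun c u => c (i, j, u))
          = infinitePi fun _ : List ℕ => colourMeasure p :=
        Measure.map_infinitePi_infinitePi_of_inj (P := fun _ : Idx => colourMeasure p) hinj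
      rw [← h2] at h1
      have hm' : Measurable fun (c : Colouring) (u : List ℕ) => c (i, j, u) := by fun_prop
      filter_upwards [ae_of_ae_map hm'.aemeasurable h1] with c hc _
      exact hc
    · exact Filter.Eventually.of_forall fun c h => absurd h hj
  filter_upwards [ae_all_iff.2 fun i => ae_all_iff.2 (key i)] with x hx i j
  rw [← treeAt_fin]
  exact hx i j j.2

/-- At level `0` the identity holds only almost surely: infinite descent must survive the
intermediate reduction, and the lines to be merged must be finite. -/
theorem redMark_markStep_zero (hq : IsOffspringLaw q) (hq' : IsOffspringLaw q')
    (hL : IsGWILaw q κ η χ L) (h0 : 0 < s) (h1 : s ≤ 1)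
    (hL' : IsGWILaw q' κ' η' χ' (reducedLaw (1 - s) L)) :
    ∀ᵐ z ∂seedLaw L, redMark 0 (markStep s z) = redMark 0 (z.1, z.2.1.1) := by
  have := hL.isProb
  have hC : IsProbabilityMeasure (colourLaw (1 - s)) := by
    rw [← map_markColour h0.le h1]
    exact isProbabilityMeasure_map (measurable_markColour s).aemeasurable
  have hsp : ∀ᵐ f ∂L, ∀ i m, FiniteInfiniteSpines ((f i).2.2 m) :=
    hL.ae_forest fun P hP => hP.ae_finiteInfiniteSpines hq
  have hsp' := hL'.ae_forest fun P hP => hP.ae_finiteInfiniteSpines hq'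
  have hae : ∀ᵐ x ∂L.prod (colourLaw (1 - s)),
      ∀ c c', reduceForest 1 (reduceForest (1 - s) x.1 x.2) c' = reduceForest 1 x.1 c := by
    filter_upwards [hL.ae_infiniteBlack hq (p := 1 - s) ⟨by linarith, by linarith⟩,
      Measure.quasiMeasurePreserving_fst.ae hsp,
      ae_of_ae_map (measurable_reduceForest (1 - s)).aemeasurable hsp'] with x h2 h3 h4 c c'
    exact reduceForest_reduceForest_one (by linarith) h2 h3 h4
  have h5 := Measure.quasiMeasurePreserving_fst (ν := markLaw.prod markLaw) |>.ae hae
  rw [← map_splitData h0 h1] at h5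
  filter_upwards [ae_of_ae_map (measurable_splitData s).aemeasurable h5] with z hz
  simp only [redMark, sub_zero]
  exact hz _ _

/-! ### Consistent forests -/

/-- The conditional law of the second component is realised as a measurable function of the first
one and a uniform variable. -/
theorem exists_measurable_map_eq_joint {X : Type} [MeasurableSpace X] [StandardBorelSpace X]
    [Nonempty X] (J : Measure (X × X)) [IsProbabilityMeasure J] :
    ∃ f : X × unitInterval → X, Measurable f ∧
      (J.fst.prod volume).map (fun z => (z.1, f z)) = J := by
  obtain ⟨f, hf, h⟩ := Kernel.exists_measurable_map_eq_unitInterval J.condKernel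
  refine ⟨Function.uncurry f, hf, ?_⟩
  have hm : Measurable fun z : X × unitInterval => (z.1, Function.uncurry f z) :=
    measurable_fst.prodMk hf
  conv_rhs => rw [← J.disintegrate J.condKernel]
  ext A hA
  rw [map_apply hm hA, Measure.prod_apply (hm hA), Measure.compProd_apply hA]
  refine lintegral_congr fun x => ?_
  have hfx : Measurable (f x) := hf.comp measurable_prodMk_left
  rw [← h x, map_apply hfx (measurable_prodMk_left hA)]
  rfl

/-- A Markov chain is run from its first marginal, one fresh uniform variable driving each
transition. Only the laws of neighbouring pairs are prescribed and needed. -/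
theorem exists_chain {X : Type} [MeasurableSpace X] [StandardBorelSpace X] [Nonempty X]
    (J : ℕ → Measure (X × X)) [∀ n, IsProbabilityMeasure (J n)]
    (hJ : ∀ n, (J n).snd = (J (n + 1)).fst) :
    ∃ (Ω : Type) (_ : MeasurableSpace Ω) (P : Measure Ω) (G : ℕ → Ω → X),
      IsProbabilityMeasure P ∧ (∀ n, Measurable (G n)) ∧
      ∀ n, P.map (fun ω => (G n ω, G (n + 1) ω)) = J n := by
  choose f hf hfJ using fun n => exists_measurable_map_eq_joint (J n)
  let ρ : Measure (ℕ → unitInterval) := infinitePi fun _ => volume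
  -- The state holds the present value and the uniform variables that have not been used yet.
  let state : ℕ → X × (ℕ → unitInterval) → X × (ℕ → unitInterval) := fun n => Nat.rec id
    (fun n s ω => (f n ((s ω).1, (s ω).2 0), shift (s ω).2)) n
  have hstep : ∀ n, Measurable fun y : X × (ℕ → unitInterval) =>
      ((y.1, f n (y.1, y.2 0)), shift y.2) := fun n => by
    have h0 : Measurable fun y : X × (ℕ → unitInterval) => (y.1, y.2 0) := by fun_prop
    exact (measurable_fst.prodMk ((hf n).comp h0)).prodMk (measurable_shift.comp measurable_snd)
  have hnext : Measurable fun z : (X × X) × (ℕ → unitInterval) => (z.1.2, z.2) := by fun_prop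
  have hstate : ∀ n, Measurable (state n) := fun n => by
    induction n with
    | zero => exact measurable_id
    | succ n ih => exact (hnext.comp (hstep n)).comp ih
  have hlaw : ∀ n, ((J n).fst.prod ρ).map (fun y => ((y.1, f n (y.1, y.2 0)), shift y.2))
      = (J n).prod ρ := by
    intro n
    have e1 : MeasurePreserving (fun z : ℕ → unitInterval => (z 0, shift z)) ρ
        ((volume : Measure unitInterval).prod ρ) :=
      ⟨(measurable_pi_apply 0).prodMk measurable_shift, infinitePi_map_shift volume⟩
    have e2 := (MeasurePreserving.id (J n).fst).prod e1
    have e3 := (measurePreserving_prodAssoc (J n).fst (volume : Measure unitInterval) ρ).symm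
    have e4 : MeasurePreserving (fun z : X × unitInterval => (z.1, f n z))
        ((J n).fst.prod volume) (J n) := ⟨measurable_fst.prodMk (hf n), hfJ n⟩
    exact ((e4.prod (MeasurePreserving.id ρ)).comp (e3.comp e2)).map_eq
  have hP : ∀ n, ((J 0).fst.prod ρ).map (state n) = (J n).fst.prod ρ := by
    intro n
    induction n with
    | zero => exact map_id
    | succ n ih =>
      have e : state (n + 1) = ((fun z : (X × X) × (ℕ → unitInterval) => (z.1.2, z.2)) ∘
        fun y => ((y.1, f n (y.1, y.2 0)), shift y.2)) ∘ state n := rfl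
      rw [e, ← map_map (hnext.comp (hstep n)) (hstate n), ih,
        ← map_map hnext (hstep n), hlaw n, ← hJ n]
      have := map_prod_map (J n) ρ measurable_snd measurable_id
      rw [map_id] at this
      exact this.symm
  refine ⟨X × (ℕ → unitInterval), inferInstance, (J 0).fst.prod ρ, fun n ω => (state n ω).1,
    inferInstance, fun n => measurable_fst.comp (hstate n), fun n => ?_⟩
  have e : (fun ω => ((state n ω).1, (state (n + 1) ω).1)) = (Prod.fst ∘
    fun y => ((y.1, f n (y.1, y.2 0)), shift y.2)) ∘ state n := rfl
  rw [e, ← map_map (measurable_fst.comp (hstep n)) (hstate n), hP n,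
    ← map_map measurable_fst (hstep n), hlaw n]
  exact fst_prod

theorem map_redMark {t : ℝ} (h0 : 0 ≤ t) (h1 : t ≤ 1) (L : Measure Forest)
    [IsProbabilityMeasure L] :
    (L.prod markLaw).map (fun g => (redMark t g, g.1)) = reducedPairLaw (1 - t) L ∧
      (L.prod markLaw).map (redMark t) = reducedLaw (1 - t) L := by
  have e : L.prod (colourLaw (1 - t)) = (L.prod markLaw).map (Prod.map id (markColour t)) := by
    rw [← map_prod_map _ _ measurable_id (measurable_markColour t), map_id,
      map_markColour h0 h1]
  have hm : Measurable (Prod.map id (markColour t) : Forest × (Idx → ℝ) → Forest × Colouring) :=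
    measurable_id.prodMap (measurable_markColour t)
  rw [reducedPairLaw, reducedLaw, e, map_map (measurable_reduceForest _) hm,
    map_map ((measurable_reduceForest _).prodMk measurable_fst) hm]
  exact ⟨rfl, rfl⟩

theorem IsGWILaw.ae_redMark_markStep (hq : IsOffspringLaw q) (hq' : IsOffspringLaw q')
    (hL : IsGWILaw q κ η χ L) {N : ℝ≥0} (hml : m < l) (hlN : l ≤ N)
    (hL' : IsGWILaw q' κ' η' χ' (reducedLaw (1 - (l : ℝ) / N) L)) :
    ∀ᵐ z ∂seedLaw L, redMark (m / l) (markStep (l / N) z) = redMark (m / N) (z.1, z.2.1.1) := by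
  have hl : (0 : ℝ) < l := lt_of_le_of_lt m.2 hml
  have hN : (0 : ℝ) < N := hl.trans_le hlN
  rcases eq_or_ne m 0 with rfl | hm
  · simpa using redMark_markStep_zero hq hq' hL (div_pos hl hN)
      ((div_le_one hN).2 (NNReal.coe_le_coe.2 hlN)) hL'
  · have hm0 : (0 : ℝ) < m := NNReal.coe_pos.2 (pos_iff_ne_zero.2 hm)
    refine Filter.Eventually.of_forall fun z => ?_
    have := redMark_markStep_of_pos (s := l / N) (t := m / N) (div_pos hm0 hN)
      ((div_lt_div_iff_of_pos_right hN).2 (NNReal.coe_lt_coe.2 hml)) z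
    rwa [div_div_div_cancel_right₀ hN.ne'] at this

theorem measurable_seed_fst : Measurable fun z : Forest × ((Idx → ℝ) × (Idx → ℝ)) × (Idx → ℝ) =>
    (z.1, z.2.1.1) := by fun_prop

theorem map_seedLaw (L : Measure Forest) [IsProbabilityMeasure L] :
    (seedLaw L).map (fun z => (z.1, z.2.1.1)) = L.prod markLaw :=
  ((MeasurePreserving.id L).prod ((measurePreserving_fst (μ := markLaw) (ν := markLaw)).comp
    (measurePreserving_fst (μ := markLaw.prod markLaw) (ν := markLaw)))).map_eq

/-- The semigroup property is proved by coupling both reductions to the same marks. -/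
theorem IsGWILaw.reducedLaw_reducedLaw (hq : IsOffspringLaw q) (hq' : IsOffspringLaw q')
    (hL : IsGWILaw q κ η χ L) {N : ℝ≥0} (hml : m < l) (hlN : l ≤ N)
    (hL' : IsGWILaw q' κ' η' χ' (reducedLaw (1 - (l : ℝ) / N) L)) :
    reducedLaw (1 - (m : ℝ) / l) (reducedLaw (1 - (l : ℝ) / N) L) = reducedLaw (1 - (m : ℝ) / N) L := by
  have := hL.isProb
  have := hL'.isProb
  have hl : (0 : ℝ) < l := lt_of_le_of_lt m.2 hml
  have hN : (0 : ℝ) < N := hl.trans_le hlN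
  have hml' : (m : ℝ) ≤ l := NNReal.coe_le_coe.2 hml.le
  have hlN' : (l : ℝ) ≤ N := NNReal.coe_le_coe.2 hlN
  rw [← (map_redMark (by positivity) ((div_le_one hl).2 hml') _).2,
    ← (map_redMark (by positivity) ((div_le_one hN).2 (hml'.trans hlN')) _).2,
    ← map_markStep (div_pos hl hN) ((div_le_one hN).2 hlN'),
    map_map (measurable_redMark _) (measurable_markStep _), ← map_seedLaw,
    map_map (measurable_redMark _) measurable_seed_fst]
  exact Measure.map_congr (hL.ae_redMark_markStep hq hq' hml hlN hL')

/-- A chain `G n` of marked forests at the levels `n + 1` is built such that each is a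
mark-preserving reduction of the next. Every level `l` is then read off from the marked forest at
the first integer level above it. -/
theorem exists_forests (hQ : ∀ l, 0 < l → IsOffspringLaw (Q l))
    (L : ℝ≥0 → Measure Forest)
    (hL : ∀ l, 0 < l → ∃ κ χ, IsGWILaw (Q l) κ (E l) χ (L l))
    (hred : ∀ m l : ℝ≥0, m < l → reducedLaw (1 - (m : ℝ) / l) (L l) = L m) :
    ∃ (Ω : Type) (_ : MeasurableSpace Ω) (P : Measure Ω) (F : ℝ≥0 → Ω → Forest),
      IsProbabilityMeasure P ∧ (∀ l, Measurable (F l)) ∧ (∀ l, P.map (F l) = L l) ∧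
      ∀ m l : ℝ≥0, m < l →
        P.map (fun ω => (F m ω, F l ω)) = reducedPairLaw (1 - (m : ℝ) / l) (P.map (F l)) := by
  have hprob : ∀ l, 0 < l → IsProbabilityMeasure (L l) := fun l hl => by
    obtain ⟨κ, χ, h⟩ := hL l hl
    exact h.isProb
  have hprobn : ∀ n : ℕ, IsProbabilityMeasure (L (n + 1)) := fun n => hprob _ (by positivity)
  have hcons : ∀ (m l N : ℝ≥0), m < l → l < N → ∀ᵐ z ∂seedLaw (L N),
      redMark (m / l) (markStep (l / N) z) = redMark (m / N) (z.1, z.2.1.1) := by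
    intro m l N hml hlN
    have hl : 0 < l := lt_of_le_of_lt m.2 hml
    obtain ⟨κ, χ, h⟩ := hL N (hl.trans hlN)
    obtain ⟨κ', χ', h'⟩ := hL l hl
    rw [← hred l N hlN] at h'
    exact h.ae_redMark_markStep (hQ N (hl.trans hlN)) (hQ l hl) hml hlN.le h'
  have hseed := fun n : ℕ => have := hprobn n; map_seedLaw (L (n + 1))
  have hproj : Measurable fun z : Forest × ((Idx → ℝ) × (Idx → ℝ)) × (Idx → ℝ) =>
    (z.1, z.2.1.1) := by fun_prop
  have hstepm : ∀ s, Measurable fun z : Forest × ((Idx → ℝ) × (Idx → ℝ)) × (Idx → ℝ) =>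
    (markStep s z, (z.1, z.2.1.1)) := fun s => (measurable_markStep s).prodMk hproj
  -- The ratio of the levels `n + 1` and `n + 2` is the threshold for the marks in the step of the
  -- chain from `G (n + 1)` down to `G n`.
  let s : ℕ → ℝ := fun n => ((n + 1 : ℝ≥0) : ℝ) / ((n + 1 : ℕ) + 1 : ℝ≥0)
  have hs0 : ∀ n, 0 < s n := fun n => by positivity
  have hlt : ∀ n : ℕ, ((n : ℝ≥0) + 1) < ((n + 1 : ℕ) : ℝ≥0) + 1 := fun n => by
    push_cast
    exact lt_add_one _
  have hs1 : ∀ n, s n ≤ 1 := fun n => (div_le_one (by positivity)).2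
    (NNReal.coe_le_coe.2 (hlt n).le)
  let J : ℕ → Measure ((Forest × (Idx → ℝ)) × (Forest × (Idx → ℝ))) := fun n =>
    (seedLaw (L ((n + 1 : ℕ) + 1))).map fun z => (markStep (s n) z, (z.1, z.2.1.1))
  have hJp : ∀ n, IsProbabilityMeasure (J n) := fun n => by
    have := hprobn (n + 1)
    exact isProbabilityMeasure_map (hstepm _).aemeasurable
  have hJfst : ∀ n, (J n).fst = (L (n + 1)).prod markLaw := fun n => by
    have := hprobn (n + 1)
    rw [← hred _ _ (hlt n), ← map_markStep (hs0 n) (hs1 n)]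
    exact map_map measurable_fst (hstepm _)
  have hJsnd : ∀ n, (J n).snd = (L ((n + 1 : ℕ) + 1)).prod markLaw := fun n => by
    rw [← hseed (n + 1)]
    exact map_map measurable_snd (hstepm _)
  obtain ⟨Ω, mΩ, P, G, hP, hG, hGJ⟩ := exists_chain J fun n => by rw [hJsnd, hJfst]
  have hGlaw : ∀ n, P.map (G n) = (L (n + 1)).prod markLaw := fun n => by
    rw [← hJfst n, ← hGJ n]
    exact (map_map measurable_fst ((hG n).prodMk (hG (n + 1)))).symm
  have hFm : ∀ (l : ℝ≥0) (k : ℕ), Measurable fun ω => redMark (l / (k + 1)) (G k ω) :=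
    fun l k => (measurable_redMark _).comp (hG k)
  have hGcons : ∀ (m : ℝ≥0) (n : ℕ), m < n + 1 → ∀ᵐ ω ∂P,
      redMark (m / (n + 1)) (G n ω) = redMark (m / ((n + 1 : ℕ) + 1)) (G (n + 1) ω) := by
    intro m n hm
    have h1 : ∀ᵐ x ∂J n, redMark (m / (n + 1)) x.1 = redMark (m / ((n + 1 : ℕ) + 1)) x.2 := by
      refine (ae_map_iff (hstepm _).aemeasurable (measurableSet_eq_fun
        ((measurable_redMark (m / (n + 1))).comp measurable_fst)
        ((measurable_redMark (m / ((n + 1 : ℕ) + 1))).comp measurable_snd))).2 ?_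
      have := hcons m (n + 1) ((n + 1 : ℕ) + 1) hm (hlt n)
      simpa [s] using this
    rw [← hGJ n] at h1
    exact ae_of_ae_map ((hG n).prodMk (hG (n + 1))).aemeasurable h1
  have hGcons' : ∀ (m : ℝ≥0) (k n : ℕ), m < k + 1 → k ≤ n → ∀ᵐ ω ∂P,
      redMark (m / (k + 1)) (G k ω) = redMark (m / (n + 1)) (G n ω) := by
    intro m k n hm hkn
    induction n, hkn using Nat.le_induction with
    | base => exact Filter.Eventually.of_forall fun ω => rfl
    | succ n hkn ih =>
      filter_upwards [ih, hGcons m n (hm.trans_le (by gcongr))] with ω h1 h2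
      rw [h1, h2]
  have hfl : ∀ l : ℝ≥0, l < (⌊l⌋₊ : ℝ≥0) + 1 := fun l => Nat.lt_floor_add_one l
  have hdiv : ∀ l : ℝ≥0, (l : ℝ) / ((⌊l⌋₊ : ℝ) + 1) ≤ 1 := fun l => by
    rw [div_le_one (by positivity)]
    exact_mod_cast (hfl l).le
  have hlaw : ∀ l : ℝ≥0, P.map (fun ω => redMark (l / ((⌊l⌋₊ : ℕ) + 1)) (G ⌊l⌋₊ ω)) = L l := by
    intro l
    have := hprobn ⌊l⌋₊
    have h1 := (map_redMark (t := l / ((⌊l⌋₊ : ℕ) + 1)) (by positivity) (hdiv l)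
      (L (⌊l⌋₊ + 1))).2
    rw [← hGlaw, map_map (measurable_redMark _) (hG _)] at h1
    have h2 := hred l _ (hfl l)
    push_cast at h2
    exact h1.trans h2
  -- The integer level used for `l` is `⌊l⌋₊ + 1`, which is strictly larger than `l`.
  refine ⟨Ω, mΩ, P, fun l ω => redMark (l / ((⌊l⌋₊ : ℕ) + 1)) (G ⌊l⌋₊ ω), hP,
    fun l => hFm l _, hlaw, fun m l hml => ?_⟩
  rw [hlaw l]
  set k := ⌊l⌋₊ with hk
  have hl : (0 : ℝ) < l := lt_of_le_of_lt m.2 hml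
  have := hprobn k
  have hs : 0 < (l : ℝ) / (k + 1) := by positivity
  have h1 : (fun ω => (redMark (m / ((⌊m⌋₊ : ℕ) + 1)) (G ⌊m⌋₊ ω), redMark (l / (k + 1)) (G k ω)))
      =ᵐ[P] fun ω => (redMark (m / (k + 1)) (G k ω), redMark (l / (k + 1)) (G k ω)) := by
    filter_upwards [hGcons' m _ k (hfl m) (Nat.floor_mono hml.le)] with ω hω
    rw [hω]
  have hm2 : ∀ a b : ℝ, Measurable fun g : Forest × (Idx → ℝ) => (redMark a g, redMark b g) :=
    fun a b => (measurable_redMark a).prodMk (measurable_redMark b)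
  have hm1 : ∀ a : ℝ, Measurable fun g : Forest × (Idx → ℝ) => (redMark a g, g.1) :=
    fun a => (measurable_redMark a).prodMk measurable_fst
  have h2 : P.map (fun ω => (redMark (m / (k + 1)) (G k ω), redMark (l / (k + 1)) (G k ω)))
      = (seedLaw (L (k + 1))).map (fun z => (redMark (m / (k + 1)) (z.1, z.2.1.1),
        redMark (l / (k + 1)) (z.1, z.2.1.1))) := by
    have e1 := map_map (μ := P) (hm2 (m / (k + 1)) (l / (k + 1))) (hG k)
    have e2 := map_map (μ := seedLaw (L (k + 1))) (hm2 (m / (k + 1)) (l / (k + 1))) hproj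
    rw [hGlaw] at e1
    rw [hseed] at e2
    exact e1.symm.trans e2
  -- Both forests are reductions of one marked forest; passing through the intermediate level `l`
  -- exhibits the smaller as a reduction, with new marks, of the larger.
  have h3 : (fun z => (redMark (m / (k + 1)) (z.1, z.2.1.1), redMark (l / (k + 1)) (z.1, z.2.1.1)))
      =ᵐ[seedLaw (L (k + 1))] fun z => (redMark (m / l) (markStep (l / (k + 1)) z),
        (markStep (l / (k + 1)) z).1) := by
    filter_upwards [hcons m l (k + 1) hml (hfl l)] with z hz
    push_cast at hz
    rw [hz]
    rfl
  have := hprob l hl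
  have h4 := (map_redMark (t := (m : ℝ) / l) (by positivity)
    ((div_le_one hl).2 (NNReal.coe_le_coe.2 hml.le)) (L l)).1
  have h5 := hred l (k + 1) (hfl l)
  push_cast at h5
  rw [Measure.map_congr h1, h2, Measure.map_congr h3, ← h4]
  rw [← h5, ← map_markStep hs (hdiv l), map_map (hm1 _) (measurable_markStep _)]
  rfl

/-! ### Reduced pairs and consistent families -/

/-- Testing on a single forest with standard exponential lifetimes and gaps is enough: its reduced
law is known, and the law of a forest determines its parameters. -/
theorem IsReducedPair.exists_root (hq : IsOffspringLaw q) (hη : η 0 = 0) (hp : p ∈ Icc (0 : ℝ) 1)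
    (h : IsReducedPair p q η q' η') : ∃ r, IsRootProb p q r ∧
      (r = 0 ∨ ∃ θ, IsReducedOffspring p q r θ q' ∧ IsReducedImmigration η r η') := by
  have hexp := isProbabilityMeasure_expMeasure (r := 1) one_pos
  have hexp0 := expMeasure_Iic_zero (c := 1) one_pos
  obtain ⟨L, hL⟩ := exists_isGWILaw q η hη (expMeasure 1) (expMeasure 1) hexp0 hexp0
  obtain ⟨P, hP, -⟩ := hL.law
  obtain ⟨r, hr⟩ : ∃ r, IsRootProb p q r := ⟨_, hP.isRootProb hq hp⟩
  refine ⟨r, hr, ?_⟩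
  rcases hr.mem.1.eq_or_lt with h0 | h0
  · exact Or.inl h0.symm
  obtain ⟨θ, q₁, hq₁⟩ := exists_isReducedOffspring hq hp hr h0
  obtain ⟨η₁, hη₁⟩ := exists_isReducedImmigration hη hr.mem h0
  obtain ⟨κ₁, χ₁, -, -, h1⟩ := hL.reduce hq hp hq₁ hη₁
  obtain ⟨κ₂, χ₂, h2⟩ := h _ _ L hL h1.ne_dirac
  obtain ⟨rfl, -, rfl, -⟩ := h1.parameters_unique h2
  exact Or.inr ⟨θ, hq₁, hη₁⟩

theorem isReducedPair_of_root (hq : IsOffspringLaw q) (hp : p ∈ Icc (0 : ℝ) 1)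
    (hr : IsRootProb p q r)
    (h : r = 0 ∨ ∃ θ, IsReducedOffspring p q r θ q' ∧ IsReducedImmigration η r η') :
    IsReducedPair p q η q' η' := by
  intro κ χ L hL hne
  rcases h with rfl | ⟨θ, h1, h2⟩
  · exact absurd (hL.reduce_zero hq hp hr) hne
  · obtain ⟨κ', χ', -, -, h3⟩ := hL.reduce hq hp h1 h2
    exact ⟨κ', χ', h3⟩

theorem one_sub_div_mem (h : m < l) : 1 - (m : ℝ) / l ∈ Icc (0 : ℝ) 1 := by
  have hl : (0 : ℝ) < l := lt_of_le_of_lt m.2 h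
  have h1 : (m : ℝ) / l ≤ 1 := (div_le_one hl).2 (NNReal.coe_le_coe.2 h.le)
  have h0 : 0 ≤ (m : ℝ) / l := by positivity
  exact ⟨by linarith, by linarith⟩

theorem IsConsistentPairFamily.exists_reduced (h : IsConsistentPairFamily Q E) (hm : 0 < m) (hml : m < l) : ∃ r θ,
      IsReducedOffspring (1 - (m : ℝ) / l) (Q l) r θ (Q m) ∧ IsReducedImmigration (E l) r (E m) := by
  have hl := hm.trans hml
  obtain ⟨r, hr, h0 | ⟨θ, h1⟩⟩ := (h.reduced m l hml).exists_root (h.offspring l hl)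
    (h.immigration l hl) (one_sub_div_mem hml)
  · have h2 := hr.eq
    rw [h0, psi_zero, sub_sub_cancel] at h2
    have hm' : (0 : ℝ) < m := hm
    have hl' : (0 : ℝ) < l := hl
    exact absurd h2 (mul_pos (div_pos hm' hl') (h.offspring l hl).toReal_pos).ne
  · exact ⟨r, θ, h1⟩

/-- Fix a forest law at level `1`. Below, the laws are its reductions. Above, the rates are divided
by `θ` and `phi (E l) r`, so that the reduction to level `1` gives the fixed law. -/
theorem IsConsistentPairFamily.hasConsistentForests
    (h : IsConsistentPairFamily Q E) {b : ℝ} (hc : 0 < c) (hb : 0 < b) :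
    ∃ C H : ℝ≥0 → ℝ, C 1 = c ∧ H 1 = b ∧ HasConsistentForests Q C E H := by
  have h01 : (0 : ℝ≥0) < 1 := one_pos
  have := isProbabilityMeasure_expMeasure hc
  have := isProbabilityMeasure_expMeasure hb
  obtain ⟨L₁, hL₁⟩ := exists_isGWILaw (Q 1) (E 1) (h.immigration 1 h01) (expMeasure c)
    (expMeasure b) (expMeasure_Iic_zero hc) (expMeasure_Iic_zero hb)
  have key : ∀ l : ℝ≥0, ∃ (C H : ℝ) (L : Measure Forest), IsExpGWILaw (Q l) C (E l) H L ∧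
      (0 < l → 0 < C ∧ 0 < H) ∧ (l < 1 → L = reducedLaw (1 - (l : ℝ) / (1 : ℝ≥0)) L₁) ∧
      (l = 1 → L = L₁ ∧ C = c ∧ H = b) ∧
      (1 < l → reducedLaw (1 - ((1 : ℝ≥0) : ℝ) / l) L = L₁) := by
    intro l
    rcases lt_trichotomy l 1 with hl | rfl | hl
    · have hp := one_sub_div_mem hl
      obtain ⟨r, hr, h0 | ⟨θ, h1, h2⟩⟩ := (h.reduced l 1 hl).exists_root (h.offspring 1 h01)
        (h.immigration 1 h01) hp
      · refine ⟨0, 0, _, Or.inr ⟨rfl, rfl⟩, fun hl0 => ?_, fun _ => ?_, fun h => absurd h hl.ne,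
          fun h => absurd h hl.not_gt⟩
        · obtain ⟨r', θ, h1, -⟩ := h.exists_reduced hl0 hl
          exact absurd (hr.unique h1.root) (h0 ▸ h1.root_pos.ne)
        · rw [hL₁.reduce_zero (h.offspring 1 h01) hp (h0 ▸ hr)]
      · have h3 := mul_pos hc h1.theta_pos
        have h4 := mul_pos hb h2.phi_pos
        exact ⟨_, _, _, Or.inl ⟨h3, h4, hL₁.reduce_exp (h.offspring 1 h01) hp hc hb h1 h2⟩,
          fun _ => ⟨h3, h4⟩, fun _ => rfl, fun h => absurd h hl.ne, fun h => absurd h hl.not_gt⟩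
    · exact ⟨c, b, L₁, Or.inl ⟨hc, hb, hL₁⟩, fun _ => ⟨hc, hb⟩, fun h => absurd h (lt_irrefl _),
        fun _ => ⟨rfl, rfl, rfl⟩, fun h => absurd h (lt_irrefl _)⟩
    · have hl0 := h01.trans hl
      obtain ⟨r, θ, h1, h2⟩ := h.exists_reduced h01 hl
      have h3 := div_pos hc h1.theta_pos
      have h4 := div_pos hb h2.phi_pos
      have := isProbabilityMeasure_expMeasure h3
      have := isProbabilityMeasure_expMeasure h4
      obtain ⟨L, hL⟩ := exists_isGWILaw (Q l) (E l) (h.immigration l hl0) _ _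
        (expMeasure_Iic_zero h3) (expMeasure_Iic_zero h4)
      refine ⟨_, _, L, Or.inl ⟨h3, h4, hL⟩, fun _ => ⟨h3, h4⟩, fun h => absurd h hl.not_gt,
        fun h => absurd h hl.ne', fun _ => ?_⟩
      have h5 := hL.reduce_exp (h.offspring l hl0) (one_sub_div_mem hl) h3 h4 h1 h2
      rw [div_mul_cancel₀ _ h1.theta_pos.ne', div_mul_cancel₀ _ h2.phi_pos.ne'] at h5
      exact h5.unique hL₁
  choose C H L hexp hpos hlt heq hgt using key
  have hGWI : ∀ l, 0 < l → IsGWILaw (Q l) (expMeasure (C l)) (E l) (expMeasure (H l)) (L l) := by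
    intro l hl
    rcases hexp l with h1 | h1
    · exact h1.2.2
    · exact absurd h1.1 (hpos l hl).2.ne'
  have hL1 : L 1 = L₁ := (heq 1 rfl).1
  have hred : ∀ m l : ℝ≥0, m < l → reducedLaw (1 - (m : ℝ) / l) (L l) = L m := by
    intro m l hml
    have hl : 0 < l := lt_of_le_of_lt m.2 hml
    rcases lt_trichotomy l 1 with hl1 | rfl | hl1
    · have h1 := hGWI l hl
      rw [hlt l hl1] at h1
      rw [hlt l hl1, hlt m (hml.trans hl1)]
      exact hL₁.reducedLaw_reducedLaw (h.offspring 1 h01) (h.offspring l hl) hml hl1.le h1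
    · rw [hlt m hml, hL1]
    · have h1 := hL₁
      rw [← hgt l hl1] at h1
      have hsemi : ∀ {m : ℝ≥0}, m < 1 → reducedLaw (1 - (m : ℝ) / (1 : ℝ≥0)) L₁
          = reducedLaw (1 - (m : ℝ) / l) (L l) := fun hm => by
        rw [← hgt l hl1]
        exact (hGWI l hl).reducedLaw_reducedLaw (h.offspring l hl) (h.offspring 1 h01) hm hl1.le h1
      rcases lt_trichotomy m 1 with hm1 | rfl | hm1
      · rw [hlt m hm1, hsemi hm1]
      · rw [hL1, hgt l hl1]
      · have hm : 0 < m := h01.trans hm1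
        obtain ⟨r, θ, h2, h3⟩ := h.exists_reduced hm hml
        obtain ⟨r', θ', h4, h5⟩ := h.exists_reduced h01 hm1
        -- Two levels above `1`: the reduction of `L l` and the law `L m` differ at most in their
        -- rates. Both reduce to `L₁` with the same factors, so the rates agree too.
        have hD := (hGWI l hl).reduce_exp (h.offspring l hl) (one_sub_div_mem hml) (hpos l hl).1
          (hpos l hl).2 h2 h3
        have hC := mul_pos (hpos l hl).1 h2.theta_pos
        have hH := mul_pos (hpos l hl).2 h3.phi_pos
        have hD1 := hD.reduce_exp (h.offspring m hm) (one_sub_div_mem hm1) hC hH h4 h5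
        rw [(hGWI l hl).reducedLaw_reducedLaw (h.offspring l hl) (h.offspring m hm) hm1 hml.le hD,
          hgt l hl1] at hD1
        have hm1' := (hGWI m hm).reduce_exp (h.offspring m hm) (one_sub_div_mem hm1) (hpos m hm).1
          (hpos m hm).2 h4 h5
        rw [hgt m hm1] at hm1'
        obtain ⟨-, e1, -, e2⟩ := hD1.parameters_unique hm1'
        have e3 := mul_right_cancel₀ h4.theta_pos.ne' (expMeasure_injective
          (mul_pos hC h4.theta_pos) (mul_pos (hpos m hm).1 h4.theta_pos) e1)
        have e4 := mul_right_cancel₀ h5.phi_pos.ne' (expMeasure_injective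
          (mul_pos hH h5.phi_pos) (mul_pos (hpos m hm).2 h5.phi_pos) e2)
        rw [e3, e4] at hD
        exact hD.unique (hGWI m hm)
  refine ⟨C, H, (heq 1 rfl).2.1, (heq 1 rfl).2.2, fun l hl => ⟨h.offspring l hl,
    h.immigration l hl, hpos l hl⟩, ?_⟩
  obtain ⟨Ω, mΩ, P, F, hP, hF, hlaw, hpair⟩ := exists_forests h.offspring L
    (fun l hl => ⟨_, _, hGWI l hl⟩) hred
  exact ⟨Ω, mΩ, P, F, hP, hF, fun l => (hlaw l).symm ▸ hexp l, hpair⟩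

/-- The forests of a consistent family are obtained from each other by reduction. -/
theorem HasConsistentForests.exists_laws {C H : ℝ≥0 → ℝ}
    (h : HasConsistentForests Q C E H) : ∃ L : ℝ≥0 → Measure Forest,
      (∀ l, IsExpGWILaw (Q l) (C l) (E l) (H l) (L l)) ∧
      ∀ m l : ℝ≥0, m < l → reducedLaw (1 - (m : ℝ) / l) (L l) = L m := by
  obtain ⟨-, Ω, mΩ, P, F, hP, hF, hlaw, hpair⟩ := h
  refine ⟨fun l => P.map (F l), hlaw, fun m l hml => ?_⟩
  have h1 := congrArg Measure.fst (hpair m l hml)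
  have hm : Measurable fun x : Forest × Colouring =>
      (reduceForest (1 - (m : ℝ) / l) x.1 x.2, x.1) :=
    (measurable_reduceForest _).prodMk measurable_fst
  rw [Measure.fst_map_prodMk (hF l), reducedPairLaw, Measure.fst, map_map measurable_fst hm]
    at h1
  exact h1.symm

theorem HasConsistentForests.exists_reduced {C H : ℝ≥0 → ℝ}
    (h : HasConsistentForests Q C E H) (hml : m < l) :
    ∃ r, IsRootProb (1 - (m : ℝ) / l) (Q l) r ∧ ((r = 0 ∧ H m = 0) ∨ (0 < r ∧ 0 < H m ∧
      ∃ θ, IsReducedOffspring (1 - (m : ℝ) / l) (Q l) r θ (Q m) ∧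
        IsReducedImmigration (E l) r (E m) ∧ C m = C l * θ ∧ H m = H l * phi (E l) r)) := by
  have hl : 0 < l := lt_of_le_of_lt m.2 hml
  obtain ⟨hq, hη, hC, hH⟩ := h.1 l hl
  obtain ⟨L, hexp, hred⟩ := h.exists_laws
  have hp := one_sub_div_mem hml
  have hL : IsGWILaw (Q l) (expMeasure (C l)) (E l) (expMeasure (H l)) (L l) := by
    rcases hexp l with h1 | h1
    · exact h1.2.2
    · exact absurd h1.1 hH.ne'
  obtain ⟨P, hP, -⟩ := hL.law
  obtain ⟨r, hr⟩ : ∃ r, IsRootProb (1 - (m : ℝ) / l) (Q l) r := ⟨_, hP.isRootProb hq hp⟩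
  refine ⟨r, hr, ?_⟩
  rcases hr.mem.1.eq_or_lt with h0 | h0
  · have h1 := hL.reduce_zero hq hp (h0 ▸ hr)
    rw [hred m l hml] at h1
    rcases hexp m with h2 | h2
    · exact absurd h1 h2.2.2.ne_dirac
    · exact Or.inl ⟨h0.symm, h2.1⟩
  · obtain ⟨θ, q₁, hq₁⟩ := exists_isReducedOffspring hq hp hr h0
    obtain ⟨η₁, hη₁⟩ := exists_isReducedImmigration hη hr.mem h0
    have h1 := hL.reduce_exp hq hp hC hH hq₁ hη₁
    rw [hred m l hml] at h1
    rcases hexp m with h2 | h2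
    · obtain ⟨e1, e2, e3, e4⟩ := h1.parameters_unique h2.2.2
      subst e1 e3
      exact Or.inr ⟨h0, h2.2.1, θ, hq₁, hη₁,
        (expMeasure_injective (mul_pos hC hq₁.theta_pos) h2.1 e2).symm,
        (expMeasure_injective (mul_pos hH hη₁.phi_pos) h2.2.1 e4).symm⟩
    · exact absurd h2.2 h1.ne_dirac

/-! ### Analytic continuation of generating functions and uniqueness -/

/-- For `0 < x < 2` and `t ≤ 1` the argument stays in `(-1, 1)`. Analyticity beyond the
probabilistic range `x ≤ 1` lets identities on a short interval be evaluated at `x = 1` and further.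
-/
theorem analyticOnNhd_pgf_one_sub (q : PMF ℕ) {t : ℝ} (ht : t ∈ Ioc (0 : ℝ) 1) :
    AnalyticOnNhd ℝ (fun x => pgf q (1 - t * x)) (Ioo 0 2) := by
  refine (analyticOnNhd_pgf q).comp (fun x _ => by fun_prop) fun x hx => ?_
  have h1 := mul_pos ht.1 hx.1
  have h2 : t * x ≤ x := mul_le_of_le_one_left hx.1.le ht.2
  exact ⟨by linarith [hx.2], by linarith⟩

theorem analyticOnNhd_psi (q : PMF ℕ) {t : ℝ} (ht : t ∈ Ioc (0 : ℝ) 1) :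
    AnalyticOnNhd ℝ (fun x => psi q (t * x)) (Ioo 0 2) :=
  (analyticOnNhd_pgf_one_sub q ht).sub fun x _ => by fun_prop

theorem analyticOnNhd_phi (q : PMF ℕ) {t : ℝ} (ht : t ∈ Ioc (0 : ℝ) 1) :
    AnalyticOnNhd ℝ (fun x => phi q (t * x)) (Ioo 0 2) :=
  AnalyticOnNhd.sub (fun x _ => by fun_prop) (analyticOnNhd_pgf_one_sub q ht)

theorem eqOn_Ioo_two {f g : ℝ → ℝ} (hf : AnalyticOnNhd ℝ f (Ioo 0 2))
    (hg : AnalyticOnNhd ℝ g (Ioo 0 2)) {d : ℝ} (hd : d ∈ Ioc (0 : ℝ) 1)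
    (h : ∀ x ∈ Ioo 0 d, f x = g x) : EqOn f g (Ioo 0 2) := by
  have h1 : d / 2 ∈ Ioo 0 d := ⟨by linarith [hd.1], by linarith [hd.1]⟩
  refine hf.eqOn_of_preconnected_of_eventuallyEq hg isPreconnected_Ioo (z₀ := d / 2)
    ⟨h1.1, by linarith [h1.2, hd.2]⟩ ?_
  filter_upwards [Ioo_mem_nhds h1.1 h1.2] with x hx using h x hx

theorem deriv_pgf_zero (q : PMF ℕ) : HasDerivAt (pgf q) (q 1).toReal 0 := by
  have h := (hasFPowerSeriesOnBall_pgf q).hasFPowerSeriesAt.hasDerivAt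
  simpa [FormalMultilinearSeries.ofScalars] using h

/-- Generating functions without linear term are determined by `φ(s) - s` up to a factor. -/
theorem eq_of_pgf_sub_eq (h : q 1 = 0) (h' : q' 1 = 0) {K : ℝ}
    (hK : ∀ x ∈ Ioo (0 : ℝ) 1, psi q x = K * psi q' x) : q = q' ∧ K = 1 := by
  have h1 : EqOn (psi q) (fun x => K * psi q' x) (Ioo 0 2) := by
    have e1 := analyticOnNhd_psi q (t := 1) ⟨one_pos, le_rfl⟩
    have e2 := analyticOnNhd_psi q' (t := 1) ⟨one_pos, le_rfl⟩
    simp only [one_mul] at e1 e2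
    exact eqOn_Ioo_two e1 (AnalyticOnNhd.mul (fun x _ => by fun_prop) e2) ⟨one_pos, le_rfl⟩ hK
  -- The point `x = 1` corresponds to the argument `0` of the generating function, so the condition
  -- `w 1 = 0` fixes the slope of `psi w` there and thereby the factor `K`.
  have hd : ∀ {w : PMF ℕ}, w 1 = 0 → HasDerivAt (psi w) 1 1 := by
    intro w hw
    have e1 : HasDerivAt (pgf w) 0 (1 - 1) := by simpa [hw] using deriv_pgf_zero w
    have e2 := (e1.comp_const_sub 1 1).sub ((hasDerivAt_id (1 : ℝ)).const_sub 1)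
    rw [show (-0 - -1 : ℝ) = 1 by norm_num] at e2
    exact e2
  have hK1 : K = 1 := by
    have e := (hd h).unique (((hd h').const_mul K).congr_of_eventuallyEq (by
      filter_upwards [Ioo_mem_nhds (show (0 : ℝ) < 1 by norm_num) one_lt_two] with x hx
      exact h1 hx))
    linarith
  refine ⟨pgf_injOn fun s hs => ?_, hK1⟩
  have e := hK (1 - s) ⟨by linarith [hs.2], by linarith [hs.1]⟩
  simp only [hK1, one_mul, psi, sub_sub_cancel] at e
  linarith

theorem IsReducedOffspring.eqOn (h : IsReducedOffspring p q r θ q') :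
    EqOn (fun x => psi q' x) (fun x => psi q (r * x) / (r * θ)) (Ioo 0 2) := by
  have e := analyticOnNhd_psi q' (t := 1) ⟨one_pos, le_rfl⟩
  simp only [one_mul] at e
  refine eqOn_Ioo_two e ?_ ⟨one_pos, le_rfl⟩ fun x hx => h.psi_eq ⟨hx.1.le, hx.2.le⟩
  simp only [div_eq_mul_inv]
  exact (analyticOnNhd_psi q ⟨h.root_pos, h.root.mem.2⟩).mul fun x _ => by fun_prop

/-! ### Recovering the original law from the reduced one -/

theorem IsReducedOffspring.mul_toReal
    (h : IsReducedOffspring p q r θ q') : (q' 0).toReal * (r * θ) = (1 - p) * (q 0).toReal := by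
  have h1 := h.psi_eq (y := 1) ⟨zero_le_one, le_rfl⟩
  rw [psi_one, mul_one, h.root.eq] at h1
  rw [h1, div_mul_cancel₀ _ (mul_pos h.root_pos h.theta_pos).ne']

/-- If `r < r'`, then `psi q₂ z` is a constant times `psi q₁ (r / r' * z)`, first near `0` and by
continuation at `z = 1`. The values at zero of the three laws give `psi q₁ (r / r') = psi q₁ 1`,
which contradicts convexity. -/
theorem IsReducedOffspring.le_of_eq (hp : p < 1)
    (h₁o : IsOffspringLaw q₁) (h₁ : IsReducedOffspring p q₁ r θ q)
    (h₂ : IsReducedOffspring p q₂ r' θ' q) : r' ≤ r := by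
  by_contra! hlt
  have hr := h₁.root_pos
  have hr' := h₂.root_pos
  have ht : r / r' ∈ Ioo (0 : ℝ) 1 := ⟨by positivity, (div_lt_one hr').2 hlt⟩
  have hm := h₁.mul_toReal
  have hm' := h₂.mul_toReal
  have hθ := h₁.theta_pos
  have hθ' := h₂.theta_pos
  have e := analyticOnNhd_psi q₂ (t := 1) ⟨one_pos, le_rfl⟩
  simp only [one_mul] at e
  have h3 := eqOn_Ioo_two (f := fun z => psi q₂ z)
    (g := fun z => r' * θ' / (r * θ) * psi q₁ (r / r' * z)) e
    (AnalyticOnNhd.mul (fun x _ => by fun_prop) (analyticOnNhd_psi q₁ ⟨ht.1, ht.2.le⟩))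
    ⟨hr', h₂.root.mem.2⟩ (fun z hz => ?_)
  · have h4 := h3 (show (1 : ℝ) ∈ Ioo 0 2 by norm_num)
    simp only [psi_one, mul_one] at h4
    have h5 : psi q₁ (r / r') = (q₁ 0).toReal := by
      have h6 : (1 - p) * (r * θ * (q₂ 0).toReal) = (1 - p) * (r' * θ' * (q₁ 0).toReal) := by
        linear_combination r' * θ' * hm - r * θ * hm'
      have h7 := mul_left_cancel₀ (by linarith : (1 - p) ≠ 0) h6
      rw [h4] at h7
      field_simp at h7 ⊢
      linarith
    exact (psi_lt_of_lt q₁ ht.1.le ht.2 le_rfl h₁o.toReal_pos (psi_one q₁)).ne h5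
  · have hz' : z / r' ∈ Icc (0 : ℝ) 1 := ⟨div_nonneg hz.1.le hr'.le, (div_le_one hr').2 hz.2.le⟩
    have e1 := (h₁.psi_eq hz').symm.trans (h₂.psi_eq hz')
    rw [mul_div_cancel₀ _ hr'.ne', show r * (z / r') = r / r' * z by ring] at e1
    field_simp at e1 ⊢
    linarith

/-- Once `r = r'`, the two functions `psi` are proportional on `(0, r)` and hence on `(0, 2)`; the
missing linear coefficients make the factor one. -/
theorem IsReducedOffspring.unique_left (hp : p < 1)
    (h₁o : IsOffspringLaw q₁) (h₂o : IsOffspringLaw q₂) (h₁ : IsReducedOffspring p q₁ r θ q)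
    (h₂ : IsReducedOffspring p q₂ r' θ' q) : q₁ = q₂ ∧ r = r' ∧ θ = θ' := by
  obtain rfl : r = r' := le_antisymm (h₂.le_of_eq hp h₂o h₁) (h₁.le_of_eq hp h₁o h₂)
  have hr := h₁.root_pos
  have hr1 := h₁.root.mem.2
  have e1 := analyticOnNhd_psi q₁ (t := 1) ⟨one_pos, le_rfl⟩
  have e2 := analyticOnNhd_psi q₂ (t := 1) ⟨one_pos, le_rfl⟩
  simp only [one_mul] at e1 e2
  have h3 := eqOn_Ioo_two (g := fun x => θ / θ' * psi q₂ x) e1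
    (AnalyticOnNhd.mul (fun x _ => by fun_prop) e2) ⟨hr, hr1⟩ (fun z hz => by
    have hz' : z / r ∈ Icc (0 : ℝ) 1 := ⟨div_nonneg hz.1.le hr.le, (div_le_one hr).2 hz.2.le⟩
    have e := (h₁.psi_eq hz').symm.trans (h₂.psi_eq hz')
    have := h₁.theta_pos
    have := h₂.theta_pos
    rw [mul_div_cancel₀ _ hr.ne'] at e
    field_simp at e ⊢
    linarith)
  obtain ⟨rfl, h4⟩ := eq_of_pgf_sub_eq h₁o.2 h₂o.2 (K := θ / θ') fun x hx =>
    h3 ⟨hx.1, by linarith [hx.2]⟩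
  exact ⟨rfl, rfl, (div_eq_one_iff_eq h₂.theta_pos.ne').1 h4⟩

theorem phi_one (hη : η 0 = 0) : phi η 1 = 1 := by simp [phi, pgf_zero, hη]

theorem eq_of_phi_eq (h : ∀ x ∈ Ioo (0 : ℝ) 1, phi η x = phi η' x) : η = η' := by
  refine pgf_injOn fun s hs => ?_
  have := h (1 - s) ⟨by linarith [hs.2], by linarith [hs.1]⟩
  simp only [phi, sub_sub_cancel] at this
  linarith

theorem IsReducedImmigration.phi_eq (h : IsReducedImmigration η r η') (hy : y ∈ Icc (0 : ℝ) 1) : phi η' y = phi η (r * y) / phi η r := by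
  rw [phi, h.pgf_eq _ ⟨by linarith [hy.2], by linarith [hy.1]⟩]
  ring_nf

/-- The functions `phi` are proportional on `(0, r)`, hence on `(0, 2)`, and both equal `1` at `1`.
-/
theorem IsReducedImmigration.unique_left {η₁ η₂ : PMF ℕ} (hr : 0 < r) (hη₁ : η₁ 0 = 0)
    (hη₂ : η₂ 0 = 0) (h₁ : IsReducedImmigration η₁ r η) (h₂ : IsReducedImmigration η₂ r η) :
    η₁ = η₂ := by
  have e1 := analyticOnNhd_phi η₁ (t := 1) ⟨one_pos, le_rfl⟩
  have e2 := analyticOnNhd_phi η₂ (t := 1) ⟨one_pos, le_rfl⟩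
  simp only [one_mul] at e1 e2
  have p1 := h₁.phi_pos
  have p2 := h₂.phi_pos
  have h3 := eqOn_Ioo_two (g := fun x => phi η₁ r / phi η₂ r * phi η₂ x) e1
    (AnalyticOnNhd.mul (fun x _ => by fun_prop) e2) ⟨hr, h₁.mem.2⟩ (fun z hz => by
    have hz' : z / r ∈ Icc (0 : ℝ) 1 := ⟨div_nonneg hz.1.le hr.le, (div_le_one hr).2 hz.2.le⟩
    have e := (h₁.phi_eq hz').symm.trans (h₂.phi_eq hz')
    rw [mul_div_cancel₀ _ hr.ne'] at e
    field_simp at e ⊢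
    linarith)
  have h4 := h3 (show (1 : ℝ) ∈ Ioo 0 2 by norm_num)
  simp only [phi_one hη₁, phi_one hη₂, mul_one] at h4
  refine eq_of_phi_eq fun x hx => ?_
  have h5 := h3 ⟨hx.1, by linarith [hx.2]⟩
  simpa [← h4] using h5

/-- Below level `1` everything is a reduction of level `1`. Above, the level is recovered from its
reduction by the `unique_left` lemmas, and the rates are recovered by cancelling `θ` and `phi (E l)
r`. -/
theorem HasConsistentForests.unique {Q' E' : ℝ≥0 → PMF ℕ} {C C' H H' : ℝ≥0 → ℝ}
    (h : HasConsistentForests Q C E H) (h' : HasConsistentForests Q' C' E' H') (hQ : Q 1 = Q' 1) :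
    (∀ l, 0 < H l → Q l = Q' l) ∧ (C 1 = C' 1 → ∀ l, 0 < H l → C l = C' l) ∧
      (E 1 = E' 1 → ∀ l, 0 < H l → E l = E' l) ∧
      (E 1 = E' 1 → H 1 = H' 1 → ∀ l, H l = H' l) := by
  suffices hs : ∀ l, (0 < H l → Q l = Q' l) ∧ (C 1 = C' 1 → 0 < H l → C l = C' l) ∧
      (E 1 = E' 1 → 0 < H l → E l = E' l) ∧ (E 1 = E' 1 → H 1 = H' 1 → H l = H' l) from
    ⟨fun l => (hs l).1, fun e l => (hs l).2.1 e, fun e l => (hs l).2.2.1 e,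
      fun e e' l => (hs l).2.2.2 e e'⟩
  intro l
  rcases lt_trichotomy l 1 with hl | rfl | hl
  · obtain ⟨r, hr, h1⟩ := h.exists_reduced hl
    obtain ⟨r', hr', h1'⟩ := h'.exists_reduced hl
    rw [← hQ] at hr' h1'
    obtain rfl := hr.unique hr'
    rcases h1 with ⟨h0, hH⟩ | ⟨h0, hH, θ, hq, he, hC, hHl⟩
    · rcases h1' with ⟨-, hH'⟩ | ⟨h0', -⟩
      · simp [hH, hH']
      · exact absurd h0 h0'.ne'
    · rcases h1' with ⟨h0', -⟩ | ⟨-, -, θ', hq', he', hC', hHl'⟩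
      · exact absurd h0' h0.ne'
      · obtain rfl := hq.theta_unique hq'
        refine ⟨fun _ => hq.unique hq', fun e _ => by rw [hC, hC', e], fun e _ => ?_,
          fun e e' => by rw [hHl, hHl', e, e']⟩
        rw [← e] at he'
        exact he.unique he'
  · exact ⟨fun _ => hQ, fun e _ => e, fun e _ => e, fun _ e => e⟩
  · have hl0 : 0 < l := lt_trans one_pos hl
    obtain ⟨o, i, -, -⟩ := h.1 l hl0
    obtain ⟨o', i', -, -⟩ := h'.1 l hl0
    have hp : 1 - ((1 : ℝ≥0) : ℝ) / l < 1 := by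
      have : (0 : ℝ) < l := hl0
      rw [NNReal.coe_one, sub_lt_self_iff]
      positivity
    obtain ⟨-, -, -, H1⟩ := h.1 1 one_pos
    obtain ⟨-, -, -, H1'⟩ := h'.1 1 one_pos
    obtain ⟨r, -, ⟨-, h0⟩ | ⟨h0, -, θ, hq, he, hC, hHl⟩⟩ := h.exists_reduced hl
    · exact absurd h0 H1.ne'
    obtain ⟨r', -, ⟨-, h0'⟩ | ⟨-, -, θ', hq', he', hC', hHl'⟩⟩ := h'.exists_reduced hl
    · exact absurd h0' H1'.ne'
    rw [← hQ] at hq'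
    obtain ⟨hQl, rfl, rfl⟩ := hq.unique_left hp o o' hq'
    have hE : E 1 = E' 1 → E l = E' l := fun e => by
      rw [← e] at he'
      exact he.unique_left h0 i i' he'
    refine ⟨fun _ => hQl, fun e _ => ?_, fun e _ => hE e, fun e e' => ?_⟩
    · exact mul_right_cancel₀ hq.theta_pos.ne' (by rw [← hC, ← hC', e])
    · exact mul_right_cancel₀ he.phi_pos.ne' (by
        rw [← hHl, e', hHl', hE e])

/-! ### Expansions of branching and immigration mechanisms -/

/-- The exponential series without its first `j` terms, normalised. -/
def expTail (j : ℕ) (u s : ℝ) : ℝ :=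
  exp (-u) * (exp (u * s) - ∑ k ∈ Finset.range j, (u * s) ^ k / k.factorial)

theorem hasSum_expTail (j : ℕ) (u s : ℝ) :
    HasSum (fun n => exp (-u) * u ^ (n + j) / (n + j).factorial * s ^ (n + j))
      (expTail j u s) := by
  have h := NormedSpace.expSeries_div_hasSum_exp (𝔸 := ℝ) (u * s)
  rw [← congrFun Real.exp_eq_exp_ℝ (u * s)] at h
  have h1 := ((hasSum_nat_add_iff' j).2 h).mul_left (exp (-u))
  refine h1.congr_fun fun n => ?_
  rw [mul_pow]
  ring

/-- These are Poisson weights of the numbers at least `j`: they sum to at most `1`, and `(n + j)! ≥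
n!` extracts the factor `u ^ j`. The bound matches the integrability condition on the Lévy measures.
-/
theorem sum_expTail_le (j N : ℕ) {u : ℝ} (hu : 0 ≤ u) :
    ∑ n ∈ Finset.range N, exp (-u) * u ^ (n + j) / (n + j).factorial ≤ min 1 (u ^ j) := by
  have h1 : ∀ M, exp (-u) * ∑ n ∈ Finset.range M, u ^ n / n.factorial ≤ 1 := fun M => by
    rw [Real.exp_neg, inv_mul_le_iff₀ (exp_pos u), mul_one]
    exact Real.sum_le_exp_of_nonneg hu M
  simp_rw [mul_div_assoc]
  rw [← mul_sum]
  refine le_min ((mul_le_mul_of_nonneg_left ?_ (exp_pos _).le).trans (h1 (j + N))) ?_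
  · rw [Finset.sum_range_add]
    simp_rw [add_comm j]
    exact le_add_of_nonneg_left (Finset.sum_nonneg fun n _ => by positivity)
  · calc exp (-u) * ∑ n ∈ Finset.range N, u ^ (n + j) / (n + j).factorial
        ≤ exp (-u) * ∑ n ∈ Finset.range N, u ^ j * (u ^ n / n.factorial) := by
          gcongr with n
          rw [pow_add, mul_comm (u ^ n), mul_div_assoc]
          gcongr
          omega
      _ = u ^ j * (exp (-u) * ∑ n ∈ Finset.range N, u ^ n / n.factorial) := by
          rw [← mul_sum]; ring
      _ ≤ u ^ j := mul_le_of_le_one_right (by positivity) (h1 N)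

theorem min_one_mul_pow_le (j : ℕ) {R x : ℝ} (hx : 0 ≤ x) :
    min 1 ((R * x) ^ j) ≤ max 1 (R ^ j) * min 1 (x ^ j) := by
  rcases le_total 1 (x ^ j) with h | h
  · rw [min_eq_left h, mul_one]
    exact (min_le_left _ _).trans (le_max_left _ _)
  · rw [min_eq_right h, mul_pow]
    exact (min_le_right _ _).trans (by gcongr; exact le_max_right _ _)

variable {ν : Measure ℝ} {R : ℝ}

theorem integrable_min_one_pow
    (hν : ∫⁻ x in Ioi (0 : ℝ), ofReal (min 1 (x ^ j)) ∂ν < ∞) (C : ℝ) :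
    IntegrableOn (fun x => C * min 1 (x ^ j)) (Ioi 0) ν := by
  refine Integrable.const_mul ⟨by fun_prop, ?_⟩ C
  rw [hasFiniteIntegral_iff_ofReal]
  · exact hν
  · filter_upwards [ae_restrict_mem measurableSet_Ioi] with x hx
    exact le_min zero_le_one (pow_nonneg (le_of_lt hx) j)

/-- The coefficients of the expansion of a mechanism around `R`, from the order `j` on. -/
def levyCoeff (j : ℕ) (a : ℝ) (ν : Measure ℝ) (R : ℝ) (n : ℕ) : ℝ :=
  (if n = 0 then a * R ^ j else 0) +
    ∫ x in Ioi (0 : ℝ), exp (-(R * x)) * (R * x) ^ (n + j) / (n + j).factorial ∂ν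

theorem levyCoeff_nonneg {a : ℝ} (ha : 0 ≤ a) (hR : 0 ≤ R) (n : ℕ) : 0 ≤ levyCoeff j a ν R n := by
  refine add_nonneg (by split_ifs <;> positivity) (setIntegral_nonneg measurableSet_Ioi ?_)
  intro x hx
  have : 0 ≤ R * x := mul_nonneg hR (le_of_lt hx)
  positivity

theorem expTail_mem_Icc {u : ℝ} (hu : 0 ≤ u) (hs : s ∈ Icc (0 : ℝ) 1) :
    expTail j u s ∈ Icc 0 (min 1 (u ^ j)) := by
  have hs0 := hs.1
  refine ⟨(hasSum_expTail j u s).nonneg fun n => by positivity,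
    le_of_tendsto' (hasSum_expTail j u s).tendsto_sum_nat fun N =>
      (Finset.sum_le_sum fun n _ => ?_).trans (sum_expTail_le j N hu)⟩
  exact mul_le_of_le_one_right (by positivity) (pow_le_one₀ hs.1 hs.2)

theorem integrableOn_expTail
    (hν : ∫⁻ x in Ioi (0 : ℝ), ofReal (min 1 (x ^ j)) ∂ν < ∞) (hR : 0 ≤ R)
    (hs : s ∈ Icc (0 : ℝ) 1) : IntegrableOn (fun x => expTail j (R * x) s) (Ioi 0) ν := by
  refine (integrable_min_one_pow hν (max 1 (R ^ j))).mono'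
    (by unfold expTail; fun_prop) ?_
  filter_upwards [ae_restrict_mem measurableSet_Ioi] with x (hx : 0 < x)
  have h := expTail_mem_Icc (j := j) (mul_nonneg hR hx.le) hs
  rw [norm_eq_abs, abs_of_nonneg h.1]
  exact h.2.trans (min_one_mul_pow_le j hx.le)

/-- Sum and integral are interchanged; `sum_expTail_le` supplies a majorant independent of the
number of terms. -/
theorem hasSum_levyCoeff
    (hν : ∫⁻ x in Ioi (0 : ℝ), ofReal (min 1 (x ^ j)) ∂ν < ∞) (hR : 0 ≤ R) (a : ℝ) (hs : s ∈ Icc (0 : ℝ) 1) :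
    HasSum (fun n => levyCoeff j a ν R n * s ^ (n + j))
      (a * (R * s) ^ j + ∫ x in Ioi (0 : ℝ), expTail j (R * x) s ∂ν) := by
  have hs0 := hs.1
  set F : ℕ → ℝ → ℝ := fun n x =>
    exp (-(R * x)) * (R * x) ^ (n + j) / (n + j).factorial * s ^ (n + j) with hF
  have hF0 : ∀ x ∈ Ioi (0 : ℝ), ∀ n, 0 ≤ F n x := by
    intro x hx n
    have : 0 ≤ R * x := mul_nonneg hR (le_of_lt hx)
    positivity
  have hle : ∀ x ∈ Ioi (0 : ℝ), ∀ N, ∑ n ∈ Finset.range N, F n x ≤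
      max 1 (R ^ j) * min 1 (x ^ j) := by
    intro x (hx : 0 < x) N
    have hu : 0 ≤ R * x := mul_nonneg hR hx.le
    refine (Finset.sum_le_sum fun n _ => ?_).trans
      ((sum_expTail_le j N hu).trans (min_one_mul_pow_le j hx.le))
    exact mul_le_of_le_one_right (by positivity) (pow_le_one₀ hs.1 hs.2)
  have hint : ∀ n, IntegrableOn (F n) (Ioi 0) ν := by
    intro n
    refine (integrable_min_one_pow hν (max 1 (R ^ j))).mono' (by simp only [hF]; fun_prop) ?_
    filter_upwards [ae_restrict_mem measurableSet_Ioi] with x hx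
    rw [norm_eq_abs, abs_of_nonneg (hF0 x hx n)]
    exact (Finset.single_le_sum (fun k _ => hF0 x hx k)
      (Finset.mem_range.2 (Nat.lt_succ_self n))).trans (hle x hx (n + 1))
  have hnorm : ∀ n, ∫ x in Ioi 0, ‖F n x‖ ∂ν = ∫ x in Ioi 0, F n x ∂ν := fun n =>
    setIntegral_congr_fun measurableSet_Ioi fun x hx => by
      rw [norm_eq_abs, abs_of_nonneg (hF0 x hx n)]
  have hsum : Summable fun n => ∫ x in Ioi 0, ‖F n x‖ ∂ν := by
    refine summable_of_sum_range_le (c := ∫ x in Ioi 0, max 1 (R ^ j) * min 1 (x ^ j) ∂ν)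
      (fun n => integral_nonneg fun x => norm_nonneg _) fun N => ?_
    simp_rw [hnorm]
    rw [← integral_finsetSum _ fun n _ => hint n]
    exact setIntegral_mono_on (integrable_finsetSum _ fun n _ => hint n)
      (integrable_min_one_pow hν _) measurableSet_Ioi fun x hx => hle x hx N
  have h1 := hasSum_integral_of_summable_integral_norm hint hsum
  rw [setIntegral_congr_fun measurableSet_Ioi (g := fun x => expTail j (R * x) s)
    fun x _ => (hasSum_expTail j (R * x) s).tsum_eq] at h1
  have h2 : HasSum (fun n : ℕ => if n = 0 then a * (R * s) ^ j else 0) (a * (R * s) ^ j) :=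
    hasSum_ite_eq 0 _
  convert h2.add h1 using 2 with n
  rw [levyCoeff, add_mul, hF, integral_mul_const]
  congr 1
  split_ifs with hn
  · rw [hn, zero_add, mul_pow]; ring
  · rw [zero_mul]

/-- The function `b r + a r² + ∫ (e^{-r x} - 1 + r x 1_{x < 1}) ν(dx)`. -/
def branchingFun (b a : ℝ) (ν : Measure ℝ) (r : ℝ) : ℝ := b * r + a * r ^ 2 +
  ∫ x in Ioi (0 : ℝ), (exp (-(r * x)) - 1 + r * x * (Iio (1 : ℝ)).indicator 1 x) ∂ν

/-- In the variable `s` the drift and the compensator are affine, so the terms of order two and more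
have the coefficients `levyCoeff 2`. The slope `D` is left unspecified because normalisation
determines it later. -/
theorem hasSum_branching {b a : ℝ}
    (hν : ∫⁻ x in Ioi (0 : ℝ), ofReal (min 1 (x ^ 2)) ∂ν < ∞) (hR : 0 ≤ R) :
    ∃ D, ∀ s ∈ Icc (0 : ℝ) 1, HasSum (fun n => levyCoeff 2 a ν R n * s ^ (n + 2))
      (branchingFun b a ν (R * (1 - s)) - branchingFun b a ν R + s * D) := by
  set A : ℝ → ℝ := fun x => exp (-(R * x)) - 1 + R * x * (Iio (1 : ℝ)).indicator 1 x with hA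
  have hAi : IntegrableOn A (Ioi 0) ν := by
    refine (integrable_min_one_pow hν (max 1 (R ^ 2))).mono' ?_ ?_
    · have : Measurable ((Iio (1 : ℝ)).indicator (1 : ℝ → ℝ)) :=
        measurable_one.indicator measurableSet_Iio
      exact Measurable.aestronglyMeasurable (by fun_prop)
    · filter_upwards [ae_restrict_mem measurableSet_Ioi] with x (hx : 0 < x)
      have hu : 0 ≤ R * x := mul_nonneg hR hx.le
      have he : exp (-(R * x)) ≤ 1 := Real.exp_le_one_iff.2 (by linarith)
      have he0 := exp_pos (-(R * x))
      rcases lt_or_ge x 1 with h1 | h1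
      · have h3 : exp (-(R * x)) ≤ 1 - R * x + (R * x) ^ 2 := by
          rw [Real.exp_neg, inv_le_iff_one_le_mul₀ (exp_pos _)]
          have := Real.add_one_le_exp (R * x)
          have h5 : 0 < 1 - R * x + (R * x) ^ 2 := by nlinarith [sq_nonneg (R * x - 1)]
          nlinarith [pow_nonneg hu 3]
        have h4 := Real.add_one_le_exp (-(R * x))
        have h6 : min 1 (x ^ 2) = x ^ 2 := min_eq_right (by nlinarith)
        have h7 : (R * x) ^ 2 ≤ max 1 (R ^ 2) * x ^ 2 := by
          rw [mul_pow]; gcongr; exact le_max_right _ _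
        simp only [hA, indicator_of_mem (show x ∈ Iio (1 : ℝ) from h1), Pi.one_apply, mul_one,
          norm_eq_abs]
        rw [h6, abs_le]
        constructor <;> nlinarith [sq_nonneg (R * x)]
      · have h6 : min 1 (x ^ 2) = 1 := min_eq_left (by nlinarith)
        simp only [hA, indicator_of_notMem (show x ∉ Iio (1 : ℝ) from not_lt.2 h1), mul_zero,
          add_zero, norm_eq_abs]
        rw [h6, abs_le, mul_one]
        constructor <;> linarith [le_max_left (1 : ℝ) (R ^ 2)]
  have h11 : (1 : ℝ) ∈ Icc (0 : ℝ) 1 := ⟨zero_le_one, le_rfl⟩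
  set T : ℝ → ℝ := fun s => ∫ x in Ioi (0 : ℝ), expTail 2 (R * x) s ∂ν with hT
  refine ⟨b * R + 2 * a * R ^ 2 + ((∫ x in Ioi 0, A x ∂ν) + T 1), fun s hs => ?_⟩
  -- Pointwise the integrand is affine in `s` plus `expTail 2`, and its vanishing at `s = 1`
  -- determines the slope. Each of the three pieces is integrable by itself.
  have key : branchingFun b a ν (R * (1 - s)) = b * (R * (1 - s)) + a * (R * (1 - s)) ^ 2 +
      ((∫ x in Ioi 0, A x ∂ν) - s * ((∫ x in Ioi 0, A x ∂ν) + T 1) + T s) := by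
    have e1 : IntegrableOn (fun x => A x + expTail 2 (R * x) 1) (Ioi 0) ν :=
      hAi.add (integrableOn_expTail hν hR h11)
    have e2 : IntegrableOn (fun x => A x - s * (A x + expTail 2 (R * x) 1)) (Ioi 0) ν :=
      hAi.sub (e1.const_mul s)
    rw [branchingFun]
    congr 1
    simp only [hT]
    rw [← integral_add hAi (integrableOn_expTail hν hR h11), ← integral_const_mul,
      ← integral_sub hAi (e1.const_mul s), ← integral_add e2 (integrableOn_expTail hν hR hs)]
    refine setIntegral_congr_fun measurableSet_Ioi fun x _ => ?_
    have e : exp (-(R * (1 - s) * x)) = exp (-(R * x)) * exp (R * x * s) := by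
      rw [← exp_add]; ring_nf
    have e' : exp (-(R * x)) * exp (R * x) = 1 := by
      rw [← exp_add]; simp
    simp only [hA, expTail, sum_range_succ, sum_range_zero, Nat.factorial, pow_zero,
      pow_one, mul_one, Nat.cast_one, div_one, zero_add, e]
    linear_combination (s : ℝ) * e'
  convert hasSum_levyCoeff hν hR a hs using 1
  rw [key, branchingFun]
  ring

theorem hasSum_immigration {d : ℝ}
    (hν : ∫⁻ x in Ioi (0 : ℝ), ofReal (min 1 x) ∂ν < ∞)
    (hφ : ∀ r, 0 ≤ r → φ r = d * r + ∫ x in Ioi (0 : ℝ), (1 - exp (-(r * x))) ∂ν)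
    (hR : 0 ≤ R) (hs : s ∈ Icc (0 : ℝ) 1) :
    HasSum (fun n => levyCoeff 1 d ν R n * s ^ (n + 1)) (φ R - φ (R * (1 - s))) := by
  have hν' : ∫⁻ x in Ioi (0 : ℝ), ofReal (min 1 (x ^ 1)) ∂ν < ∞ := by simpa using hν
  have h11 : (1 : ℝ) ∈ Icc (0 : ℝ) 1 := ⟨zero_le_one, le_rfl⟩
  have e1 : ∀ x, 1 - exp (-(R * x)) = expTail 1 (R * x) 1 := fun x => by
    have e' : exp (-(R * x)) * exp (R * x) = 1 := by rw [← exp_add]; simp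
    simp only [expTail, sum_range_succ, sum_range_zero, Nat.factorial, pow_zero,
      mul_one, Nat.cast_one, div_one, zero_add]
    linear_combination -e'
  have e2 : ∀ x, 1 - exp (-(R * (1 - s) * x)) = expTail 1 (R * x) 1 - expTail 1 (R * x) s := by
    intro x
    have e : exp (-(R * (1 - s) * x)) = exp (-(R * x)) * exp (R * x * s) := by
      rw [← exp_add]; ring_nf
    rw [← e1, e]
    simp only [expTail, sum_range_succ, sum_range_zero, Nat.factorial, pow_zero,
      Nat.cast_one, div_one, zero_add]
    ring
  convert hasSum_levyCoeff hν' hR d hs using 1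
  rw [hφ R hR, hφ _ (mul_nonneg hR (by linarith [hs.2]))]
  simp_rw [e1, e2]
  rw [integral_sub (integrableOn_expTail hν' hR h11) (integrableOn_expTail hν' hR hs)]
  ring

/-! ### The consistent family of a pair of mechanisms -/

theorem IsBranchingMechanism.hasSum (h : IsBranchingMechanism ψ) (hR : 0 ≤ R) :
    ∃ (D : ℝ) (c : ℕ → ℝ), (∀ n, 0 ≤ c n) ∧ ∀ s ∈ Icc (0 : ℝ) 1,
      HasSum (fun n => c n * s ^ (n + 2)) (ψ (R * (1 - s)) - ψ R + s * D) := by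
  obtain ⟨b, a, ν, ha, hν, hψ⟩ := h
  obtain ⟨D, hD⟩ := hasSum_branching (b := b) (a := a) hν hR
  refine ⟨D, levyCoeff 2 a ν R, levyCoeff_nonneg ha hR, fun s hs => ?_⟩
  rw [hψ R hR, hψ _ (mul_nonneg hR (by linarith [hs.2]))]
  exact hD s hs

theorem IsBranchingMechanism.zero (h : IsBranchingMechanism ψ) : ψ 0 = 0 := by
  obtain ⟨b, a, ν, -, -, hψ⟩ := h
  simp [hψ 0 le_rfl]

theorem IsImmigrationMechanism.zero (h : IsImmigrationMechanism φ) : φ 0 = 0 := by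
  obtain ⟨d, ν, -, -, hφ⟩ := h
  simp [hφ 0 le_rfl]

/-- Dividing the expansion by its slope `D` makes `s + ψ (R * (1 - s)) / D` a power series with
constant term `ψ R / D`, no linear term and nonnegative further coefficients. Nonnegativity at `s =
1` gives `D ≥ ψ R > 0`. -/
theorem IsBranchingMechanism.exists_offspring (h : IsBranchingMechanism ψ)
    (hR : 0 ≤ R) (hpos : 0 < ψ R) : ∃ q, IsOffspringLaw q ∧ ∃ K : ℝ, 0 < K ∧
      ∀ x ∈ Icc (0 : ℝ) 1, psi q x = ψ (R * x) / K := by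
  obtain ⟨D, c, hc, hs⟩ := h.hasSum hR
  have hD : 0 < D := by
    have h1 := (hs 1 ⟨zero_le_one, le_rfl⟩).nonneg fun n => by simpa using hc n
    rw [sub_self, mul_zero, h.zero] at h1
    linarith
  set w : ℕ → ℝ := fun n => if n = 0 then ψ R / D else if n = 1 then 0 else c (n - 2) / D with hw
  have hw0 : ∀ n, 0 ≤ w n := fun n => by
    simp only [hw]
    split_ifs
    exacts [by positivity, le_rfl, div_nonneg (hc _) hD.le]
  have hsum : ∀ s ∈ Icc (0 : ℝ) 1, HasSum (fun n => w n * s ^ n) (s + ψ (R * (1 - s)) / D) := by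
    intro s hs'
    rw [← hasSum_nat_add_iff' 2]
    rw [show s + ψ (R * (1 - s)) / D - ∑ i ∈ Finset.range 2, w i * s ^ i
      = (ψ (R * (1 - s)) - ψ R + s * D) / D by
        simp only [hw, sum_range_succ, sum_range_zero]
        simp
        field_simp
        ring]
    exact ((hs s hs').div_const D).congr_fun fun n => by simp [hw]; ring
  obtain ⟨q, hq⟩ := exists_pmf hw0 (by
    simpa [h.zero] using hsum 1 ⟨zero_le_one, le_rfl⟩)
  refine ⟨q, ⟨?_, ?_⟩, D, hD, fun x hx => ?_⟩
  · exact (ENNReal.toReal_pos_iff.1 ((hq 0).symm ▸ (by simp [hw]; positivity))).1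
  · have := hq 1
    simpa [hw, toReal_eq_zero_iff, q.apply_ne_top] using this
  · have h1 := hsum (1 - x) ⟨by linarith [hx.2], by linarith [hx.1]⟩
    simp_rw [← hq] at h1
    rw [psi, pgf, h1.tsum_eq, sub_sub_cancel]
    ring

theorem IsImmigrationMechanism.monotone (h : IsImmigrationMechanism φ) {x : ℝ}
    (hx : 0 ≤ x) (hxy : x ≤ y) (hy : 0 < y) : φ x ≤ φ y := by
  obtain ⟨d, ν, hd, hν, hφ⟩ := h
  have h1 : x / y ≤ 1 := (div_le_one hy).2 hxy
  have h0 : 0 ≤ x / y := by positivity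
  have h2 := (hasSum_immigration (s := 1 - x / y) hν hφ hy.le ⟨by linarith, by linarith⟩).nonneg
    fun n => mul_nonneg (levyCoeff_nonneg hd hy.le n) (pow_nonneg (by linarith) _)
  rw [sub_sub_cancel, mul_div_cancel₀ _ hy.ne'] at h2
  linarith

theorem IsImmigrationMechanism.exists_immigration (h : IsImmigrationMechanism φ)
    (hR : 0 ≤ R) (hpos : 0 < φ R) : ∃ η : PMF ℕ, η 0 = 0 ∧
      ∀ x ∈ Icc (0 : ℝ) 1, phi η x = φ (R * x) / φ R := by
  have h0 := h.zero
  obtain ⟨d, ν, hd, hν, hφ⟩ := h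
  set w : ℕ → ℝ := fun n => if n = 0 then 0 else levyCoeff 1 d ν R (n - 1) / φ R with hw
  have hw0 : ∀ n, 0 ≤ w n := fun n => by
    simp only [hw]
    split_ifs
    exacts [le_rfl, div_nonneg (levyCoeff_nonneg hd hR _) hpos.le]
  have hsum : ∀ s ∈ Icc (0 : ℝ) 1, HasSum (fun n => w n * s ^ n) (1 - φ (R * (1 - s)) / φ R) := by
    intro s hs'
    rw [← hasSum_nat_add_iff' 1]
    rw [show 1 - φ (R * (1 - s)) / φ R - ∑ i ∈ Finset.range 1, w i * s ^ i
      = (φ R - φ (R * (1 - s))) / φ R by simp [hw]; field_simp]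
    exact ((hasSum_immigration hν hφ hR hs').div_const (φ R)).congr_fun fun n => by
      simp [hw]; ring
  obtain ⟨q, hq⟩ := exists_pmf hw0 (by
    simpa [h0] using hsum 1 ⟨zero_le_one, le_rfl⟩)
  refine ⟨q, ?_, fun x hx => ?_⟩
  · have := hq 0
    simpa [hw, toReal_eq_zero_iff, q.apply_ne_top] using this
  · have h1 := hsum (1 - x) ⟨by linarith [hx.2], by linarith [hx.1]⟩
    simp_rw [← hq] at h1
    rw [phi, pgf, h1.tsum_eq, sub_sub_cancel, sub_sub_cancel]

/-! ### The right inverse of a branching mechanism -/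

theorem IsBranchingMechanism.continuousOn (h : IsBranchingMechanism ψ) :
    ContinuousOn ψ (Ici 0) := by
  intro y (hy : 0 ≤ y)
  have hR : (0 : ℝ) < y + 1 := by linarith
  set R := y + 1 with hRdef
  obtain ⟨D, c, hc, hs⟩ := h.hasSum hR.le
  have hsum : Summable c := by simpa using (hs 1 ⟨zero_le_one, le_rfl⟩).summable
  have h1 : ContinuousOn (fun s : ℝ => ∑' n, c n * s ^ (n + 2)) (Icc 0 1) := by
    -- The power series around `R = y + 1` converges uniformly on the unit interval, as its
    -- nonnegative coefficients are summable.
    refine continuousOn_tsum (fun n => by fun_prop) hsum fun n s hs' => ?_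
    rw [norm_eq_abs, abs_of_nonneg (mul_nonneg (hc n) (pow_nonneg hs'.1 _))]
    exact mul_le_of_le_one_right (hc n) (pow_le_one₀ hs'.1 hs'.2)
  have hmaps : MapsTo (fun z : ℝ => 1 - z / R) (Icc 0 R) (Icc 0 1) := fun z hz =>
    ⟨sub_nonneg.2 ((div_le_one hR).2 hz.2), sub_le_self _ (div_nonneg hz.1 hR.le)⟩
  have h2 : ContinuousOn (fun z => (∑' n, c n * (1 - z / R) ^ (n + 2)) + ψ R - (1 - z / R) * D)
      (Icc 0 R) :=
    ((h1.comp (by fun_prop) hmaps).add continuousOn_const).sub (by fun_prop)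
  have h3 : ContinuousOn ψ (Icc 0 R) := h2.congr fun z hz => by
    have e := (hs _ (hmaps hz)).tsum_eq
    simp only [sub_sub_cancel, mul_div_cancel₀ z hR.ne'] at e
    simp only [e]
    ring
  refine (h3 y ⟨hy, by linarith⟩).mono_of_mem_nhdsWithin ?_
  rw [← Ici_inter_Iic]
  exact Filter.inter_mem self_mem_nhdsWithin
    (mem_nhdsWithin_of_mem_nhds (Iic_mem_nhds (by linarith)))

/-- This is convexity with `ψ 0 = 0`, obtained by comparing the terms of the expansion at `s = 1 - 1
/ R` with those at `s = 1`. With `ψ 1 > 0` it gives linear growth. -/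
theorem IsBranchingMechanism.mul_le (h : IsBranchingMechanism ψ) (hR : 1 ≤ R) :
    R * ψ 1 ≤ ψ R := by
  have hR0 : 0 < R := by linarith
  obtain ⟨D, c, hc, hs⟩ := h.hasSum hR0.le
  have h1 : 1 - 1 / R ∈ Icc (0 : ℝ) 1 :=
    ⟨sub_nonneg.2 ((div_le_one hR0).2 hR), sub_le_self _ (by positivity)⟩
  have e1 := hs _ h1
  have e2 := (hs 1 ⟨zero_le_one, le_rfl⟩).mul_left (1 - 1 / R)
  have h2 := hasSum_le (fun n => ?_) e1 e2
  · rw [sub_sub_cancel, mul_div_cancel₀ _ hR0.ne', sub_self, mul_zero, h.zero] at h2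
    field_simp at h2
    nlinarith
  · have : c n * (1 - 1 / R) ^ (n + 2) = (1 - 1 / R) ^ (n + 1) * (c n * (1 - 1 / R)) := by ring
    rw [this, one_pow, mul_one, mul_comm _ (c n)]
    exact mul_le_of_le_one_left (mul_nonneg (hc n) h1.1) (pow_le_one₀ h1.1 h1.2)

theorem IsBranchingMechanism.exists_ge (h : IsBranchingMechanism ψ) (h1 : 0 < ψ 1)
    {x : ℝ} (hx : 0 ≤ x) (hxy : ψ x ≤ y) : ∃ r, x ≤ r ∧ ψ r = y := by
  set B := max (max 1 x) (y / ψ 1) with hB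
  have hB1 : 1 ≤ B := (le_max_left _ _).trans (le_max_left _ _)
  have hBx : x ≤ B := (le_max_right _ _).trans (le_max_left _ _)
  have hBy : y ≤ ψ B := ((div_le_iff₀ h1).1 (le_max_right _ _)).trans (h.mul_le hB1)
  obtain ⟨r, hr, hr'⟩ := intermediate_value_Icc hBx
    (h.continuousOn.mono fun z hz => hx.trans hz.1) ⟨hxy, hBy⟩
  exact ⟨r, hr.1, hr'⟩

/-- The level set is nonempty by the intermediate value theorem, closed by continuity and bounded by
the growth of `ψ`, so the supremum is attained. -/
theorem IsBranchingMechanism.isGreatest_rightInv (h : IsBranchingMechanism ψ)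
    (h1 : 0 < ψ 1) (hy : 0 ≤ y) : IsGreatest {r | 0 ≤ r ∧ ψ r = y} (rightInv ψ y) := by
  have hb : BddAbove {r | 0 ≤ r ∧ ψ r = y} := by
    refine ⟨max 1 (y / ψ 1), fun r hr => ?_⟩
    rcases le_total r 1 with h2 | h2
    · exact h2.trans (le_max_left _ _)
    · exact ((le_div_iff₀ h1).2 (hr.2 ▸ h.mul_le h2)).trans (le_max_right _ _)
  have hc : IsClosed {r | 0 ≤ r ∧ ψ r = y} :=
    h.continuousOn.preimage_isClosed_of_isClosed isClosed_Ici (isClosed_singleton (x := y))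
  obtain ⟨r, hr⟩ := h.exists_ge h1 le_rfl (h.zero.le.trans hy)
  exact ⟨hc.csSup_mem ⟨r, hr⟩ hb, fun r hr => le_csSup hb hr⟩

theorem IsReducedOffspring.one_eq_zero
    (h : IsReducedOffspring p q r θ q') : q' 1 = 0 := by
  have h1 := h.weight 1
  rw [blackWeight, if_neg one_ne_zero, if_pos rfl, zero_mul, mul_eq_zero] at h1
  exact h1.resolve_right (by
    simpa using mul_pos h.theta_pos h.root_pos)

theorem OffspringRep.psi_eq (h : OffspringRep q ψ) {x : ℝ} (hx : x ∈ Icc (0 : ℝ) 1) :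
    psi q x = ψ x := by
  rw [psi, h.2 _ ⟨by linarith [hx.2], by linarith [hx.1]⟩]
  ring_nf

theorem ImmigrationRep.phi_eq (h : ImmigrationRep η φ) {x : ℝ} (hx : x ∈ Icc (0 : ℝ) 1) :
    phi η x = φ x := by
  rw [phi, h.2 _ ⟨by linarith [hx.2], by linarith [hx.1]⟩]
  ring_nf

theorem ImmigrationRep.pos (hη : η 0 = 0) (h : ImmigrationRep η φ) (hR : 0 < R) : 0 < φ R := by
  rcases le_total R 1 with h1 | h1
  · rw [← h.phi_eq ⟨hR.le, h1⟩]
    exact phi_pos hη ⟨hR.le, h1⟩ hR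
  · refine lt_of_lt_of_le ?_ (h.1.monotone zero_le_one h1 hR)
    rw [← h.phi_eq ⟨zero_le_one, le_rfl⟩, phi_one hη]
    exact one_pos

theorem OffspringRep.pos (hq : IsOffspringLaw q) (h : OffspringRep q ψ) : 0 < ψ 1 := by
  rw [← h.psi_eq ⟨zero_le_one, le_rfl⟩, psi_one]
  exact hq.toReal_pos

theorem OffspringRep.isGreatest (hq : IsOffspringLaw q) (h : OffspringRep q ψ) (l : ℝ≥0) :
    IsGreatest {r | 0 ≤ r ∧ ψ r = l * ψ 1} (rightInv ψ (l * ψ 1)) :=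
  h.1.isGreatest_rightInv (h.pos hq) (mul_nonneg l.2 (h.pos hq).le)

theorem OffspringRep.rightInv_one (hq : IsOffspringLaw q) (h : OffspringRep q ψ) :
    rightInv ψ ((1 : ℝ≥0) * ψ 1) = 1 := by
  have h1 := h.isGreatest hq 1
  have h2 : 1 ≤ rightInv ψ ((1 : ℝ≥0) * ψ 1) := h1.2 ⟨zero_le_one, by simp⟩
  have h3 := h.1.mul_le h2
  rw [h1.1.2] at h3
  exact le_antisymm (le_of_mul_le_mul_right h3 (h.pos hq)) h2

theorem OffspringRep.rightInv_mono (hq : IsOffspringLaw q) (h : OffspringRep q ψ)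
    (hml : m ≤ l) : rightInv ψ (m * ψ 1) ≤ rightInv ψ (l * ψ 1) := by
  have h1 := (h.isGreatest hq m).1
  obtain ⟨r, hr, hr'⟩ := h.1.exists_ge (h.pos hq) h1.1 (y := l * ψ 1) (by
    rw [h1.2]
    exact mul_le_mul_of_nonneg_right (NNReal.coe_le_coe.2 hml) (h.pos hq).le)
  exact hr.trans ((h.isGreatest hq l).2 ⟨h1.1.trans hr, hr'⟩)

theorem OffspringRep.rightInv_pos (hq : IsOffspringLaw q) (h : OffspringRep q ψ)
    (hl : 0 < l) : 0 < rightInv ψ (l * ψ 1) := by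
  have h1 := (h.isGreatest hq l).1
  refine h1.1.lt_of_ne fun e => ?_
  have h2 := h1.2
  rw [← e, h.1.zero] at h2
  exact (mul_pos (NNReal.coe_pos.2 hl) (h.pos hq)).ne h2

/-- In the forest of level `l`, where `psi` is `ψ (R_l * x)` up to a factor, the largest root at the
level of `m` is the largest root of `ψ` divided by `R_l`. -/
theorem OffspringRep.isRootProb (hq : IsOffspringLaw q) (h : OffspringRep q ψ)
    (hml : m < l) {K : ℝ} (hK : 0 < K)
    (hq' : ∀ x ∈ Icc (0 : ℝ) 1, psi q' x = ψ (rightInv ψ (l * ψ 1) * x) / K) :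
    IsRootProb (1 - (m : ℝ) / l) q' (rightInv ψ (m * ψ 1) / rightInv ψ (l * ψ 1)) := by
  have hl : 0 < l := lt_of_le_of_lt m.2 hml
  have hl' : (0 : ℝ) < l := hl
  have hR := h.rightInv_pos hq hl
  have hm := h.isGreatest hq m
  have h0 := psi_one q' ▸ hq' 1 ⟨zero_le_one, le_rfl⟩
  rw [mul_one, (h.isGreatest hq l).1.2] at h0
  have hv : (1 - (1 - (m : ℝ) / l)) * (q' 0).toReal = m * ψ 1 / K := by
    rw [h0]; field_simp; ring
  have hmem : rightInv ψ (m * ψ 1) / rightInv ψ (l * ψ 1) ∈ Icc (0 : ℝ) 1 :=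
    ⟨div_nonneg hm.1.1 hR.le, (div_le_one hR).2 (h.rightInv_mono hq hml.le)⟩
  refine ⟨hmem, ?_, fun x hx hx' => ?_⟩
  · rw [hq' _ hmem, mul_div_cancel₀ _ hR.ne', hm.1.2, hv]
  · rw [hq' x hx, hv, div_left_inj' hK.ne'] at hx'
    rw [le_div_iff₀ hR, mul_comm]
    exact hm.2 ⟨mul_nonneg hR.le hx.1, hx'⟩

/-- The laws are prescribed by `psi (Q l) x = ψ (R_l * x) / K_l` and `phi (E l) x = φ (R_l * x) / φ
(R_l)`. Reducing from `l` to `m` scales the argument by `R_m / R_l`, which reproduces the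
prescription at `m`. -/
theorem exists_consistentPairFamily (hq : IsOffspringLaw q) (hη : η 0 = 0) (hψ : OffspringRep q ψ)
    (hφ : ImmigrationRep η φ) : ∃ Q E : ℝ≥0 → PMF ℕ, IsConsistentPairFamily Q E ∧ Q 1 = q ∧
      E 1 = η ∧ ∀ l, 0 < l →
        (∃ K, 0 < K ∧ ∀ x ∈ Icc (0 : ℝ) 1, psi (Q l) x = ψ (rightInv ψ (l * ψ 1) * x) / K) ∧
        ∀ x ∈ Icc (0 : ℝ) 1,
          phi (E l) x = φ (rightInv ψ (l * ψ 1) * x) / φ (rightInv ψ (l * ψ 1)) := by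
  set ρ : ℝ≥0 → ℝ := fun l => rightInv ψ (l * ψ 1) with hρ
  have h1 := hψ.rightInv_one hq
  have hG := hψ.isGreatest hq
  have hlaw : ∀ l, ∃ q' η' : PMF ℕ, (0 < l → IsOffspringLaw q' ∧ η' 0 = 0) ∧
      (0 < ρ l → q' 1 = 0 ∧ (∃ K, 0 < K ∧ ∀ x ∈ Icc (0 : ℝ) 1, psi q' x = ψ (ρ l * x) / K) ∧
        ∀ x ∈ Icc (0 : ℝ) 1, phi η' x = φ (ρ l * x) / φ (ρ l)) := by
    intro l
    rcases (zero_le (a := l)).eq_or_lt with rfl | hl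
    -- At level `0` the mechanism vanishes at `R_0`, so the expansion argument does not apply. For
    -- `R_0 = 0` the laws are arbitrary placeholders, since all reductions to level `0` are empty;
    -- for `R_0 > 0` they are the reductions of `q` and `η`.
    · rcases (hG 0).1.1.eq_or_lt with h0 | h0
      · exact ⟨q, η, fun h => absurd h (lt_irrefl _), fun h => absurd h0 h.ne⟩
      · have hr : IsRootProb (1 - ((0 : ℝ≥0) : ℝ) / (1 : ℝ≥0)) q (ρ 0 / ρ 1) :=
          hψ.isRootProb hq one_pos one_pos fun x hx => by
            rw [hψ.psi_eq hx, h1, one_mul, div_one]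
        simp only [NNReal.coe_zero, zero_div, sub_zero] at hr
        rw [show ρ 1 = 1 from h1, div_one] at hr
        obtain ⟨θ, q', h2⟩ := exists_isReducedOffspring hq ⟨zero_le_one, le_rfl⟩ hr h0
        obtain ⟨η', h3⟩ := exists_isReducedImmigration hη hr.mem h0
        have hmem : ∀ x ∈ Icc (0 : ℝ) 1, ρ 0 * x ∈ Icc (0 : ℝ) 1 := fun x hx =>
          ⟨mul_nonneg hr.mem.1 hx.1, mul_le_one₀ hr.mem.2 hx.1 hx.2⟩
        refine ⟨q', η', fun h => absurd h (lt_irrefl _), fun _ => ⟨h2.one_eq_zero,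
          ⟨_, mul_pos h0 h2.theta_pos, fun x hx => ?_⟩, fun x hx => ?_⟩⟩
        · rw [h2.psi_eq hx, hψ.psi_eq (hmem x hx)]
        · rw [h3.phi_eq hx, hφ.phi_eq (hmem x hx), hφ.phi_eq hr.mem]
    · have hR := hψ.rightInv_pos hq hl
      have hpos : 0 < ψ (ρ l) := by
        rw [(hG l).1.2]
        exact mul_pos (NNReal.coe_pos.2 hl) (hψ.pos hq)
      obtain ⟨q', h2, K, hK, h3⟩ := hψ.1.exists_offspring hR.le hpos
      obtain ⟨η', h4, h5⟩ := hφ.1.exists_immigration hR.le (hφ.pos hη hR)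
      exact ⟨q', η', fun _ => ⟨h2, h4⟩, fun _ => ⟨h2.2, ⟨K, hK, h3⟩, h5⟩⟩
  choose Q E hQE hmech using hlaw
  have hρ0 : ∀ {l}, 0 < l → 0 < ρ l := fun hl => hψ.rightInv_pos hq hl
  refine ⟨Q, E, ⟨fun l hl => (hQE l hl).1, fun l hl => (hQE l hl).2, fun m l hml => ?_⟩, ?_, ?_,
    fun l hl => (hmech l (hρ0 hl)).2⟩
  · have hl : 0 < l := lt_of_le_of_lt m.2 hml
    have hR := hρ0 hl
    obtain ⟨-, ⟨K, hK, h3⟩, h5⟩ := hmech l hR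
    have hr : IsRootProb (1 - (m : ℝ) / l) (Q l) (ρ m / ρ l) := hψ.isRootProb hq hml hK h3
    have hr' := hr.mem
    refine isReducedPair_of_root (hQE l hl).1 (one_sub_div_mem hml) hr ?_
    rcases (show 0 ≤ ρ m from (hG m).1.1).eq_or_lt with h0 | h0
    · left; rw [← h0, zero_div]
    right
    obtain ⟨hm1, ⟨K', hK', h3'⟩, h5'⟩ := hmech m h0
    obtain ⟨θ, q', h2⟩ := exists_isReducedOffspring (hQE l hl).1 (one_sub_div_mem hml) hr
      (div_pos h0 hR)
    obtain ⟨η', h4⟩ := exists_isReducedImmigration (hQE l hl).2 hr.mem (div_pos h0 hR)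
    have hmem : ∀ x ∈ Icc (0 : ℝ) 1, ρ m / ρ l * x ∈ Icc (0 : ℝ) 1 := fun x hx =>
      ⟨mul_nonneg hr'.1 hx.1, mul_le_one₀ hr'.2 hx.1 hx.2⟩
    have hmul : ∀ x, ρ l * (ρ m / ρ l * x) = ρ m * x := fun x => by field_simp
    have hθ := h2.theta_pos
    obtain ⟨rfl, -⟩ := eq_of_pgf_sub_eq h2.one_eq_zero hm1
      (K := K' / (K * (ρ m / ρ l * θ))) fun x hx => by
        have hx' : x ∈ Icc (0 : ℝ) 1 := ⟨hx.1.le, hx.2.le⟩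
        rw [h2.psi_eq hx', h3 _ (hmem x hx'), h3' x hx', hmul]
        field_simp
    obtain rfl : η' = E m := eq_of_phi_eq fun x hx => by
      have hx' : x ∈ Icc (0 : ℝ) 1 := ⟨hx.1.le, hx.2.le⟩
      have e := h5 _ hr'
      rw [mul_div_cancel₀ _ hR.ne'] at e
      have p1 := hφ.pos hη hR
      have p2 := hφ.pos hη h0
      rw [h4.phi_eq hx', h5 _ (hmem x hx'), h5' x hx', hmul, e]
      field_simp
    exact ⟨θ, h2, h4⟩
  · obtain ⟨e1, ⟨K, hK, h3⟩, -⟩ := hmech 1 (hρ0 one_pos)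
    refine (eq_of_pgf_sub_eq e1 hq.2 (K := 1 / K) fun x hx => ?_).1
    have hx' : x ∈ Icc (0 : ℝ) 1 := ⟨hx.1.le, hx.2.le⟩
    rw [h3 x hx', hψ.psi_eq hx', show ρ 1 = 1 from h1, one_mul]
    ring
  · obtain ⟨-, -, h5⟩ := hmech 1 (hρ0 one_pos)
    refine eq_of_phi_eq fun x hx => ?_
    have hx' : x ∈ Icc (0 : ℝ) 1 := ⟨hx.1.le, hx.2.le⟩
    rw [h5 x hx', hφ.phi_eq hx', show ρ 1 = 1 from h1, one_mul,
      ← hφ.phi_eq ⟨zero_le_one, le_rfl⟩, phi_one hη, div_one]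

/-- Below level `1` the root probability is `R_l` itself, because `R_1 = 1`. Above level `1`,
uniqueness identifies the family with the one built from the mechanisms. -/
theorem HasConsistentForests.explicit {C H : ℝ≥0 → ℝ}
    (h : HasConsistentForests Q C E H) (hq : IsOffspringLaw q) (hη : η 0 = 0)
    (hψ : OffspringRep q ψ) (hφ : ImmigrationRep η φ) (hQ : Q 1 = q) (hE : E 1 = η) (l : ℝ≥0) :
    H l = H 1 * φ (rightInv ψ (l * ψ 1)) ∧ (0 < H l → ∀ x ∈ Icc (0 : ℝ) 1,
      phi (E l) x = φ (rightInv ψ (l * ψ 1) * x) / φ (rightInv ψ (l * ψ 1))) := by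
  have h1 := hψ.rightInv_one hq
  have hφ1 : φ 1 = 1 := by rw [← hφ.phi_eq ⟨zero_le_one, le_rfl⟩, phi_one hη]
  have hm1 : ∀ x ∈ Icc (0 : ℝ) 1, psi q x = ψ (rightInv ψ ((1 : ℝ≥0) * ψ 1) * x) / 1 :=
    fun x hx => by rw [hψ.psi_eq hx, h1, one_mul, div_one]
  rcases lt_trichotomy l 1 with hl | rfl | hl
  · obtain ⟨r, hr, h2⟩ := h.exists_reduced hl
    rw [hQ] at hr
    obtain rfl := hr.unique (hψ.isRootProb hq hl one_pos hm1)
    have hmem := hr.mem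
    rw [h1, div_one] at h2 hmem
    rcases h2 with ⟨h0, hH⟩ | ⟨-, -, θ, -, h3, -, h4⟩
    · rw [h0, hφ.1.zero, mul_zero, hH]
      exact ⟨rfl, fun h => absurd h (lt_irrefl _)⟩
    · rw [hE] at h3 h4
      refine ⟨by rw [h4, hφ.phi_eq hmem], fun _ x hx => ?_⟩
      rw [h3.phi_eq hx, hφ.phi_eq hmem,
        hφ.phi_eq ⟨mul_nonneg hmem.1 hx.1, mul_le_one₀ hmem.2 hx.1 hx.2⟩]
  · rw [h1, hφ1, mul_one, hE]
    exact ⟨rfl, fun _ x hx => by rw [hφ.phi_eq hx, one_mul, div_one]⟩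
  · have hl0 : 0 < l := lt_trans one_pos hl
    obtain ⟨Q', E', hc, hQ', hE', h2⟩ := exists_consistentPairFamily hq hη hψ hφ
    obtain ⟨C', H', -, hH', h'⟩ := hc.hasConsistentForests (h.1 1 one_pos).2.2.1
      (h.1 1 one_pos).2.2.2
    obtain ⟨u1, -, u3, -⟩ := h.unique h' (hQ.trans hQ'.symm)
    have hEl := u3 (hE.trans hE'.symm) l (h.1 l hl0).2.2.2
    have hR := hψ.rightInv_pos hq hl0
    obtain ⟨r, hr, ⟨-, h0⟩ | ⟨-, -, θ, -, -, -, h5⟩⟩ := h.exists_reduced hl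
    · exact absurd h0 (h.1 1 one_pos).2.2.2.ne'
    obtain ⟨⟨K, hK, hpsi⟩, hphi⟩ := h2 l hl0
    rw [← hEl] at hphi
    rw [← u1 l (h.1 l hl0).2.2.2] at hpsi
    obtain rfl := hr.unique (hψ.isRootProb hq hl hK hpsi)
    have hmem := hr.mem
    rw [h1] at h5 hmem
    refine ⟨?_, fun _ => hphi⟩
    rw [h5, hphi _ hmem, mul_div_cancel₀ _ hR.ne', hφ1, mul_assoc,
      one_div_mul_cancel (hφ.pos hη hR).ne', mul_one]

/-! ### A moment problem -/

/-- Powers and falling factorials differ in lower order only. On a lattice of mesh `ε` the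
difference becomes a factor `ε`, so moments and factorial moments merge in the limit. -/
theorem pow_succ_le_descFactorial (i n : ℕ) :
    i ^ (n + 1) ≤ i.descFactorial (n + 1) + (n + 1) ^ 2 * i ^ n := by
  induction n with
  | zero => simp
  | succ n ih =>
    have h1 : i * i.descFactorial (n + 1) ≤ i.descFactorial (n + 2) + (n + 1) * i ^ (n + 1) := by
      rw [Nat.descFactorial_succ i (n + 1)]
      calc i * i.descFactorial (n + 1)
          ≤ (i - (n + 1) + (n + 1)) * i.descFactorial (n + 1) := by gcongr; omega
        _ ≤ _ := by
          rw [add_mul]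
          gcongr
          exact Nat.descFactorial_le_pow i (n + 1)
    calc i ^ (n + 2) = i * i ^ (n + 1) := by ring
      _ ≤ i * (i.descFactorial (n + 1) + (n + 1) ^ 2 * i ^ n) := by gcongr
      _ = i * i.descFactorial (n + 1) + (n + 1) ^ 2 * i ^ (n + 1) := by ring
      _ ≤ i.descFactorial (n + 2) + (n + 1) * i ^ (n + 1) + (n + 1) ^ 2 * i ^ (n + 1) := by gcongr
      _ ≤ _ := by nlinarith [Nat.zero_le (i ^ (n + 1))]

/-- A bound for the moments in terms of the factorial moments `M`. -/
def momentBound (M : ℕ → ℝ≥0∞) : ℕ → ℝ≥0∞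
  | 0 => M 0
  | n + 1 => M (n + 1) + (n + 1) ^ 2 * momentBound M n

theorem momentBound_ne_top {M : ℕ → ℝ≥0∞} (hM : ∀ n, M n ≠ ∞) (n : ℕ) : momentBound M n ≠ ∞ := by
  induction n with
  | zero => exact hM 0
  | succ n ih => exact ENNReal.add_ne_top.2 ⟨hM _, mul_ne_top (by finiteness) ih⟩

/-- The measure with mass `B i` at the point `i * ε`. -/
def latticeMeasure (B : ℕ → ℝ≥0∞) (ε : ℝ≥0) : Measure ℝ≥0 :=
  Measure.sum fun i => B i • dirac (i * ε)

theorem lintegral_latticeMeasure (B : ℕ → ℝ≥0∞) (ε : ℝ≥0) {f : ℝ≥0 → ℝ≥0∞} (hf : Measurable f) :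
    ∫⁻ x, f x ∂latticeMeasure B ε = ∑' i : ℕ, B i * f (i * ε) := by
  simp [latticeMeasure, lintegral_sum_measure, lintegral_dirac' _ hf]

section Lattice

variable {M B : ℕ → ℝ≥0∞} {ε : ℝ≥0}

theorem le_lintegral_latticeMeasure
    (h : ∀ n, ∑' i : ℕ, B i * (i.descFactorial n * (ε : ℝ≥0∞) ^ n) = M n) (n : ℕ) :
    M n ≤ ∫⁻ x, (x : ℝ≥0∞) ^ n ∂latticeMeasure B ε := by
  rw [lintegral_latticeMeasure _ _ (by fun_prop), ← h n]
  refine tsum_le_tsum fun i => ?_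
  push_cast
  rw [mul_pow]
  gcongr
  exact_mod_cast Nat.descFactorial_le_pow i n

theorem lintegral_latticeMeasure_succ_le
    (h : ∀ n, ∑' i : ℕ, B i * (i.descFactorial n * (ε : ℝ≥0∞) ^ n) = M n) (n : ℕ) :
    ∫⁻ x, (x : ℝ≥0∞) ^ (n + 1) ∂latticeMeasure B ε ≤
      M (n + 1) + (n + 1) ^ 2 * ε * ∫⁻ x, (x : ℝ≥0∞) ^ n ∂latticeMeasure B ε := by
  rw [lintegral_latticeMeasure _ _ (by fun_prop), lintegral_latticeMeasure _ _ (by fun_prop),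
    ← h (n + 1), ← ENNReal.tsum_mul_left, ← tsum_add]
  refine tsum_le_tsum fun i => ?_
  have h1 : (i : ℝ≥0∞) ^ (n + 1) ≤ i.descFactorial (n + 1) + (n + 1) ^ 2 * (i : ℝ≥0∞) ^ n := by
    exact_mod_cast pow_succ_le_descFactorial i n
  push_cast
  calc B i * ((i : ℝ≥0∞) * ε) ^ (n + 1) = B i * ε ^ (n + 1) * (i : ℝ≥0∞) ^ (n + 1) := by ring
    _ ≤ B i * ε ^ (n + 1) * (i.descFactorial (n + 1) + (n + 1) ^ 2 * (i : ℝ≥0∞) ^ n) := by gcongr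
    _ = _ := by ring

theorem lintegral_latticeMeasure_zero
    (h : ∀ n, ∑' i : ℕ, B i * (i.descFactorial n * (ε : ℝ≥0∞) ^ n) = M n) :
    latticeMeasure B ε univ = M 0 := by
  rw [← lintegral_one, lintegral_latticeMeasure _ _ measurable_const, ← h 0]
  simp

theorem lintegral_latticeMeasure_le (hε : ε ≤ 1)
    (h : ∀ n, ∑' i : ℕ, B i * (i.descFactorial n * (ε : ℝ≥0∞) ^ n) = M n) (n : ℕ) :
    ∫⁻ x, (x : ℝ≥0∞) ^ n ∂latticeMeasure B ε ≤ momentBound M n := by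
  induction n with
  | zero => simp [lintegral_latticeMeasure_zero h, momentBound]
  | succ n ih =>
    refine (lintegral_latticeMeasure_succ_le h n).trans ?_
    rw [momentBound]
    gcongr
    exact mul_le_of_le_one_right zero_le (by exact_mod_cast hε)

end Lattice

open Filter Topology in
-- The lattice measures have the same factorial moments for all meshes. Their moments are therefore
-- bounded, which gives tightness, and every weak limit has the factorial moments as its moments.
theorem exists_measure_moments {M : ℕ → ℝ≥0∞} (hM : ∀ n, M n ≠ ∞)
    (h : ∀ δ : ℝ≥0, 0 < δ → ∃ ε ≤ δ, ∃ B : ℕ → ℝ≥0∞,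
      ∀ n, ∑' i : ℕ, B i * (i.descFactorial n * (ε : ℝ≥0∞) ^ n) = M n) :
    ∃ m : Measure ℝ≥0, IsFiniteMeasure m ∧ ∀ n, ∫⁻ x, (x : ℝ≥0∞) ^ n ∂m = M n := by
  choose ε hε B hB using fun k : ℕ => h (1 / ((k : ℝ≥0) + 1)) (by positivity)
  have hε1 : ∀ k, ε k ≤ 1 := fun k => (hε k).trans (by
    rw [div_le_one (by positivity)]; exact le_add_self)
  have hε0 : Tendsto (fun k => (ε k : ℝ≥0∞)) (hyperfilter ℕ) (𝓝 0) := by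
    have h1 : Tendsto ε atTop (𝓝 0) := tendsto_of_tendsto_of_tendsto_of_le_of_le
      tendsto_const_nhds tendsto_one_div_add_atTop_nhds_zero_nat (fun _ => zero_le) hε
    exact (ENNReal.tendsto_coe.2 h1).mono_left Nat.hyperfilter_le_atTop
  have hfin : ∀ k, IsFiniteMeasure (latticeMeasure (B k) (ε k)) := fun k =>
    ⟨by rw [lintegral_latticeMeasure_zero (hB k)]; exact (hM 0).lt_top⟩
  set K := momentBound M with hK
  have hKt : ∀ n, K n ≠ ∞ := momentBound_ne_top hM
  set μ : ℕ → FiniteMeasure ℝ≥0 := fun k => ⟨latticeMeasure (B k) (ε k), hfin k⟩ with hμ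
  -- Prokhorov's theorem; by Markov's inequality the first moment bounds the mass outside `[0, n +
  -- 1]`.
  have hcomp := isCompact_setOfPred_finiteMeasure_mass_le_compl_isCompact_le (E := ℝ≥0)
    (u := fun n => (K 1).toNNReal / ((n : ℝ≥0) + 1)) (K := fun n => Icc 0 ((n : ℝ≥0) + 1))
    (M 0).toNNReal (by
      have h1 := (tendsto_one_div_add_atTop_nhds_zero_nat (𝕜 := ℝ≥0)).const_mul (K 1).toNNReal
      simpa [div_eq_mul_inv] using h1)
    (fun n => isCompact_Icc) (Or.inl inferInstance)
  have hmem : ∀ k, (μ k).mass ≤ (M 0).toNNReal ∧ ∀ n : ℕ, μ k (Icc 0 ((n : ℝ≥0) + 1))ᶜ ≤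
      (K 1).toNNReal / ((n : ℝ≥0) + 1) := by
    intro k
    constructor
    · refine le_of_eq (congrArg ENNReal.toNNReal ?_)
      exact lintegral_latticeMeasure_zero (hB k)
    · intro n
      rw [le_div_iff₀ (by positivity), ← ENNReal.coe_le_coe, ENNReal.coe_mul,
        FiniteMeasure.ennreal_coeFn_eq_coeFn_toMeasure, ENNReal.coe_toNNReal (hKt 1), mul_comm]
      refine le_trans ?_ (lintegral_latticeMeasure_le (hε1 k) (hB k) 1)
      refine le_trans ?_ (mul_meas_ge_le_lintegral (by fun_prop) (((n : ℝ≥0) + 1 : ℝ≥0) : ℝ≥0∞))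
      refine mul_le_mul_right (measure_mono fun x hx => ?_) _
      have h2 : (n : ℝ≥0) + 1 < x := by simpa using hx
      change _ ≤ (x : ℝ≥0∞) ^ 1
      rw [pow_one]
      exact_mod_cast h2.le
  -- A limit along an ultrafilter takes the place of a convergent subsequence.
  obtain ⟨m, -, hm⟩ := hcomp.ultrafilter_le_nhds ((hyperfilter ℕ).map μ) (by
    rw [Ultrafilter.coe_map, le_principal_iff]
    exact mem_map.2 (univ_mem' hmem))
  have hlim : Tendsto μ (hyperfilter ℕ) (𝓝 m) := hm
  rw [FiniteMeasure.tendsto_iff_forall_lintegral_tendsto] at hlim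
  have hcut : ∀ n N : ℕ, Tendsto
      (fun k => ∫⁻ x, ((min (x ^ n) N : ℝ≥0) : ℝ≥0∞) ∂latticeMeasure (B k) (ε k)) (hyperfilter ℕ)
      (𝓝 (∫⁻ x, ((min (x ^ n) N : ℝ≥0) : ℝ≥0∞) ∂(m : Measure ℝ≥0))) := fun n N =>
    hlim (BoundedContinuousFunction.mkOfBound ⟨fun x => min (x ^ n) N, by fun_prop⟩ N
      fun x y => by
        have h1 : (min (x ^ n) N : ℝ≥0) ≤ N := min_le_right _ _
        have h2 : (min (y ^ n) N : ℝ≥0) ≤ N := min_le_right _ _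
        rw [← NNReal.coe_le_coe] at h1 h2
        simp only [ContinuousMap.coe_mk, NNReal.dist_eq, abs_le]
        constructor <;> linarith [(min (x ^ n) N : ℝ≥0).2, (min (y ^ n) N : ℝ≥0).2,
          h1.trans_eq (NNReal.coe_natCast N), h2.trans_eq (NNReal.coe_natCast N)])
  refine ⟨m, inferInstance, fun n => le_antisymm ?_ ?_⟩
  · have h1 : ∀ x : ℝ≥0, (x : ℝ≥0∞) ^ n = ⨆ N : ℕ, ((min (x ^ n) N : ℝ≥0) : ℝ≥0∞) := fun x => by
      refine le_antisymm ?_ (iSup_le fun N => by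
        exact_mod_cast min_le_left (x ^ n) (N : ℝ≥0))
      obtain ⟨N, hN⟩ := exists_nat_ge (x ^ n)
      refine le_iSup_of_le N ?_
      rw [min_eq_left hN, ENNReal.coe_pow]
    simp_rw [h1]
    rw [lintegral_iSup (f := fun (N : ℕ) (x : ℝ≥0) => ((min (x ^ n) N : ℝ≥0) : ℝ≥0∞))
      (fun N => by fun_prop) (fun N N' hN x =>
      ENNReal.coe_le_coe.2 (min_le_min_left _ (Nat.cast_le.2 hN)))]
    refine iSup_le fun N => ?_
    -- The error between moments and factorial moments vanishes with the mesh. For `n = 0` the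
    -- factor `n ^ 2` makes the truncated index harmless.
    have h2 : Tendsto (fun k => M n + n ^ 2 * ε k * K (n - 1)) (hyperfilter ℕ) (𝓝 (M n)) := by
      have h3 := ENNReal.Tendsto.const_mul (a := (n : ℝ≥0∞) ^ 2) hε0 (Or.inr (by finiteness))
      have h4 := ENNReal.Tendsto.mul_const (b := K (n - 1)) h3 (Or.inr (hKt _))
      simpa using tendsto_const_nhds.add h4
    refine le_of_tendsto_of_tendsto' (hcut n N) h2 fun k => ?_
    have h5 : ∫⁻ x, ((min (x ^ n) N : ℝ≥0) : ℝ≥0∞) ∂latticeMeasure (B k) (ε k) ≤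
        ∫⁻ x, (x : ℝ≥0∞) ^ n ∂latticeMeasure (B k) (ε k) :=
      lintegral_mono fun x =>
        (ENNReal.coe_le_coe.2 (min_le_left _ _)).trans_eq (ENNReal.coe_pow _ _)
    refine h5.trans ?_
    cases n with
    | zero => simp [lintegral_latticeMeasure_zero (hB k)]
    | succ n =>
      refine (lintegral_latticeMeasure_succ_le (hB k) n).trans ?_
      push_cast
      gcongr
      exact lintegral_latticeMeasure_le (hε1 k) (hB k) n
  -- No mass of the `n`-th moment escapes: cutting at `N + 1` loses at most the moment of order `2
  -- n` divided by `N + 1`, uniformly in the mesh.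
  · have h1 : ∀ N : ℕ, M n ≤ ∫⁻ x, (x : ℝ≥0∞) ^ n ∂(m : Measure ℝ≥0) +
        (K (n + n) * ((N + 1 : ℕ) : ℝ≥0∞)⁻¹) := by
      intro N
      have h2 : M n ≤ ∫⁻ x, ((min (x ^ n) ((N + 1 : ℕ) : ℝ≥0) : ℝ≥0) : ℝ≥0∞) ∂(m : Measure ℝ≥0) +
          (K (n + n) * ((N + 1 : ℕ) : ℝ≥0∞)⁻¹) := by
        refine ge_of_tendsto' ((hcut n (N + 1)).add_const _) fun k => ?_
        refine (le_lintegral_latticeMeasure (hB k) n).trans ?_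
        refine le_trans ?_ (add_le_add_right (mul_le_mul_left
          (lintegral_latticeMeasure_le (hε1 k) (hB k) (n + n)) _) _)
        rw [← lintegral_mul_const _ (by fun_prop), ← lintegral_add_left (by fun_prop)]
        refine lintegral_mono fun x => ?_
        have h3 : x ^ n ≤ min (x ^ n) ((N + 1 : ℕ) : ℝ≥0) + x ^ (n + n) * ((N + 1 : ℕ) : ℝ≥0)⁻¹ := by
          rcases le_total (x ^ n) ((N + 1 : ℕ) : ℝ≥0) with h4 | h4
          · rw [min_eq_left h4]; exact le_self_add
          · refine le_add_of_nonneg_of_le zero_le ?_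
            rw [← div_eq_mul_inv, le_div_iff₀ (by positivity), pow_add]
            gcongr
        have h5 := ENNReal.coe_le_coe.2 h3
        rw [ENNReal.coe_add, ENNReal.coe_mul, ENNReal.coe_inv (by positivity)] at h5
        simpa using h5
      refine h2.trans (add_le_add_left (lintegral_mono fun x => ?_) _)
      exact (ENNReal.coe_le_coe.2 (min_le_left _ _)).trans_eq (ENNReal.coe_pow _ _)
    have h2 : Tendsto (fun N : ℕ => K (n + n) * ((N + 1 : ℕ) : ℝ≥0∞)⁻¹) atTop (𝓝 0) := by
      have h3 := ENNReal.Tendsto.const_mul (a := K (n + n))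
        ((tendsto_add_atTop_iff_nat 1).2 ENNReal.tendsto_inv_nat_nhds_zero) (Or.inr (hKt _))
      simpa using h3
    have h3 := tendsto_const_nhds (x := ∫⁻ x, (x : ℝ≥0∞) ^ n ∂(m : Measure ℝ≥0)) |>.add h2
    rw [add_zero] at h3
    exact ge_of_tendsto' h3 h1

/-! ### From consistent families to mechanisms -/

/-- Thinning weights are factorial moments: with mesh `ε = r / (1 - r)` one has `(1 - r) * ε = r`,
and the rest is an identity between binomial coefficients. The lattice point `i` stands for `i + j`
individuals. -/
theorem tsum_thin_eq {A : PMF ℕ} (hr : r ∈ Ioo (0 : ℝ) 1) (j n : ℕ) :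
    ∑' i : ℕ, A (i + j) * ((i + j).choose j * ofReal (1 - r) ^ i * ofReal r ^ j) *
      (i.descFactorial n * (toNNReal (r / (1 - r)) : ℝ≥0∞) ^ n) * j.factorial =
      thin A (ofReal (1 - r)) (n + j) * ofReal r ^ (n + j) * (n + j).factorial := by
  set g := ofReal (1 - r) with hg
  have hge : g * (toNNReal (r / (1 - r)) : ℝ≥0∞) = ofReal r := by
    have : 1 - r ≠ 0 := by linarith [hr.2]
    change g * ofReal _ = _
    rw [hg, ← ofReal_mul (by linarith [hr.2]), mul_div_cancel₀ _ this]
  rw [thin, ← Summable.sum_add_tsum_nat_add' (k := j)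
    (f := fun k => A k * (k.choose (n + j) * g ^ (k - (n + j)))) ENNReal.summable,
    Finset.sum_eq_zero, zero_add, ← ENNReal.tsum_mul_right, ← ENNReal.tsum_mul_right]
  · refine tsum_congr fun i => ?_
    rcases lt_or_ge i n with hi | hi
    · simp [Nat.descFactorial_of_lt hi, Nat.choose_eq_zero_of_lt (show i + j < n + j by omega)]
    · obtain ⟨t, rfl⟩ := Nat.exists_eq_add_of_le hi
      have h1 : (n + t + j).choose j * (n + t).descFactorial n * j.factorial =
          (n + t + j).choose (n + j) * (n + j).factorial := by
        have e := Nat.descFactorial_mul_descFactorial (n := n + t + j) (show j ≤ n + j by omega)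
        rw [Nat.descFactorial_eq_factorial_mul_choose _ j,
          Nat.descFactorial_eq_factorial_mul_choose _ (n + j), Nat.add_sub_cancel,
          Nat.add_sub_cancel] at e
        linarith
      have h2 : ((n + t + j).choose j : ℝ≥0∞) * (n + t).descFactorial n * j.factorial =
          (n + t + j).choose (n + j) * (n + j).factorial := by exact_mod_cast h1
      rw [show n + t + j - (n + j) = t by omega, pow_add (ofReal r), ← hge, pow_add g,
        mul_pow]
      calc _ = A (n + t + j) * (g ^ n * g ^ t * (g * (toNNReal (r / (1 - r)) : ℝ≥0∞)) ^ j *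
            (toNNReal (r / (1 - r)) : ℝ≥0∞) ^ n) *
            (((n + t + j).choose j : ℝ≥0∞) * (n + t).descFactorial n * j.factorial) := by ring
        _ = _ := by rw [h2]; ring
  · intro i hi
    simp [Nat.choose_eq_zero_of_lt (show i < n + j by have := Finset.mem_range.1 hi; omega)]

/-- The same weights `c` are thinnings for arbitrarily small `r`, hence factorial moments on
arbitrarily fine lattices, so `exists_measure_moments` applies. -/
theorem exists_moments_of_thin {c : ℕ → ℝ≥0∞} (hc : ∀ n, c n ≠ ∞)
    (h : ∀ δ : ℝ, 0 < δ → ∃ r ∈ Ioo (0 : ℝ) 1, r < δ ∧ ∃ (A : PMF ℕ) (κ : ℝ), 0 < κ ∧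
      ∀ n, c n * ofReal κ =
        thin A (ofReal (1 - r)) (n + j) * ofReal r ^ (n + j)) :
    ∃ m : Measure ℝ≥0, IsFiniteMeasure m ∧
      ∀ n, (∫⁻ x, (x : ℝ≥0∞) ^ n ∂m) * j.factorial = c n * (n + j).factorial := by
  have hj0 : (j.factorial : ℝ≥0∞) ≠ 0 := by exact_mod_cast j.factorial_ne_zero
  have hjt : (j.factorial : ℝ≥0∞) ≠ ∞ := ENNReal.natCast_ne_top _
  obtain ⟨m, hm, hmom⟩ := exists_measure_moments
    (M := fun n => c n * (n + j).factorial * (j.factorial : ℝ≥0∞)⁻¹)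
    (fun n => mul_ne_top (mul_ne_top (hc n) (ENNReal.natCast_ne_top _))
      (ENNReal.inv_ne_top.2 hj0)) (fun δ hδ => by
      -- For `r < 1 / 2` the mesh `r / (1 - r)` is below `2 * r`, hence below `δ`.
      obtain ⟨r, hr, hrδ, A, κ, hκ, hA⟩ := h (min (1 / 2) (δ / 2)) (by positivity)
      have hκ0 : ofReal κ ≠ 0 := by simpa using hκ
      refine ⟨toNNReal (r / (1 - r)), ?_, fun i => A (i + j) * ((i + j).choose j *
        ofReal (1 - r) ^ i * ofReal r ^ j) * (ofReal κ)⁻¹, fun n => ?_⟩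
      · have h1 : r < 1 / 2 := hrδ.trans_le (min_le_left _ _)
        have h2 : r < δ / 2 := hrδ.trans_le (min_le_right _ _)
        rw [Real.toNNReal_le_iff_le_coe, div_le_iff₀ (by linarith)]
        nlinarith [NNReal.coe_pos.2 hδ]
      · have h3 := tsum_thin_eq (A := A) hr j n
        rw [← hA n, ENNReal.tsum_mul_right] at h3
        simp_rw [mul_right_comm _ (ofReal κ)⁻¹]
        rw [← div_eq_mul_inv (c n * _), ENNReal.eq_div_iff hj0 hjt, ENNReal.tsum_mul_right,
          ← mul_assoc, mul_comm (j.factorial : ℝ≥0∞), h3, mul_right_comm, mul_assoc (c n),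
          ENNReal.mul_inv_cancel hκ0 ofReal_ne_top, mul_one])
  exact ⟨m, hm, fun n => by
    rw [hmom, mul_assoc, ENNReal.inv_mul_cancel hj0 hjt, mul_one]⟩

/-- `expTail j x 1` is the Poisson probability of at least `j`. Each of the `j` missing weights,
multiplied by `min 1 (x ^ j)`, is at most `exp (-x) * x ^ j`. This converse bound yields
integrability of the Lévy measure. -/
theorem min_one_pow_le_expTail (j : ℕ) {x : ℝ} (hx : 0 ≤ x) :
    min 1 (x ^ j) ≤ expTail j x 1 + j * (exp (-x) * x ^ j) := by
  have h1 : exp (-x) * exp x = 1 := by rw [← exp_add]; simp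
  have h2 : expTail j x 1 = 1 - exp (-x) * ∑ k ∈ Finset.range j, x ^ k / k.factorial := by
    simp only [expTail, mul_one]
    linear_combination h1
  have h0 := (expTail_mem_Icc (j := j) hx (s := 1) ⟨zero_le_one, le_rfl⟩).1
  have h3 : min 1 (x ^ j) * (exp (-x) * ∑ k ∈ Finset.range j, x ^ k / k.factorial) ≤
      j * (exp (-x) * x ^ j) := by
    rw [mul_sum, mul_sum, ← nsmul_eq_mul, ← card_range j, ← Finset.sum_const,
      card_range]
    refine Finset.sum_le_sum fun k hk => ?_
    have hf : (1 : ℝ) ≤ k.factorial := by exact_mod_cast k.factorial_pos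
    have h4 : min 1 (x ^ j) * x ^ k ≤ x ^ j := by
      rcases le_total x 1 with h | h
      · exact (mul_le_of_le_one_right (by positivity) (pow_le_one₀ hx h)).trans (min_le_right _ _)
      · exact (mul_le_of_le_one_left (by positivity) (min_le_left _ _)).trans
          (pow_le_pow_right₀ h (Finset.mem_range.1 hk).le)
    calc min 1 (x ^ j) * (exp (-x) * (x ^ k / k.factorial))
        = exp (-x) * (min 1 (x ^ j) * x ^ k / k.factorial) := by ring
      _ ≤ _ := by
        gcongr
        exact (div_le_self (by positivity) hf).trans h4
  nlinarith [min_le_left (1 : ℝ) (x ^ j)]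

/-- Away from `0`, the density `j! * x ^ (-j) * exp x` turns the moments of `m` into Poisson
integrals against `ν`. The atom of `m` at `0` contributes to `n = 0` only and becomes the
coefficient `a`. -/
theorem exists_levyCoeff_of_moments {c : ℕ → ℝ≥0∞} (hc : ∑' n, c n ≠ ∞) {m : Measure ℝ≥0}
    [IsFiniteMeasure m]
    (hm : ∀ n, (∫⁻ x, (x : ℝ≥0∞) ^ n ∂m) * j.factorial = c n * (n + j).factorial) :
    ∃ (a : ℝ) (ν : Measure ℝ), 0 ≤ a ∧
      ∫⁻ x in Ioi (0 : ℝ), ofReal (min 1 (x ^ j)) ∂ν < ∞ ∧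
      ∀ n, (c n).toReal = levyCoeff j a ν 1 n := by
  have hct : ∀ n, c n ≠ ∞ := fun n => ne_top_of_le_ne_top hc (ENNReal.le_tsum n)
  set w : ℝ≥0 → ℝ≥0∞ := fun x =>
    ofReal (j.factorial * ((x : ℝ) ^ j)⁻¹ * exp x) with hw
  have hwm : Measurable w := by fun_prop
  set ν : Measure ℝ := (m.withDensity w).map NNReal.toReal with hν
  set G : ℕ → ℝ → ℝ := fun n x => exp (-x) * x ^ (n + j) / (n + j).factorial with hG
  have hGm : ∀ n, Measurable (G n) := fun n => by fun_prop
  have hint : ∀ n, (∫⁻ x in Ioi (0 : ℝ), ofReal (G n x) ∂ν) +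
      (if n = 0 then m {0} else 0) = c n := by
    intro n
    have hn0 : ((n + j).factorial : ℝ≥0∞) ≠ 0 := by exact_mod_cast (n + j).factorial_ne_zero
    have hnt : ((n + j).factorial : ℝ≥0∞) ≠ ∞ := ENNReal.natCast_ne_top _
    have hpre : NNReal.toReal ⁻¹' Ioi 0 = ({0} : Set ℝ≥0)ᶜ := by
      ext x
      simp [pos_iff_ne_zero]
    have h1 : (∫⁻ x in Ioi (0 : ℝ), ofReal (G n x) ∂ν) * (n + j).factorial =
        (∫⁻ x in ({0} : Set ℝ≥0)ᶜ, (x : ℝ≥0∞) ^ n ∂m) * j.factorial := by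
      rw [hν, setLIntegral_map measurableSet_Ioi (by fun_prop) (by fun_prop), hpre,
        setLIntegral_withDensity_eq_setLIntegral_mul _ hwm (by fun_prop)
          (measurableSet_singleton 0).compl, ← lintegral_mul_const _ (by fun_prop),
        ← lintegral_mul_const _ (by fun_prop)]
      refine setLIntegral_congr_fun (measurableSet_singleton 0).compl fun x hx => ?_
      have hx0 : (0 : ℝ) < x := NNReal.coe_pos.2 (pos_iff_ne_zero.2 hx)
      have e' : exp (-x) * exp x = 1 := by rw [← exp_add]; simp
      simp only [Pi.mul_apply, hw, hG]
      rw [← ENNReal.ofReal_natCast, ← ENNReal.ofReal_natCast, ← ENNReal.ofReal_coe_nnreal (p := x),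
        ← ENNReal.ofReal_pow (NNReal.coe_nonneg x), ← ofReal_mul (by positivity),
        ← ofReal_mul (by positivity), ← ofReal_mul (by positivity)]
      congr 1
      have : ((n + j).factorial : ℝ) ≠ 0 := by exact_mod_cast (n + j).factorial_ne_zero
      rw [pow_add]
      field_simp
      linear_combination e'
    have h2 : (if n = 0 then m {0} else 0) * ((n + j).factorial : ℝ≥0∞) =
        (∫⁻ x in ({0} : Set ℝ≥0), (x : ℝ≥0∞) ^ n ∂m) * j.factorial := by
      rw [lintegral_singleton]
      rcases eq_or_ne n 0 with rfl | hn
      · simp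
      · simp [hn]
    rw [← ENNReal.mul_left_inj hn0 hnt, add_mul, h1, h2, ← add_mul, add_comm,
      lintegral_add_compl _ (measurableSet_singleton 0), hm]
  have hle : ∀ n, ∫⁻ x in Ioi (0 : ℝ), ofReal (G n x) ∂ν ≤ c n := fun n =>
    (hint n).symm ▸ le_self_add
  refine ⟨(m {0}).toReal, ν, toReal_nonneg, ?_, fun n => ?_⟩
  · have hb : ∀ x ∈ Ioi (0 : ℝ), ofReal (min 1 (x ^ j)) ≤
        (∑' n, ofReal (G n x)) + ofReal (j * j.factorial) *
          ofReal (G 0 x) := by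
      intro x (hx : 0 < x)
      have h1 := hasSum_expTail j x 1
      simp only [one_pow, mul_one] at h1
      rw [← ENNReal.ofReal_tsum_of_nonneg (fun n => by positivity) h1.summable, h1.tsum_eq,
        ← ofReal_mul (by positivity), ← ofReal_add (h1.nonneg fun n => by positivity)
          (by positivity)]
      refine ENNReal.ofReal_le_ofReal ((min_one_pow_le_expTail j hx.le).trans_eq ?_)
      have : (j.factorial : ℝ) ≠ 0 := by exact_mod_cast j.factorial_ne_zero
      simp only [hG, zero_add]
      field_simp
    refine (setLIntegral_mono (by fun_prop) hb).trans_lt ?_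
    rw [lintegral_add_left (by fun_prop), lintegral_tsum (fun n => by fun_prop),
      lintegral_const_mul _ (by fun_prop)]
    exact ENNReal.add_lt_top.2 ⟨(tsum_le_tsum hle).trans_lt hc.lt_top,
      ENNReal.mul_lt_top ENNReal.ofReal_lt_top ((hle 0).trans_lt (hct 0).lt_top)⟩
  · have h1 : ∫ x in Ioi (0 : ℝ), G n x ∂ν =
        (∫⁻ x in Ioi (0 : ℝ), ofReal (G n x) ∂ν).toReal := by
      refine integral_eq_lintegral_of_nonneg_ae ?_ (hGm n).aestronglyMeasurable
      filter_upwards [ae_restrict_mem measurableSet_Ioi] with x (hx : 0 < x)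
      change 0 ≤ exp (-x) * x ^ (n + j) / (n + j).factorial
      positivity
    have h2 := congrArg ENNReal.toReal (hint n)
    rw [toReal_add (ne_top_of_le_ne_top (hct n) (hle n)) (by split_ifs <;> finiteness),
      ← h1] at h2
    simp only [levyCoeff, one_pow, mul_one, one_mul]
    rw [← h2, add_comm]
    congr 1
    split_ifs <;> simp

/-! ### Mechanisms from Lévy coefficients -/

theorem hasSum_pgf_nat_add (q : PMF ℕ) (j : ℕ) (hs : s ∈ Icc (0 : ℝ) 1) :
    HasSum (fun n => (q (n + j)).toReal * s ^ (n + j))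
      (pgf q s - ∑ i ∈ Finset.range j, (q i).toReal * s ^ i) :=
  (hasSum_nat_add_iff' j).2 (summable_pgf q (abs_le_one_of_mem hs)).hasSum

theorem tsum_nat_add_ne_top (q : PMF ℕ) (j : ℕ) : ∑' n, q (n + j) ≠ ∞ :=
  ne_top_of_le_ne_top q.tsum_coe_ne_top
    (ENNReal.tsum_comp_le_tsum_of_injective (add_left_injective j) q)

theorem offspringRep_of_levyCoeff (hq : q 1 = 0) {a : ℝ} {ν : Measure ℝ} (ha : 0 ≤ a)
    (hν : ∫⁻ x in Ioi (0 : ℝ), ofReal (min 1 (x ^ 2)) ∂ν < ∞)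
    (h : ∀ n, (q (n + 2)).toReal = levyCoeff 2 a ν 1 n) : ∃ ψ, OffspringRep q ψ := by
  obtain ⟨D, hD⟩ := hasSum_branching (b := 0) (a := a) hν zero_le_one
  set f := branchingFun 0 a ν with hf
  have h0 : f 0 = 0 := by simp [hf, branchingFun]
  have key : ∀ s ∈ Icc (0 : ℝ) 1, pgf q s = (q 0).toReal + f (1 - s) - f 1 + s * D := by
    intro s hs
    have h1 := hasSum_pgf_nat_add q 2 hs
    simp_rw [h] at h1
    have h2 := h1.unique (hD s hs)
    simp [sum_range_succ, hq] at h2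
    linarith
  have h1 := key 1 ⟨zero_le_one, le_rfl⟩
  rw [pgf_one, sub_self, h0] at h1
  -- The coefficients from order two on determine the generating function up to an affine function.
  -- This drift matches the constant term, and the value `1` at `s = 1` takes care of the slope.
  refine ⟨branchingFun ((q 0).toReal - f 1) a ν, ⟨_, a, ν, ha, hν, fun r _ => rfl⟩, fun s hs => ?_⟩
  have h2 : ∀ b r, branchingFun b a ν r = b * r + f r := fun b r => by
    simp only [hf, branchingFun]; ring
  rw [h2, key s hs]
  linear_combination s * (-h1)

theorem immigrationRep_of_levyCoeff (hη : η 0 = 0) {d : ℝ} {ν : Measure ℝ}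
    (hd : 0 ≤ d) (hν : ∫⁻ x in Ioi (0 : ℝ), ofReal (min 1 (x ^ 1)) ∂ν < ∞)
    (h : ∀ n, (η (n + 1)).toReal = levyCoeff 1 d ν 1 n) : ∃ φ, ImmigrationRep η φ := by
  rw [show (fun x : ℝ => ofReal (min 1 (x ^ 1))) = fun x => ofReal (min 1 x) by
    simp only [pow_one]] at hν
  set φ : ℝ → ℝ := fun r => d * r + ∫ x in Ioi (0 : ℝ), (1 - exp (-(r * x))) ∂ν with hφ
  have h0 : φ 0 = 0 := by simp [hφ]
  have key : ∀ s ∈ Icc (0 : ℝ) 1, pgf η s = φ 1 - φ (1 - s) := by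
    intro s hs
    have h1 := hasSum_pgf_nat_add η 1 hs
    simp_rw [h] at h1
    have h2 := h1.unique (hasSum_immigration hν (φ := φ) (fun r _ => rfl) zero_le_one hs)
    simpa [hη] using h2
  have h1 := key 1 ⟨zero_le_one, le_rfl⟩
  rw [pgf_one, sub_self, h0, sub_zero] at h1
  exact ⟨φ, ⟨d, ν, hd, hν, fun r _ => rfl⟩, fun s hs => by rw [key s hs, ← h1]⟩

/-! ### Root probabilities become arbitrarily small -/

theorem pgf_le_one (q : PMF ℕ) (hs : |s| ≤ 1) : pgf q s ≤ 1 := by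
  rw [← tsum_toReal q]
  refine (summable_pgf q hs).tsum_le_tsum (fun n => ?_) (summable_toReal q)
  refine mul_le_of_le_one_right toReal_nonneg ((le_abs_self _).trans ?_)
  rw [abs_pow]
  exact pow_le_one₀ (abs_nonneg s) hs

/-- A root larger than `2 / 3` bounds the ratio of the parameters, as the generating function of
the reduced law can be continued beyond the corresponding point. -/
theorem IsReducedOffspring.root_le (hp : p < 1)
    (h : IsReducedOffspring p q r θ q') (h2 : 2 * (1 - p) < (q' 0).toReal) : r ≤ 2 / 3 := by
  by_contra! hr
  have hr1 := h.root.mem.2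
  have hr0 := h.root_pos
  have h1 : 1 / r < 3 / 2 := by rw [div_lt_iff₀ hr0]; linarith
  have h1' : 1 ≤ 1 / r := by rw [le_div_iff₀ hr0]; linarith
  -- The continued identity at `1 / r` gives `psi q' (1 / r) = q 0 / (r * θ) = q' 0 / (1 - p)`,
  -- whereas `psi q'` is at most `2` there.
  have h3 := h.eqOn (show 1 / r ∈ Ioo (0 : ℝ) 2 from ⟨by positivity, by linarith⟩)
  simp only [mul_one_div_cancel hr0.ne', psi_one] at h3
  have h4 : psi q' (1 / r) ≤ 2 := by
    have := pgf_le_one q' (s := 1 - 1 / r) (by rw [abs_le]; constructor <;> linarith)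
    rw [psi]
    linarith
  rw [h3, div_le_iff₀ (mul_pos hr0 h.theta_pos)] at h4
  have h5 := h.mul_toReal
  nlinarith [mul_pos hr0 h.theta_pos]

/-- Each passage to a sufficiently high level multiplies the root probability by a factor of at most
`2 / 3`. -/
theorem IsConsistentPairFamily.exists_root_le (h : IsConsistentPairFamily Q E)
    (n : ℕ) : ∃ l : ℝ≥0, 1 < l ∧ ∃ r θ, r ≤ (2 / 3) ^ n ∧
      IsReducedOffspring (1 - ((1 : ℝ≥0) : ℝ) / l) (Q l) r θ (Q 1) ∧
      IsReducedImmigration (E l) r (E 1) := by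
  induction n with
  | zero =>
    obtain ⟨r, θ, h1, h2⟩ := h.exists_reduced one_pos one_lt_two
    exact ⟨2, one_lt_two, r, θ, by simpa using h1.root.mem.2, h1, h2⟩
  | succ n ih =>
    obtain ⟨l, hl, r, θ, hr, h1, -⟩ := ih
    have hl0 : 0 < l := one_pos.trans hl
    have hl0' : (0 : ℝ) < l := hl0
    have hq := (h.offspring l hl0).toReal_pos
    -- This size of `l'` makes `2 * (l / l')` smaller than `Q l 0`, as `root_le` requires.
    obtain ⟨l', hl'⟩ := exists_gt (max l ⟨l * (2 / (Q l 0).toReal), by positivity⟩)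
    have hll' : l < l' := (le_max_left _ _).trans_lt hl'
    have hl1 : 0 < l' := hl0.trans hll'
    have hl1' : (0 : ℝ) < l' := hl1
    have h3 : l * (2 / (Q l 0).toReal) < (l' : ℝ) :=
      NNReal.coe_lt_coe.2 ((le_max_right _ _).trans_lt hl')
    obtain ⟨ρ, θ', h4, -⟩ := h.exists_reduced hl0 hll'
    obtain ⟨r', θ'', h5, h6⟩ := h.exists_reduced one_pos (hl.trans hll')
    have hρ : ρ ≤ 2 / 3 := h4.root_le (sub_lt_self _ (by positivity)) (by
      rw [sub_sub_cancel]
      field_simp at h3 ⊢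
      linarith)
    -- Root probabilities multiply along successive reductions; for a positive level it suffices to
    -- verify the equation.
    have hroot : IsRootProb (1 - ((1 : ℝ≥0) : ℝ) / l') (Q l') (ρ * r) := by
      refine isRootProb_of_lt (h.offspring l' hl1) (sub_lt_self _ (by positivity))
        ⟨mul_nonneg h4.root_pos.le h1.root_pos.le,
          mul_le_one₀ h4.root.mem.2 h1.root_pos.le h1.root.mem.2⟩ ?_
      have e1 := h4.psi_eq h1.root.mem
      have e2 := h1.root.eq
      have e3 := h4.mul_toReal
      have hpos := mul_pos h4.root_pos h4.theta_pos
      rw [e1, div_eq_iff hpos.ne'] at e2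
      rw [e2]
      simp only [sub_sub_cancel, NNReal.coe_one] at e3 ⊢
      rw [mul_assoc, e3]
      field_simp
    refine ⟨l', hl.trans hll', r', θ'', ?_, h5, h6⟩
    rw [h5.root.unique hroot, pow_succ, mul_comm]
    exact mul_le_mul hr hρ h4.root_pos.le (by positivity)

/-- The moment argument is applied to the weights of `Q 1` from `2` on and to those of `E 1` from
`1` on, that is, with `j = 2` and `j = 1`. -/
theorem IsConsistentPairFamily.exists_rep (h : IsConsistentPairFamily Q E) :
    (∃ ψ, OffspringRep (Q 1) ψ) ∧ ∃ φ, ImmigrationRep (E 1) φ := by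
  have hsmall : ∀ δ : ℝ, 0 < δ → ∃ r ∈ Ioo (0 : ℝ) 1, r < δ ∧ ∃ (p θ : ℝ) (q η : PMF ℕ),
      IsReducedOffspring p q r θ (Q 1) ∧ IsReducedImmigration η r (E 1) := by
    intro δ hδ
    obtain ⟨n, hn⟩ := exists_pow_lt_of_lt_one (lt_min one_pos hδ) (show (2 / 3 : ℝ) < 1 by norm_num)
    obtain ⟨l, -, r, θ, hr, h1, h2⟩ := h.exists_root_le n
    have hr' := hr.trans_lt hn
    exact ⟨r, ⟨h1.root_pos, hr'.trans_le (min_le_left _ _)⟩, hr'.trans_le (min_le_right _ _), _, θ,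
      _, _, h1, h2⟩
  constructor
  · obtain ⟨m, hm, hmom⟩ := exists_moments_of_thin (j := 2) (c := fun n => Q 1 (n + 2))
      (fun n => (Q 1).apply_ne_top _) fun δ hδ => by
        obtain ⟨r, hr, hrδ, p, θ, q, η, h1, -⟩ := hsmall δ hδ
        refine ⟨r, hr, hrδ, q, θ * r, mul_pos h1.theta_pos h1.root_pos, fun n => ?_⟩
        rw [h1.weight (n + 2), blackWeight, if_neg (by omega), if_neg (by omega)]
    obtain ⟨a, ν, ha, hν, hc⟩ := exists_levyCoeff_of_moments (tsum_nat_add_ne_top (Q 1) 2) hmom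
    exact offspringRep_of_levyCoeff (h.offspring 1 one_pos).2 ha hν hc
  · obtain ⟨m, hm, hmom⟩ := exists_moments_of_thin (j := 1) (c := fun n => E 1 (n + 1))
      (fun n => (E 1).apply_ne_top _) fun δ hδ => by
        obtain ⟨r, hr, hrδ, p, θ, q, η, -, h1⟩ := hsmall δ hδ
        exact ⟨r, hr, hrδ, η, phi η r, h1.phi_pos, fun n => h1.weight (n + 1) (by omega)⟩
    obtain ⟨a, ν, ha, hν, hc⟩ := exists_levyCoeff_of_moments (tsum_nat_add_ne_top (E 1) 1) hmom
    exact immigrationRep_of_levyCoeff (h.immigration 1 one_pos) ha hν hc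

end GWGrowth

end

theorem theorem3 (q η : PMF ℕ) (hq : GWGrowth.IsOffspringLaw q) (hη : η 0 = 0) :
    -- (i) if and only if (ii)
    ((∃ Q E : ℝ≥0 → PMF ℕ, GWGrowth.IsConsistentPairFamily Q E ∧ Q 1 = q ∧ E 1 = η) ↔
      ((∃ ψ : ℝ → ℝ, GWGrowth.OffspringRep q ψ) ∧
        ∃ φ : ℝ → ℝ, GWGrowth.ImmigrationRep η φ)) ∧
    -- consistent forests exist for every consistent family of laws and all `c`, `h`
    (∀ Q E : ℝ≥0 → PMF ℕ, GWGrowth.IsConsistentPairFamily Q E → Q 1 = q → E 1 = η →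
      ∀ c h : ℝ, 0 < c → 0 < h →
        ∃ C H : ℝ≥0 → ℝ, C 1 = c ∧ H 1 = h ∧ GWGrowth.HasConsistentForests Q C E H) ∧
    -- uniqueness of the parameters, and on what they do not depend
    (∀ (Q Q' E E' : ℝ≥0 → PMF ℕ) (C C' H H' : ℝ≥0 → ℝ),
      GWGrowth.HasConsistentForests Q C E H → GWGrowth.HasConsistentForests Q' C' E' H' →
      Q 1 = q → Q' 1 = q →
        (∀ l, 0 < H l → Q l = Q' l) ∧
        (C 1 = C' 1 → ∀ l, 0 < H l → C l = C' l) ∧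
        (E 1 = η → E' 1 = η → ∀ l, 0 < H l → E l = E' l) ∧
        (E 1 = η → E' 1 = η → H 1 = H' 1 → ∀ l, H l = H' l)) ∧
    -- the explicit form of the immigration laws and immigration rates
    (∀ ψ φ : ℝ → ℝ, GWGrowth.OffspringRep q ψ → GWGrowth.ImmigrationRep η φ →
      ∀ (Q E : ℝ≥0 → PMF ℕ) (C H : ℝ≥0 → ℝ), GWGrowth.HasConsistentForests Q C E H →
        Q 1 = q → E 1 = η →
        ∀ l : ℝ≥0,
          H l = H 1 * φ (GWGrowth.rightInv ψ (l * ψ 1)) ∧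
          (0 < H l → ∀ s ∈ Icc (0 : ℝ) 1,
            GWGrowth.pgf (E l) s =
              1 - φ (GWGrowth.rightInv ψ (l * ψ 1) * (1 - s)) /
                φ (GWGrowth.rightInv ψ (l * ψ 1)))) := by
  refine ⟨⟨?_, ?_⟩, ?_, ?_, ?_⟩
  · rintro ⟨Q, E, h, rfl, rfl⟩
    exact h.exists_rep
  · rintro ⟨⟨ψ, hψ⟩, φ, hφ⟩
    obtain ⟨Q, E, h, hQ, hE, -⟩ := GWGrowth.exists_consistentPairFamily hq hη hψ hφ
    exact ⟨Q, E, h, hQ, hE⟩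
  · intro Q E h _ _ c b hc hb
    exact h.hasConsistentForests hc hb
  · intro Q Q' E E' C C' H H' h h' hQ hQ'
    obtain ⟨h1, h2, h3, h4⟩ := h.unique h' (hQ.trans hQ'.symm)
    exact ⟨h1, h2, fun e e' => h3 (e.trans e'.symm), fun e e' => h4 (e.trans e'.symm)⟩
  · intro ψ φ hψ hφ Q E C H h hQ hE l
    obtain ⟨h1, h2⟩ := h.explicit hq hη hψ hφ hQ hE l
    refine ⟨h1, fun hl s hs => ?_⟩
    have h3 := h2 hl (1 - s) ⟨by linarith [hs.2], by linarith [hs.1]⟩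
    rw [← h3, GWGrowth.phi, sub_sub_cancel, sub_sub_cancel]
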